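/- **Setting.** For $(X,E)\in\mathbb R^2$ let $R(X,E)=\int_X^\infty \frac{dv}{\sqrt{2E-v^2+v^4/2}}$, and for $E<\frac14$, with $m=\sqrt{1+\sqrt{1-4E}}$, let $S(X,E)=\Big(\int_m^{|X|}+\int_m^\infty\Big)\frac{dv}{\sqrt{2E-v^2+v^4/2}}$; these equal $+\infty$ when an integral diverges or a square root has a negative argument on a set of positive measure. Let $X_C>1$ be the unique number with $R(X_C,\frac12X_C^2-\frac14X_C^4)=\pi$. For $X\le X_C$ let $\tilde\beta_+(X)$ be the unique $E\ge\frac12X^2-\frac14X^4$ with $R(X,E)=\pi$, and for $X<-X_C$ let $\tilde\beta_-(X)$ be the unique $E\in[\frac12X^2-\frac14X^4,\frac14)$ with $S(X,E)=\pi$. The threshold function is $$\beta(X)=\sqrt{2\tilde\beta_+(X)-X^2+\tfrac12X^4}\ \ (X\le X_C),\qquad \beta(X)=-\sqrt{2\tilde\beta_-(-X)-X^2+\tfrac12X^4}\ \ (X>X_C).$$ **Notation.** $\|f\|_{\dot H^s}^2=\int_{\mathbb R^3}|\xi|^{2s}|\hat f(\xi)|^2\,d\xi$ with $\hat f(\xi)=\int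 e^{-ix\cdot\xi}f(x)\,dx$ (Fourier–Plancherel transform on $L^2(\mathbb R^3)$). We write $a(t)=O(b(t))$ if there is a constant $C$ independent of $t$ with $|a(t)|\le C|b(t)|$ for all large $t$, and $a(t)\approx b(t)$ if $a(t)=O(b(t))$ and $b(t)=O(a(t))$. **Theorem.** Let $(X,Y)\in\mathbb R^2$ with $Y=\beta(X)$ or $Y=-\beta(-X)$. Then there is a smooth solution $u$, defined on $(T,\infty)\times\mathbb R^3$ for some $T<0$, of $$\partial_t^2u-\Delta u=u^3,\qquad u(0,x)=\frac{2X}{1+|x|^2},\quad \partial_tu(0,x)=\frac{4Y}{(1+|x|^2)^2}.$$ Every such solution $u$ has, for all large $t$, finite norms in all that follows, and as $t\to\infty$ it satisfies: 1. for every real $p>\frac32$, $$\frac1{(4\pi)^{1/p}}\|u(t)\|_{L^p(\mathbb R^3)}=\frac{\sqrt2}{3^{1/p}}t^{\frac3p-1}+O\big(t^{\frac2p-1}\big),\qquad \forall M>0,\ \|u(t)\|_{L^p(\{|x|>t-M\})}=O\big(t^{\frac2p-1}\big);$$ 2. for every real $p\ge1$, $\|\partial_tu(t)\|_{L^p(\mathbb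 R^3)}\approx t^{-1+\frac2p}$; 3. for every $0\le\nu<\frac12$, $$\|u(t)\|_{\dot H^\nu}^2=\kappa_\nu t^{1-2\nu}+O\big(t^{\frac12-\nu}\big),\qquad \|\partial_tu(t)\|_{\dot H^{\nu-1}}^2=O\big(t^{1-2\nu}\big),$$ where $\kappa_\nu=128\pi^3\int_0^\infty(\sin\sigma-\sigma\cos\sigma)^2\sigma^{-4+2\nu}\,d\sigma<\infty$; 4. $\|u(t)\|_{\dot H^{1/2}}^2=64\pi^3\log t+O(\sqrt{\log t})$ and $\|\partial_tu(t)\|_{\dot H^{-1/2}}^2=O(\log t)$; 5. for every $\nu>\frac12$, $\|u(t)\|_{\dot H^\nu}^2\approx1$ and $\|\partial_tu(t)\|_{\dot H^{\nu-1}}^2\approx1$. -/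

import Mathlib

open Real Set Filter Topology MeasureTheory Asymptotics
open scoped ENNReal ContDiff FourierTransform Laplacian

noncomputable section

namespace CubicWave

/-- Physical space `ℝ³` with its Euclidean norm. -/
abbrev E3 : Type := EuclideanSpace ℝ (Fin 3)

/-! ### The threshold function

The Duffing equation `U'' + U = U ^ 3` with `U 0 = X`, `U' 0 = Y` conserves the energy
`E = Y ^ 2 / 2 + X ^ 2 / 2 - X ^ 4 / 4`, so that `(dU/ds) ^ 2 = 2 E - U ^ 2 + U ^ 4 / 2`. -/

/-- The integrand `(2 E - v ^ 2 + v ^ 4 / 2) ^ (-1 / 2)`, which is `+∞` wherever the expression under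
the square root is not positive. -/
def duffingWeight (E v : ℝ) : ℝ≥0∞ :=
  (ENNReal.ofReal √(2 * E - v ^ 2 + v ^ 4 / 2))⁻¹

/-- The least energy compatible with position `X`, attained at zero velocity. -/
def potential (X : ℝ) : ℝ := X ^ 2 / 2 - X ^ 4 / 4

/-- `R(X, E)` is the integral of `(2 E - v ^ 2 + v ^ 4 / 2) ^ (-1 / 2)` over `v > X`, with value
`+∞` when the integral diverges or the square root has a negative argument. -/
def R (X E : ℝ) : ℝ≥0∞ := ∫⁻ v in Ioi X, duffingWeight E v

/-- The turning point of a Duffing trajectory with `|U| > 1` and energy `E < 1 / 4`. -/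
def turningPoint (E : ℝ) : ℝ := √(1 + √(1 - 4 * E))

/-- `S(X, E)`: the time from `|X|` down to the turning point and from there up to infinity
(used for `E < 1 / 4` and `|X| > 1`). -/
def S (X E : ℝ) : ℝ≥0∞ :=
  (∫⁻ v in Ioc (turningPoint E) |X|, duffingWeight E v) +
    ∫⁻ v in Ioi (turningPoint E), duffingWeight E v

/-- `X_C`: the position `X > 1` for which the trajectory starting at rest reaches infinity in time
exactly `π`. The set is a singleton. -/
def XC : ℝ := sInf {X : ℝ | 1 < X ∧ R X (potential X) = ENNReal.ofReal π}

/-- For `X ≤ X_C`: the admissible energy `E` with `R(X, E) = π` (the set is a singleton). -/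
def betaPlus (X : ℝ) : ℝ :=
  sInf {E : ℝ | potential X ≤ E ∧ R X E = ENNReal.ofReal π}

/-- For `X < - X_C`: the admissible energy `E < 1 / 4` with `S(X, E) = π`
(the set is a singleton). -/
def betaMinus (X : ℝ) : ℝ :=
  sInf {E : ℝ | potential X ≤ E ∧ E < 1 / 4 ∧ S X E = ENNReal.ofReal π}

/-- The threshold function `β`. -/
def beta (X : ℝ) : ℝ :=
  if X ≤ XC then √(2 * betaPlus X - X ^ 2 + X ^ 4 / 2)
  else -√(2 * betaMinus (-X) - X ^ 2 + X ^ 4 / 2)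

/-! ### The solutions of the cubic wave equation -/

/-- The time derivative `∂ₜ u (t, ·)`. -/
def dt (u : ℝ → E3 → ℝ) (t : ℝ) (x : E3) : ℝ := deriv (fun τ => u τ x) t

/-- `u` is the smooth solution `u_{X,Y}`, global in the future, of `∂ₜ² u - Δ u = u ^ 3` on
`ℝ^{1+3}` with initial data `u(0) = 2 X / (1 + |x| ^ 2)`, `∂ₜ u(0) = 4 Y / (1 + |x| ^ 2) ^ 2`:
it is smooth and solves the equation for all times in an open half-line that contains
`[0, ∞)`. -/
structure IsGlobalSolution (X Y : ℝ) (u : ℝ → E3 → ℝ) : Prop where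
  exists_interval : ∃ T : ℝ, T < 0 ∧
    ContDiffOn ℝ ∞ (fun z : ℝ × E3 => u z.1 z.2) (Ioi T ×ˢ univ) ∧
    ∀ t : ℝ, T < t → ∀ x : E3,
      iteratedDeriv 2 (fun τ => u τ x) t - Δ (u t) x = u t x ^ 3
  initial_position : ∀ x : E3, u 0 x = 2 * X / (1 + ‖x‖ ^ 2)
  initial_velocity : ∀ x : E3, dt u 0 x = 4 * Y / (1 + ‖x‖ ^ 2) ^ 2

/-! ### Norms -/

/-- The Lebesgue norm of `f` in `L^p` of the set `A`, as a real number. -/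
def lebesgueNorm (p : ℝ) (A : Set E3) (f : E3 → ℝ) : ℝ :=
  (eLpNorm f (ENNReal.ofReal p) (volume.restrict A)).toReal

open Classical in
/-- The squared homogeneous Sobolev norm of order `s`, that is the integral of
`|ξ| ^ (2 s) |f̂(ξ)| ^ 2`, where `f̂` is the Fourier-Plancherel transform of `f ∈ L²(ℝ³)` in the
normalization `f̂(ξ) = ∫ exp(-i x·ξ) f(x) dx`. Mathlib's `𝓕` has the kernel `exp(-2 π i x·η)`,
whence `f̂(ξ) = 𝓕 f (ξ / (2 π))`. The value is `+∞` if the integral diverges; a function that is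
not in `L²` is also given the value `+∞`. -/
def sobolevSqENorm (s : ℝ) (f : E3 → ℝ) : ℝ≥0∞ :=
  if h : MemLp (fun x => (f x : ℂ)) 2 (volume : Measure E3) then
    ∫⁻ ξ : E3, ENNReal.ofReal (‖ξ‖ ^ (2 * s)) *
      ‖(𝓕 (h.toLp (fun x => (f x : ℂ))) : Lp ℂ 2 (volume : Measure E3))
        ((2 * π)⁻¹ • ξ)‖ₑ ^ 2
  else ⊤

/-- The squared homogeneous Sobolev norm as a real number. -/
def sobolevSq (s : ℝ) (f : E3 → ℝ) : ℝ := (sobolevSqENorm s f).toReal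

/-- The integrand `(sin σ - σ cos σ) ^ 2 σ ^ (-4 + 2 ν)` of the constant `κ_ν`. -/
def kappaIntegrand (ν σ : ℝ) : ℝ := (sin σ - σ * cos σ) ^ 2 * σ ^ (-4 + 2 * ν)

/-- The constant `κ_ν`. -/
def kappa (ν : ℝ) : ℝ := 128 * π ^ 3 * ∫ σ in Ioi (0 : ℝ), kappaIntegrand ν σ

end CubicWave

end

open CubicWave

/-!
Minkowski space is conformal to a part of the Einstein cylinder `ℝ × S³`, and the cubic wave equation
is conformally invariant. The data `2 X / (1 + |x|²)`, `4 Y / (1 + |x|²)²` correspond to constant data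
on the sphere, so that `u = Ω · U(T)`, where `U'' + U = U³`, `U 0 = X`, `U' 0 = Y` is a Duffing
equation, `T = arctan (t + r) + arctan (t - r)` is the time on the cylinder, with values in `(-π, π)`,
and `Ω = 2 / √((1 + (t + r)²) (1 + (t - r)²))`.

*The trajectory.* The threshold function selects the energies for which the time that the trajectory
needs to reach infinity, directly or after a turn, is exactly `π`. In the variable `φ` with
`U = tan φ` or, if there is a turning point `m`, with `U = m / cos φ`, infinity is an ordinary point
`φ = π / 2`, which is passed with positive speed. Hence `U` has a simple pole at `π`, and
`H θ = sin θ * U (π - θ)` extends to a smooth function with `H 0 ^ 2 = 2` (`IsProfile`,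
`exists_isProfile`). As `Ω = sin T / t`, this gives `u = H (π - T) / t` for `t > 0`, a smooth global
solution (`isGlobalSolution_penrose`); it is the only one by the energy method in backward cones
(`IsGlobalSolution.eq`). All assertions therefore concern one explicit radial function.

*Lebesgue norms.* The angle `π - T` tends to `0` in the interior of the light cone, while `H (π - T)`
is small in the exterior. So `u` is the multiple `H 0 / t` of the characteristic function of the ball
`|x| < t` up to an error concentrated near the cone (`exists_bound_sub_box`), and `∂ₜu` is `O(t⁻²)` in
the ball, again up to a term concentrated near the cone (`exists_bound_velProfile`). Near the cone the
error terms have size `1 / t`, and the sphere `|x| = t` has area `4 π t²`, whence the power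
`t ^ (2 / p - 1)`. The velocity does have this size there, since `H` is not constant
(`exists_window`).

*Sobolev norms.* The Fourier transform of a radial function on `ℝ³` is, up to the factor `i / |ξ|`,
the Fourier transform of the odd function `r u` on the line (`fourier_radial`), so that the squared
norms are `16 π³` times weighted integrals over `ρ > 0` of a spectral density (`sobolevSqENorm_eq`).
High frequencies contribute a bounded amount to every norm, because all derivatives of `r u` and
`r ∂ₜu`, apart from `r u` itself, are bounded in `L²(ℝ)` uniformly in time (`exists_pos_seq`,
`exists_vel_seq`). At low frequencies `r u` is `L²`-close to the odd function
`r (H 0 / t) 1_{|r| < t}`, whose transform is explicit: it produces the integral of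
`(sin σ - σ cos σ)² σ ^ (-4 + 2 ν)` over `0 < σ ≤ t`, which converges to `κ_ν` up to a factor if
`ν < 1 / 2`, grows like half the logarithm if `ν = 1 / 2`, and like a power if `ν > 1 / 2`
(`lowEnergy_boxProfile`, `exists_bound_sobolevSq_posProfile`). For the velocity, `r ∂ₜu` is odd and
bounded in `L¹(ℝ)`, which bounds its density by a multiple of `min 1 ((t ρ)²)`
(`exists_spectralDensity_velProfile_le`). The lower bounds for `ν > 1 / 2` follow from one norm that
does not decay, that of the first derivatives of `r u` in `L²(ℝ)`, by interpolation between an upper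
bound at higher and one at lower order (`exists_lower_bound_moment`).
-/

noncomputable section

namespace CubicWave

/-! ### Smooth functions and autonomous equations on the line -/

/-- Differentiation under the integral sign for the moments occurring in Hadamard's lemma. -/
lemma hasDerivAt_integral_pow_mul_comp_mul {g g' : ℝ → ℝ} (hg : ∀ x, HasDerivAt g (g' x) x)
    (hg' : Continuous g') (n : ℕ) (x : ℝ) :
    HasDerivAt (fun y => ∫ s in (0 : ℝ)..1, s ^ n * g (s * y))
      (∫ s in (0 : ℝ)..1, s ^ (n + 1) * g' (s * x)) x := by
  have hgc : Continuous g := continuous_iff_continuousAt.2 fun x => (hg x).continuousAt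
  obtain ⟨C, hC⟩ := (isCompact_Icc (a := -(|x| + 1)) (b := |x| + 1)).exists_bound_of_continuousOn
    hg'.continuousOn
  refine (intervalIntegral.hasDerivAt_integral_of_dominated_loc_of_deriv_le
    (F' := fun y s => s ^ (n + 1) * g' (s * y)) (bound := fun _ => C)
    (Metric.ball_mem_nhds x one_pos) ?_ ?_ ?_ ?_ ?_ ?_).2
  · exact Eventually.of_forall fun y => (by fun_prop : Continuous _).aestronglyMeasurable
  · exact (by fun_prop : Continuous _).intervalIntegrable _ _
  · exact (by fun_prop : Continuous _).aestronglyMeasurable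
  · refine Eventually.of_forall fun s hs y hy => ?_
    rw [uIoc_of_le zero_le_one] at hs
    have hy' : |y| ≤ |x| + 1 := by
      have := abs_sub_abs_le_abs_sub y x
      rw [Metric.mem_ball, Real.dist_eq] at hy
      linarith
    have hsy : |s * y| ≤ |x| + 1 := by
      rw [abs_mul, abs_of_pos hs.1]
      nlinarith [abs_nonneg y, hs.1, hs.2]
    have h1 := hC (s * y) (abs_le.1 hsy)
    rw [norm_mul, norm_pow, Real.norm_eq_abs, abs_of_pos hs.1]
    have h2 : s ^ (n + 1) ≤ 1 := pow_le_one₀ hs.1.le hs.2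
    nlinarith [norm_nonneg (g' (s * y)), pow_pos hs.1 (n + 1)]
  · exact intervalIntegrable_const
  · refine Eventually.of_forall fun s _ y _ => ?_
    have h := ((hg (s * y)).comp y ((hasDerivAt_id y).const_mul s)).const_mul (s ^ n)
    exact h.congr_deriv (by ring)

/-- The moments `∫₀¹ sⁿ g⁽ⁿ⁾(s y) ds` of a smooth function are smooth. -/
lemma contDiff_integral_comp_mul {g : ℝ → ℝ} (hg : ContDiff ℝ ∞ g) :
    ContDiff ℝ ∞ (fun y => ∫ s in (0 : ℝ)..1, g (s * y)) := by
  have hd : ∀ n x, HasDerivAt (iteratedDeriv n g) (iteratedDeriv (n + 1) g x) x := fun n x => by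
    rw [iteratedDeriv_succ]
    exact ((hg.differentiable_iteratedDeriv n (by exact_mod_cast ENat.natCast_lt_top n)) x).hasDerivAt
  have hc : ∀ n, Continuous (iteratedDeriv n g) := fun n =>
    hg.continuous_iteratedDeriv n (by exact_mod_cast le_top)
  have key : ∀ n, deriv (fun y => ∫ s in (0 : ℝ)..1, s ^ n * iteratedDeriv n g (s * y)) =
      fun y => ∫ s in (0 : ℝ)..1, s ^ (n + 1) * iteratedDeriv (n + 1) g (s * y) := fun n => by
    ext x
    exact (hasDerivAt_integral_pow_mul_comp_mul (hd n) (hc (n + 1)) n x).deriv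
  have hsm : ∀ k : ℕ, ∀ n, ContDiff ℝ k
      (fun y => ∫ s in (0 : ℝ)..1, s ^ n * iteratedDeriv n g (s * y)) := by
    intro k
    induction k with
    | zero =>
      intro n
      exact contDiff_zero.2 (continuous_iff_continuousAt.2 fun x =>
        (hasDerivAt_integral_pow_mul_comp_mul (hd n) (hc (n + 1)) n x).continuousAt)
    | succ k ih =>
      intro n
      push_cast
      refine contDiff_succ_iff_deriv.2 ⟨fun x =>
        (hasDerivAt_integral_pow_mul_comp_mul (hd n) (hc (n + 1)) n x).differentiableAt,
        by simp, ?_⟩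
      rw [key]
      exact ih (n + 1)
  have := contDiff_infty.2 fun k => hsm k 0
  simpa using this

/-- **Hadamard's lemma** in one variable: a smooth function vanishing at the origin is `x` times a
smooth function. -/
lemma exists_contDiff_mul_of_zero {f : ℝ → ℝ} (hf : ContDiff ℝ ∞ f) (h0 : f 0 = 0) :
    ∃ k : ℝ → ℝ, ContDiff ℝ ∞ k ∧ k 0 = deriv f 0 ∧ ∀ x, f x = x * k x := by
  have hf' : ContDiff ℝ ∞ (deriv f) := (contDiff_infty_iff_deriv.1 hf).2
  refine ⟨fun y => ∫ s in (0 : ℝ)..1, deriv f (s * y), contDiff_integral_comp_mul hf', by simp,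
    fun x => ?_⟩
  have hd : ∀ s ∈ uIcc (0 : ℝ) 1, HasDerivAt (fun s => f (s * x)) (x * deriv f (s * x)) s :=
    fun s _ => by
      have h1 := ((contDiff_infty_iff_deriv.1 hf).1 (s * x)).hasDerivAt
      have h := h1.comp s ((hasDerivAt_id s).mul_const x)
      exact h.congr_deriv (by ring)
  have hint := intervalIntegral.integral_eq_sub_of_hasDerivAt hd
    (Continuous.intervalIntegrable (by have := hf'.continuous; fun_prop) _ _)
  rw [intervalIntegral.integral_const_mul, one_mul, zero_mul, h0, sub_zero] at hint
  exact hint.symm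

/-- The autonomous equation `φ' = 1 / p(φ)` with a smooth speed that is bounded above has global
smooth solutions; the time needed to travel from `A` to `B` is `∫ p` over `[A, B]`. -/
lemma exists_global_flow {p : ℝ → ℝ} (hp : ContDiff ℝ ∞ p) {c : ℝ} (hc : 0 < c)
    (hpc : ∀ y, c ≤ p y) (A : ℝ) :
    ∃ φ : ℝ → ℝ, ContDiff ℝ ∞ φ ∧ φ 0 = A ∧ (∀ s, HasDerivAt φ (p (φ s))⁻¹ s) ∧
      StrictMono φ ∧ ∀ B, φ (∫ y in A..B, p y) = B := by
  set Φ : ℝ → ℝ := fun y => ∫ z in A..y, p z with hΦ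
  have hpcont := hp.continuous
  have hder : ∀ y, HasDerivAt Φ (p y) y := fun y =>
    intervalIntegral.integral_hasDerivAt_right (hpcont.intervalIntegrable _ _)
      (hpcont.stronglyMeasurableAtFilter _ _) hpcont.continuousAt
  have hderiv : deriv Φ = p := funext fun y => (hder y).deriv
  have hsm : ContDiff ℝ ∞ Φ := contDiff_infty_iff_deriv.2
    ⟨fun y => (hder y).differentiableAt, by rwa [hderiv]⟩
  have hmono : StrictMono Φ := strictMono_of_deriv_pos fun y => by
    rw [hderiv]; exact hc.trans_le (hpc y)
  have hlow : Monotone fun y => Φ y - c * y := by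
    apply monotone_of_deriv_nonneg
    · exact fun y => ((hder y).fun_sub ((hasDerivAt_id' y).const_mul c)).differentiableAt
    · intro y
      rw [((hder y).fun_sub ((hasDerivAt_id' y).const_mul c)).deriv]
      linarith [hpc y]
  have hA : Φ A = 0 := by simp [hΦ]
  have htop : Tendsto Φ atTop atTop := by
    refine tendsto_atTop_mono' _ ?_ ((tendsto_id.const_mul_atTop hc).atTop_add
      (tendsto_const_nhds (x := -(c * A))))
    filter_upwards [eventually_ge_atTop A] with y hy
    have := hlow hy
    simp only [hA, id] at this ⊢
    linarith
  have hbot : Tendsto Φ atBot atBot := by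
    refine tendsto_atBot_mono' _ ?_ ((tendsto_id.const_mul_atBot hc).atBot_add
      (tendsto_const_nhds (x := -(c * A))))
    filter_upwards [eventually_le_atBot A] with y hy
    have := hlow hy
    simp only [hA, id] at this ⊢
    linarith
  have hsurj : Function.Surjective Φ := hsm.continuous.surjective htop hbot
  let e := hmono.orderIsoOfSurjective Φ hsurj
  have hes : ContDiff ℝ ∞ e.toHomeomorph.symm :=
    e.toHomeomorph.contDiff_symm_deriv (f' := p) (fun x => (hc.trans_le (hpc x)).ne') hder hsm
  have hinv : ∀ y, e.toHomeomorph.symm (Φ y) = y := fun y => e.toHomeomorph.symm_apply_apply y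
  refine ⟨e.toHomeomorph.symm, hes, ?_, fun s => ?_, e.symm.strictMono, fun B => hinv B⟩
  · rw [← hA]; exact hinv A
  · exact HasDerivAt.of_local_left_inverse hes.continuous.continuousAt (hder _)
      (hc.trans_le (hpc _)).ne' (Eventually.of_forall fun y => e.toHomeomorph.apply_symm_apply y)

/-- A smooth function that is positive on a compact interval agrees near the interval with a smooth
function that is positive everywhere and bounded. -/
lemma exists_pos_extension {q : ℝ → ℝ} (hq : ContDiff ℝ ∞ q) {A B : ℝ} (hAB : A ≤ B)
    (hpos : ∀ y ∈ Icc A B, 0 < q y) :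
    ∃ (δ : ℝ) (Q : ℝ → ℝ) (C : ℝ), 0 < δ ∧ ContDiff ℝ ∞ Q ∧ (∀ y, 0 < Q y) ∧ (∀ y, Q y ≤ C) ∧
      ∀ y ∈ Ioo (A - δ) (B + δ), Q y = q y := by
  have hopen : IsOpen {y | 0 < q y} := isOpen_lt continuous_const hq.continuous
  obtain ⟨δ, hδ, hsub⟩ := (isCompact_Icc (a := A) (b := B)).exists_cthickening_subset_open hopen
    (fun y hy => hpos y hy)
  let χ : ContDiffBump ((A + B) / 2) :=
    ⟨(B - A) / 2 + δ / 2, (B - A) / 2 + δ, by linarith, by linarith⟩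
  have hχ1 : ∀ y ∈ Ioo (A - δ / 2) (B + δ / 2), χ y = 1 := fun y hy => by
    refine χ.one_of_mem_closedBall ?_
    simp only [Metric.mem_closedBall, Real.dist_eq, χ]
    rw [abs_le]
    constructor <;> linarith [hy.1, hy.2]
  have hχq : ∀ y, χ y ≠ 0 → 0 < q y := fun y hy => by
    have hy' : y ∈ Metric.ball ((A + B) / 2) ((B - A) / 2 + δ) := by
      rw [← χ.support_eq]; exact hy
    refine hsub ?_
    rw [Metric.mem_ball, Real.dist_eq, abs_lt] at hy'
    by_cases h1 : y < A
    · exact Metric.mem_cthickening_of_dist_le y A _ _ (left_mem_Icc.2 hAB) (by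
        rw [Real.dist_eq, abs_le]; constructor <;> linarith [hy'.1])
    by_cases h2 : B < y
    · exact Metric.mem_cthickening_of_dist_le y B _ _ (right_mem_Icc.2 hAB) (by
        rw [Real.dist_eq, abs_le]; constructor <;> linarith [hy'.2])
    · exact Metric.self_subset_cthickening _ ⟨not_lt.1 h1, not_lt.1 h2⟩
  have hcs : HasCompactSupport fun y => χ y * (q y - 1) := χ.hasCompactSupport.mul_right
  have hcd : ContDiff ℝ ∞ fun y => χ y * (q y - 1) := χ.contDiff.mul (hq.sub contDiff_const)
  obtain ⟨C, hC⟩ := hcs.exists_bound_of_continuous hcd.continuous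
  refine ⟨δ / 2, fun y => 1 + χ y * (q y - 1), 1 + C, by positivity, contDiff_const.add hcd,
    fun y => ?_, fun y => ?_, fun y hy => ?_⟩
  · by_cases h : χ y = 0
    · simp [h]
    · have h1 := hχq y h
      have h2 : 0 < χ y := lt_of_le_of_ne χ.nonneg (Ne.symm h)
      have h3 : χ y ≤ 1 := χ.le_one
      nlinarith [mul_pos h2 h1]
  · have := (le_abs_self _).trans (hC y)
    linarith
  · simp [hχ1 y hy]

/-! ### Duffing trajectories with a simple pole -/

/-- `U` is a solution of `U'' + U = U ^ 3` on `(-ε, π)` with `U 0 = X`, `U' 0 = Y` that has a simple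
pole at `π`: the function `θ ↦ sin θ * U (π - θ)` extends from `(0, π)` to a smooth function `H` on
the line, whose value at the origin is `√2` up to the sign. -/
structure IsProfile (X Y ε : ℝ) (U H : ℝ → ℝ) : Prop where
  pos : 0 < ε
  contDiffOn : ContDiffOn ℝ ∞ U (Ioo (-ε) π)
  hasDerivAt_deriv : ∀ s ∈ Ioo (-ε) π, HasDerivAt (deriv U) (-U s + U s ^ 3) s
  position : U 0 = X
  velocity : deriv U 0 = Y
  contDiff : ContDiff ℝ ∞ H
  eq_sin_mul : ∀ θ ∈ Ioo 0 π, H θ = sin θ * U (π - θ)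
  sq_zero : H 0 ^ 2 = 2

lemma IsProfile.neg {X Y ε : ℝ} {U H : ℝ → ℝ} (h : IsProfile X Y ε U H) :
    IsProfile (-X) (-Y) ε (fun s => -U s) (fun θ => -H θ) where
  pos := h.pos
  contDiffOn := h.contDiffOn.neg
  hasDerivAt_deriv s hs := by
    rw [deriv.fun_neg']
    exact ((h.hasDerivAt_deriv s hs).neg).congr_deriv (by ring)
  position := by rw [h.position]
  velocity := by rw [deriv.fun_neg, h.velocity]
  contDiff := h.contDiff.neg
  eq_sin_mul θ hθ := by rw [h.eq_sin_mul θ hθ]; ring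
  sq_zero := by rw [neg_sq, h.sq_zero]

/-- A solution with a simple pole at time `π`, from a compactified form of the Duffing equation. The
position is written as `N φ / cos φ` (with derivatives `M₁` and `M₂` in `φ`), where the angle `φ`
moves with the speed `√(q φ)` that does not vanish between the initial angle `A` and the angle `π/2`
which stands for infinity. The hypothesis `hode` is `U'' = -U + U ^ 3` in terms of `φ`. -/
lemma exists_isProfile_of_speed {q q' N M₁ M₂ : ℝ → ℝ} (hq : ContDiff ℝ ∞ q)
    (hN : ContDiff ℝ ∞ N) (hq' : ∀ y, HasDerivAt q (q' y) y)
    (hM₁ : ∀ y ∈ Ioo (-(π / 2)) (π / 2), HasDerivAt (fun y => N y / cos y) (M₁ y) y)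
    (hM₂ : ∀ y ∈ Ioo (-(π / 2)) (π / 2), HasDerivAt M₁ (M₂ y) y)
    (hode : ∀ y ∈ Ioo (-(π / 2)) (π / 2),
      M₂ y * q y + M₁ y * q' y / 2 = -(N y / cos y) + (N y / cos y) ^ 3)
    (hN2 : N (π / 2) ^ 2 = 2 * q (π / 2)) {A : ℝ} (hA : A ∈ Ioo (-(π / 2)) (π / 2))
    (hpos : ∀ y ∈ Icc A (π / 2), 0 < q y) (hint : ∫ y in A..π / 2, (√(q y))⁻¹ = π) :
    ∃ ε U H, IsProfile (N A / cos A) (√(q A) * M₁ A) ε U H := by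
  obtain ⟨δ, Q, C, hδ, hQ, hQpos, hQC, hQq⟩ := exists_pos_extension hq hA.2.le hpos
  have hsq : ContDiff ℝ ∞ fun y => √(Q y) := hQ.sqrt fun y => (hQpos y).ne'
  have hp : ContDiff ℝ ∞ fun y => (√(Q y))⁻¹ :=
    hsq.inv fun y => (sqrt_pos.2 (hQpos y)).ne'
  have hC : 0 < √C := sqrt_pos.2 ((hQpos 0).trans_le (hQC 0))
  obtain ⟨φ, hφ, hφ0, hφd, hφm, hφt⟩ := exists_global_flow hp (inv_pos.2 hC)
    (fun y => inv_anti₀ (sqrt_pos.2 (hQpos y)) (sqrt_le_sqrt (hQC y))) A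
  simp only [inv_inv] at hφd
  have hφπ : φ π = π / 2 := by
    have h1 : ∫ y in A..π / 2, (√(Q y))⁻¹ = ∫ y in A..π / 2, (√(q y))⁻¹ := ?_
    · rw [← hφt (π / 2), h1, hint]
    refine intervalIntegral.integral_congr fun y hy => ?_
    rw [uIcc_of_le hA.2.le] at hy
    simp only [hQq y ⟨by linarith [hy.1], by linarith [hy.2]⟩]
  -- The time `-ε` is so small that the angle stays in the range where nothing degenerates.
  obtain ⟨ε, hε, hεφ⟩ : ∃ ε > 0, ∀ s ∈ Ioo (-ε) π,
      φ s ∈ Ioo (-(π / 2)) (π / 2) ∧ φ s ∈ Ioo (A - δ) (π / 2 + δ) := by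
    have hcont : ContinuousAt φ 0 := hφ.continuous.continuousAt
    have hev : ∀ᶠ s in 𝓝 (0 : ℝ), φ s ∈ Ioi (max (-(π / 2)) (A - δ)) := by
      refine hcont.eventually (Ioi_mem_nhds ?_)
      rw [hφ0]
      exact max_lt hA.1 (by linarith)
    obtain ⟨ε, hε, hball⟩ := Metric.eventually_nhds_iff.1 hev
    refine ⟨ε, hε, fun s hs => ?_⟩
    have h2 : φ s < π / 2 := by rw [← hφπ]; exact hφm hs.2
    have h1 : max (-(π / 2)) (A - δ) < φ s := by
      rcases lt_or_ge s 0 with h | h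
      · exact hball (by rw [dist_zero_right, Real.norm_eq_abs, abs_lt]; constructor <;> linarith [hs.1])
      · exact (hball (y := (0 : ℝ)) (by simpa using hε)).trans_le (hφm.monotone h)
    exact ⟨⟨(le_max_left _ _).trans_lt h1, h2⟩, (le_max_right _ _).trans_lt h1, by linarith⟩
  have hcos : ∀ s ∈ Ioo (-ε) π, 0 < cos (φ s) := fun s hs => cos_pos_of_mem_Ioo (hεφ s hs).1
  have hU1 : ∀ s ∈ Ioo (-ε) π,
      HasDerivAt (fun s => N (φ s) / cos (φ s)) (M₁ (φ s) * √(Q (φ s))) s := fun s hs =>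
    (hM₁ _ (hεφ s hs).1).comp s (hφd s)
  have hderiv : ∀ s ∈ Ioo (-ε) π,
      deriv (fun s => N (φ s) / cos (φ s)) s = M₁ (φ s) * √(Q (φ s)) := fun s hs => (hU1 s hs).deriv
  have hQ' : ∀ s ∈ Ioo (-ε) π, HasDerivAt Q (q' (φ s)) (φ s) := fun s hs =>
    (hq' (φ s)).congr_of_eventuallyEq
      (eventually_of_mem (Ioo_mem_nhds (hεφ s hs).2.1 (hεφ s hs).2.2) hQq)
  -- The factor that resolves the pole: `cos (φ (π - θ)) = θ * k θ` and `sin θ = θ * j θ`.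
  have hrefl : ContDiff ℝ ∞ fun θ : ℝ => π - θ := contDiff_const.sub contDiff_id
  have hc : ContDiff ℝ ∞ fun θ => cos (φ (π - θ)) := contDiff_cos.comp (hφ.comp hrefl)
  obtain ⟨k, hk, hk0, hkeq⟩ := exists_contDiff_mul_of_zero hc (by simp [hφπ])
  obtain ⟨j, hj, hj0, hjeq⟩ := exists_contDiff_mul_of_zero contDiff_sin sin_zero
  have hQπ : Q (π / 2) = q (π / 2) := hQq _ ⟨by linarith [hA.2], by linarith⟩
  have hqπ : 0 < q (π / 2) := hpos _ ⟨hA.2.le, le_rfl⟩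
  have hk0' : k 0 = √(q (π / 2)) := by
    have h1 : HasDerivAt (fun θ : ℝ => π - θ) (-1) 0 := by
      simpa using (hasDerivAt_id' (0 : ℝ)).const_sub π
    have h2 := ((hφd (π - 0)).comp (0 : ℝ) h1).cos
    simp only [sub_zero, Function.comp_apply, hφπ, sin_pi_div_two, hQπ] at h2
    rw [hk0]
    exact (h2.congr_deriv (by ring)).deriv
  have hkpos : ∀ θ ∈ Icc 0 π, 0 < k θ := fun θ hθ => by
    rcases hθ.1.eq_or_lt with h | h
    · rw [← h, hk0']; exact sqrt_pos.2 hqπ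
    · have h1 := hcos (π - θ) ⟨by linarith [hθ.2], by linarith⟩
      rw [hkeq] at h1
      exact pos_of_mul_pos_right h1 h.le
  -- `k` is positive on `[0, π]` only, whereas `H` has to be smooth on the whole line.
  obtain ⟨η, k', -, hη, hk', hk'pos, -, hkk'⟩ := exists_pos_extension hk pi_pos.le hkpos
  refine ⟨ε, fun s => N (φ s) / cos (φ s), fun θ => j θ * N (φ (π - θ)) / k' θ, hε, ?_, ?_, ?_, ?_,
    ?_, ?_, ?_⟩
  · exact ((hN.comp hφ).contDiffOn).div (contDiff_cos.comp hφ).contDiffOn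
      fun s hs => (hcos s hs).ne'
  · intro s hs
    have hs' : Ioo (-ε) π ∈ 𝓝 s := Ioo_mem_nhds hs.1 hs.2
    refine HasDerivAt.congr_of_eventuallyEq ?_ (eventually_of_mem hs' hderiv)
    have h := ((hM₂ _ (hεφ s hs).1).comp s (hφd s)).mul
      (((hQ' s hs).comp s (hφd s)).sqrt (hQpos _).ne')
    refine h.congr_deriv ?_
    have hq1 := hQq _ (hεφ s hs).2
    have hr : √(Q (φ s)) * √(Q (φ s)) = q (φ s) := by rw [mul_self_sqrt (hQpos _).le, hq1]
    have hr0 : √(Q (φ s)) ≠ 0 := (sqrt_pos.2 (hQpos _)).ne'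
    rw [← hode _ (hεφ s hs).1, ← hr]
    simp only [Function.comp_apply]
    field_simp
  · simp only [hφ0]
  · rw [hderiv 0 ⟨by linarith, pi_pos⟩, hφ0, hQq A ⟨by linarith, by linarith [hA.2]⟩, mul_comm]
  · exact (hj.mul (hN.comp (hφ.comp hrefl))).div hk'
      fun θ => (hk'pos θ).ne'
  · intro θ hθ
    have h1 := hkk' θ ⟨by linarith [hθ.1], by linarith [hθ.2]⟩
    have h2 := (hkpos θ ⟨hθ.1.le, hθ.2.le⟩).ne'
    have h3 := hθ.1.ne'
    simp only [h1, hkeq, hjeq]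
    field_simp
  · have h1 := hkk' 0 ⟨by linarith, by linarith [pi_pos]⟩
    have h2 : j 0 = 1 := by rw [hj0]; simp
    simp only [h1, h2, hk0', sub_zero, hφπ, one_mul, div_pow, hN2, sq_sqrt hqπ.le]
    field_simp

/-- The square of the angular velocity for the substitution `U = tan φ` at energy `E`. -/
def tanSpeed (E y : ℝ) : ℝ := 2 * E * cos y ^ 4 - sin y ^ 2 * cos y ^ 2 + sin y ^ 4 / 2

/-- The square of the angular velocity for the substitution `U = m / cos φ`, where `m` is the turning
point. -/
def secSpeed (m y : ℝ) : ℝ := (m ^ 2 + (m ^ 2 - 2) * cos y ^ 2) / 2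

lemma contDiff_tanSpeed (E : ℝ) : ContDiff ℝ ∞ (tanSpeed E) := by
  unfold tanSpeed; fun_prop

lemma contDiff_secSpeed (m : ℝ) : ContDiff ℝ ∞ (secSpeed m) := by
  unfold secSpeed; fun_prop

lemma secSpeed_pos {m : ℝ} (hm : 1 < m) (y : ℝ) : 0 < secSpeed m y := by
  have h : secSpeed m y = (m ^ 2 * sin y ^ 2 + (2 * m ^ 2 - 2) * cos y ^ 2) / 2 := by
    unfold secSpeed
    rw [sin_sq]; ring
  rw [h]
  have h1 := sin_sq_add_cos_sq y
  have h2 : 0 < 2 * m ^ 2 - 2 := by nlinarith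
  rcases (sq_nonneg (cos y)).eq_or_lt with h3 | h3
  · rw [← h3] at h1 ⊢
    nlinarith
  · nlinarith [sq_nonneg (sin y), sq_nonneg m, mul_nonneg (sq_nonneg m) (sq_nonneg (sin y)), mul_pos h2 h3]

lemma tanSpeed_eq (E : ℝ) {y : ℝ} (hy : cos y ≠ 0) :
    tanSpeed E y = cos y ^ 4 * (2 * E - tan y ^ 2 + tan y ^ 4 / 2) := by
  unfold tanSpeed
  rw [tan_eq_sin_div_cos]
  field_simp

/-- A trajectory of energy `E` with increasing position, in terms of `U = tan φ`. It starts at the angle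
`A` and reaches infinity at time `π`. -/
lemma exists_isProfile_tan {E A : ℝ} (hA : A ∈ Ioo (-(π / 2)) (π / 2))
    (hpos : ∀ y ∈ Icc A (π / 2), 0 < tanSpeed E y)
    (hint : ∫ y in A..π / 2, (√(tanSpeed E y))⁻¹ = π) :
    ∃ ε U H, IsProfile (tan A) (√(tanSpeed E A) * (1 / cos A ^ 2)) ε U H := by
  rw [tan_eq_sin_div_cos]
  have hcos : ∀ y ∈ Ioo (-(π / 2)) (π / 2), cos y ≠ 0 := fun y hy => (cos_pos_of_mem_Ioo hy).ne'
  refine exists_isProfile_of_speed (N := sin) (M₁ := fun y => 1 / cos y ^ 2)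
    (M₂ := fun y => 2 * sin y / cos y ^ 3)
    (q' := fun y => -8 * E * cos y ^ 3 * sin y - 2 * sin y * cos y ^ 3 + 4 * sin y ^ 3 * cos y)
    (contDiff_tanSpeed E) contDiff_sin (fun y => ?_) (fun y hy => ?_) (fun y hy => ?_)
    (fun y hy => ?_) ?_ hA hpos hint
  · have hc := hasDerivAt_cos y
    have hs := hasDerivAt_sin y
    exact ((((hc.pow 4).const_mul (2 * E)).sub ((hs.pow 2).mul (hc.pow 2))).add
      ((hs.pow 4).div_const 2)).congr_deriv (by simp; ring)
  · refine ((hasDerivAt_sin y).div (hasDerivAt_cos y) (hcos y hy)).congr_deriv ?_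
    rw [← sin_sq_add_cos_sq y]; ring
  · refine ((((hasDerivAt_cos y).pow 2).inv (pow_ne_zero 2 (hcos y hy))).congr_deriv ?_).congr_of_eventuallyEq
      (Eventually.of_forall fun y => by simp)
    have := hcos y hy
    field_simp
    simp only [Nat.cast_ofNat, Pi.pow_apply]
    ring
  · have := hcos y hy
    have h2 : cos y ^ 2 = 1 - sin y ^ 2 := by rw [← sin_sq_add_cos_sq y]; ring
    unfold tanSpeed
    field_simp
    ring_nf
    have h4 : cos y ^ 4 = (1 - sin y ^ 2) ^ 2 := by rw [← h2]; ring
    simp only [h4, h2]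
    ring
  · simp [tanSpeed]

/-- A trajectory with a turning point at the position `m`, which corresponds to `φ = 0`, in terms of
`U = m / cos φ`. For `A < 0` it runs down to `m` and then up to infinity. -/
lemma exists_isProfile_sec {m A : ℝ} (hm : 1 < m) (hA : A ∈ Ioo (-(π / 2)) (π / 2))
    (hint : ∫ y in A..π / 2, (√(secSpeed m y))⁻¹ = π) :
    ∃ ε U H, IsProfile (m / cos A) (√(secSpeed m A) * (m * sin A / cos A ^ 2)) ε U H := by
  have hcos : ∀ y ∈ Ioo (-(π / 2)) (π / 2), cos y ≠ 0 := fun y hy => (cos_pos_of_mem_Ioo hy).ne'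
  refine exists_isProfile_of_speed (N := fun _ => m) (M₁ := fun y => m * sin y / cos y ^ 2)
    (M₂ := fun y => m * (1 / cos y + 2 * sin y ^ 2 / cos y ^ 3))
    (q' := fun y => -(m ^ 2 - 2) * cos y * sin y)
    (contDiff_secSpeed m) contDiff_const (fun y => ?_) (fun y hy => ?_) (fun y hy => ?_)
    (fun y hy => ?_) ?_ hA (fun y _ => secSpeed_pos hm y) hint
  · exact (((((hasDerivAt_cos y).pow 2).const_mul (m ^ 2 - 2)).const_add (m ^ 2)).div_const
      2).congr_deriv (by simp; ring)
  · refine ((hasDerivAt_const y m).div (hasDerivAt_cos y) (hcos y hy)).congr_deriv ?_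
    ring
  · have := hcos y hy
    refine (((hasDerivAt_sin y).const_mul m).div ((hasDerivAt_cos y).pow 2)
      (pow_ne_zero 2 this)).congr_deriv ?_
    simp
    field_simp
  · have := hcos y hy
    have h2 : sin y ^ 2 = 1 - cos y ^ 2 := by rw [← sin_sq_add_cos_sq y]; ring
    unfold secSpeed
    field_simp
    rw [h2]
    ring
  · simp [secSpeed]; ring

/-! ### Travel times to infinity -/

lemma measurable_duffingWeight (E : ℝ) : Measurable (duffingWeight E) := by
  unfold duffingWeight; fun_prop

lemma duffingWeight_anti {E E' : ℝ} (h : E ≤ E') (v : ℝ) :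
    duffingWeight E' v ≤ duffingWeight E v :=
  ENNReal.inv_le_inv.2 (ENNReal.ofReal_le_ofReal (sqrt_le_sqrt (by linarith)))

lemma R_anti (X : ℝ) {E E' : ℝ} (h : E ≤ E') : R X E' ≤ R X E :=
  lintegral_mono fun v => duffingWeight_anti h v

lemma R_strictAnti (X : ℝ) {E E' : ℝ} (h : E < E') (hfin : R X E ≠ ⊤) : R X E' < R X E := by
  refine lintegral_strict_mono (by simp) (measurable_duffingWeight E).aemeasurable
    (ne_top_of_le_ne_top hfin (R_anti X h.le)) ?_
  filter_upwards [ae_lt_top (measurable_duffingWeight E) hfin] with v hv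
  have h1 : 0 < √(2 * E - v ^ 2 + v ^ 4 / 2) := by
    by_contra h0
    simp [duffingWeight, ENNReal.ofReal_of_nonpos (not_lt.1 h0)] at hv
  refine ENNReal.inv_lt_inv.2 ((ENNReal.ofReal_lt_ofReal_iff ?_).2 ?_)
  · exact h1.trans_le (sqrt_le_sqrt (by linarith))
  · exact sqrt_lt_sqrt (sqrt_pos.1 h1).le (by linarith)

lemma continuous_duffingWeight_energy (v : ℝ) : Continuous fun E => duffingWeight E v := by
  unfold duffingWeight
  exact ContinuousInv.continuous_inv.comp (ENNReal.continuous_ofReal.comp (by fun_prop))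

lemma continuousOn_R (X : ℝ) {E₀ : ℝ} (hfin : R X E₀ ≠ ⊤) : ContinuousOn (R X) (Ici E₀) := by
  intro E _
  refine tendsto_lintegral_filter_of_dominated_convergence (duffingWeight E₀)
    (Eventually.of_forall fun E => measurable_duffingWeight E) ?_ hfin ?_
  · filter_upwards [self_mem_nhdsWithin] with E' hE'
    exact Eventually.of_forall fun v => duffingWeight_anti hE' v
  · exact Eventually.of_forall fun v =>
      (continuous_duffingWeight_energy v).continuousAt.continuousWithinAt

/-- The travel time is continuous from the right in `E` even where it is infinite. -/
lemma tendsto_R_right (X E : ℝ) :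
    Tendsto (fun n : ℕ => R X (E + 1 / (n + 1))) atTop (𝓝 (R X E)) := by
  refine lintegral_tendsto_of_tendsto_of_monotone
    (fun n => (measurable_duffingWeight _).aemeasurable) (Eventually.of_forall fun v => ?_)
    (Eventually.of_forall fun v => ?_)
  · intro m n hmn
    exact duffingWeight_anti (by gcongr) v
  · have h := (continuous_duffingWeight_energy v).tendsto E
    refine h.comp ?_
    simpa using (tendsto_one_div_add_atTop_nhds_zero_nat (𝕜 := ℝ)).const_add E

lemma tendsto_R_atTop (X : ℝ) {E : ℝ} (hfin : R X E ≠ ⊤) :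
    Tendsto (fun n : ℕ => R X (E + n)) atTop (𝓝 0) := by
  have h : Tendsto (fun n : ℕ => R X (E + n)) atTop
      (𝓝 (∫⁻ _ in Ioi X, (0 : ℝ≥0∞))) := by
    refine tendsto_lintegral_of_dominated_convergence (duffingWeight E)
      (fun n => measurable_duffingWeight _) (fun n => Eventually.of_forall fun v =>
        duffingWeight_anti (by simp) v) hfin (Eventually.of_forall fun v => ?_)
    rw [← ENNReal.inv_top]
    refine (ContinuousInv.continuous_inv.tendsto _).comp (ENNReal.tendsto_ofReal_atTop.comp
      (tendsto_sqrt_atTop.comp ?_))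
    have h1 : Tendsto (fun n : ℕ => (n : ℝ)) atTop atTop := tendsto_natCast_atTop_atTop
    refine tendsto_atTop_mono (fun n => ?_) (((h1.const_mul_atTop (two_pos)).atTop_add
      (tendsto_const_nhds (x := 2 * E - v ^ 2 + v ^ 4 / 2))))
    linarith
  simpa using h

lemma image_tan_Ioo (X : ℝ) : tan '' Ioo (arctan X) (π / 2) = Ioi X := by
  ext v
  constructor
  · rintro ⟨y, hy, rfl⟩
    rw [mem_Ioi]
    conv_lhs => rw [← tan_arctan X]
    exact tan_lt_tan_of_lt_of_lt_pi_div_two (neg_pi_div_two_lt_arctan X) hy.2 hy.1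
  · intro hv
    exact ⟨arctan v, ⟨arctan_strictMono hv, arctan_lt_pi_div_two v⟩, tan_arctan v⟩

/-- The travel time to infinity in terms of the angle `arctan v`. -/
lemma R_eq_lintegral_tanSpeed (X E : ℝ) :
    R X E = ∫⁻ y in Ioo (arctan X) (π / 2), (ENNReal.ofReal √(tanSpeed E y))⁻¹ := by
  have hcos : ∀ y ∈ Ioo (arctan X) (π / 2), 0 < cos y := fun y hy =>
    cos_pos_of_mem_Ioo ⟨(neg_pi_div_two_lt_arctan X).trans hy.1, hy.2⟩
  rw [R, ← image_tan_Ioo X, lintegral_image_eq_lintegral_abs_deriv_mul measurableSet_Ioo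
    (fun y hy => (hasDerivAt_tan (hcos y hy).ne').hasDerivWithinAt)
    (fun y hy z hz h => ?_)]
  · refine setLIntegral_congr_fun measurableSet_Ioo fun y hy => ?_
    have hc := hcos y hy
    have hc2 : 0 < cos y ^ 2 := by positivity
    simp only [tanSpeed_eq E hc.ne', duffingWeight]
    rw [show cos y ^ 4 = (cos y ^ 2) ^ 2 by ring, sqrt_mul (by positivity), sqrt_sq hc2.le,
      ENNReal.ofReal_mul hc2.le, ENNReal.mul_inv (Or.inl (by simpa using hc.ne')) (Or.inl (by simp)),
      abs_of_pos (by positivity), one_div, ENNReal.ofReal_inv_of_pos hc2]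
  · have h1 := neg_pi_div_two_lt_arctan X
    exact strictMonoOn_tan.injOn ⟨h1.trans hy.1, hy.2⟩ ⟨h1.trans hz.1, hz.2⟩ h

lemma setLIntegral_Ioo_eq_ofReal {f : ℝ → ℝ} {a b : ℝ} (hab : a ≤ b)
    (hf : ContinuousOn f (Icc a b)) (h0 : ∀ y ∈ Icc a b, 0 ≤ f y) :
    ∫⁻ y in Ioo a b, ENNReal.ofReal (f y) = ENNReal.ofReal (∫ y in a..b, f y) := by
  rw [intervalIntegral.integral_of_le hab, ← ofReal_integral_eq_lintegral_ofReal]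
  · congr 2
    exact Measure.restrict_congr_set Ioo_ae_eq_Ioc
  · exact (hf.integrableOn_Icc).mono_set Ioo_subset_Icc_self
  · exact (ae_restrict_iff' measurableSet_Ioo).2 (Eventually.of_forall fun y hy =>
      h0 y (Ioo_subset_Icc_self hy))

/-- If the angular velocity does not vanish on the way, the travel time to infinity is finite and given
by an interval integral. -/
lemma R_eq_ofReal {X E : ℝ} (hpos : ∀ y ∈ Icc (arctan X) (π / 2), 0 < tanSpeed E y) :
    R X E = ENNReal.ofReal (∫ y in arctan X..π / 2, (√(tanSpeed E y))⁻¹) := by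
  rw [R_eq_lintegral_tanSpeed, ← setLIntegral_Ioo_eq_ofReal (arctan_lt_pi_div_two X).le]
  · refine setLIntegral_congr_fun measurableSet_Ioo fun y hy => ?_
    exact (ENNReal.ofReal_inv_of_pos (sqrt_pos.2 (hpos y (Ioo_subset_Icc_self hy)))).symm
  · exact ((contDiff_tanSpeed E).continuous.sqrt).continuousOn.inv₀
      fun y hy => (sqrt_pos.2 (hpos y hy)).ne'
  · exact fun y _ => by positivity

/-! ### Travel times in terms of the turning point -/

/-- The time which the trajectory with turning point `m` needs from there to the position
`m / cos B`. -/
def secTime (m B : ℝ) : ℝ := ∫ y in (0 : ℝ)..B, (√(secSpeed m y))⁻¹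

lemma continuous_inv_sqrt_secSpeed {m : ℝ} (hm : 1 < m) :
    Continuous fun y => (√(secSpeed m y))⁻¹ :=
  (contDiff_secSpeed m).continuous.sqrt.inv₀ fun y => (sqrt_pos.2 (secSpeed_pos hm y)).ne'

lemma image_sec_Ioo {m : ℝ} (hm : 0 < m) : (fun y => m / cos y) '' Ioo 0 (π / 2) = Ioi m := by
  ext v
  constructor
  · rintro ⟨y, hy, rfl⟩
    have hc : 0 < cos y := cos_pos_of_mem_Ioo ⟨by linarith [hy.1, pi_pos], hy.2⟩
    have hc1 : cos y < 1 := by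
      rw [← cos_zero]
      exact cos_lt_cos_of_nonneg_of_le_pi_div_two le_rfl hy.2.le hy.1
    rw [mem_Ioi, lt_div_iff₀ hc]
    nlinarith
  · intro hv
    have hv0 : 0 < v := hm.trans hv
    have h1 : m / v < 1 := (div_lt_one hv0).2 hv
    have h0 : 0 < m / v := by positivity
    refine ⟨arccos (m / v), ⟨arccos_pos.2 h1, arccos_lt_pi_div_two.2 h0⟩, ?_⟩
    simp only
    rw [cos_arccos (by linarith) h1.le]
    field_simp

lemma image_sec_Ioc {m X : ℝ} (hm : 0 < m) (hX : m ≤ X) :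
    (fun y => m / cos y) '' Ioc 0 (arccos (m / X)) = Ioc m X := by
  have hX0 : 0 < X := hm.trans_le hX
  have hb : arccos (m / X) < π / 2 := arccos_lt_pi_div_two.2 (by positivity)
  have hmX : m / X ≤ 1 := (div_le_one hX0).2 hX
  have hmX0 : 0 < m / X := by positivity
  ext v
  constructor
  · rintro ⟨y, hy, rfl⟩
    have hy2 := hy.2.trans_lt hb
    have hmem : m / cos y ∈ Ioi m := by rw [← image_sec_Ioo hm]; exact ⟨y, ⟨hy.1, hy2⟩, rfl⟩
    have hc : 0 < cos y := cos_pos_of_mem_Ioo ⟨by linarith [hy.1, pi_pos], hy2⟩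
    refine ⟨hmem, ?_⟩
    have h1 : cos (arccos (m / X)) ≤ cos y :=
      cos_le_cos_of_nonneg_of_le_pi hy.1.le (by linarith [pi_pos]) hy.2
    rw [cos_arccos (by linarith) hmX, div_le_iff₀ hX0] at h1
    rw [div_le_iff₀ hc]
    linarith
  · intro hv
    have hv0 : 0 < v := hm.trans hv.1
    have h1 : m / v < 1 := (div_lt_one hv0).2 hv.1
    have h0 : 0 < m / v := by positivity
    refine ⟨arccos (m / v), ⟨arccos_pos.2 h1, arccos_le_arccos ?_⟩, ?_⟩
    · gcongr
      exact hv.2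
    · simp only
      rw [cos_arccos (by linarith) h1.le]
      field_simp

lemma duffing_sec {m y : ℝ} (hy : cos y ≠ 0) :
    2 * potential m - (m / cos y) ^ 2 + (m / cos y) ^ 4 / 2 =
      (m * sin y / cos y ^ 2) ^ 2 * secSpeed m y := by
  have h2 : sin y ^ 2 = 1 - cos y ^ 2 := by rw [← sin_sq_add_cos_sq y]; ring
  unfold potential secSpeed
  field_simp
  rw [h2]
  ring

lemma setLIntegral_image_sec {m : ℝ} (hm : 1 < m) {s : Set ℝ} (hs : MeasurableSet s)
    (hsub : s ⊆ Ioo 0 (π / 2)) :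
    ∫⁻ v in (fun y => m / cos y) '' s, duffingWeight (potential m) v =
      ∫⁻ y in s, ENNReal.ofReal (√(secSpeed m y))⁻¹ := by
  have hcos : ∀ y ∈ s, 0 < cos y := fun y hy =>
    cos_pos_of_mem_Ioo ⟨by linarith [(hsub hy).1, pi_pos], (hsub hy).2⟩
  have hm0 : 0 < m := by linarith
  rw [lintegral_image_eq_lintegral_abs_deriv_mul hs (f' := fun y => m * sin y / cos y ^ 2)
    (fun y hy => ?_) (fun y hy z hz h => ?_)]
  · refine setLIntegral_congr_fun hs fun y hy => ?_
    have hc := hcos y hy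
    have hsin : 0 < sin y := sin_pos_of_pos_of_lt_pi (hsub hy).1 (by linarith [(hsub hy).2, pi_pos])
    have hd : 0 < m * sin y / cos y ^ 2 := by positivity
    have hq := sqrt_pos.2 (secSpeed_pos hm y)
    simp only [duffingWeight, duffing_sec hc.ne']
    rw [sqrt_mul (by positivity), sqrt_sq hd.le, abs_of_pos hd, ENNReal.ofReal_mul hd.le,
      ENNReal.mul_inv (Or.inl (by simpa using hd)) (Or.inl (by simp)), ← mul_assoc,
      ENNReal.mul_inv_cancel (by simpa using hd) (by simp), one_mul, ENNReal.ofReal_inv_of_pos hq]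
  · refine (((hasDerivAt_const y m).div (hasDerivAt_cos y) (hcos y hy).ne').congr_deriv
      ?_).hasDerivWithinAt
    ring
  · have h1 : cos y = cos z := by
      have hy0 := (hcos y hy).ne'
      have hz0 := (hcos z hz).ne'
      field_simp at h
      exact h.symm
    have hp := pi_pos
    exact injOn_cos ⟨(hsub hy).1.le, by linarith [(hsub hy).2]⟩
      ⟨(hsub hz).1.le, by linarith [(hsub hz).2]⟩ h1

lemma R_potential {m : ℝ} (hm : 1 < m) :
    R m (potential m) = ENNReal.ofReal (secTime m (π / 2)) := by
  rw [R, ← image_sec_Ioo (by linarith : 0 < m), setLIntegral_image_sec hm measurableSet_Ioo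
    subset_rfl, secTime, setLIntegral_Ioo_eq_ofReal (by positivity)
      (continuous_inv_sqrt_secSpeed hm).continuousOn fun y _ => by positivity]

lemma secTime_nonneg (m : ℝ) {B : ℝ} (hB : 0 ≤ B) : 0 ≤ secTime m B :=
  intervalIntegral.integral_nonneg hB fun y _ => by positivity

lemma turningPoint_potential {m : ℝ} (hm : 1 < m) : turningPoint (potential m) = m := by
  unfold turningPoint potential
  rw [show 1 - 4 * (m ^ 2 / 2 - m ^ 4 / 4) = (m ^ 2 - 1) ^ 2 by ring, sqrt_sq (by nlinarith),
    add_sub_cancel, sqrt_sq (by linarith)]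

lemma S_potential {m X : ℝ} (hm : 1 < m) (hX : m ≤ |X|) :
    S X (potential m) =
      ENNReal.ofReal (secTime m (arccos (m / |X|)) + secTime m (π / 2)) := by
  have hX0 : 0 < |X| := by linarith
  have hb : arccos (m / |X|) < π / 2 := arccos_lt_pi_div_two.2 (by positivity)
  have h2 := R_potential hm
  rw [R] at h2
  rw [S, turningPoint_potential hm, h2, ENNReal.ofReal_add (secTime_nonneg m (arccos_nonneg _))
    (secTime_nonneg m (by positivity)), ← image_sec_Ioc (by linarith) hX,
    setLIntegral_image_sec hm measurableSet_Ioc fun y hy => ⟨hy.1, hy.2.trans_lt hb⟩]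
  nth_rw 2 [secTime]
  rw [← setLIntegral_Ioo_eq_ofReal (arccos_nonneg _) (continuous_inv_sqrt_secSpeed hm).continuousOn
      fun y _ => by positivity]
  congr 1
  exact setLIntegral_congr Ioo_ae_eq_Ioc.symm

lemma secTime_strictAnti {m n : ℝ} (hm : 1 < m) (hmn : m < n) :
    secTime n (π / 2) < secTime m (π / 2) := by
  have hlt : ∀ y, (√(secSpeed n y))⁻¹ < (√(secSpeed m y))⁻¹ := fun y => by
    have h0 := secSpeed_pos hm y
    refine inv_strictAnti₀ (sqrt_pos.2 h0) (sqrt_lt_sqrt h0.le ?_)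
    unfold secSpeed
    nlinarith [sq_nonneg (cos y), mul_nonneg (sq_nonneg (cos y)) (by nlinarith : 0 ≤ n ^ 2 - m ^ 2)]
  exact intervalIntegral.integral_lt_integral_of_continuousOn_of_le_of_exists_lt (by positivity)
    (continuous_inv_sqrt_secSpeed (hm.trans hmn)).continuousOn
    (continuous_inv_sqrt_secSpeed hm).continuousOn (fun y _ => (hlt y).le)
    ⟨0, ⟨le_rfl, by positivity⟩, hlt 0⟩

lemma continuousOn_secTime {a : ℝ} (ha : 1 < a) {B : ℝ → ℝ} (hB : ContinuousOn B (Ici a)) :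
    ContinuousOn (fun m => secTime m (B m)) (Ici a) := by
  have h1 : Continuous (Function.uncurry fun m y => (√(secSpeed (max m a) y))⁻¹) := by
    refine Continuous.inv₀ ?_ fun z => (sqrt_pos.2 (secSpeed_pos (lt_max_of_lt_right ha) _)).ne'
    change Continuous fun z : ℝ × ℝ => √(((max z.1 a) ^ 2 + ((max z.1 a) ^ 2 - 2) * cos z.2 ^ 2) / 2)
    fun_prop
  have h2 := intervalIntegral.continuous_parametric_primitive_of_continuous (a₀ := 0)
    (μ := volume) h1
  have h3 : ContinuousOn (fun m => (m, B m)) (Ici a) := continuousOn_id.prodMk hB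
  refine (h2.comp_continuousOn h3).congr fun m hm => ?_
  simp [secTime, max_eq_left (mem_Ici.1 hm)]

lemma secTime_two_lt : secTime 2 (π / 2) < π := by
  have h : secTime 2 (π / 2) ≤ ∫ _ in (0 : ℝ)..π / 2, (1 : ℝ) := by
    refine intervalIntegral.integral_mono_on (by positivity)
      ((continuous_inv_sqrt_secSpeed one_lt_two).intervalIntegrable _ _)
      intervalIntegrable_const fun y _ => ?_
    refine inv_le_one_of_one_le₀ (one_le_sqrt.2 ?_)
    unfold secSpeed
    nlinarith [sq_nonneg (cos y)]
  simp at h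
  linarith [pi_pos]

/-- Trajectories with turning point close to the equilibrium `1` take arbitrarily long. -/
lemma exists_pi_lt_secTime : ∃ m, 1 < m ∧ m ≤ 2 ∧ π < secTime m (π / 2) := by
  have hη : 0 < exp (-4) := exp_pos _
  have hη1 : exp (-4) < 1 := by rw [exp_lt_one_iff]; norm_num
  have hη2 : 0 < exp (-4) ^ 2 := by positivity
  have hη3 : exp (-4) ^ 2 < 1 := by nlinarith
  have hm2 : √(1 + exp (-4) ^ 2) ^ 2 = 1 + exp (-4) ^ 2 := sq_sqrt (by positivity)
  have hm1 : 1 < √(1 + exp (-4) ^ 2) := by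
    rw [lt_sqrt (by norm_num)]; linarith
  -- With `m ^ 2 = 1 + η ^ 2` and `η = exp (-4)` the speed is at most `y + η`, so that the travel time is
  -- at least `log ((π / 2 + η) / η) ≥ 4 > π`.
  refine ⟨√(1 + exp (-4) ^ 2), hm1, ?_, ?_⟩
  · rw [sqrt_le_left (by norm_num)]; linarith
  have hle : ∫ y in (0 : ℝ)..π / 2, (y + exp (-4))⁻¹ ≤ secTime (√(1 + exp (-4) ^ 2)) (π / 2) := by
    refine intervalIntegral.integral_mono_on (by positivity) ?_
      ((continuous_inv_sqrt_secSpeed hm1).intervalIntegrable _ _) fun y hy => ?_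
    · refine ContinuousOn.intervalIntegrable (ContinuousOn.inv₀ (by fun_prop) fun y hy => ?_)
      rw [uIcc_of_le (by positivity)] at hy
      linarith [hy.1]
    · have hy0 := hy.1
      refine inv_anti₀ (sqrt_pos.2 (secSpeed_pos hm1 y)) ((sqrt_le_left (by positivity)).2 ?_)
      unfold secSpeed
      rw [hm2]
      have hs : sin y ^ 2 ≤ y ^ 2 := by rw [sq_le_sq]; exact abs_sin_le_abs
      have hc : cos y ^ 2 = 1 - sin y ^ 2 := by rw [← sin_sq_add_cos_sq y]; ring
      rw [hc]
      nlinarith [sq_nonneg (sin y), mul_nonneg hy0 hη.le, mul_nonneg hη2.le (sq_nonneg (sin y))]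
  refine lt_of_lt_of_le ?_ hle
  rw [intervalIntegral.integral_comp_add_right fun y => y⁻¹, integral_inv_of_pos (by linarith)
    (by positivity), zero_add, log_div (by positivity) hη.ne', log_exp]
  have h1 : 0 ≤ log (π / 2 + exp (-4)) := log_nonneg (by linarith [pi_gt_three])
  linarith [pi_lt_four]

/-- `XC` is a turning point with travel time exactly `π`: the travel time is continuous and strictly
decreasing in the turning point, so that the set in the definition of `XC` is a singleton. -/
lemma XC_spec : 1 < XC ∧ secTime XC (π / 2) = π := by
  obtain ⟨a, ha1, ha2, ha⟩ := exists_pi_lt_secTime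
  have hcont := continuousOn_secTime ha1 (B := fun _ => π / 2) continuousOn_const
  obtain ⟨m, hm, hmπ⟩ := intermediate_value_Icc' ha2 (hcont.mono Icc_subset_Ici_self)
    ⟨secTime_two_lt.le, ha.le⟩
  have hm1 : 1 < m := ha1.trans_le hm.1
  have hset : {X : ℝ | 1 < X ∧ R X (potential X) = ENNReal.ofReal π} = {m} := by
    ext X
    simp only [mem_ofPred_eq, mem_singleton_iff]
    constructor
    · rintro ⟨hX, h⟩
      rw [R_potential hX, ENNReal.ofReal_eq_ofReal_iff (secTime_nonneg X (by positivity))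
        pi_pos.le] at h
      rcases lt_trichotomy X m with h1 | h1 | h1
      · have := secTime_strictAnti hX h1
        simp only [hmπ] at this; linarith
      · exact h1
      · have := secTime_strictAnti hm1 h1
        simp only [hmπ] at this; linarith
    · rintro rfl
      simp only at hmπ
      exact ⟨hm1, by rw [R_potential hm1, hmπ]⟩
  have hXC : XC = m := by rw [XC, hset, csInf_singleton]
  rw [hXC]
  exact ⟨hm1, hmπ⟩

/-! ### Trajectories on the threshold curve -/

lemma potential_le (X : ℝ) : potential X ≤ 1 / 4 := by
  unfold potential
  nlinarith [sq_nonneg (X ^ 2 - 1)]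

/-- At the energy of the separatrix and below, the equilibrium `1` cannot be passed within time
`π`. -/
lemma pi_lt_R_of_le_one {X E : ℝ} (hX : X ≤ 1) (hE : E ≤ 1 / 4) : ENNReal.ofReal π < R X E := by
  refine lt_of_lt_of_le ?_ (R_anti X hE)
  have hη : 0 < exp (-12) := exp_pos _
  have hη1 : exp (-12) < 1 := by rw [exp_lt_one_iff]; norm_num
  have hcont : ContinuousOn (fun v : ℝ => (3 * (v - 1))⁻¹) (Icc (1 + exp (-12)) 2) :=
    ContinuousOn.inv₀ (by fun_prop) fun v hv => by
      have := hv.1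
      exact (by linarith : 0 < 3 * (v - 1)).ne'
  -- For `E = 1 / 4` the radicand is `(v ^ 2 - 1) ^ 2 / 2`, at most `(3 * (v - 1)) ^ 2` for `v` between
  -- `1` and `2`. The integral of `1 / (3 * (v - 1))` from `1 + exp (-12)` to `2` is `4 > π`.
  calc ENNReal.ofReal π
      < ENNReal.ofReal (∫ v in (1 + exp (-12))..2, (3 * (v - 1))⁻¹) := by
        refine (ENNReal.ofReal_lt_ofReal_iff_of_nonneg pi_pos.le).2 ?_
        simp_rw [mul_inv]
        rw [intervalIntegral.integral_const_mul,
          intervalIntegral.integral_comp_sub_right fun v => v⁻¹, integral_inv_of_pos (by linarith)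
          (by norm_num), add_sub_cancel_left, log_div (by norm_num) hη.ne', log_exp]
        norm_num
        linarith [pi_lt_four]
    _ = ∫⁻ v in Ioo (1 + exp (-12)) 2, ENNReal.ofReal (3 * (v - 1))⁻¹ :=
        (setLIntegral_Ioo_eq_ofReal (by linarith) hcont fun v hv => by
          have := hv.1
          exact inv_nonneg.2 (by linarith)).symm
    _ ≤ ∫⁻ v in Ioo (1 + exp (-12)) 2, duffingWeight (1 / 4) v := by
        refine setLIntegral_mono' measurableSet_Ioo fun v hv => ?_
        have h1 : 0 < v - 1 := by linarith [hv.1]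
        rw [ENNReal.ofReal_inv_of_pos (by positivity), duffingWeight]
        refine ENNReal.inv_le_inv.2 (ENNReal.ofReal_le_ofReal
          ((sqrt_le_left (by positivity)).2 ?_))
        nlinarith [hv.2, sq_nonneg (v - 1), mul_pos h1 h1, mul_nonneg (mul_pos h1 h1).le (by
          nlinarith [hv.2] : 0 ≤ 9 - (v + 1) ^ 2)]
    _ ≤ R X (1 / 4) := lintegral_mono_set fun v hv => by
        have := hv.1
        rw [mem_Ioi]; linarith

/-- Above the critical energy the angular velocity does not vanish up to infinity. -/
lemma tanSpeed_pos {X E : ℝ} (hE : if X ≤ 1 then 1 / 4 < E else potential X < E) :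
    ∀ y ∈ Icc (arctan X) (π / 2), 0 < tanSpeed E y := by
  intro y hy
  rcases hy.2.eq_or_lt with h | h
  · simp [h, tanSpeed]
  have hy' : y ∈ Ioo (-(π / 2)) (π / 2) := ⟨(neg_pi_div_two_lt_arctan X).trans_le hy.1, h⟩
  have hc := cos_pos_of_mem_Ioo hy'
  rw [tanSpeed_eq E hc.ne']
  have hv : X ≤ tan y := by
    conv_lhs => rw [← tan_arctan X]
    exact strictMonoOn_tan.monotoneOn (arctan_mem_Ioo X) hy' hy.1
  refine mul_pos (by positivity) ?_
  split_ifs at hE with hX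
  · nlinarith [sq_nonneg (tan y ^ 2 - 1)]
  · have h1 : 1 < X := not_le.1 hX
    unfold potential at hE
    have h2 : X ^ 2 ≤ tan y ^ 2 := by nlinarith
    nlinarith [mul_nonneg (sub_nonneg.2 h2) (by nlinarith : 0 ≤ tan y ^ 2 + X ^ 2 - 2)]

/-- The travel time to infinity is strictly decreasing in the energy, so that the admissible energy is
unique. -/
lemma betaPlus_eq {X E : ℝ} (hE : potential X ≤ E) (hR : R X E = ENNReal.ofReal π) :
    betaPlus X = E := by
  have hset : {E : ℝ | potential X ≤ E ∧ R X E = ENNReal.ofReal π} = {E} := by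
    ext E'
    simp only [mem_ofPred_eq, mem_singleton_iff]
    constructor
    · rintro ⟨-, h⟩
      rcases lt_trichotomy E' E with h1 | h1 | h1
      · have := R_strictAnti X h1 (by rw [h]; simp)
        rw [h, hR] at this
        exact absurd this (lt_irrefl _)
      · exact h1
      · have := R_strictAnti X h1 (by rw [hR]; simp)
        rw [h, hR] at this
        exact absurd this (lt_irrefl _)
    · rintro rfl; exact ⟨hE, hR⟩
  rw [betaPlus, hset, csInf_singleton]

/-- For `X ≤ XC` the trajectory with the energy `betaPlus X` and nonnegative velocity reaches infinity at
time `π`. This energy exists by the intermediate value theorem: at the critical energy the travel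
time is at least `π`, above it the travel time is finite and it decreases to zero. -/
lemma exists_isProfile_of_le_XC {X : ℝ} (hX : X ≤ XC) :
    ∃ ε U H, IsProfile X (√(2 * betaPlus X - X ^ 2 + X ^ 4 / 2)) ε U H := by
  obtain ⟨hXC1, hXCπ⟩ := XC_spec
  -- The critical energy, above which the trajectory reaches infinity without obstruction.
  set E₀ : ℝ := if X ≤ 1 then 1 / 4 else potential X with hE₀
  have hcrit : ∀ E, E₀ < E → if X ≤ 1 then 1 / 4 < E else potential X < E := fun E hE => by
    rw [hE₀] at hE
    split_ifs at hE ⊢ <;> exact hE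
  have hpot : potential X ≤ E₀ := by
    rw [hE₀]; split_ifs
    exacts [potential_le X, le_rfl]
  have hge : ENNReal.ofReal π ≤ R X E₀ := by
    rw [hE₀]
    split_ifs with h
    · exact (pi_lt_R_of_le_one h le_rfl).le
    · rw [R_potential (not_le.1 h)]
      refine ENNReal.ofReal_le_ofReal ?_
      rcases hX.eq_or_lt with h1 | h1
      · rw [h1, hXCπ]
      · exact hXCπ.symm.le.trans (secTime_strictAnti (not_le.1 h) h1).le
  rcases hge.eq_or_lt with h | h
  -- Equality occurs only for `X = XC`, where the trajectory starts at rest in its turning point.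
  · have h1 : 1 < X := by
      by_contra h1
      have := pi_lt_R_of_le_one (not_lt.1 h1) (E := E₀) (by simp [hE₀, not_lt.1 h1])
      exact this.ne h
    have hE₀' : E₀ = potential X := by simp [hE₀, h1]
    rw [betaPlus_eq hpot h.symm, hE₀']
    rw [hE₀', R_potential h1, ENNReal.ofReal_eq_ofReal_iff pi_pos.le
      (secTime_nonneg X (by positivity))] at h
    have := exists_isProfile_sec h1 (A := 0) ⟨by linarith [pi_pos], by positivity⟩ h.symm
    have h0 : 2 * potential X - X ^ 2 + X ^ 4 / 2 = 0 := by unfold potential; ring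
    rw [h0]
    simpa using this
  -- The travel time may be infinite at the critical energy itself, so the intermediate value theorem is
  -- applied on an interval that starts slightly above it.
  · obtain ⟨n, hn⟩ := ((tendsto_R_right X E₀).eventually (lt_mem_nhds h)).exists
    have hn0 : E₀ < E₀ + 1 / ((n : ℝ) + 1) := by
      have : 0 < 1 / ((n : ℝ) + 1) := by positivity
      linarith
    have hfin : R X (E₀ + 1 / ((n : ℝ) + 1)) ≠ ⊤ := by
      rw [R_eq_ofReal (tanSpeed_pos (hcrit _ hn0))]; simp
    obtain ⟨k, hk⟩ := ((tendsto_R_atTop X hfin).eventually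
      (gt_mem_nhds (ENNReal.ofReal_pos.2 pi_pos))).exists
    obtain ⟨E, hE, hEπ⟩ := intermediate_value_Icc' (by simp)
      ((continuousOn_R X hfin).mono Icc_subset_Ici_self) ⟨hk.le, hn.le⟩
    have hE0 : E₀ < E := hn0.trans_le hE.1
    have hpos := tanSpeed_pos (hcrit E hE0)
    rw [betaPlus_eq (hpot.trans hE0.le) hEπ]
    rw [R_eq_ofReal hpos, ENNReal.ofReal_eq_ofReal_iff (intervalIntegral.integral_nonneg
      (arctan_lt_pi_div_two X).le fun y _ => by positivity) pi_pos.le] at hEπ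
    have := exists_isProfile_tan (arctan_mem_Ioo X) hpos hEπ
    have hc : 0 < cos (arctan X) := cos_arctan_pos X
    rw [tanSpeed_eq E hc.ne', tan_arctan, show cos (arctan X) ^ 4 = (cos (arctan X) ^ 2) ^ 2 by ring,
      sqrt_mul (by positivity), sqrt_sq (by positivity)] at this
    convert this using 2
    field_simp

lemma potential_strictAnti {m n : ℝ} (hm : 1 < m) (h : m < n) : potential n < potential m := by
  unfold potential
  nlinarith [mul_pos (by nlinarith : 0 < n ^ 2 - m ^ 2) (by nlinarith : 0 < n ^ 2 + m ^ 2 - 2)]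

lemma exists_potential_eq {E : ℝ} (hE : E < 1 / 4) : ∃ m, 1 < m ∧ potential m = E := by
  have h1 : 0 < √(1 - 4 * E) := sqrt_pos.2 (by linarith)
  refine ⟨√(1 + √(1 - 4 * E)), by rw [lt_sqrt (by norm_num)]; linarith, ?_⟩
  have h2 : √(1 + √(1 - 4 * E)) ^ 2 = 1 + √(1 - 4 * E) := sq_sqrt (by positivity)
  have h3 : √(1 - 4 * E) ^ 2 = 1 - 4 * E := sq_sqrt (by linarith)
  unfold potential
  rw [show √(1 + √(1 - 4 * E)) ^ 4 = (√(1 + √(1 - 4 * E)) ^ 2) ^ 2 by ring, h2]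
  linarith

/-- For `X > XC` the trajectory with the energy `betaMinus (-X)` and nonpositive velocity runs down to
its turning point and then up to infinity, where it arrives at time `π`. -/
lemma exists_isProfile_of_XC_lt {X : ℝ} (hX : XC < X) :
    ∃ ε U H, IsProfile X (-√(2 * betaMinus (-X) - X ^ 2 + X ^ 4 / 2)) ε U H := by
  obtain ⟨hXC1, hXCπ⟩ := XC_spec
  have hX1 : 1 < X := hXC1.trans hX
  have habs : |-X| = X := by rw [abs_neg, abs_of_pos (by linarith)]
  have hpotX : potential (-X) = potential X := by unfold potential; ring
  -- The total travel time as a function of the turning point.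
  set σ : ℝ → ℝ := fun m => secTime m (arccos (m / X)) + secTime m (π / 2) with hσ
  have hσc : ContinuousOn σ (Icc XC X) := by
    refine ContinuousOn.mono (s := Ici XC) ?_ Icc_subset_Ici_self
    exact (continuousOn_secTime hXC1 (continuous_arccos.comp
      (continuous_id.div_const X)).continuousOn).add (continuousOn_secTime hXC1 continuousOn_const)
  have hS : ∀ m, 1 < m → m ≤ X → S (-X) (potential m) = ENNReal.ofReal (σ m) := fun m hm hmX => by
    rw [S_potential hm (by rwa [habs]), habs]
  have hcomp : IsCompact (Icc XC X ∩ σ ⁻¹' {π}) :=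
    isCompact_Icc.of_isClosed_subset (hσc.preimage_isClosed_of_isClosed isClosed_Icc
      isClosed_singleton) inter_subset_left
  have hne : (Icc XC X ∩ σ ⁻¹' {π}).Nonempty := by
    have hπ : π ∈ Icc (σ X) (σ XC) := by
      constructor
      · have h1 := secTime_strictAnti hXC1 hX
        have h2 : secTime X (arccos (X / X)) = 0 := by
          rw [div_self (by linarith), arccos_one, secTime, intervalIntegral.integral_same]
        simp only [hσ, h2]
        linarith
      · have h1 := secTime_nonneg XC (arccos_nonneg (XC / X))
        simp only [hσ, hXCπ]
        linarith
    obtain ⟨m, hm, hmπ⟩ := intermediate_value_Icc' hX.le hσc hπ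
    exact ⟨m, hm, hmπ⟩
  -- The least energy corresponds to the largest turning point.
  have hmem := hcomp.sSup_mem hne
  set m := sSup (Icc XC X ∩ σ ⁻¹' {π}) with hm_def
  have hm1 : 1 < m := hXC1.trans_le hmem.1.1
  have hmX : m ≤ X := hmem.1.2
  have hmπ : σ m = π := hmem.2
  have hbeta : betaMinus (-X) = potential m := by
    refine IsLeast.csInf_eq ⟨⟨?_, ?_, ?_⟩, ?_⟩
    · rw [hpotX]
      rcases hmX.eq_or_lt with h | h
      · rw [h]
      · exact (potential_strictAnti hm1 h).le
    · unfold potential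
      nlinarith [mul_pos (by nlinarith : 0 < m ^ 2 - 1) (by nlinarith : 0 < m ^ 2 - 1)]
    · rw [hS m hm1 hmX, hmπ]
    · rintro E ⟨hE1, hE2, hE3⟩
      obtain ⟨n, hn1, rfl⟩ := exists_potential_eq hE2
      have hnX : n ≤ X := by
        by_contra h
        rw [hpotX] at hE1
        exact absurd (potential_strictAnti hX1 (not_le.1 h)) (not_lt.2 hE1)
      have h1 := secTime_nonneg n (arccos_nonneg (n / X))
      have h2 := secTime_nonneg n (B := π / 2) (by positivity)
      rw [hS n hn1 hnX, ENNReal.ofReal_eq_ofReal_iff (add_nonneg h1 h2) pi_pos.le] at hE3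
      have hnXC : XC ≤ n := by
        by_contra h
        have := secTime_strictAnti hn1 (not_le.1 h)
        have hE3' : secTime n (arccos (n / X)) + secTime n (π / 2) = π := hE3
        linarith
      have hnm : n ≤ m := le_csSup hcomp.bddAbove ⟨⟨hnXC, hnX⟩, hE3⟩
      rcases hnm.eq_or_lt with h | h
      · rw [h]
      · exact (potential_strictAnti hn1 h).le
  have hmX0 : 0 < m / X := by positivity
  have hmX1 : m / X ≤ 1 := (div_le_one (by linarith)).2 hmX
  have hint : ∫ y in -arccos (m / X)..π / 2, (√(secSpeed m y))⁻¹ = π := by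
    have hc := continuous_inv_sqrt_secSpeed hm1
    rw [← intervalIntegral.integral_add_adjacent_intervals (b := 0) (hc.intervalIntegrable _ _)
      (hc.intervalIntegrable _ _)]
    refine Eq.trans ?_ hmπ
    simp only [hσ, secTime]
    congr 1
    have := intervalIntegral.integral_comp_neg (a := 0) (b := arccos (m / X))
      fun y => (√(secSpeed m y))⁻¹
    rw [neg_zero] at this
    rw [← this]
    simp [secSpeed]
  have h := exists_isProfile_sec hm1 (A := -arccos (m / X))
    ⟨by linarith [arccos_lt_pi_div_two.2 hmX0], by linarith [arccos_nonneg (m / X), pi_pos]⟩ hint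
  have hcos : cos (-arccos (m / X)) = m / X := by
    rw [cos_neg, cos_arccos (by linarith) hmX1]
  have hpos : m / cos (-arccos (m / X)) = X := by rw [hcos]; field_simp
  have hd := duffing_sec (m := m) (y := -arccos (m / X)) (by rw [hcos]; exact hmX0.ne')
  have hsin : sin (-arccos (m / X)) ≤ 0 := by
    rw [sin_neg]
    linarith [sin_nonneg_of_nonneg_of_le_pi (arccos_nonneg (m / X)) (arccos_le_pi _)]
  rw [hpos] at hd h
  rw [hbeta, hd, sqrt_mul (by positivity), sqrt_sq_eq_abs, abs_of_nonpos]
  · convert h using 2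
    ring_nf
  · exact div_nonpos_of_nonpos_of_nonneg (mul_nonpos_of_nonneg_of_nonpos (by linarith) hsin)
      (by positivity)

/-- Data on the threshold curve launch a Duffing trajectory that blows up exactly at time `π`. -/
theorem exists_isProfile {X Y : ℝ} (hXY : Y = beta X ∨ Y = -beta (-X)) :
    ∃ ε U H, IsProfile X Y ε U H := by
  have key : ∀ X, ∃ ε U H, IsProfile X (beta X) ε U H := fun X => by
    unfold beta
    split_ifs with h
    exacts [exists_isProfile_of_le_XC h, exists_isProfile_of_XC_lt (not_le.1 h)]
  rcases hXY with rfl | rfl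
  · exact key X
  · obtain ⟨ε, U, H, h⟩ := key (-X)
    exact ⟨ε, _, _, by simpa using h.neg⟩

/-! ### The conformal compactification -/

/-- The Laplacian of a radial function given in terms of the squared norm. -/
lemma laplacian_comp_norm_sq {φ φ₁ : ℝ → ℝ} {φ₂ : ℝ} {x : E3}
    (h₁ : ∀ᶠ s in 𝓝 (‖x‖ ^ 2), HasDerivAt φ (φ₁ s) s) (h₂ : HasDerivAt φ₁ φ₂ (‖x‖ ^ 2)) :
    Δ (fun y : E3 => φ (‖y‖ ^ 2)) x = 4 * ‖x‖ ^ 2 * φ₂ + 6 * φ₁ (‖x‖ ^ 2) := by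
  have hn : ∀ y : E3, HasFDerivAt (fun y : E3 => ‖y‖ ^ 2) (2 • innerSL ℝ y) y :=
    fun y => (hasStrictFDerivAt_norm_sq y).hasFDerivAt
  obtain ⟨L, hL⟩ : ∃ L : E3 →L[ℝ] E3 →L[ℝ] ℝ, ∀ a b, L a b = inner ℝ a b :=
    ⟨innerSL ℝ, fun _ _ => rfl⟩
  have hev : fderiv ℝ (fun y : E3 => φ (‖y‖ ^ 2)) =ᶠ[𝓝 x]
      fun y => (2 * φ₁ (‖y‖ ^ 2)) • L y := by
    have hcont : ContinuousAt (fun y : E3 => ‖y‖ ^ 2) x := by fun_prop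
    filter_upwards [hcont.eventually h₁] with y hy
    have h : HasFDerivAt (fun y : E3 => φ (‖y‖ ^ 2)) _ y := hy.comp_hasFDerivAt y (hn y)
    rw [h.fderiv]
    ext z
    simp [hL]
    ring
  have hd : HasFDerivAt (fun y : E3 => (2 * φ₁ (‖y‖ ^ 2)) • L y)
      ((2 * φ₁ (‖x‖ ^ 2)) • L +
        ((2 : ℝ) • φ₂ • 2 • innerSL ℝ x).smulRight (L x)) x :=
    ((h₂.comp_hasFDerivAt x (hn x)).const_mul 2).smul L.hasFDerivAt
  have hsum : ∑ i, (x i) ^ 2 = ‖x‖ ^ 2 := by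
    rw [EuclideanSpace.norm_sq_eq]; simp
  rw [InnerProductSpace.laplacian_eq_iteratedFDeriv_orthonormalBasis _
    (EuclideanSpace.basisFun (Fin 3) ℝ)]
  simp only [iteratedFDeriv_two_apply, hev.fderiv_eq, hd.fderiv]
  rw [← hsum]
  simp [Fin.sum_univ_three, hL, EuclideanSpace.inner_single_right]
  ring

/-- `(1 + (t + r) ^ 2) * (1 + (t - r) ^ 2)` as a function of `t` and `s = r ^ 2`. -/
def confK (t s : ℝ) : ℝ := (1 + s - t ^ 2) ^ 2 + (2 * t) ^ 2

/-- The time coordinate on the Einstein cylinder `ℝ × S³` as a function of `t` and `s = |x| ^ 2`, in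
a form that is manifestly smooth. -/
def confTime (t s : ℝ) : ℝ := 2 * arctan (2 * t / (√(confK t s) + (1 + s - t ^ 2)))

/-- The function on Minkowski space that corresponds, under the conformal embedding into the
Einstein cylinder, to a function `U` of the time on the cylinder: the product of `U` with the
conformal factor. -/
def penrose (U : ℝ → ℝ) (t : ℝ) (x : E3) : ℝ :=
  2 * (√(confK t (‖x‖ ^ 2)))⁻¹ * U (confTime t (‖x‖ ^ 2))

lemma confK_pos {t s : ℝ} (hs : -1 < s) : 0 < confK t s := by
  unfold confK
  rcases eq_or_ne t 0 with rfl | h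
  · have : 0 < 1 + s := by linarith
    nlinarith [mul_pos this this]
  · have : 0 < t ^ 2 := by positivity
    nlinarith [sq_nonneg (1 + s - t ^ 2)]

lemma sqrt_confK_add_pos {t s : ℝ} (hs : -1 < s) : 0 < √(confK t s) + (1 + s - t ^ 2) := by
  rcases eq_or_ne t 0 with rfl | h
  · have := sqrt_nonneg (confK 0 s)
    linarith
  · have h1 : |1 + s - t ^ 2| < √(confK t s) := by
      rw [lt_sqrt (abs_nonneg _), sq_abs, confK]
      have : 0 < t ^ 2 := by positivity
      linarith
    linarith [neg_abs_le (1 + s - t ^ 2)]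

lemma hasDerivAt_inv_sqrt_confK {g : ℝ → ℝ} {g' y : ℝ} (hg : HasDerivAt g g' y) (h0 : 0 < g y) :
    HasDerivAt (fun y => (√(g y))⁻¹) (-(√(g y))⁻¹ * (g' / (2 * g y))) y := by
  refine ((hg.sqrt h0.ne').inv (sqrt_pos.2 h0).ne').congr_deriv ?_
  have h1 := (sqrt_pos.2 h0).ne'
  have h2 : √(g y) ^ 2 = g y := sq_sqrt h0.le
  have h3 := h0.ne'
  rw [h2]
  field_simp

/-- Derivative of twice the half-angle formula for the argument of `P + i a`. -/
lemma hasDerivAt_two_mul_arctan {a P : ℝ → ℝ} {a' P' y : ℝ} (ha : HasDerivAt a a' y)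
    (hP : HasDerivAt P P' y) (hK : 0 < P y ^ 2 + a y ^ 2) (hpos : 0 < √(P y ^ 2 + a y ^ 2) + P y) :
    HasDerivAt (fun y => 2 * arctan (a y / (√(P y ^ 2 + a y ^ 2) + P y)))
      ((a' * P y - a y * P') / (P y ^ 2 + a y ^ 2)) y := by
  have hD : HasDerivAt (fun y => √(P y ^ 2 + a y ^ 2))
      ((P y * P' + a y * a') / √(P y ^ 2 + a y ^ 2)) y := by
    refine (((hP.fun_pow 2).fun_add (ha.fun_pow 2)).sqrt hK.ne').congr_deriv ?_
    have := (sqrt_pos.2 hK).ne'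
    field_simp
    simp
    ring
  refine (((ha.fun_div (hD.fun_add hP) hpos.ne').arctan).const_mul 2).congr_deriv ?_
  have hD0 := sqrt_pos.2 hK
  have hD2 : √(P y ^ 2 + a y ^ 2) ^ 2 = P y ^ 2 + a y ^ 2 := sq_sqrt hK.le
  set D := √(P y ^ 2 + a y ^ 2) with hDdef
  have h1 : 1 + (a y / (D + P y)) ^ 2 = 2 * D / (D + P y) := by
    have := hpos.ne'
    rw [div_pow, eq_div_iff this, add_mul, div_mul_eq_mul_div, pow_two (D + P y),
      mul_div_mul_right _ _ this, eq_comm, ← sub_eq_iff_eq_add', eq_div_iff this]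
    linear_combination hD2
  rw [h1, ← hD2]
  field_simp
  linear_combination a' * hD2

lemma hasDerivAt_confK_left (t s : ℝ) :
    HasDerivAt (fun t => confK t s) (4 * t * (1 - s + t ^ 2)) t := by
  unfold confK
  have h := hasDerivAt_id' t
  exact ((((h.fun_pow 2).const_sub (1 + s)).fun_pow 2).fun_add
    ((h.const_mul 2).fun_pow 2)).congr_deriv (by simp; ring)

lemma hasDerivAt_confK_right (t s : ℝ) :
    HasDerivAt (fun s => confK t s) (2 * (1 + s - t ^ 2)) s := by
  unfold confK
  have h := hasDerivAt_id' s
  exact ((((h.const_add 1).sub_const (t ^ 2)).fun_pow 2).add_const ((2 * t) ^ 2)).congr_deriv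
    (by simp)

lemma hasDerivAt_confTime_left {t s : ℝ} (hs : -1 < s) :
    HasDerivAt (fun t => confTime t s) (2 * (1 + s + t ^ 2) / confK t s) t := by
  have h := hasDerivAt_id' t
  exact (hasDerivAt_two_mul_arctan (h.const_mul 2) ((h.fun_pow 2).const_sub (1 + s))
    (confK_pos hs) (sqrt_confK_add_pos hs)).congr_deriv (by simp [confK]; ring)

lemma hasDerivAt_confTime_right {t s : ℝ} (hs : -1 < s) :
    HasDerivAt (fun s => confTime t s) (-(2 * t) / confK t s) s := by
  have h := hasDerivAt_id' s
  exact (hasDerivAt_two_mul_arctan (hasDerivAt_const s (2 * t)) ((h.const_add 1).sub_const (t ^ 2))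
    (confK_pos hs) (sqrt_confK_add_pos hs)).congr_deriv (by simp [confK])

lemma contDiffOn_confK : ContDiffOn ℝ ∞ (fun z : ℝ × ℝ => confK z.1 z.2) {z | -1 < z.2} := by
  unfold confK; fun_prop

lemma contDiffOn_confTime : ContDiffOn ℝ ∞ (fun z : ℝ × ℝ => confTime z.1 z.2) {z | -1 < z.2} := by
  unfold confTime
  refine contDiffOn_const.mul (contDiff_arctan.comp_contDiffOn (ContDiffOn.div (by fun_prop)
    ((contDiffOn_confK.sqrt fun z hz => (confK_pos hz).ne').add (by fun_prop))
    fun z hz => (sqrt_confK_add_pos hz).ne'))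

lemma confK_sq (t r : ℝ) : confK t (r ^ 2) = (1 + (t + r) ^ 2) * (1 + (t - r) ^ 2) := by
  unfold confK; ring

/-- The conformal time in terms of the null coordinates `t + r` and `t - r`. -/
lemma confTime_sq (t r : ℝ) : confTime t (r ^ 2) = arctan (t + r) + arctan (t - r) := by
  set A := arctan (t + r)
  set B := arctan (t - r)
  have hA := arctan_mem_Ioo (t + r)
  have hB := arctan_mem_Ioo (t - r)
  have h0 : -1 < r ^ 2 := by nlinarith [sq_nonneg r]
  have hK := confK_pos (t := t) h0
  have hD : √(confK t (r ^ 2)) = √(1 + (t + r) ^ 2) * √(1 + (t - r) ^ 2) := by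
    rw [confK_sq, sqrt_mul (by positivity)]
  have hpos := sqrt_confK_add_pos (t := t) h0
  have h1 : 0 < √(1 + (t + r) ^ 2) := by positivity
  have h2 : 0 < √(1 + (t - r) ^ 2) := by positivity
  have hs : sin (A + B) = 2 * t / √(confK t (r ^ 2)) := by
    rw [sin_add, sin_arctan, sin_arctan, cos_arctan, cos_arctan, hD]
    field_simp
    ring
  have hc : cos (A + B) = (1 + r ^ 2 - t ^ 2) / √(confK t (r ^ 2)) := by
    rw [cos_add, sin_arctan, sin_arctan, cos_arctan, cos_arctan, hD]
    field_simp
    ring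
  have hhalf : (A + B) / 2 ∈ Ioo (-(π / 2)) (π / 2) :=
    ⟨by linarith [hA.1, hB.1], by linarith [hA.2, hB.2]⟩
  have hcos : cos ((A + B) / 2) ≠ 0 := (cos_pos_of_mem_Ioo hhalf).ne'
  have htan : tan ((A + B) / 2) = 2 * t / (√(confK t (r ^ 2)) + (1 + r ^ 2 - t ^ 2)) := by
    have e1 : sin (A + B) = 2 * sin ((A + B) / 2) * cos ((A + B) / 2) := by
      rw [← sin_two_mul]; ring_nf
    have e2 : cos (A + B) = 2 * cos ((A + B) / 2) ^ 2 - 1 := by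
      rw [← cos_two_mul]; ring_nf
    have hD0 := (sqrt_pos.2 hK).ne'
    have e3 : 2 * t = √(confK t (r ^ 2)) * sin (A + B) := by rw [hs]; field_simp
    have e4 : 1 + r ^ 2 - t ^ 2 = √(confK t (r ^ 2)) * cos (A + B) := by rw [hc]; field_simp
    rw [tan_eq_sin_div_cos, div_eq_div_iff hcos hpos.ne', e4, e3, e1, e2]
    ring
  rw [confTime, ← htan, arctan_tan hhalf.1 hhalf.2]
  ring

lemma confTime_lt_pi (t r : ℝ) : confTime t (r ^ 2) < π := by
  rw [confTime_sq]
  linarith [arctan_lt_pi_div_two (t + r), arctan_lt_pi_div_two (t - r)]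

lemma confTime_pos {t : ℝ} (ht : 0 < t) (r : ℝ) : 0 < confTime t (r ^ 2) := by
  rw [confTime_sq]
  have : arctan (r - t) < arctan (t + r) := arctan_strictMono (by linarith)
  rw [← neg_sub, arctan_neg] at this
  linarith

lemma confTime_neg (t s : ℝ) : confTime (-t) s = -confTime t s := by
  unfold confTime confK
  rw [show 2 * -t = -(2 * t) by ring, neg_sq, neg_sq, neg_div, arctan_neg]
  ring

lemma confTime_zero (s : ℝ) : confTime 0 s = 0 := by simp [confTime]

lemma confTime_le {t s : ℝ} (ht : 0 ≤ t) (hs : 0 ≤ s) : confTime t s ≤ 2 * t := by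
  have hderiv : ∀ τ, HasDerivAt (fun τ => 2 * τ - confTime τ s)
      (2 - 2 * (1 + s + τ ^ 2) / confK τ s) τ := fun τ =>
    (((hasDerivAt_id' τ).const_mul 2).fun_sub
      (hasDerivAt_confTime_left (by linarith))).congr_deriv (by ring)
  have hmono : Monotone fun τ => 2 * τ - confTime τ s := by
    refine monotone_of_deriv_nonneg (fun τ => (hderiv τ).differentiableAt) fun τ => ?_
    rw [(hderiv τ).deriv, sub_nonneg, div_le_iff₀ (confK_pos (by linarith))]
    unfold confK
    nlinarith [sq_nonneg (s - τ ^ 2), sq_nonneg τ]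
  have := hmono ht
  simp only [confTime_zero] at this
  linarith

/-- Evaluation of the conformal solution at positive times. -/
lemma penrose_eq {X Y ε : ℝ} {U H : ℝ → ℝ} (h : IsProfile X Y ε U H) {t : ℝ} (ht : 0 < t) (x : E3) :
    penrose U t x = H (π - confTime t (‖x‖ ^ 2)) / t := by
  have h1 := confTime_pos ht ‖x‖
  have h2 := confTime_lt_pi t ‖x‖
  rw [h.eq_sin_mul _ ⟨by linarith, by linarith⟩, sin_pi_sub, sub_sub_cancel, penrose]
  -- The conformal factor is `sin T / t` in terms of the conformal time `T`.
  have hs : sin (confTime t (‖x‖ ^ 2)) = 2 * t / √(confK t (‖x‖ ^ 2)) := by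
    have h3 : 0 < √(1 + (t + ‖x‖) ^ 2) := by positivity
    have h4 : 0 < √(1 + (t - ‖x‖) ^ 2) := by positivity
    rw [confTime_sq, sin_add, sin_arctan, sin_arctan, cos_arctan, cos_arctan, confK_sq,
      sqrt_mul (by positivity)]
    field_simp
    ring
  rw [hs]
  field_simp

lemma neg_lt_confTime {t ε s : ℝ} (hε : 0 < ε) (ht : -(ε / 2) < t) (hs : 0 ≤ s) :
    -ε < confTime t s := by
  rcases le_total 0 t with h | h
  · have hr : s = √s ^ 2 := (sq_sqrt hs).symm
    rcases h.eq_or_lt with h | h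
    · rw [← h, confTime_zero]; linarith
    · have := confTime_pos h √s
      rw [← hr] at this
      linarith
  · have := confTime_le (neg_nonneg.2 h) hs
    rw [confTime_neg] at this
    linarith

lemma confTime_mem {t ε s : ℝ} (hε : 0 < ε) (ht : -(ε / 2) < t) (hs : 0 ≤ s) :
    confTime t s ∈ Ioo (-ε) π := by
  refine ⟨neg_lt_confTime hε ht hs, ?_⟩
  rw [← sq_sqrt hs]
  exact confTime_lt_pi t √s

/-- The conformal solution is smooth on a neighbourhood of the closed future, because the conformal time
of its points stays between `-ε` and `π`. -/
lemma contDiffOn_penrose {X Y ε : ℝ} {U H : ℝ → ℝ} (h : IsProfile X Y ε U H) :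
    ContDiffOn ℝ ∞ (fun z : ℝ × E3 => penrose U z.1 z.2) (Ioi (-(ε / 2)) ×ˢ univ) := by
  have hmap : ContDiffOn ℝ ∞ (fun z : ℝ × E3 => (z.1, ‖z.2‖ ^ 2)) (Ioi (-(ε / 2)) ×ˢ univ) :=
    (contDiff_fst.prodMk (contDiff_snd.norm_sq ℝ)).contDiffOn
  have hs : ∀ z : ℝ × E3, -1 < ‖z.2‖ ^ 2 := fun z => by nlinarith [sq_nonneg ‖z.2‖]
  have hK : ContDiffOn ℝ ∞ (fun z : ℝ × E3 => confK z.1 (‖z.2‖ ^ 2)) (Ioi (-(ε / 2)) ×ˢ univ) :=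
    contDiffOn_confK.comp hmap fun z _ => hs z
  have hT : ContDiffOn ℝ ∞ (fun z : ℝ × E3 => confTime z.1 (‖z.2‖ ^ 2))
      (Ioi (-(ε / 2)) ×ˢ univ) :=
    (contDiffOn_confTime.comp hmap fun z _ => hs z).congr fun z _ => rfl
  have hU : ContDiffOn ℝ ∞ (fun z : ℝ × E3 => U (confTime z.1 (‖z.2‖ ^ 2)))
      (Ioi (-(ε / 2)) ×ˢ univ) :=
    h.contDiffOn.comp hT fun z hz => confTime_mem h.pos hz.1 (sq_nonneg _)
  have hD : ContDiffOn ℝ ∞ (fun z : ℝ × E3 => (√(confK z.1 (‖z.2‖ ^ 2)))⁻¹)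
      (Ioi (-(ε / 2)) ×ˢ univ) :=
    (hK.sqrt fun z _ => (confK_pos (hs z)).ne').inv
      fun z _ => (sqrt_pos.2 (confK_pos (hs z))).ne'
  exact (contDiffOn_const.mul hD).mul hU

/-- First time derivative of the conformal solution. -/
lemma hasDerivAt_penrose_left {X Y ε : ℝ} {U H : ℝ → ℝ} (h : IsProfile X Y ε U H) {t s : ℝ}
    (hs : -1 < s) (hT : confTime t s ∈ Ioo (-ε) π) :
    HasDerivAt (fun t => 2 * (√(confK t s))⁻¹ * U (confTime t s))
      ((√(confK t s))⁻¹ * (4 / confK t s) * (-(t * (1 - s + t ^ 2)) * U (confTime t s) +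
        (1 + s + t ^ 2) * deriv U (confTime t s))) t := by
  have hK := confK_pos (t := t) hs
  have hU : HasDerivAt U _ (confTime t s) :=
    ((h.contDiffOn.contDiffAt (Ioo_mem_nhds hT.1 hT.2)).differentiableAt (by simp)).hasDerivAt
  refine (((hasDerivAt_inv_sqrt_confK (hasDerivAt_confK_left t s) hK).const_mul 2).fun_mul
    (hU.comp t (hasDerivAt_confTime_left hs))).congr_deriv ?_
  simp only [Function.comp_apply]
  field_simp
  ring

lemma hasDerivAt_penrose_right {X Y ε : ℝ} {U H : ℝ → ℝ} (h : IsProfile X Y ε U H) {t s : ℝ}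
    (hs : -1 < s) (hT : confTime t s ∈ Ioo (-ε) π) :
    HasDerivAt (fun s => 2 * (√(confK t s))⁻¹ * U (confTime t s))
      ((√(confK t s))⁻¹ * (2 / confK t s) * (-(1 + s - t ^ 2) * U (confTime t s) -
        2 * t * deriv U (confTime t s))) s := by
  have hK := confK_pos (t := t) hs
  have hU : HasDerivAt U _ (confTime t s) :=
    ((h.contDiffOn.contDiffAt (Ioo_mem_nhds hT.1 hT.2)).differentiableAt (by simp)).hasDerivAt
  refine (((hasDerivAt_inv_sqrt_confK (hasDerivAt_confK_right t s) hK).const_mul 2).fun_mul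
    (hU.comp s (hasDerivAt_confTime_right hs))).congr_deriv ?_
  simp only [Function.comp_apply]
  field_simp
  ring

/-- The conformal solution solves the cubic wave equation. -/
lemma isGlobalSolution_penrose {X Y ε : ℝ} {U H : ℝ → ℝ} (h : IsProfile X Y ε U H) :
    IsGlobalSolution X Y (penrose U) where
  exists_interval := by
    have hε := h.pos
    refine ⟨-(ε / 2), by linarith, contDiffOn_penrose h, fun t ht x => ?_⟩
    have hs : (-1 : ℝ) < ‖x‖ ^ 2 := by nlinarith [sq_nonneg ‖x‖]
    have hT := confTime_mem hε ht (sq_nonneg ‖x‖)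
    have hK := confK_pos (t := t) hs
    have hU : HasDerivAt U _ (confTime t (‖x‖ ^ 2)) :=
      ((h.contDiffOn.contDiffAt (Ioo_mem_nhds hT.1 hT.2)).differentiableAt (by simp)).hasDerivAt
    have hU' := h.hasDerivAt_deriv _ hT
    have hid := hasDerivAt_id' t
    have hcT := hasDerivAt_confTime_left (t := t) hs
    have hd2 := (((hasDerivAt_inv_sqrt_confK (hasDerivAt_confK_left t (‖x‖ ^ 2)) hK).fun_mul
        ((hasDerivAt_const t 4).fun_div (hasDerivAt_confK_left t (‖x‖ ^ 2)) hK.ne')).fun_mul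
        (((hid.fun_mul ((hid.fun_pow 2).const_add (1 - ‖x‖ ^ 2))).fun_neg.fun_mul
          (hU.comp t hcT)).fun_add (((hid.fun_pow 2).const_add (1 + ‖x‖ ^ 2)).fun_mul
            (hU'.comp t hcT))))
    have htt := hd2.deriv
    have hev : deriv (fun τ => penrose U τ x) =ᶠ[𝓝 t] fun t => (√(confK t (‖x‖ ^ 2)))⁻¹ *
        (4 / confK t (‖x‖ ^ 2)) * (-(t * (1 - ‖x‖ ^ 2 + t ^ 2)) * U (confTime t (‖x‖ ^ 2)) +
        (1 + ‖x‖ ^ 2 + t ^ 2) * deriv U (confTime t (‖x‖ ^ 2))) := by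
      filter_upwards [Ioi_mem_nhds ht] with τ hτ
      exact (hasDerivAt_penrose_left h hs (confTime_mem hε hτ (sq_nonneg ‖x‖))).deriv
    have hid := hasDerivAt_id' (‖x‖ ^ 2)
    have hcT := hasDerivAt_confTime_right (t := t) hs
    have hd2 := (((hasDerivAt_inv_sqrt_confK (hasDerivAt_confK_right t (‖x‖ ^ 2)) hK).fun_mul
        ((hasDerivAt_const _ 2).fun_div (hasDerivAt_confK_right t (‖x‖ ^ 2)) hK.ne')).fun_mul
        ((((hid.const_add 1).sub_const (t ^ 2)).fun_neg.fun_mul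
          (hU.comp (‖x‖ ^ 2) hcT)).fun_sub ((hU'.comp (‖x‖ ^ 2) hcT).const_mul (2 * t))))
    have hlap := laplacian_comp_norm_sq (φ := fun s => 2 * (√(confK t s))⁻¹ * U (confTime t s))
      (by
        filter_upwards [Ioi_mem_nhds hs, hcT.continuousAt.eventually (Ioo_mem_nhds hT.1 hT.2)]
          with s hs1 hs2
        exact hasDerivAt_penrose_right h hs1 hs2) hd2
    have hlap' : Δ (penrose U t) x = Δ (fun y : E3 => 2 * (√(confK t (‖y‖ ^ 2)))⁻¹ *
      U (confTime t (‖y‖ ^ 2))) x := rfl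
    rw [hlap', hlap, iteratedDeriv_succ, iteratedDeriv_one, hev.deriv_eq]
    refine (congrArg (· - _) htt).trans ?_
    rw [penrose]
    simp only [Function.comp_apply]
    have hc3 : (√(confK t (‖x‖ ^ 2)))⁻¹ ^ 3 =
        (√(confK t (‖x‖ ^ 2)))⁻¹ / confK t (‖x‖ ^ 2) := by
      have h1 := (sqrt_pos.2 hK).ne'
      have h2 : √(confK t (‖x‖ ^ 2)) ^ 2 = confK t (‖x‖ ^ 2) := sq_sqrt hK.le
      nth_rw 3 [← h2]
      field_simp
    rw [mul_pow, mul_pow, hc3]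
    -- The equation is now an identity of rational functions, in which the values of `U` and `U'` and the
    -- square root in the conformal factor are indeterminates.
    generalize (√(confK t (‖x‖ ^ 2)))⁻¹ = c
    generalize U (confTime t (‖x‖ ^ 2)) = a
    generalize deriv U (confTime t (‖x‖ ^ 2)) = b
    generalize ‖x‖ ^ 2 = s at hK
    have hK' := hK.ne'
    field_simp
    simp only [confK]
    push_cast
    ring
  initial_position x := by
    have hs : 0 < 1 + ‖x‖ ^ 2 := by positivity
    have h1 : √(confK 0 (‖x‖ ^ 2)) = 1 + ‖x‖ ^ 2 := by
      simp only [confK, ne_eq, OfNat.ofNat_ne_zero, not_false_eq_true, zero_pow, sub_zero, mul_zero,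
        add_zero]
      exact sqrt_sq hs.le
    rw [penrose, confTime_zero, h.position, h1]
    field_simp
  initial_velocity x := by
    have hs : (-1 : ℝ) < ‖x‖ ^ 2 := by nlinarith [sq_nonneg ‖x‖]
    have hs' : 0 < 1 + ‖x‖ ^ 2 := by positivity
    have hT := confTime_mem h.pos (t := 0) (by linarith [h.pos]) (sq_nonneg ‖x‖)
    have h1 : confK 0 (‖x‖ ^ 2) = (1 + ‖x‖ ^ 2) ^ 2 := by simp [confK]
    rw [dt]
    refine (hasDerivAt_penrose_left h hs hT).deriv.trans ?_
    rw [confTime_zero, h.position, h.velocity, h1, sqrt_sq hs'.le]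
    field_simp
    ring

/-! ### Uniqueness for the wave equation in backward cones -/

lemma two_le_infty : (2 : ℕ∞ω) ≤ (∞ : ℕ∞ω) :=
  WithTop.coe_le_coe.2 (le_top : (2 : ℕ∞) ≤ ⊤)

/-- Differentiation under the integral sign for functions with compact support in space. -/
lemma hasDerivAt_integral_of_contDiffOn {F : ℝ × E3 → ℝ} {T ρ : ℝ}
    (hF : ContDiffOn ℝ 1 F (Ioi T ×ˢ univ)) (h0 : ∀ t, T < t → ∀ x, ρ < ‖x‖ → F (t, x) = 0)
    {t : ℝ} (ht : T < t) :
    HasDerivAt (fun τ => ∫ x, F (τ, x)) (∫ x, fderiv ℝ F (t, x) (1, 0)) t := by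
  have hO : IsOpen (Ioi T ×ˢ (univ : Set E3)) := isOpen_Ioi.prod isOpen_univ
  have hd : ∀ τ, T < τ → ∀ x, HasDerivAt (fun τ => F (τ, x)) (fderiv ℝ F (τ, x) (1, 0)) τ :=
    fun τ hτ x => by
      have h1 : DifferentiableAt ℝ F (τ, x) :=
        (hF.contDiffAt (hO.mem_nhds (mk_mem_prod hτ (mem_univ x)))).differentiableAt (by simp)
      exact h1.hasFDerivAt.comp_hasDerivAt τ ((hasDerivAt_id' τ).prodMk (hasDerivAt_const τ x))
  have hcont : ∀ τ, T < τ → Continuous fun x => F (τ, x) := fun τ hτ =>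
    hF.continuousOn.comp_continuous (f := fun x => (τ, x)) (continuous_const.prodMk continuous_id)
      fun x => mk_mem_prod hτ (mem_univ x)
  have hdc : ContinuousOn (fun z => fderiv ℝ F z (1, 0)) (Ioi T ×ˢ univ) :=
    (hF.continuousOn_fderiv_of_isOpen hO le_rfl).clm_apply continuousOn_const
  have hd0 : ∀ τ, T < τ → ∀ x, ρ < ‖x‖ → fderiv ℝ F (τ, x) (1, 0) = 0 := fun τ hτ x hx => by
    refine (hd τ hτ x).unique ((hasDerivAt_const τ (0 : ℝ)).congr_of_eventuallyEq ?_)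
    filter_upwards [Ioi_mem_nhds hτ] with σ hσ using h0 σ hσ x hx
  obtain ⟨δ, hδ, hδt⟩ : ∃ δ > 0, T < t - δ := ⟨(t - T) / 2, by linarith, by linarith⟩
  have hcomp : IsCompact (Icc (t - δ) (t + δ) ×ˢ Metric.closedBall (0 : E3) ρ) :=
    isCompact_Icc.prod (isCompact_closedBall _ _)
  obtain ⟨C, hC⟩ := hcomp.exists_bound_of_continuousOn
    (hdc.mono (prod_mono (fun τ hτ => hδt.trans_le hτ.1) (subset_univ _)))
  have hsupp : ∀ τ, T < τ → HasCompactSupport fun x => F (τ, x) := fun τ hτ =>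
    HasCompactSupport.intro (isCompact_closedBall (0 : E3) ρ) fun x hx => by
      exact h0 τ hτ x (by simpa using hx)
  refine (hasDerivAt_integral_of_dominated_loc_of_deriv_le (F := fun τ x => F (τ, x))
    (F' := fun τ x => fderiv ℝ F (τ, x) (1, 0))
    (bound := (Metric.closedBall (0 : E3) ρ).indicator fun _ => C)
    (Ioo_mem_nhds (by linarith) (by linarith) : Ioo (t - δ) (t + δ) ∈ 𝓝 t) ?_ ?_ ?_ ?_ ?_ ?_).2
  · filter_upwards [Ioi_mem_nhds ht] with τ hτ using (hcont τ hτ).aestronglyMeasurable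
  · exact (hcont t ht).integrable_of_hasCompactSupport (hsupp t ht)
  · exact (hdc.comp_continuous (continuous_const.prodMk continuous_id)
      fun x => mk_mem_prod ht (mem_univ x)).aestronglyMeasurable
  · refine Eventually.of_forall fun x τ hτ => ?_
    have hτT : T < τ := hδt.trans hτ.1
    by_cases hx : ‖x‖ ≤ ρ
    · rw [indicator_of_mem (by simpa using hx)]
      exact hC (τ, x) ⟨⟨hτ.1.le, hτ.2.le⟩, by simpa using hx⟩
    · rw [hd0 τ hτT x (not_le.1 hx), indicator_of_notMem (by simpa using hx), norm_zero]
  · exact (integrable_indicator_iff measurableSet_closedBall).2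
      (integrableOn_const (isCompact_closedBall _ _).measure_lt_top.ne)
  · exact Eventually.of_forall fun x τ hτ => hd τ (hδt.trans hτ.1) x

lemma integral_fderiv_eq_zero {h : E3 → ℝ} (hh : ContDiff ℝ 1 h) (hs : HasCompactSupport h)
    (v : E3) : ∫ x, fderiv ℝ h x v = 0 := by
  have h1 := integral_mul_fderiv_eq_neg_fderiv_mul_of_integrable (μ := (volume : Measure E3))
    (f := h) (g := fun _ => (1 : ℝ)) (v := v) ?_ ?_ ?_ (fun x _ => hh.differentiable (by simp) x)
    (fun x _ => by fun_prop)
  · simpa using h1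
  · simp only [mul_one]
    refine Continuous.integrable_of_hasCompactSupport
      ((hh.continuous_fderiv (by simp)).clm_apply continuous_const) ?_
    exact (hs.fderiv ℝ).mono fun x hx hx' => hx (by simp [hx'])
  · simp
  · simpa using hh.continuous.integrable_of_hasCompactSupport hs

/-- The Laplacian as the sum of the second partial derivatives. -/
lemma laplacian_eq_sum_fderiv {f : E3 → ℝ} {x : E3} (hf : ContDiffAt ℝ 2 f x) :
    Δ f x = ∑ i, fderiv ℝ (fun y => fderiv ℝ f y (EuclideanSpace.single i 1)) x
      (EuclideanSpace.single i 1) := by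
  have h1 : DifferentiableAt ℝ (fderiv ℝ f) x :=
    (hf.fderiv_right (m := 1) (by norm_num)).differentiableAt (by simp)
  rw [InnerProductSpace.laplacian_eq_iteratedFDeriv_orthonormalBasis _
    (EuclideanSpace.basisFun (Fin 3) ℝ)]
  refine Finset.sum_congr rfl fun i _ => ?_
  rw [fderiv_clm_apply h1 (differentiableAt_const _)]
  simp [iteratedFDeriv_two_apply]

/-- A smooth weight supported in the backward cone below the point `(ρ, 0)`, rounded at the tip. -/
def coneWeight (ρ : ℝ) (z : ℝ × E3) : ℝ := expNegInvGlue (ρ - z.1 - √(1 + ‖z.2‖ ^ 2))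

lemma contDiff_coneWeight (ρ : ℝ) : ContDiff ℝ ∞ (coneWeight ρ) := by
  refine expNegInvGlue.contDiff.comp ((contDiff_const.sub contDiff_fst).sub ?_)
  exact (contDiff_const.add (contDiff_snd.norm_sq ℝ)).sqrt fun z => by positivity

lemma coneWeight_eq_zero {ρ t : ℝ} {x : E3} (h : ρ - t ≤ ‖x‖) : coneWeight ρ (t, x) = 0 := by
  refine expNegInvGlue.zero_of_nonpos ?_
  have : ‖x‖ ≤ √(1 + ‖x‖ ^ 2) := le_sqrt_of_sq_le (by linarith)
  simp only
  linarith

/-- The gradient of the weight is dominated by minus its time derivative. -/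
lemma exists_fderiv_coneWeight (ρ : ℝ) (z : ℝ × E3) :
    ∃ c ≥ 0, ∃ g : Fin 3 → ℝ, ∑ i, g i ^ 2 ≤ 1 ∧ fderiv ℝ (coneWeight ρ) z (1, 0) = -c ∧
      ∀ i, fderiv ℝ (coneWeight ρ) z (0, EuclideanSpace.single i 1) = -c * g i := by
  have hs : 0 < 1 + ‖z.2‖ ^ 2 := by positivity
  set c := deriv expNegInvGlue (ρ - z.1 - √(1 + ‖z.2‖ ^ 2)) with hc
  have hχ : HasDerivAt expNegInvGlue c (ρ - z.1 - √(1 + ‖z.2‖ ^ 2)) :=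
    ((expNegInvGlue.contDiff (n := 1)).differentiable (by simp) _).hasDerivAt
  have h1 : HasFDerivAt (fun z : ℝ × E3 => z.2) (ContinuousLinearMap.snd ℝ ℝ E3) z := hasFDerivAt_snd
  have h2 : HasFDerivAt (fun z : ℝ × E3 => z.1) (ContinuousLinearMap.fst ℝ ℝ E3) z := hasFDerivAt_fst
  have h3 := hχ.comp_hasFDerivAt z ((h2.const_sub ρ).fun_sub ((h1.norm_sq.const_add 1).sqrt hs.ne'))
  have h4 : fderiv ℝ (coneWeight ρ) z = _ := h3.fderiv
  refine ⟨c, expNegInvGlue.monotone.deriv_nonneg, fun i => z.2 i / √(1 + ‖z.2‖ ^ 2), ?_, ?_, ?_⟩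
  · simp only [div_pow, sq_sqrt hs.le]
    rw [← Finset.sum_div, div_le_one hs, EuclideanSpace.norm_sq_eq]
    simp
  · rw [h4]; simp
  · intro i
    rw [h4]
    simp [EuclideanSpace.inner_single_right]
    left
    field_simp

set_option maxHeartbeats 1000000 in
/-- Smooth solutions of a linear wave equation with a continuous potential and vanishing data
vanish: the energy in a backward cone satisfies a Gronwall inequality. -/
theorem eq_zero_of_wave {W V : ℝ × E3 → ℝ} {T : ℝ} (hT : T < 0)
    (hW : ContDiffOn ℝ ∞ W (Ioi T ×ˢ univ)) (hV : ContinuousOn V (Ioi T ×ˢ univ))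
    (heq : ∀ t, T < t → ∀ x, iteratedDeriv 2 (fun τ => W (τ, x)) t - Δ (fun y => W (t, y)) x =
      V (t, x) * W (t, x))
    (h0 : ∀ x, W (0, x) = 0) (h1 : ∀ x, deriv (fun τ => W (τ, x)) 0 = 0) {t₀ : ℝ} (ht₀ : 0 ≤ t₀)
    (x₀ : E3) : W (t₀, x₀) = 0 := by
  have hO : IsOpen (Ioi T ×ˢ (univ : Set E3)) := isOpen_Ioi.prod isOpen_univ
  have h2le : (2 : ℕ∞ω) ≤ (∞ : ℕ∞ω) := two_le_infty
  set e : Fin 3 → E3 := fun i => EuclideanSpace.single i 1 with he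
  set p : ℝ × E3 → ℝ := fun z => fderiv ℝ W z (1, 0) with hp
  set q : Fin 3 → ℝ × E3 → ℝ := fun i z => fderiv ℝ W z (0, e i) with hq
  have hpc : ContDiffOn ℝ ∞ p (Ioi T ×ˢ univ) :=
    (hW.fderiv_of_isOpen hO (by simp)).clm_apply contDiffOn_const
  have hqc : ∀ i, ContDiffOn ℝ ∞ (q i) (Ioi T ×ˢ univ) := fun i =>
    (hW.fderiv_of_isOpen hO (by simp)).clm_apply contDiffOn_const
  -- Differentiability at the points of the slab, in all variables and in each variable separately.
  have hdiff : ∀ {f : ℝ × E3 → ℝ}, ContDiffOn ℝ ∞ f (Ioi T ×ˢ univ) → ∀ t, T < t → ∀ x,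
      DifferentiableAt ℝ f (t, x) := fun hf t ht x =>
    (hf.contDiffAt (hO.mem_nhds (mk_mem_prod ht (mem_univ x)))).differentiableAt (by simp)
  have hdt : ∀ {f : ℝ × E3 → ℝ}, ContDiffOn ℝ ∞ f (Ioi T ×ˢ univ) → ∀ t, T < t → ∀ x,
      HasDerivAt (fun τ => f (τ, x)) (fderiv ℝ f (t, x) (1, 0)) t := fun hf t ht x =>
    (hdiff hf t ht x).hasFDerivAt.comp_hasDerivAt t
      ((hasDerivAt_id' t).prodMk (hasDerivAt_const t x))
  have hdx : ∀ {f : ℝ × E3 → ℝ}, ContDiffOn ℝ ∞ f (Ioi T ×ˢ univ) → ∀ t, T < t → ∀ x v,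
      fderiv ℝ (fun y => f (t, y)) x v = fderiv ℝ f (t, x) (0, v) := fun hf t ht x v => by
    have h : HasFDerivAt (fun y : E3 => (t, y)) (ContinuousLinearMap.inr ℝ ℝ E3) x :=
      (hasFDerivAt_prodMk_right t x)
    have h' := ((hdiff hf t ht x).hasFDerivAt.comp x h).fderiv
    rw [Function.comp_def] at h'
    rw [h']
    simp
  have hslice : ∀ {f : ℝ × E3 → ℝ}, ContDiffOn ℝ ∞ f (Ioi T ×ˢ univ) → ∀ t, T < t →
      ContDiff ℝ ∞ (fun y => f (t, y)) := fun hf t ht => contDiffOn_univ.1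
    (hf.comp (f := fun y => (t, y)) (contDiff_const.prodMk contDiff_id).contDiffOn
      fun y _ => mk_mem_prod ht (mem_univ y))
  -- Symmetry of the second derivatives and the equation in terms of `p` and `q`.
  have hsymm : ∀ t, T < t → ∀ x i, fderiv ℝ (q i) (t, x) (1, 0) = fderiv ℝ p (t, x) (0, e i) := by
    intro t ht x i
    have hWat : ContDiffAt ℝ 2 W (t, x) :=
      (hW.contDiffAt (hO.mem_nhds (mk_mem_prod ht (mem_univ x)))).of_le h2le
    have hd : DifferentiableAt ℝ (fderiv ℝ W) (t, x) :=
      (hWat.fderiv_right (m := 1) (by norm_num)).differentiableAt (by simp)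
    have := (hWat.isSymmSndFDerivAt (by simp)).eq (1, 0) (0, e i)
    simp only [hp, hq]
    rw [fderiv_clm_apply hd (differentiableAt_const _), fderiv_clm_apply hd
      (differentiableAt_const _)]
    simpa using this
  have hwave : ∀ t, T < t → ∀ x, fderiv ℝ p (t, x) (1, 0) =
      ∑ i, fderiv ℝ (q i) (t, x) (0, e i) + V (t, x) * W (t, x) := by
    intro t ht x
    have h2 : iteratedDeriv 2 (fun τ => W (τ, x)) t = fderiv ℝ p (t, x) (1, 0) := by
      have hev : deriv (fun τ => W (τ, x)) =ᶠ[𝓝 t] fun τ => p (τ, x) := by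
        filter_upwards [Ioi_mem_nhds ht] with τ hτ using (hdt hW τ hτ x).deriv
      rw [iteratedDeriv_succ, iteratedDeriv_one, hev.deriv_eq, (hdt hpc t ht x).deriv]
    have h3 : Δ (fun y => W (t, y)) x = ∑ i, fderiv ℝ (q i) (t, x) (0, e i) := by
      rw [laplacian_eq_sum_fderiv ((hslice hW t ht).contDiffAt.of_le h2le)]
      refine Finset.sum_congr rfl fun i _ => ?_
      rw [← hdx (hqc i) t ht x]
      congr 2
      ext y
      exact hdx hW t ht y _
    rw [← h2, ← h3, ← heq t ht x]
    ring
  -- The tip of the cone lies so high that the weight is positive at `(t₀, x₀)`.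
  set ρ : ℝ := t₀ + √(1 + ‖x₀‖ ^ 2) + 1 with hρ
  set φ := coneWeight ρ with hφ
  have hφc : ContDiffOn ℝ ∞ φ (Ioi T ×ˢ univ) := (contDiff_coneWeight ρ).contDiffOn
  have hφ0 : ∀ z, 0 ≤ φ z := fun z => expNegInvGlue.nonneg _
  -- The weighted energy density and the weighted energy flux.
  set F : ℝ × E3 → ℝ := fun z => φ z * (p z ^ 2 + ∑ i, q i z ^ 2 + W z ^ 2) with hF
  set J : Fin 3 → ℝ × E3 → ℝ := fun i z => φ z * (p z * q i z) with hJ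
  have hec : ContDiffOn ℝ ∞ (fun z => p z ^ 2 + ∑ i, q i z ^ 2 + W z ^ 2) (Ioi T ×ˢ univ) :=
    ((hpc.pow 2).add (ContDiffOn.sum fun i _ => (hqc i).pow 2)).add (hW.pow 2)
  have hFc : ContDiffOn ℝ ∞ F (Ioi T ×ˢ univ) := hφc.mul hec
  have hJc : ∀ i, ContDiffOn ℝ ∞ (J i) (Ioi T ×ˢ univ) := fun i => hφc.mul (hpc.mul (hqc i))
  have hzero : ∀ t, T < t → ∀ x : E3, ρ - T < ‖x‖ → φ (t, x) = 0 := fun t ht x hx =>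
    coneWeight_eq_zero (by linarith)
  have hEd : ∀ t, T < t → HasDerivAt (fun τ => ∫ x, F (τ, x)) (∫ x, fderiv ℝ F (t, x) (1, 0)) t :=
    fun t ht => hasDerivAt_integral_of_contDiffOn (ρ := ρ - T)
      (hFc.of_le (by exact_mod_cast le_top)) (fun t ht x hx => by simp [hF, hzero t ht x hx]) ht
  have hsupp : ∀ {f : ℝ × E3 → ℝ}, (∀ z, φ z = 0 → f z = 0) → ∀ t, T < t →
      HasCompactSupport fun x => f (t, x) := fun hf t ht =>
    HasCompactSupport.intro (isCompact_closedBall (0 : E3) (ρ - T)) fun x hx =>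
      hf _ (hzero t ht x (by simpa using hx))
  have hFs : ∀ t, T < t → HasCompactSupport fun x => F (t, x) :=
    hsupp fun z hz => by simp [hF, hz]
  have hJs : ∀ i, ∀ t, T < t → HasCompactSupport fun x => J i (t, x) := fun i =>
    hsupp fun z hz => by simp [hJ, hz]
  have hJ0 : ∀ t, T < t → ∀ i, ∫ x, fderiv ℝ (J i) (t, x) (0, e i) = 0 := fun t ht i => by
    refine Eq.trans ?_ (integral_fderiv_eq_zero ((hslice (hJc i) t ht).of_le
      (by exact_mod_cast le_top)) (hJs i t ht) (e i))
    exact integral_congr_ae (Eventually.of_forall fun x => (hdx (hJc i) t ht x _).symm)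
  -- The potential is bounded in the part of the cone above the initial time.
  obtain ⟨C, hC⟩ := (isCompact_Icc.prod (isCompact_closedBall (0 : E3) (ρ - T))).exists_bound_of_continuousOn
    (hV.mono (prod_mono (fun t ht => hT.trans_le ht.1 : Icc 0 t₀ ⊆ Ioi T) (subset_univ _)))
  have hFn : ∀ z, 0 ≤ F z := fun z => mul_nonneg (hφ0 z) (by positivity)
  have hpoint : ∀ t ∈ Icc 0 t₀, ∀ x, fderiv ℝ F (t, x) (1, 0) -
      2 * ∑ i, fderiv ℝ (J i) (t, x) (0, e i) ≤ (C + 1) * F (t, x) := by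
    intro t ht x
    have htT : T < t := hT.trans_le ht.1
    obtain ⟨c, hc, g, hg, hφt, hφx⟩ := exists_fderiv_coneWeight ρ (t, x)
    have dφ := (hdiff hφc t htT x).hasFDerivAt
    have dp := (hdiff hpc t htT x).hasFDerivAt
    have dq := fun i => (hdiff (hqc i) t htT x).hasFDerivAt
    have dW := (hdiff hW t htT x).hasFDerivAt
    have dF : fderiv ℝ F (t, x) (1, 0) = -c * (p (t, x) ^ 2 + ∑ i, q i (t, x) ^ 2 + W (t, x) ^ 2) +
        φ (t, x) * (2 * p (t, x) * fderiv ℝ p (t, x) (1, 0) +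
          ∑ i, 2 * q i (t, x) * fderiv ℝ (q i) (t, x) (1, 0) + 2 * W (t, x) * p (t, x)) := by
      have h := (dφ.fun_mul (((dp.pow 2).fun_add (HasFDerivAt.fun_sum (u := Finset.univ)
        fun i _ => (dq i).pow 2)).fun_add (dW.pow 2))).fderiv
      refine (congrArg (fun L => L (1, 0)) h).trans ?_
      simp [Fin.sum_univ_three, hφ, hφt]
      ring
    have dJ : ∀ i, fderiv ℝ (J i) (t, x) (0, e i) = -c * g i * (p (t, x) * q i (t, x)) +
        φ (t, x) * (fderiv ℝ p (t, x) (0, e i) * q i (t, x) +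
          p (t, x) * fderiv ℝ (q i) (t, x) (0, e i)) := fun i => by
      have h := (dφ.fun_mul (dp.fun_mul (dq i))).fderiv
      refine (congrArg (fun L => L (0, e i)) h).trans ?_
      simp [hφ, he, hφx i]
      ring
    have hVW : φ (t, x) * (2 * V (t, x) * W (t, x) * p (t, x)) ≤
        φ (t, x) * (C * (W (t, x) ^ 2 + p (t, x) ^ 2)) := by
      by_cases hx : ‖x‖ ≤ ρ - T
      · refine mul_le_mul_of_nonneg_left ?_ (hφ0 _)
        have hVC := abs_le.1 (hC (t, x) ⟨ht, by simpa using hx⟩)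
        nlinarith [sq_nonneg (W (t, x) - p (t, x)), sq_nonneg (W (t, x) + p (t, x)), hVC.1, hVC.2]
      · simp [hzero t htT x (not_le.1 hx)]
    rw [dF, hwave t htT x]
    simp only [dJ, hsymm t htT x, hF]
    simp only [Fin.sum_univ_three] at hg ⊢
    -- Cauchy-Schwarz: the flux through the boundary of the cone is dominated by the energy density.
    have h3 : 2 * p (t, x) * (g 0 * q 0 (t, x) + g 1 * q 1 (t, x) + g 2 * q 2 (t, x)) ≤
        p (t, x) ^ 2 + (q 0 (t, x) ^ 2 + q 1 (t, x) ^ 2 + q 2 (t, x) ^ 2) := by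
      have h4 : (g 0 * q 0 (t, x) + g 1 * q 1 (t, x) + g 2 * q 2 (t, x)) ^ 2 ≤
          (g 0 ^ 2 + g 1 ^ 2 + g 2 ^ 2) * (q 0 (t, x) ^ 2 + q 1 (t, x) ^ 2 + q 2 (t, x) ^ 2) := by
        nlinarith [sq_nonneg (g 0 * q 1 (t, x) - g 1 * q 0 (t, x)),
          sq_nonneg (g 0 * q 2 (t, x) - g 2 * q 0 (t, x)),
          sq_nonneg (g 1 * q 2 (t, x) - g 2 * q 1 (t, x))]
      have h5 := mul_le_mul_of_nonneg_right hg
        (by positivity : 0 ≤ q 0 (t, x) ^ 2 + q 1 (t, x) ^ 2 + q 2 (t, x) ^ 2)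
      nlinarith [sq_nonneg (p (t, x) - (g 0 * q 0 (t, x) + g 1 * q 1 (t, x) + g 2 * q 2 (t, x)))]
    have h6 := mul_le_mul_of_nonneg_left h3 hc
    have hC0 : 0 ≤ C := (norm_nonneg _).trans (hC (0, 0) ⟨⟨le_rfl, ht₀⟩, by
      simp only [Metric.mem_closedBall, dist_self]
      have := sqrt_nonneg (1 + ‖x₀‖ ^ 2)
      linarith⟩)
    have h7 : φ (t, x) * (2 * W (t, x) * p (t, x)) ≤ φ (t, x) * (W (t, x) ^ 2 + p (t, x) ^ 2) :=
      mul_le_mul_of_nonneg_left (by nlinarith [sq_nonneg (W (t, x) - p (t, x))]) (hφ0 _)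
    have h8 : 0 ≤ φ (t, x) * (C + 1) * (q 0 (t, x) ^ 2 + q 1 (t, x) ^ 2 + q 2 (t, x) ^ 2) :=
      mul_nonneg (mul_nonneg (hφ0 _) (by linarith)) (by positivity)
    have h9 : 0 ≤ c * W (t, x) ^ 2 := by positivity
    linarith
  have hFcont : ∀ t, T < t → Continuous fun x => F (t, x) := fun t ht => (hslice hFc t ht).continuous
  have hdcont : ∀ {f : ℝ × E3 → ℝ}, ContDiffOn ℝ ∞ f (Ioi T ×ˢ univ) → ∀ v t, T < t →
      Continuous fun x => fderiv ℝ f (t, x) v := fun hf v t ht =>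
    (hslice ((hf.fderiv_of_isOpen hO (by simp)).clm_apply contDiffOn_const) t ht).continuous
  have hGronwall : ∀ t ∈ Icc 0 t₀, ∫ x, fderiv ℝ F (t, x) (1, 0) ≤ (C + 1) * ∫ x, F (t, x) := by
    intro t ht
    have htT : T < t := hT.trans_le ht.1
    have hi1 : Integrable fun x => fderiv ℝ F (t, x) (1, 0) := by
      refine (hdcont hFc _ t htT).integrable_of_hasCompactSupport
        (HasCompactSupport.intro (isCompact_closedBall (0 : E3) (ρ - T)) fun x hx => ?_)
      refine (hdt hFc t htT x).unique ((hasDerivAt_const t (0 : ℝ)).congr_of_eventuallyEq ?_)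
      filter_upwards [Ioi_mem_nhds htT] with σ hσ
      simp [hF, hzero σ hσ x (by simpa using hx)]
    have hi2 : ∀ i, Integrable fun x => fderiv ℝ (J i) (t, x) (0, e i) := fun i => by
      simp only [← hdx (hJc i) t htT]
      refine Continuous.integrable_of_hasCompactSupport ?_ (((hJs i t htT).fderiv ℝ).mono
        fun x hx hx' => hx (by simp [hx']))
      simp only [hdx (hJc i) t htT]
      exact hdcont (hJc i) _ t htT
    have hi3 := (hFcont t htT).integrable_of_hasCompactSupport (hFs t htT)
      (μ := (volume : Measure E3))
    have h1 := integral_mono (hi1.sub ((integrable_finsetSum Finset.univ fun i _ => hi2 i).const_mul 2))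
      (hi3.const_mul (C + 1)) (fun x => hpoint t ht x)
    simp only [Pi.sub_apply] at h1
    rw [integral_sub hi1 ((integrable_finsetSum Finset.univ fun i _ => hi2 i).const_mul 2),
      integral_const_mul, integral_const_mul, integral_finsetSum _ fun i _ => hi2 i] at h1
    simpa [hJ0 t htT] using h1
  have hEinit : ∫ x, F (0, x) = 0 := by
    have : ∀ x, F (0, x) = 0 := fun x => by
      have hp0 : p (0, x) = 0 := (hdt hW 0 hT x).deriv.symm.trans (h1 x)
      have hq0 : ∀ i, q i (0, x) = 0 := fun i => by
        simp only [hq]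
        rw [← hdx hW 0 hT x]
        simp [h0]
      simp [hF, hp0, hq0, h0]
    simp [this]
  have hanti : AntitoneOn (fun t => exp (-(C + 1) * t) * ∫ x, F (t, x)) (Icc 0 t₀) := by
    have hd : ∀ t, T < t → HasDerivAt (fun t => exp (-(C + 1) * t) * ∫ x, F (t, x))
        (exp (-(C + 1) * t) * ((∫ x, fderiv ℝ F (t, x) (1, 0)) - (C + 1) * ∫ x, F (t, x))) t :=
      fun t ht => ((((hasDerivAt_id' t).const_mul (-(C + 1))).exp).fun_mul (hEd t ht)).congr_deriv
        (by ring)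
    refine antitoneOn_of_deriv_nonpos (convex_Icc _ _) (fun t ht =>
      (hd t (hT.trans_le ht.1)).continuousAt.continuousWithinAt) (fun t ht => ?_) fun t ht => ?_
    · rw [interior_Icc] at ht
      exact (hd t (hT.trans ht.1)).differentiableAt.differentiableWithinAt
    · rw [interior_Icc] at ht
      rw [(hd t (hT.trans ht.1)).deriv]
      exact mul_nonpos_of_nonneg_of_nonpos (exp_pos _).le
        (by linarith [hGronwall t ⟨ht.1.le, ht.2.le⟩])
  have hfin := hanti ⟨le_rfl, ht₀⟩ ⟨ht₀, le_rfl⟩ ht₀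
  simp only [hEinit, mul_zero] at hfin
  have hE0 : ∫ x, F (t₀, x) = 0 := le_antisymm
    (nonpos_of_mul_nonpos_right hfin (exp_pos _)) (integral_nonneg fun x => hFn _)
  have ht₀T : T < t₀ := hT.trans_le ht₀
  have hFz : F (t₀, x₀) = 0 := by
    have h2 := (integral_eq_zero_iff_of_nonneg (fun x => hFn (t₀, x))
      ((hFcont t₀ ht₀T).integrable_of_hasCompactSupport (hFs t₀ ht₀T))).1 hE0
    have h3 := (Continuous.ae_eq_iff_eq (μ := (volume : Measure E3)) (hFcont t₀ ht₀T)
      (g := 0) continuous_const).1 h2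
    exact congrFun h3 x₀
  have hφpos : 0 < φ (t₀, x₀) := by
    have h : 0 < ρ - t₀ - √(1 + ‖x₀‖ ^ 2) := by linarith
    exact expNegInvGlue.pos_of_pos h
  have h3 := (mul_eq_zero.1 hFz).resolve_left hφpos.ne'
  have h4 : W (t₀, x₀) ^ 2 = 0 := by
    have h5 : 0 ≤ ∑ i, q i (t₀, x₀) ^ 2 := by positivity
    nlinarith [sq_nonneg (p (t₀, x₀)), sq_nonneg (W (t₀, x₀))]
  exact pow_eq_zero_iff two_ne_zero |>.1 h4

/-- Smooth solutions are determined by their data at all later times. -/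
theorem IsGlobalSolution.eq {X Y : ℝ} {u v : ℝ → E3 → ℝ} (hu : IsGlobalSolution X Y u)
    (hv : IsGlobalSolution X Y v) {t : ℝ} (ht : 0 ≤ t) (x : E3) : u t x = v t x := by
  obtain ⟨T₁, hT₁, hu1, hu2⟩ := hu.exists_interval
  obtain ⟨T₂, hT₂, hv1, hv2⟩ := hv.exists_interval
  set T := max T₁ T₂ with hT
  have hu1 : ContDiffOn ℝ ∞ (fun z : ℝ × E3 => u z.1 z.2) (Ioi T ×ˢ univ) :=
    hu1.mono (prod_mono (Ioi_subset_Ioi (le_max_left _ _)) subset_rfl)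
  have hv1 : ContDiffOn ℝ ∞ (fun z : ℝ × E3 => v z.1 z.2) (Ioi T ×ˢ univ) :=
    hv1.mono (prod_mono (Ioi_subset_Ioi (le_max_right _ _)) subset_rfl)
  have hO : IsOpen (Ioi T ×ˢ (univ : Set E3)) := isOpen_Ioi.prod isOpen_univ
  have hT0 : T < 0 := max_lt hT₁ hT₂
  have h2le : (2 : ℕ∞ω) ≤ (∞ : ℕ∞ω) := two_le_infty
  have hsx : ∀ {f : ℝ → E3 → ℝ}, ContDiffOn ℝ ∞ (fun z : ℝ × E3 => f z.1 z.2) (Ioi T ×ˢ univ) →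
      ∀ t, T < t → ∀ x, ContDiffAt ℝ 2 (f t) x := fun hf t ht x =>
    ((hf.contDiffAt (hO.mem_nhds (mk_mem_prod ht (mem_univ x)))).of_le h2le).comp (f := fun y => (t, y)) x
      (contDiffAt_const.prodMk contDiffAt_id)
  have hst : ∀ {f : ℝ → E3 → ℝ}, ContDiffOn ℝ ∞ (fun z : ℝ × E3 => f z.1 z.2) (Ioi T ×ˢ univ) →
      ∀ t, T < t → ∀ x, ContDiffAt ℝ 2 (fun τ => f τ x) t := fun hf t ht x =>
    ((hf.contDiffAt (hO.mem_nhds (mk_mem_prod ht (mem_univ x)))).of_le h2le).comp (f := fun τ => (τ, x)) t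
      (contDiffAt_id.prodMk contDiffAt_const)
  have h := eq_zero_of_wave (W := fun z => u z.1 z.2 - v z.1 z.2)
    (V := fun z => u z.1 z.2 ^ 2 + u z.1 z.2 * v z.1 z.2 + v z.1 z.2 ^ 2) hT0 (hu1.sub hv1)
    (((hu1.pow 2).add (hu1.mul hv1)).add (hv1.pow 2)).continuousOn (fun t ht x => ?_)
    (fun x => ?_) (fun x => ?_) ht x
  · exact sub_eq_zero.1 h
  · have e1 := hu2 t ((le_max_left _ _).trans_lt ht) x
    have e2 := hv2 t ((le_max_right _ _).trans_lt ht) x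
    have e3 : Δ (fun y => u t y - v t y) x = Δ (u t) x - Δ (v t) x :=
      (hsx hu1 t ht x).laplacian_sub (hsx hv1 t ht x)
    have e4 : iteratedDeriv 2 (fun τ => u τ x - v τ x) t = _ :=
      iteratedDeriv_fun_sub (hst hu1 t ht x) (hst hv1 t ht x)
    rw [e3, e4]
    linear_combination e1 - e2
  · simp [hu.initial_position, hv.initial_position]
  · have e1 := hu.initial_velocity x
    have e2 := hv.initial_velocity x
    rw [dt] at e1 e2
    refine (deriv_fun_sub ((hst hu1 0 hT0 x).differentiableAt (by simp))
      ((hst hv1 0 hT0 x).differentiableAt (by simp))).trans ?_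
    rw [e1, e2, sub_self]

/-! ### The Fourier transform of radial functions -/

/-- Polar coordinates in `ℝ³` for radial functions. -/
lemma lintegral_fun_norm {G : ℝ → ℝ≥0∞} (hG : Measurable G) :
    ∫⁻ x : E3, G ‖x‖ = ENNReal.ofReal (4 * π) * ∫⁻ r in Ioi 0, ENNReal.ofReal (r ^ 2) * G r := by
  have hdim : Module.finrank ℝ E3 = 3 := by simp
  have hsphere : (volume : Measure E3).toSphere univ = ENNReal.ofReal (4 * π) := by
    rw [Measure.toSphere_apply_univ, hdim, EuclideanSpace.volume_ball_fin_three]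
    rw [show ((3 : ℕ) : ℝ≥0∞) = ENNReal.ofReal 3 by simp, show ENNReal.ofReal 1 = 1 by simp,
      one_pow, one_mul, ← ENNReal.ofReal_mul (by norm_num)]
    ring_nf
  calc ∫⁻ x : E3, G ‖x‖ = ∫⁻ x : ({(0 : E3)}ᶜ : Set E3), G ‖x.1‖ ∂((volume : Measure E3).comap (↑)) := by
        rw [lintegral_subtype_comap (measurableSet_singleton _).compl fun x => G ‖x‖,
          restrict_compl_singleton]
    _ = ∫⁻ x, G x.2 ∂((volume : Measure E3).toSphere.prod (Measure.volumeIoiPow (3 - 1))) := by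
        have := ((volume : Measure E3).measurePreserving_homeomorphUnitSphereProd).lintegral_comp
          (f := fun p => G p.2) (by fun_prop)
        rw [hdim] at this
        simpa using this
    _ = (volume : Measure E3).toSphere univ * ∫⁻ x, G x ∂(Measure.volumeIoiPow (3 - 1)) := by
        rw [lintegral_prod _ (by fun_prop)]
        dsimp only
        rw [lintegral_const, mul_comm]
    _ = _ := by
        rw [hsphere, Measure.volumeIoiPow, lintegral_withDensity_eq_lintegral_mul _ (by fun_prop)
          (by fun_prop), ← lintegral_subtype_comap measurableSet_Ioi]
        rfl

lemma ae_norm {p : ℝ → Prop} (hp : ∀ᵐ r : ℝ, p r) : ∀ᵐ x : E3, p ‖x‖ := by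
  obtain ⟨s, hs, hsm, hs0⟩ := exists_measurable_superset_of_null (ae_iff.1 hp)
  have h := lintegral_fun_norm (G := s.indicator 1) (measurable_one.indicator hsm)
  have h0 : ∫⁻ r in Ioi (0 : ℝ), ENNReal.ofReal (r ^ 2) * s.indicator 1 r = 0 := by
    rw [lintegral_eq_zero_iff' (by fun_prop (disch := exact hsm))]
    refine ae_restrict_of_ae ?_
    filter_upwards [measure_eq_zero_iff_ae_notMem.1 hs0] with r hr
    simp [hr]
  rw [h0, mul_zero, lintegral_eq_zero_iff (by fun_prop (disch := exact hsm))] at h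
  filter_upwards [h] with x hx
  by_contra hc
  have : ‖x‖ ∈ s := hs hc
  simp [this] at hx

/-- The Fourier-Plancherel transform of a square integrable function. -/
def plancherel {V : Type*} [NormedAddCommGroup V] [InnerProductSpace ℝ V]
    [FiniteDimensional ℝ V] [MeasurableSpace V] [BorelSpace V] {f : V → ℂ}
    (hf : MemLp f 2 (volume : Measure V)) : V → ℂ :=
  ((𝓕 (hf.toLp f) : Lp ℂ 2 (volume : Measure V)) : V → ℂ)

/-- On `L¹ ∩ L²` the Plancherel transform is given by the Fourier integral. -/
lemma plancherel_ae_eq {V : Type*} [NormedAddCommGroup V] [InnerProductSpace ℝ V]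
    [FiniteDimensional ℝ V] [MeasurableSpace V] [BorelSpace V] {f : V → ℂ}
    (h1 : Integrable f) (h2 : MemLp f 2 (volume : Measure V)) :
    plancherel h2 =ᵐ[volume] 𝓕 f := by
  unfold plancherel
  refine ae_eq_of_integral_contDiff_smul_eq ((Lp.memLp _).locallyIntegrable (by norm_num))
    (VectorFourier.fourierIntegral_continuous Real.continuous_fourierChar
      (L := innerₗ V) continuous_inner h1).locallyIntegrable fun g hg hgs => ?_
  have hgc : HasCompactSupport fun x => (g x : ℂ) := hgs.comp_left (g := fun x : ℝ => (x : ℂ)) (by simp)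
  have hgC : ContDiff ℝ ∞ fun x => (g x : ℂ) := Complex.ofRealCLM.contDiff.comp hg
  set G : SchwartzMap V ℂ := hgc.toSchwartzMap hgC with hG
  have hGx : ∀ x, G x = (g x : ℂ) := fun x => rfl
  have e := DFunLike.congr_fun (Lp.fourier_toTemperedDistribution_eq (h2.toLp f)) G
  rw [TemperedDistribution.fourier_apply, Lp.toTemperedDistribution_apply,
    Lp.toTemperedDistribution_apply] at e
  have e1 : ∫ x, g x • (𝓕 (h2.toLp f) : Lp ℂ 2 (volume : Measure V)) x =
      ∫ x, G x • (𝓕 (h2.toLp f) : Lp ℂ 2 (volume : Measure V)) x := by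
    refine integral_congr_ae (.of_forall fun x => ?_)
    simp [hGx]
  have e2 : ∫ x, g x • 𝓕 f x = ∫ x, G x • 𝓕 f x := by
    refine integral_congr_ae (.of_forall fun x => ?_)
    simp [hGx]
  rw [e1, e2, ← e]
  have e3 : ∫ x, (𝓕 G) x • (h2.toLp f) x = ∫ x, (𝓕 (G : V → ℂ)) x • f x := by
    refine integral_congr_ae ?_
    filter_upwards [h2.coeFn_toLp] with x hx
    rw [hx, SchwartzMap.fourier_coe]
  rw [e3]
  simpa using! (VectorFourier.integral_fourierIntegral_smul_eq_flip (L := innerₗ V)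
      Real.continuous_fourierChar continuous_inner G.integrable h1)

/-- The Plancherel transform may be moved to a Schwartz function. -/
lemma integral_fourier_mul {φ : ℝ → ℂ} (hφ : MemLp φ 2 (volume : Measure ℝ))
    (Ψ : SchwartzMap ℝ ℂ) :
    ∫ x, (𝓕 Ψ : SchwartzMap ℝ ℂ) x * φ x = ∫ x, Ψ x * plancherel hφ x := by
  have e := DFunLike.congr_fun (Lp.fourier_toTemperedDistribution_eq (hφ.toLp φ)) Ψ
  rw [TemperedDistribution.fourier_apply, Lp.toTemperedDistribution_apply,
    Lp.toTemperedDistribution_apply] at e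
  simp only [smul_eq_mul] at e
  refine Eq.trans ?_ e
  refine integral_congr_ae ?_
  filter_upwards [hφ.coeFn_toLp] with x hx
  rw [hx]

/-- The Plancherel transform of a derivative on the line. -/
lemma plancherel_deriv {f f' : ℝ → ℂ} (h : MemLp f 2 (volume : Measure ℝ))
    (h' : MemLp f' 2 (volume : Measure ℝ)) (hd : ∀ x, HasDerivAt f (f' x) x) :
    plancherel h' =ᵐ[volume] fun η => 2 * π * Complex.I * η * plancherel h η := by
  have hloc : LocallyIntegrable (plancherel h) := (Lp.memLp _).locallyIntegrable (by norm_num)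
  refine ae_eq_of_integral_contDiff_smul_eq ((Lp.memLp _).locallyIntegrable (by norm_num))
    ?_ fun g hg hgs => ?_
  · have := (hloc.continuous_smul (g := fun η : ℝ => 2 * π * Complex.I * (η : ℂ)) (by fun_prop))
    simpa [smul_eq_mul] using this
  have hgc : HasCompactSupport fun x => (g x : ℂ) := hgs.comp_left (g := fun x : ℝ => (x : ℂ)) (by simp)
  have hgC : ContDiff ℝ ∞ fun x => (g x : ℂ) := Complex.ofRealCLM.contDiff.comp hg
  set G : SchwartzMap ℝ ℂ := hgc.toSchwartzMap hgC with hG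
  have hGx : ∀ x, G x = (g x : ℂ) := fun x => rfl
  have hder : ∀ φ : SchwartzMap ℝ ℂ, ∫ x, φ x * f' x = -∫ x, deriv φ x * f x := by
    intro φ
    have hφ : MemLp φ 2 (volume : Measure ℝ) := φ.memLp 2
    have hφ' : MemLp (deriv φ) 2 (volume : Measure ℝ) := by
      have := (SchwartzMap.derivCLM ℝ ℂ φ).memLp 2 (volume : Measure ℝ)
      simpa using! this
    exact integral_mul_deriv_eq_deriv_mul_of_integrable (fun x _ => φ.differentiableAt.hasDerivAt)
      (fun x _ => hd x)
      (hφ.integrable_mul h') (hφ'.integrable_mul h) (hφ.integrable_mul h)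
  have hG2C : ContDiff ℝ ∞ fun x : ℝ => -2 * π * Complex.I * (x : ℂ) * (g x : ℂ) :=
    (contDiff_const.mul Complex.ofRealCLM.contDiff).mul hgC
  have hG2c : HasCompactSupport fun x : ℝ => -2 * π * Complex.I * (x : ℂ) * (g x : ℂ) :=
    hgc.mul_left
  set G₂ : SchwartzMap ℝ ℂ := hG2c.toSchwartzMap hG2C with hG₂
  have hG2x : ∀ x, G₂ x = -2 * π * Complex.I * (x : ℂ) * (g x : ℂ) := fun x => rfl
  have hderG : deriv (𝓕 G : SchwartzMap ℝ ℂ) = (𝓕 G₂ : SchwartzMap ℝ ℂ) := by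
    rw [SchwartzMap.fourier_coe, SchwartzMap.fourier_coe, Real.deriv_fourier G.integrable]
    · congr 1
    · refine (G₂.integrable.const_mul (-2 * π * Complex.I)⁻¹).congr (.of_forall fun x => ?_)
      simp only [hGx, hG2x, Complex.real_smul]
      field_simp
  have e1 := integral_fourier_mul h' G
  rw [hder, hderG, integral_fourier_mul h G₂] at e1
  simp only [Complex.real_smul]
  rw [show ∫ x, (g x : ℂ) * plancherel h' x = _ from e1.symm, ← integral_neg]
  refine integral_congr_ae (.of_forall fun x => ?_)
  simp only [hG2x]
  ring

/-- The integral of a radial function over the plane at height `s`, which is identified with `ℂ`. -/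
lemma integral_slice (F : ℝ → ℂ) (s : ℝ) :
    ∫ y : ℂ, F (√(s ^ 2 + ‖y‖ ^ 2)) = 2 * π * ∫ r in Ioi |s|, r * F r := by
  have himg : (fun y : ℝ => √(s ^ 2 + y ^ 2)) '' Ioi 0 = Ioi |s| := by
    ext r
    simp only [mem_image, mem_Ioi]
    constructor
    · rintro ⟨y, hy, rfl⟩
      exact lt_sqrt_of_sq_lt (by rw [sq_abs]; nlinarith)
    · intro hr
      have h0 := abs_nonneg s
      have h1 : s ^ 2 < r ^ 2 := by rw [← sq_abs s]; nlinarith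
      refine ⟨√(r ^ 2 - s ^ 2), sqrt_pos.2 (by linarith), ?_⟩
      rw [sq_sqrt (by linarith), add_sub_cancel, sqrt_sq (by linarith)]
  have hinj : InjOn (fun y : ℝ => √(s ^ 2 + y ^ 2)) (Ioi 0) := by
    intro a ha b hb hab
    simp only [mem_Ioi] at ha hb
    have := (sqrt_inj (by positivity) (by positivity)).1 hab
    exact (sq_eq_sq₀ ha.le hb.le).1 (by linarith)
  have hder : ∀ y ∈ Ioi (0 : ℝ), HasDerivWithinAt (fun y : ℝ => √(s ^ 2 + y ^ 2))
      (y / √(s ^ 2 + y ^ 2)) (Ioi 0) y := by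
    intro y hy
    simp only [mem_Ioi] at hy
    have h0 : 0 < s ^ 2 + y ^ 2 := by positivity
    refine (((((hasDerivAt_id' y).fun_pow 2).const_add (s ^ 2)).sqrt h0.ne').congr_deriv
      ?_).hasDerivWithinAt
    have := (sqrt_pos.2 h0).ne'
    field_simp
    simp
  have h := integral_image_eq_integral_abs_deriv_smul measurableSet_Ioi hder hinj
    fun r => (r : ℂ) * F r
  rw [himg] at h
  have hball : (volume : Measure ℂ).real (Metric.ball 0 1) = π := by
    rw [Measure.real, Complex.volume_ball]
    simp
  rw [h, integral_fun_norm_addHaar volume fun y => F (√(s ^ 2 + y ^ 2)), hball]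
  simp only [Complex.finrank_real_complex, nsmul_eq_mul, Complex.real_smul]
  push_cast
  rw [mul_assoc]
  congr 2
  refine setIntegral_congr_fun measurableSet_Ioi fun y hy => ?_
  simp only [mem_Ioi] at hy
  have h0 : 0 < √(s ^ 2 + y ^ 2) := by positivity
  simp only [pow_one]
  rw [abs_of_pos (by positivity)]
  push_cast
  have : ((√(s ^ 2 + y ^ 2) : ℝ) : ℂ) ≠ 0 := by exact_mod_cast h0.ne'
  field_simp

lemma integral_fourierChar_interval {r ρ : ℝ} (hr : 0 ≤ r) (hρ : ρ ≠ 0) :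
    ∫ s in Ioo (-r) r, (Real.fourierChar (-(s * ρ)) : ℂ) = Complex.sin (2 * π * r * ρ) / (π * ρ) := by
  rw [integral_Ioc_eq_integral_Ioo.symm, ← intervalIntegral.integral_of_le (by linarith)]
  have hc : (-(2 * π * ρ) * Complex.I : ℂ) ≠ 0 := by
    simp [hρ, pi_ne_zero]
  have : ∀ s : ℝ, (Real.fourierChar (-(s * ρ)) : ℂ) = Complex.exp (-(2 * π * ρ) * Complex.I * s) := by
    intro s
    rw [Real.fourierChar_apply]
    push_cast
    ring_nf
  simp only [this]
  rw [integral_exp_mul_complex hc, Complex.sin]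
  have h2 : (π : ℂ) ≠ 0 := by exact_mod_cast pi_ne_zero
  have h3 : (ρ : ℂ) ≠ 0 := by exact_mod_cast hρ
  push_cast
  rw [div_eq_div_iff hc (by simp [h2, h3])]
  rw [show -(2 * π * ρ) * Complex.I * r = -(2 * π * r * ρ) * Complex.I by ring,
    show -(2 * π * ρ) * Complex.I * -(r : ℂ) = (2 * π * r * ρ) * Complex.I by ring]
  ring_nf
  simp
  ring

/-- Orthonormal coordinates in which the first axis points in the direction of `ξ`. -/
lemma exists_linearIsometryEquiv (ξ : E3) :
    ∃ A : WithLp 2 (ℝ × ℂ) ≃ₗᵢ[ℝ] E3, A (WithLp.toLp 2 (‖ξ‖, 0)) = ξ := by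
  have hdim : Module.finrank ℝ (WithLp 2 (ℝ × ℂ)) = Module.finrank ℝ E3 := by
    rw [(WithLp.linearEquiv 2 ℝ (ℝ × ℂ)).finrank_eq]
    simp [Complex.finrank_real_complex]
  obtain ⟨B⟩ : Nonempty (WithLp 2 (ℝ × ℂ) ≃ₗᵢ[ℝ] E3) :=
    ⟨(stdOrthonormalBasis ℝ (WithLp 2 (ℝ × ℂ))).equiv (stdOrthonormalBasis ℝ E3) (finCongr hdim)⟩
  have hn : ‖B (WithLp.toLp 2 (‖ξ‖, 0))‖ = ‖ξ‖ := by
    rw [B.norm_map, WithLp.prod_norm_eq_of_L2]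
    simp
  exact ⟨B.trans (Submodule.reflection (ℝ ∙ (B (WithLp.toLp 2 (‖ξ‖, 0)) - ξ))ᗮ),
    by simpa using Submodule.reflection_sub hn⟩

/-- The Fourier transform of a radial function in `ℝ³` is a one-dimensional Fourier transform: slicing
by planes orthogonal to `ξ` gives the integral of `F r * r` over `r > |s|` as a function of the
height `s`. -/
lemma fourier_radial_of_integrable {F : ℝ → ℂ} (hf : Integrable fun x : E3 => F ‖x‖)
    (hg : Integrable fun r : ℝ => r * F |r|) {ξ : E3} (hξ : ξ ≠ 0) :
    𝓕 (fun x : E3 => F ‖x‖) ξ = Complex.I / ‖ξ‖ * 𝓕 (fun r : ℝ => r * F |r|) ‖ξ‖ := by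
  have hρ : ‖ξ‖ ≠ 0 := norm_ne_zero_iff.2 hξ
  obtain ⟨A, hA⟩ := exists_linearIsometryEquiv ξ
  set ρ := ‖ξ‖ with hρdef
  have hmp : MeasurePreserving (WithLp.toLp 2 : ℝ × ℂ → WithLp 2 (ℝ × ℂ)) :=
    WithLp.volume_preserving_toLp ℝ ℂ
  have hemb : MeasurableEmbedding (WithLp.toLp 2 : ℝ × ℂ → WithLp 2 (ℝ × ℂ)) :=
    (MeasurableEquiv.toLp 2 (ℝ × ℂ)).measurableEmbedding
  have hnorm : ∀ p : ℝ × ℂ, ‖A (WithLp.toLp 2 p)‖ = √(p.1 ^ 2 + ‖p.2‖ ^ 2) := by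
    intro p
    rw [A.norm_map, WithLp.prod_norm_eq_of_L2]
    simp
  have hint : Integrable fun p : ℝ × ℂ => F (√(p.1 ^ 2 + ‖p.2‖ ^ 2)) := by
    have h1 : Integrable (fun w : WithLp 2 (ℝ × ℂ) => F ‖A w‖) :=
      (A.measurePreserving.integrable_comp_emb A.toHomeomorph.measurableEmbedding).2 hf
    have h2 := (hmp.integrable_comp_emb hemb).2 h1
    simpa only [Function.comp_def, hnorm] using h2
  set c : ℝ → ℂ := fun s => (Real.fourierChar (-(s * ρ)) : ℂ) with hc
  have hccont : Continuous c := by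
    refine continuous_subtype_val.comp (Real.continuous_fourierChar.comp (by fun_prop))
  have hcn : ∀ s, ‖c s‖ = 1 := fun s => Circle.norm_coe _
  have hF3 : 𝓕 (fun x : E3 => F ‖x‖) ξ = ∫ s : ℝ, c s * (2 * π * ∫ r in Ioi |s|, r * F r) := by
    rw [← hA, ← fourier_comp_linearIsometry, Real.fourier_eq, ← hmp.integral_comp hemb]
    have e : ∀ p : ℝ × ℂ, Real.fourierChar
        (-inner ℝ (WithLp.toLp 2 p) (WithLp.toLp 2 ((ρ, 0) : ℝ × ℂ))) •
          ((fun x : E3 => F ‖x‖) ∘ A) (WithLp.toLp 2 p) =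
        c p.1 * F (√(p.1 ^ 2 + ‖p.2‖ ^ 2)) := by
      intro p
      rw [Function.comp_apply, hnorm, Circle.smul_def, smul_eq_mul, hc]
      congr 4
      rw [WithLp.prod_inner_apply]
      simp [mul_comm]
    simp only [e]
    rw [Measure.volume_eq_prod, integral_prod]
    · refine integral_congr_ae (.of_forall fun s => ?_)
      simp only
      rw [integral_const_mul, integral_slice]
    · refine (hint.bdd_mul (c := 1) (f := fun p : ℝ × ℂ => c p.1) ?_ ?_)
      · exact (hccont.comp continuous_fst).aestronglyMeasurable
      · exact .of_forall fun p => (hcn p.1).le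
  have hg0 : IntegrableOn (fun r : ℝ => (r : ℂ) * F r) (Ioi 0) :=
    hg.integrableOn.congr_fun (fun r (hr : 0 < r) => by simp [abs_of_pos hr]) measurableSet_Ioi
  have hmeas : MeasurableSet {p : ℝ × ℝ | |p.1| < p.2} :=
    measurableSet_lt (by fun_prop) (by fun_prop)
  set K : ℝ × ℝ → ℂ := {p : ℝ × ℝ | |p.1| < p.2}.indicator fun p => c p.1 * (p.2 * F p.2) with hK
  have hKs : ∀ s r : ℝ, K (s, r) = (Ioi |s|).indicator (fun r => c s * (r * F r)) r := by
    intro s r; by_cases h : |s| < r <;> simp [hK, h]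
  have hKr : ∀ s r : ℝ, K (s, r) = (Ioo (-r) r).indicator (fun s => c s * (r * F r)) s := by
    intro s r
    by_cases h : |s| < r
    · have h' := abs_lt.1 h
      simp [hK, h, h']
    · have h' : ¬ (-r < s ∧ s < r) := fun h' => h (abs_lt.2 h')
      simp [hK, h, h']
  have hcint : ∀ r, IntegrableOn c (Ioo (-r) r) := fun r =>
    (hccont.integrableOn_Icc (a := -r) (b := r)).mono_set Ioo_subset_Icc_self
  have hKint : Integrable K (volume.prod (volume.restrict (Ioi 0))) := by
    have hm : AEStronglyMeasurable K (volume.prod (volume.restrict (Ioi (0 : ℝ)))) :=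
      ((hccont.comp continuous_fst).aestronglyMeasurable.mul
        hg0.aestronglyMeasurable.comp_snd).indicator hmeas
    rw [integrable_prod_iff' hm]
    constructor
    · refine .of_forall fun r => ?_
      simp only [hKr]
      exact (integrable_indicator_iff measurableSet_Ioo).2 (Integrable.mul_const (hcint r) _)
    · have h2 : Integrable (fun r : ℝ => 2 * (r ^ 2 • ‖F r‖)) (volume.restrict (Ioi 0)) := by
        have := (integrable_fun_norm_addHaar (volume : Measure E3) (f := fun r => ‖F r‖)).1 hf.norm
        simp only [finrank_euclideanSpace, Fintype.card_fin, Nat.add_one_sub_one] at this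
        exact this.const_mul 2
      refine h2.congr ((ae_restrict_iff' measurableSet_Ioi).2 (.of_forall fun r hr => ?_))
      have hr : 0 < r := hr
      have e : ∀ s, ‖K (s, r)‖ = (Ioo (-r) r).indicator (fun _ => r * ‖F r‖) s := by
        intro s
        rw [hKr, norm_indicator_eq_indicator_norm]
        simp [hcn, abs_of_pos hr]
      simp only [e]
      rw [integral_indicator measurableSet_Ioo, setIntegral_const, Measure.real, Real.volume_Ioo,
        ENNReal.toReal_ofReal (by linarith)]
      simp only [smul_eq_mul]
      ring
  have hL : ∫ s : ℝ, c s * (2 * π * ∫ r in Ioi |s|, r * F r) =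
      ∫ r in Ioi (0 : ℝ), 2 * Complex.sin (2 * π * r * ρ) / ρ * (r * F r) := by
    calc ∫ s : ℝ, c s * (2 * π * ∫ r in Ioi |s|, r * F r)
        = 2 * π * ∫ s : ℝ, ∫ r in Ioi (0 : ℝ), K (s, r) := by
          rw [← integral_const_mul]
          refine integral_congr_ae (.of_forall fun s => ?_)
          simp only [hKs]
          rw [setIntegral_indicator measurableSet_Ioi, inter_eq_right.2
            (Ioi_subset_Ioi (abs_nonneg s)), integral_const_mul]
          ring
      _ = 2 * π * ∫ r in Ioi (0 : ℝ), ∫ s : ℝ, K (s, r) := by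
          rw [integral_integral_swap (f := fun s r => K (s, r)) hKint]
      _ = _ := by
          rw [← integral_const_mul]
          refine setIntegral_congr_fun measurableSet_Ioi fun r hr => ?_
          simp only [hKr]
          rw [integral_indicator measurableSet_Ioo, integral_mul_const,
            integral_fourierChar_interval (le_of_lt hr) hρ]
          have h2 : (π : ℂ) ≠ 0 := by exact_mod_cast pi_ne_zero
          field_simp
  have hcsin : ∀ r : ℝ, c r - c (-r) = -2 * Complex.I * Complex.sin (2 * π * r * ρ) := by
    intro r
    simp only [hc, Real.fourierChar_apply, Complex.sin]
    push_cast
    rw [show 2 * (π : ℂ) * -(r * ρ) * Complex.I = -(2 * π * r * ρ) * Complex.I by ring,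
      show 2 * (π : ℂ) * -(-r * ρ) * Complex.I = 2 * π * r * ρ * Complex.I by ring]
    linear_combination (Complex.exp (-(2 * π * r * ρ) * Complex.I) -
      Complex.exp (2 * π * r * ρ * Complex.I)) * Complex.I_sq
  have hR : 𝓕 (fun r : ℝ => (r : ℂ) * F |r|) ρ =
      ∫ r in Ioi (0 : ℝ), -2 * Complex.I * Complex.sin (2 * π * r * ρ) * (r * F r) := by
    have hci : Integrable fun r : ℝ => c r * (r * F |r|) :=
      hg.bdd_mul (c := 1) hccont.aestronglyMeasurable (.of_forall fun p => (hcn p).le)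
    have e : 𝓕 (fun r : ℝ => (r : ℂ) * F |r|) ρ = ∫ r : ℝ, c r * (r * F |r|) := by
      rw [Real.fourier_real_eq]
      rfl
    have hneg := integral_comp_neg_Ioi 0 fun r : ℝ => c r * (r * F |r|)
    rw [neg_zero] at hneg
    have hci' : IntegrableOn (fun r : ℝ => c (-r) * ((-r : ℝ) * F |(-r)|)) (Ioi 0) :=
      hci.comp_neg.integrableOn
    rw [e, ← setIntegral_univ, ← Iic_union_Ioi (a := 0), setIntegral_union
      (Iic_disjoint_Ioi le_rfl) measurableSet_Ioi hci.integrableOn hci.integrableOn, ← hneg,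
      ← integral_add hci' hci.integrableOn]
    refine setIntegral_congr_fun measurableSet_Ioi fun r (hr : 0 < r) => ?_
    simp only [← hcsin, abs_neg, abs_of_pos hr]
    push_cast
    ring
  rw [hF3, hL, hR, ← integral_const_mul]
  refine integral_congr_ae (.of_forall fun r => ?_)
  simp only
  linear_combination (2 * Complex.sin (2 * π * r * ρ) * (r * F r) / ρ) * Complex.I_sq

lemma enorm_sq_integral_eq {α : Type*} [MeasurableSpace α] {μ : Measure α} (f : α → ℂ) :
    eLpNorm f 2 μ ^ 2 = ∫⁻ x, ‖f x‖ₑ ^ 2 ∂μ := by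
  have := eLpNorm_nnreal_pow_eq_lintegral (μ := μ) (f := f) (p := 2) (by norm_num)
  simpa using this

lemma tendsto_eLpNorm_sub_indicator {V : Type*} [NormedAddCommGroup V] [MeasurableSpace V]
    [BorelSpace V] {μ : Measure V} {f : V → ℂ} (hf : MemLp f 2 μ) :
    Tendsto (fun n : ℕ => eLpNorm (f - (Metric.closedBall 0 n).indicator f) 2 μ) atTop (𝓝 0) := by
  have h1 : Tendsto (fun n : ℕ => ∫⁻ x, ‖(f - (Metric.closedBall 0 (n : ℝ)).indicator f) x‖ₑ ^ 2 ∂μ)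
      atTop (𝓝 (∫⁻ _, 0 ∂μ)) := by
    refine tendsto_lintegral_of_dominated_convergence' (fun x => ‖f x‖ₑ ^ 2) (fun n => ?_)
      (fun n => .of_forall fun x => ?_) ?_ (.of_forall fun x => ?_)
    · exact ((hf.1.sub (hf.1.indicator Metric.isClosed_closedBall.measurableSet)).enorm).pow_const 2
    · by_cases hx : x ∈ Metric.closedBall (0 : V) n <;> simp [hx]
    · rw [← enorm_sq_integral_eq]
      exact ENNReal.pow_ne_top hf.2.ne
    · obtain ⟨N, hN⟩ := exists_nat_ge ‖x‖
      refine tendsto_const_nhds.congr' ?_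
      filter_upwards [eventually_ge_atTop N] with n hn
      have : x ∈ Metric.closedBall (0 : V) n := by
        rw [mem_closedBall_zero_iff]
        exact hN.trans (by exact_mod_cast hn)
      simp [this]
  rw [lintegral_zero] at h1
  simp only [← enorm_sq_integral_eq] at h1
  have h2 := (ENNReal.continuous_rpow_const (y := (1 / 2 : ℝ))).tendsto 0 |>.comp h1
  rw [ENNReal.zero_rpow_of_pos (by norm_num)] at h2
  refine h2.congr fun n => ?_
  simp only [Function.comp_apply]
  rw [← ENNReal.rpow_natCast, ← ENNReal.rpow_mul]
  norm_num

lemma stronglyMeasurable_plancherel {V : Type*} [NormedAddCommGroup V] [InnerProductSpace ℝ V]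
    [FiniteDimensional ℝ V] [MeasurableSpace V] [BorelSpace V] {f : V → ℂ}
    (hf : MemLp f 2 (volume : Measure V)) : StronglyMeasurable (plancherel hf) :=
  Lp.stronglyMeasurable _

lemma eLpNorm_plancherel_sub {V : Type*} [NormedAddCommGroup V] [InnerProductSpace ℝ V]
    [FiniteDimensional ℝ V] [MeasurableSpace V] [BorelSpace V] {f g : V → ℂ}
    (hf : MemLp f 2 (volume : Measure V)) (hg : MemLp g 2 (volume : Measure V)) :
    eLpNorm (plancherel hf - plancherel hg) 2 volume = eLpNorm (f - g) 2 volume := by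
  have h1 : (𝓕 (hf.toLp f) - 𝓕 (hg.toLp g) : Lp ℂ 2 (volume : Measure V)) =
      𝓕 ((hf.sub hg).toLp (f - g)) := by
    rw [MemLp.toLp_sub]
    exact ((Lp.fourierTransformₗᵢ V ℂ).map_sub _ _).symm
  have h2 := Lp.coeFn_sub (𝓕 (hf.toLp f)) (𝓕 (hg.toLp g) : Lp ℂ 2 (volume : Measure V))
  refine (eLpNorm_congr_ae h2.symm).trans ?_
  rw [h1, ← Lp.enorm_def, ← ofReal_norm, Lp.norm_fourier_eq,
    ofReal_norm, Lp.enorm_toLp]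

/-- Dividing by `|ξ|` maps square integrable functions on the line to square integrable radial
functions on `ℝ³`. -/
lemma eLpNorm_div_norm_le {G : ℝ → ℂ} (hG : StronglyMeasurable G) :
    eLpNorm (fun ξ : E3 => Complex.I / ‖ξ‖ * G ‖ξ‖) 2 volume ^ 2 ≤
      ENNReal.ofReal (4 * π) * eLpNorm G 2 volume ^ 2 := by
  have hm : Measurable fun r : ℝ => ‖Complex.I / r * G r‖ₑ ^ 2 := by
    have := hG.measurable
    fun_prop
  rw [enorm_sq_integral_eq, enorm_sq_integral_eq]
  rw [lintegral_fun_norm (G := fun r : ℝ => ‖Complex.I / r * G r‖ₑ ^ 2) hm]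
  refine mul_le_mul' le_rfl ?_
  refine (setLIntegral_congr_fun measurableSet_Ioi fun r (hr : 0 < r) => ?_).trans_le
    (setLIntegral_le_lintegral (Ioi 0) fun r => ‖G r‖ₑ ^ 2)
  rw [enorm_mul, mul_pow, ← mul_assoc]
  have : ‖Complex.I / r‖ₑ = ENNReal.ofReal (r⁻¹) := by
    rw [← ofReal_norm]
    simp [abs_of_pos hr]
  rw [this, ← ENNReal.ofReal_pow (by positivity), ← ENNReal.ofReal_mul (by positivity)]
  rw [← mul_pow, mul_inv_cancel₀ hr.ne']
  simp

/-- The relation between the transforms of a radial function and of an odd function on the line for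
square integrable functions, by truncation to balls, where the functions are integrable. -/
lemma fourier_radial {F : ℝ → ℂ} (hf : MemLp (fun x : E3 => F ‖x‖) 2 (volume : Measure E3))
    (hg : MemLp (fun r : ℝ => r * F |r|) 2 (volume : Measure ℝ)) :
    ∀ᵐ ξ : E3, plancherel hf ξ = Complex.I / ‖ξ‖ * plancherel hg ‖ξ‖ := by
  set f : E3 → ℂ := fun x => F ‖x‖ with hfdef
  set g : ℝ → ℂ := fun r => r * F |r| with hgdef
  set f' : ℕ → E3 → ℂ := fun n => (Metric.closedBall 0 (n : ℝ)).indicator f with hf'def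
  set g' : ℕ → ℝ → ℂ := fun n => (Metric.closedBall 0 (n : ℝ)).indicator g with hg'def
  have hf2 : ∀ n, MemLp (f' n) 2 volume := fun n =>
    hf.indicator Metric.isClosed_closedBall.measurableSet
  have hg2 : ∀ n, MemLp (g' n) 2 volume := fun n =>
    hg.indicator Metric.isClosed_closedBall.measurableSet
  have hf1 : ∀ n, Integrable (f' n) := fun n =>
    (hf.locallyIntegrable (by norm_num)).integrableOn_isCompact (isCompact_closedBall 0 (n : ℝ))
      |>.integrable_indicator Metric.isClosed_closedBall.measurableSet
  have hg1 : ∀ n, Integrable (g' n) := fun n =>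
    (hg.locallyIntegrable (by norm_num)).integrableOn_isCompact (isCompact_closedBall 0 (n : ℝ))
      |>.integrable_indicator Metric.isClosed_closedBall.measurableSet
  have hrad : ∀ n, ∀ᵐ ξ : E3, plancherel (hf2 n) ξ = Complex.I / ‖ξ‖ * plancherel (hg2 n) ‖ξ‖ := by
    intro n
    have e1 : f' n = fun x : E3 => (Iic (n : ℝ)).indicator F ‖x‖ := by
      ext x
      simp only [hf'def, hfdef, indicator, mem_closedBall_zero_iff, mem_Iic]
    have e2 : g' n = fun r : ℝ => (r : ℂ) * (Iic (n : ℝ)).indicator F |r| := by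
      ext r
      simp only [hg'def, hgdef, indicator, mem_closedBall_zero_iff, mem_Iic, Real.norm_eq_abs]
      split_ifs <;> simp
    filter_upwards [plancherel_ae_eq (hf1 n) (hf2 n),
      ae_norm (plancherel_ae_eq (hg1 n) (hg2 n)), Measure.ae_ne volume (0 : E3)] with ξ h1 h2 h3
    rw [h1, h2, e1, e2]
    exact fourier_radial_of_integrable (e1 ▸ hf1 n) (e2 ▸ hg1 n) h3
  have hGgm : StronglyMeasurable (plancherel hg) := stronglyMeasurable_plancherel _
  have hGfm : StronglyMeasurable (plancherel hf) := stronglyMeasurable_plancherel _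
  have hmeasJ : ∀ G : ℝ → ℂ, StronglyMeasurable G →
      Measurable (fun ξ : E3 => Complex.I / ‖ξ‖ * G ‖ξ‖) := by
    intro G hG
    have := hG.measurable
    fun_prop
  have hbound : ∀ n, eLpNorm (fun ξ => plancherel hf ξ - Complex.I / ‖ξ‖ * plancherel hg ‖ξ‖) 2 volume ≤
      eLpNorm (f - f' n) 2 volume +
        (ENNReal.ofReal (4 * π) * eLpNorm (g - g' n) 2 volume ^ 2) ^ (1 / 2 : ℝ) := by
    intro n
    have hGg'm : StronglyMeasurable (plancherel (hg2 n)) := stronglyMeasurable_plancherel _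
    have hGf'm : StronglyMeasurable (plancherel (hf2 n)) := stronglyMeasurable_plancherel _
    have h1 : (fun ξ => plancherel hf ξ - Complex.I / ‖ξ‖ * plancherel hg ‖ξ‖) =ᵐ[volume]
        (plancherel hf - plancherel (hf2 n)) + fun ξ => -(Complex.I / ‖ξ‖ * (plancherel hg - plancherel (hg2 n)) ‖ξ‖) := by
      filter_upwards [hrad n] with ξ hξ
      simp only [Pi.add_apply, Pi.sub_apply]
      rw [hξ]
      ring
    rw [eLpNorm_congr_ae h1]
    refine (eLpNorm_add_le (hGfm.sub hGf'm).aestronglyMeasurable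
      (hmeasJ _ (hGgm.sub hGg'm)).neg.aestronglyMeasurable (by norm_num)).trans ?_
    rw [eLpNorm_plancherel_sub]
    gcongr
    have h3 := eLpNorm_div_norm_le (hGgm.sub hGg'm)
    have h4 : eLpNorm (plancherel hg - plancherel (hg2 n)) 2 volume = eLpNorm (g - g' n) 2 volume :=
      eLpNorm_plancherel_sub hg (hg2 n)
    rw [h4] at h3
    rw [eLpNorm_neg]
    have h5 := ENNReal.rpow_le_rpow h3 (by norm_num : (0 : ℝ) ≤ 1 / 2)
    rw [← ENNReal.rpow_natCast, ← ENNReal.rpow_mul] at h5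
    simpa using h5
  have hlim : Tendsto (fun n : ℕ => eLpNorm (f - f' n) 2 volume +
        (ENNReal.ofReal (4 * π) * eLpNorm (g - g' n) 2 volume ^ 2) ^ (1 / 2 : ℝ)) atTop (𝓝 0) := by
    have h1 := tendsto_eLpNorm_sub_indicator hf
    have h2 := tendsto_eLpNorm_sub_indicator hg
    have h3 := ENNReal.Tendsto.const_mul (a := ENNReal.ofReal (4 * π))
      ((ENNReal.continuous_pow 2).tendsto _ |>.comp h2) (.inr ENNReal.ofReal_ne_top)
    have h4 := (ENNReal.continuous_rpow_const (y := (1 / 2 : ℝ))).tendsto _ |>.comp h3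
    simpa using! h1.add h4
  have hzero : eLpNorm (fun ξ => plancherel hf ξ - Complex.I / ‖ξ‖ * plancherel hg ‖ξ‖) 2 volume = 0 :=
    le_antisymm (ge_of_tendsto' hlim hbound) bot_le
  rw [eLpNorm_eq_zero_iff (f := fun ξ => plancherel hf ξ - Complex.I / ‖ξ‖ * plancherel hg ‖ξ‖)
    (hGfm.measurable.sub (hmeasJ _ hGgm)).aestronglyMeasurable
    (by norm_num)] at hzero
  filter_upwards [hzero] with ξ hξ
  exact sub_eq_zero.1 hξ

/-- The Sobolev norms of a radial function as weighted norms of a Fourier transform on the line. -/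
lemma sobolevSqENorm_radial {F : ℝ → ℝ} (hF : Measurable F) (s : ℝ)
    (hg : MemLp (fun r : ℝ => (r : ℂ) * (F |r| : ℂ)) 2 (volume : Measure ℝ)) :
    sobolevSqENorm s (fun x => F ‖x‖) = ENNReal.ofReal (16 * π ^ 3) *
      ∫⁻ ρ in Ioi 0, ENNReal.ofReal (ρ ^ (2 * s)) * ‖plancherel hg ((2 * π)⁻¹ * ρ)‖ₑ ^ 2 := by
  have hf : MemLp (fun x : E3 => (F ‖x‖ : ℂ)) 2 (volume : Measure E3) := by
    refine ⟨(by fun_prop : Measurable _).aestronglyMeasurable, ?_⟩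
    have h1 : eLpNorm (fun x : E3 => (F ‖x‖ : ℂ)) 2 volume ^ 2 < ⊤ := by
      rw [enorm_sq_integral_eq, lintegral_fun_norm (G := fun r => ‖(F r : ℂ)‖ₑ ^ 2) (by fun_prop)]
      refine ENNReal.mul_lt_top ENNReal.ofReal_lt_top (lt_of_le_of_lt ?_
        (ENNReal.pow_lt_top hg.2 (n := 2)))
      rw [enorm_sq_integral_eq]
      refine (setLIntegral_congr_fun measurableSet_Ioi fun r (hr : 0 < r) => ?_).trans_le
        (setLIntegral_le_lintegral (Ioi 0) fun r : ℝ => ‖(r : ℂ) * (F |r| : ℂ)‖ₑ ^ 2)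
      rw [enorm_mul, mul_pow, abs_of_pos hr, ENNReal.ofReal_pow hr.le, ← ofReal_norm (r : ℂ)]
      simp [abs_of_pos hr]
    by_contra hc
    rw [not_lt, top_le_iff] at hc
    simp [hc] at h1
  have hpi : (2 * π)⁻¹ ≠ 0 := by positivity
  have hqmp : Measure.QuasiMeasurePreserving (fun ξ : E3 => (2 * π)⁻¹ • ξ) volume volume := by
    refine ⟨by fun_prop, ?_⟩
    rw [Measure.map_addHaar_smul _ hpi]
    exact Measure.smul_absolutelyContinuous
  have hae := hqmp.ae (fourier_radial (F := fun r => (F r : ℂ)) hf hg)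
  rw [sobolevSqENorm, dif_pos hf]
  have hGm := (stronglyMeasurable_plancherel hg).measurable
  calc _ = ∫⁻ ξ : E3, ENNReal.ofReal (‖ξ‖ ^ (2 * s)) * ‖Complex.I / (((2 * π)⁻¹ * ‖ξ‖ : ℝ) : ℂ) *
        plancherel hg ((2 * π)⁻¹ * ‖ξ‖)‖ₑ ^ 2 := by
        refine lintegral_congr_ae ?_
        filter_upwards [hae] with ξ hξ
        have hn : ‖(2 * π)⁻¹ • ξ‖ = (2 * π)⁻¹ * ‖ξ‖ := by
          rw [norm_smul, Real.norm_eq_abs, abs_of_pos (by positivity)]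
        rw [hn] at hξ
        rw [← hξ]
        rfl
    _ = ENNReal.ofReal (4 * π) * ∫⁻ ρ in Ioi 0, ENNReal.ofReal (ρ ^ 2) *
        (ENNReal.ofReal (ρ ^ (2 * s)) * ‖Complex.I / (((2 * π)⁻¹ * ρ : ℝ) : ℂ) *
        plancherel hg ((2 * π)⁻¹ * ρ)‖ₑ ^ 2) := by
        rw [lintegral_fun_norm (G := fun ρ => ENNReal.ofReal (ρ ^ (2 * s)) *
          ‖Complex.I / (((2 * π)⁻¹ * ρ : ℝ) : ℂ) * plancherel hg ((2 * π)⁻¹ * ρ)‖ₑ ^ 2)]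
        fun_prop
    _ = ENNReal.ofReal (4 * π) * ∫⁻ ρ in Ioi 0, ENNReal.ofReal (4 * π ^ 2) *
        (ENNReal.ofReal (ρ ^ (2 * s)) * ‖plancherel hg ((2 * π)⁻¹ * ρ)‖ₑ ^ 2) := by
        congr 1
        refine setLIntegral_congr_fun measurableSet_Ioi fun ρ (hρ : 0 < ρ) => ?_
        have h1 : ‖Complex.I / (((2 * π)⁻¹ * ρ : ℝ) : ℂ)‖ₑ = ENNReal.ofReal (2 * π / ρ) := by
          rw [← ofReal_norm, norm_div, Complex.norm_I, Complex.norm_real, Real.norm_eq_abs,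
            abs_of_pos (by positivity)]
          congr 1
          field_simp
        rw [enorm_mul, mul_pow, h1, mul_left_comm, ← mul_assoc (ENNReal.ofReal (ρ ^ 2)),
          ← ENNReal.ofReal_pow (by positivity), ← ENNReal.ofReal_mul (by positivity),
          mul_left_comm]
        congr 2
        field_simp
        norm_num
    _ = _ := by
        rw [lintegral_const_mul' _ _ ENNReal.ofReal_ne_top, ← mul_assoc,
          ← ENNReal.ofReal_mul (by positivity)]
        congr 2
        ring

/-! ### Pointwise bounds for the solution at late times -/

/-- The distance of the conformal time from the value `π`, where the trajectory has its pole. -/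
def angle (t r : ℝ) : ℝ := π - (arctan (t + r) + arctan (t - r))

/-- The radial profile of the conformal solution for `t > 0`, an even function of `r`. -/
def posProfile (H : ℝ → ℝ) (t r : ℝ) : ℝ := H (angle t r) / t

/-- The radial profile of the time derivative of the conformal solution for `t > 0`, an even function
of `r`. -/
def velProfile (H : ℝ → ℝ) (t r : ℝ) : ℝ :=
  -(H (angle t r) / t + deriv H (angle t r) * ((1 + (t + r) ^ 2)⁻¹ + (1 + (t - r) ^ 2)⁻¹)) / t

lemma angle_eq (t r : ℝ) : angle t r = π - confTime t (r ^ 2) := by rw [confTime_sq]; rfl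

lemma angle_pos (t r : ℝ) : 0 < angle t r := by
  rw [angle_eq]; linarith [confTime_lt_pi t r]

lemma angle_lt_pi {t : ℝ} (ht : 0 < t) (r : ℝ) : angle t r < π := by
  rw [angle_eq]; linarith [confTime_pos ht r]

lemma angle_neg (t r : ℝ) : angle t (-r) = angle t r := by
  unfold angle; rw [sub_neg_eq_add, ← sub_eq_add_neg, add_comm (arctan _)]

lemma posProfile_abs (H : ℝ → ℝ) (t r : ℝ) : posProfile H t |r| = posProfile H t r := by
  rcases abs_choice r with h | h <;> rw [h]
  unfold posProfile; rw [angle_neg]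

lemma velProfile_abs (H : ℝ → ℝ) (t r : ℝ) : velProfile H t |r| = velProfile H t r := by
  rcases abs_choice r with h | h <;> rw [h]
  unfold velProfile; rw [angle_neg]
  ring_nf

lemma sin_angle (t r : ℝ) :
    sin (angle t r) = 2 * t / (√(1 + (t + r) ^ 2) * √(1 + (t - r) ^ 2)) := by
  have h1 : 0 < √(1 + (t + r) ^ 2) := by positivity
  have h2 : 0 < √(1 + (t - r) ^ 2) := by positivity
  rw [angle, sin_pi_sub, sin_add, sin_arctan, sin_arctan, cos_arctan, cos_arctan]
  field_simp
  ring

lemma cos_angle (t r : ℝ) : cos (angle t r) =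
    -((1 + r ^ 2 - t ^ 2) / (√(1 + (t + r) ^ 2) * √(1 + (t - r) ^ 2))) := by
  have h1 : 0 < √(1 + (t + r) ^ 2) := by positivity
  have h2 : 0 < √(1 + (t - r) ^ 2) := by positivity
  rw [angle, cos_pi_sub, cos_add, sin_arctan, sin_arctan, cos_arctan, cos_arctan]
  field_simp
  ring

lemma hasDerivAt_angle_left (t r : ℝ) : HasDerivAt (fun t => angle t r)
    (-((1 + (t + r) ^ 2)⁻¹ + (1 + (t - r) ^ 2)⁻¹)) t := by
  have h := hasDerivAt_id' t
  exact (((h.add_const r).arctan.fun_add (h.sub_const r).arctan).const_sub π).congr_deriv (by simp)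

lemma hasDerivAt_angle_right (t r : ℝ) : HasDerivAt (fun r => angle t r)
    (-(1 + (t + r) ^ 2)⁻¹ + (1 + (t - r) ^ 2)⁻¹) r := by
  have h := hasDerivAt_id' r
  exact (((h.const_add t).arctan.fun_add (h.const_sub t).arctan).const_sub π).congr_deriv
    (by simp [add_comm])

section

variable {X Y ε : ℝ} {U H : ℝ → ℝ}

lemma penrose_eq_posProfile (h : IsProfile X Y ε U H) {t : ℝ} (ht : 0 < t) (x : E3) :
    penrose U t x = posProfile H t ‖x‖ := by
  rw [penrose_eq h ht, posProfile, angle_eq]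

lemma dt_penrose (h : IsProfile X Y ε U H) {t : ℝ} (ht : 0 < t) (x : E3) :
    dt (penrose U) t x = velProfile H t ‖x‖ := by
  have hd : HasDerivAt (fun τ => posProfile H τ ‖x‖) (velProfile H t ‖x‖) t := by
    have hH : HasDerivAt H (deriv H (angle t ‖x‖)) (angle t ‖x‖) :=
      (h.contDiff.differentiable (by simp) _).hasDerivAt
    refine ((hH.comp t (hasDerivAt_angle_left t ‖x‖)).fun_div (hasDerivAt_id' t) ht.ne').congr_deriv
      ?_
    simp only [Function.comp_apply, velProfile]
    field_simp
    ring
  rw [dt, ← hd.deriv]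
  refine Filter.EventuallyEq.deriv_eq ?_
  filter_upwards [Ioi_mem_nhds ht] with τ hτ
  exact penrose_eq_posProfile h hτ x

/-- The time derivative in terms of `U` instead of `H`. This form is of use outside the light cone, where
the argument of `U` stays away from the pole. -/
lemma velProfile_eq (h : IsProfile X Y ε U H) {t : ℝ} (ht : 0 < t) (r : ℝ) : velProfile H t r =
    (√(confK t (r ^ 2)))⁻¹ * (4 / confK t (r ^ 2)) * (-(t * (1 - r ^ 2 + t ^ 2)) *
      U (confTime t (r ^ 2)) + (1 + r ^ 2 + t ^ 2) * deriv U (confTime t (r ^ 2))) := by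
  set x : E3 := EuclideanSpace.single 0 r with hx
  have hn : ‖x‖ = |r| := by simp [hx]
  have h1 := dt_penrose h ht x
  rw [hn, velProfile_abs] at h1
  have hT : confTime t (r ^ 2) ∈ Ioo (-ε) π :=
    ⟨by linarith [confTime_pos ht r, h.pos], confTime_lt_pi t r⟩
  have hs : (-1 : ℝ) < r ^ 2 := by nlinarith [sq_nonneg r]
  rw [← h1, ← (hasDerivAt_penrose_left h hs hT).deriv, dt]
  simp only [penrose, hn, sq_abs]

lemma exists_bound_H (h : IsProfile X Y ε U H) : ∃ C, 0 ≤ C ∧ ∀ θ ∈ Icc 0 π,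
    |H θ| ≤ C ∧ |deriv H θ| ≤ C ∧ |H θ - H 0| ≤ C * θ := by
  obtain ⟨A, hA⟩ := isCompact_Icc.exists_bound_of_continuousOn (s := Icc 0 π)
    h.contDiff.continuous.continuousOn
  obtain ⟨B, hB⟩ := isCompact_Icc.exists_bound_of_continuousOn (s := Icc 0 π)
    (h.contDiff.continuous_deriv (by simp)).continuousOn
  have h0 : (0 : ℝ) ∈ Icc 0 π := ⟨le_rfl, pi_pos.le⟩
  refine ⟨max A B, (norm_nonneg _).trans ((hA 0 h0).trans (le_max_left _ _)), fun θ hθ =>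
    ⟨(hA θ hθ).trans (le_max_left _ _), (hB θ hθ).trans (le_max_right _ _), ?_⟩⟩
  have := (convex_Icc 0 π).norm_image_sub_le_of_norm_deriv_le (f := H) (C := max A B)
    (fun x _ => h.contDiff.differentiable (by simp) x)
    (fun x hx => (hB x hx).trans (le_max_right _ _)) h0 hθ
  simpa [abs_of_nonneg hθ.1] using this

lemma exists_bound_U (h : IsProfile X Y ε U H) : ∃ C, 0 ≤ C ∧ ∀ T ∈ Icc 0 (π / 2),
    |U T| ≤ C ∧ |deriv U T| ≤ C := by
  have hmem : ∀ T ∈ Icc 0 (π / 2), T ∈ Ioo (-ε) π := fun T hT =>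
    ⟨by linarith [hT.1, h.pos], by linarith [hT.2, pi_pos]⟩
  obtain ⟨A, hA⟩ := isCompact_Icc.exists_bound_of_continuousOn (s := Icc 0 (π / 2))
    (h.contDiffOn.continuousOn.mono hmem)
  obtain ⟨B, hB⟩ := isCompact_Icc.exists_bound_of_continuousOn (s := Icc 0 (π / 2)) (f := deriv U)
    fun T hT => (h.hasDerivAt_deriv T (hmem T hT)).continuousAt.continuousWithinAt
  have h0 : (0 : ℝ) ∈ Icc 0 (π / 2) := ⟨le_rfl, by positivity⟩
  exact ⟨max A B, (norm_nonneg _).trans ((hA 0 h0).trans (le_max_left _ _)), fun θ hθ =>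
    ⟨(hA θ hθ).trans (le_max_left _ _), (hB θ hθ).trans (le_max_right _ _)⟩⟩

/-- Outside the light cone the conformal time is at most `π / 2`. -/
lemma confTime_le_pi_div_two {t r : ℝ} (ht : 0 < t) (hr : t ≤ r) :
    confTime t (r ^ 2) ∈ Icc 0 (π / 2) := by
  refine ⟨(confTime_pos ht r).le, ?_⟩
  have h1 := cos_angle t r
  rw [angle_eq, cos_pi_sub] at h1
  have h2 : 0 < (1 + r ^ 2 - t ^ 2) / (√(1 + (t + r) ^ 2) * √(1 + (t - r) ^ 2)) := by
    have : 0 < 1 + r ^ 2 - t ^ 2 := by nlinarith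
    positivity
  by_contra hc
  rw [not_le] at hc
  have := cos_nonpos_of_pi_div_two_le_of_le hc.le (by linarith [confTime_lt_pi t r, pi_pos])
  linarith

/-- Inside the light cone the profile is close to `H 0`, outside it is close to `0`. -/
lemma exists_bound_sub_box (h : IsProfile X Y ε U H) : ∃ C, 0 ≤ C ∧ ∀ t r : ℝ, 1 ≤ t → 0 ≤ r →
    |H (angle t r) - (if r < t then H 0 else 0)| ≤ C * sin (angle t r) := by
  obtain ⟨A, hA0, hA⟩ := exists_bound_H h
  obtain ⟨B, hB0, hB⟩ := exists_bound_U h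
  refine ⟨4 * A + B, by positivity, fun t r ht hr => ?_⟩
  have ht0 : 0 < t := by linarith
  have hmem : angle t r ∈ Icc 0 π := ⟨(angle_pos t r).le, (angle_lt_pi ht0 r).le⟩
  have hsin : 0 ≤ sin (angle t r) := sin_nonneg_of_mem_Icc hmem
  split_ifs with hrt
  -- Jordan's inequality if the angle is acute; otherwise `r` is close to `t` and `sin` is bounded below.
  · rcases le_or_gt (angle t r) (π / 2) with hle | hlt
    · have h1 := mul_le_sin hmem.1 hle
      have h2 : angle t r ≤ 4 * sin (angle t r) := by
        have h3 : 1 / 2 ≤ 2 / π := by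
          rw [div_le_div_iff₀ (by norm_num) pi_pos]; linarith [pi_le_four]
        nlinarith [hmem.1]
      nlinarith [(hA _ hmem).2.2, mul_le_mul_of_nonneg_left h2 hA0, mul_nonneg hB0 hsin]
    · have h0 := (hA 0 ⟨le_rfl, pi_pos.le⟩).1
      have h1 := (hA _ hmem).1
      have hD : 0 < √(1 + (t + r) ^ 2) * √(1 + (t - r) ^ 2) := by positivity
      have hc := cos_nonpos_of_pi_div_two_le_of_le hlt.le (by linarith [hmem.2, pi_pos])
      rw [cos_angle, neg_nonpos, le_div_iff₀ hD, zero_mul] at hc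
      have hs : 1 / 2 ≤ sin (angle t r) := by
        rw [sin_angle, div_le_div_iff₀ (by norm_num) hD, ← sqrt_mul (by positivity), one_mul,
          sqrt_le_iff]
        refine ⟨by positivity, ?_⟩
        rw [← confK_sq, confK]
        have h3 : 1 + r ^ 2 - t ^ 2 ≤ 1 := by nlinarith
        nlinarith
      have h2 := abs_sub (H (angle t r)) (H 0)
      nlinarith [mul_nonneg hB0 hsin]
  · rw [not_lt] at hrt
    rw [sub_zero]
    have hT := confTime_le_pi_div_two ht0 hrt
    rw [h.eq_sin_mul _ ⟨angle_pos t r, angle_lt_pi ht0 r⟩, abs_mul, abs_of_nonneg hsin, angle_eq,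
      sub_sub_cancel, ← angle_eq]
    nlinarith [(hB _ hT).1, mul_nonneg hA0 hsin]

/-- The velocity is `O(t⁻²)` inside the light cone, up to a term concentrated near the cone. Only this
term remains outside, where `velProfile_eq` and bounds for `U` away from its pole apply. -/
lemma exists_bound_velProfile (h : IsProfile X Y ε U H) : ∃ C, 0 ≤ C ∧ ∀ t r : ℝ, 1 ≤ t → 0 ≤ r →
    |velProfile H t r| ≤ C * ((if r < t then (t ^ 2)⁻¹ else 0) +
      t / ((1 + (t + r) ^ 2) * (1 + (t - r) ^ 2))) := by
  obtain ⟨A, hA0, hA⟩ := exists_bound_H h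
  obtain ⟨B, hB0, hB⟩ := exists_bound_U h
  refine ⟨10 * A + 24 * B, by positivity, fun t r ht hr => ?_⟩
  have ht0 : 0 < t := by linarith
  have hmem : angle t r ∈ Icc 0 π := ⟨(angle_pos t r).le, (angle_lt_pi ht0 r).le⟩
  have hp : 0 < 1 + (t + r) ^ 2 := by positivity
  have hq : 0 < 1 + (t - r) ^ 2 := by positivity
  split_ifs with hrt
  · obtain ⟨h0, h1, -⟩ := hA _ hmem
    have e1 : (1 + (t + r) ^ 2)⁻¹ ≤ (1 + (t - r) ^ 2)⁻¹ := by
      gcongr ?_⁻¹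
      nlinarith
    have e2 : (1 + (t - r) ^ 2)⁻¹ / t ≤ 5 * (t / ((1 + (t + r) ^ 2) * (1 + (t - r) ^ 2))) := by
      rw [← mul_div_assoc, inv_eq_one_div, div_div, div_le_div_iff₀ (by positivity) (by positivity)]
      have : 1 + (t + r) ^ 2 ≤ 5 * t * t := by nlinarith
      nlinarith [mul_le_mul_of_nonneg_right this hq.le]
    have e3 : |velProfile H t r| ≤ (A / t + A * (2 * (1 + (t - r) ^ 2)⁻¹)) / t := by
      rw [velProfile, abs_div, abs_neg, abs_of_pos ht0]
      gcongr
      refine (abs_add_le _ _).trans ?_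
      rw [abs_div, abs_mul, abs_of_pos ht0, abs_of_pos (a := (1 + (t + r) ^ 2)⁻¹ + _) (by positivity)]
      gcongr
      linarith
    refine e3.trans ?_
    have e4 : (A / t + A * (2 * (1 + (t - r) ^ 2)⁻¹)) / t =
      A * (t ^ 2)⁻¹ + 2 * A * ((1 + (t - r) ^ 2)⁻¹ / t) := by field_simp
    rw [e4]
    have : 0 ≤ (t ^ 2)⁻¹ := by positivity
    have : 0 ≤ t / ((1 + (t + r) ^ 2) * (1 + (t - r) ^ 2)) := by positivity
    nlinarith [mul_nonneg hA0 this, mul_nonneg hB0 this, mul_le_mul_of_nonneg_left e2 hA0,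
      mul_nonneg hA0 (by positivity : 0 ≤ (t ^ 2)⁻¹), mul_nonneg hB0 (by positivity : 0 ≤ (t ^ 2)⁻¹)]
  · rw [not_lt] at hrt
    obtain ⟨h0, h1⟩ := hB _ (confTime_le_pi_div_two ht0 hrt)
    rw [velProfile_eq h ht0, confK_sq, sqrt_mul hp.le, zero_add]
    obtain ⟨a, ha, ha2⟩ : ∃ a, 0 < a ∧ 1 + (t + r) ^ 2 = a ^ 2 :=
      ⟨√(1 + (t + r) ^ 2), by positivity, (sq_sqrt hp.le).symm⟩
    obtain ⟨b, hb, hb2⟩ : ∃ b, 0 < b ∧ 1 + (t - r) ^ 2 = b ^ 2 :=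
      ⟨√(1 + (t - r) ^ 2), by positivity, (sq_sqrt hq.le).symm⟩
    rw [ha2, hb2, sqrt_sq ha.le, sqrt_sq hb.le]
    have a1 : t + r ≤ a := by nlinarith
    have b1 : r - t ≤ b := by nlinarith
    have b2 : 1 ≤ b := by nlinarith
    have a2 : a ≤ 1 + (t + r) := by nlinarith
    have a3 : a ≤ 4 * t * b := by nlinarith
    have c1 : |1 - r ^ 2 + t ^ 2| ≤ 2 * (a * b) := by
      have : (r - t) * (t + r) ≤ b * a := mul_le_mul b1 a1 (by linarith) hb.le
      rw [abs_le]; constructor <;> nlinarith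
    have c2 : 1 + r ^ 2 + t ^ 2 ≤ a ^ 2 := by nlinarith
    rw [abs_mul, abs_of_pos (by positivity)]
    have c3 : |-(t * (1 - r ^ 2 + t ^ 2)) * U (confTime t (r ^ 2)) +
        (1 + r ^ 2 + t ^ 2) * deriv U (confTime t (r ^ 2))| ≤
        t * (2 * (a * b)) * B + a * (4 * t * b) * B := by
      refine (abs_add_le _ _).trans ?_
      rw [abs_mul, abs_mul, abs_neg, abs_mul, abs_of_pos ht0,
        abs_of_pos (by positivity : 0 < 1 + r ^ 2 + t ^ 2)]
      gcongr
      nlinarith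
    refine (mul_le_mul_of_nonneg_left c3 (by positivity)).trans ?_
    have c4 : (a * b)⁻¹ * (4 / (a ^ 2 * b ^ 2)) * (t * (2 * (a * b)) * B + a * (4 * t * b) * B) =
        24 * B * (t / (a ^ 2 * b ^ 2)) := by field_simp; ring
    rw [c4]
    gcongr
    linarith

/-- The profile is not constant, since it vanishes at `π`. -/
lemma exists_deriv_ne_zero (h : IsProfile X Y ε U H) : ∃ θ ∈ Ioo 0 π, deriv H θ ≠ 0 := by
  by_contra! hc
  have hpi : H π = 0 := by
    have h1 : Tendsto H (𝓝[<] π) (𝓝 (H π)) := h.contDiff.continuous.continuousAt.mono_left nhdsWithin_le_nhds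
    have hU : ContinuousAt (fun θ => sin θ * U (π - θ)) π := by
      have : ContinuousAt U (π - π) := by
        rw [sub_self]
        exact h.contDiffOn.continuousOn.continuousAt
          (Ioo_mem_nhds (by linarith [h.pos]) pi_pos)
      exact continuous_sin.continuousAt.mul
        (this.comp (f := fun θ => π - θ) (by fun_prop))
    have h2 : Tendsto (fun θ => sin θ * U (π - θ)) (𝓝[<] π) (𝓝 0) := by
      have := hU.tendsto
      simp only [sin_pi, zero_mul] at this
      exact this.mono_left nhdsWithin_le_nhds
    refine tendsto_nhds_unique h1 (h2.congr' ?_)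
    filter_upwards [Ioo_mem_nhdsLT pi_pos] with θ hθ
    exact (h.eq_sin_mul θ hθ).symm
  have hconst : H π = H 0 := by
    obtain ⟨θ, hθ, e⟩ := exists_deriv_eq_slope H pi_pos h.contDiff.continuous.continuousOn
      fun x _ => (h.contDiff.differentiable (by simp) x).differentiableWithinAt
    rw [hc θ hθ, eq_comm, div_eq_zero_iff] at e
    rcases e with e | e
    · linarith
    · linarith [pi_pos]
  have := h.sq_zero
  rw [← hconst, hpi] at this
  norm_num at this

end

/-! ### Radial derivatives and localization at the light cone -/

/-- A weight concentrated at distance `O(1)` from the light cone `|r| = |t|`. -/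
def shellWeight (t r : ℝ) : ℝ := (1 + (t + r) ^ 2)⁻¹ + (1 + (t - r) ^ 2)⁻¹

lemma shellWeight_nonneg (t r : ℝ) : 0 ≤ shellWeight t r := by unfold shellWeight; positivity

lemma shellWeight_neg (t r : ℝ) : shellWeight t (-r) = shellWeight t r := by
  unfold shellWeight; rw [add_comm]; ring_nf

lemma shellWeight_abs (t r : ℝ) : shellWeight t |r| = shellWeight t r := by
  rcases abs_choice r with h | h <;> rw [h]
  exact shellWeight_neg t r

lemma integrable_shellWeight (t : ℝ) : Integrable (shellWeight t) :=
  (integrable_inv_one_add_sq.comp_add_left t).add (integrable_inv_one_add_sq.comp_sub_left t)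

lemma integral_shellWeight (t : ℝ) : ∫ r, shellWeight t r = 2 * π := by
  unfold shellWeight
  rw [integral_add (integrable_inv_one_add_sq.comp_add_left t)
    (integrable_inv_one_add_sq.comp_sub_left t),
    integral_add_left_eq_self (fun x : ℝ => (1 + x ^ 2)⁻¹) t,
    integral_sub_left_eq_self (fun x : ℝ => (1 + x ^ 2)⁻¹) volume t, integral_univ_inv_one_add_sq]
  ring

lemma lintegral_enorm_sq_le {t C : ℝ} {φ : ℝ → ℝ} (hC : 0 ≤ C)
    (hφ : ∀ r, φ r ^ 2 ≤ C * shellWeight t r) :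
    ∫⁻ r, ‖(φ r : ℂ)‖ₑ ^ 2 ≤ ENNReal.ofReal (C * (2 * π)) := by
  rw [← integral_shellWeight t, ← integral_const_mul,
    ofReal_integral_eq_lintegral_ofReal ((integrable_shellWeight t).const_mul C)
      (.of_forall fun r => mul_nonneg hC (shellWeight_nonneg t r))]
  refine lintegral_mono fun r => ?_
  rw [← ofReal_norm, ← ENNReal.ofReal_pow (norm_nonneg _)]
  refine ENNReal.ofReal_le_ofReal ?_
  simpa using hφ r

lemma memLp_two_of_sq_le {t C : ℝ} {φ : ℝ → ℝ} (hC : 0 ≤ C) (hm : Measurable φ)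
    (hφ : ∀ r, φ r ^ 2 ≤ C * shellWeight t r) :
    MemLp (fun r => (φ r : ℂ)) 2 (volume : Measure ℝ) := by
  refine ⟨(by fun_prop : Measurable _).aestronglyMeasurable, ?_⟩
  have h1 := (lintegral_enorm_sq_le hC hφ).trans_lt ENNReal.ofReal_lt_top
  rw [← enorm_sq_integral_eq] at h1
  by_contra hc
  rw [not_lt, top_le_iff] at hc
  simp [hc] at h1

/-- Functions of `(t, r)` that are smooth in `(arctan (t + r), arctan (t - r))` and vanish together
with their first derivatives where one of these arguments is `± π / 2`. They decay like the inverse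
square of the distance to the light cone, and so do their radial derivatives. -/
def IsConeSymbol (w : ℝ → ℝ → ℝ) : Prop :=
  ∃ Φ Ψ : ℝ × ℝ → ℝ, ContDiff ℝ ∞ Φ ∧ ContDiff ℝ ∞ Ψ ∧ ∀ t r,
    w t r = (1 + (t + r) ^ 2)⁻¹ * Φ (arctan (t + r), arctan (t - r)) +
      (1 + (t - r) ^ 2)⁻¹ * Ψ (arctan (t + r), arctan (t - r))

lemma hasDerivAt_comp_arctan {Φ : ℝ × ℝ → ℝ} (hΦ : ContDiff ℝ ∞ Φ) (t r : ℝ) :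
    HasDerivAt (fun r => Φ (arctan (t + r), arctan (t - r)))
      ((1 + (t + r) ^ 2)⁻¹ * fderiv ℝ Φ (arctan (t + r), arctan (t - r)) (1, 0) +
        (1 + (t - r) ^ 2)⁻¹ * -fderiv ℝ Φ (arctan (t + r), arctan (t - r)) (0, 1)) r := by
  have hid := hasDerivAt_id' r
  have hA := (hid.const_add t).arctan
  have hB := (hid.const_sub t).arctan
  have hΦ' := (hΦ.differentiable (by simp) (arctan (t + r), arctan (t - r))).hasFDerivAt
  refine (hΦ'.comp_hasDerivAt r (hA.prodMk hB)).congr_deriv ?_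
  have e : ((1 / (1 + (t + r) ^ 2) * 1, 1 / (1 + (t - r) ^ 2) * -1) : ℝ × ℝ) =
      (1 + (t + r) ^ 2)⁻¹ • ((1, 0) : ℝ × ℝ) + (-(1 + (t - r) ^ 2)⁻¹) • ((0, 1) : ℝ × ℝ) := by
    simp
  rw [e, map_add, map_smul, map_smul]
  simp

lemma contDiff_fderiv_apply {Φ : ℝ × ℝ → ℝ} (hΦ : ContDiff ℝ ∞ Φ) (v : ℝ × ℝ) :
    ContDiff ℝ ∞ fun z => fderiv ℝ Φ z v :=
  (hΦ.fderiv_right (m := ∞) (by simp)).clm_apply contDiff_const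

lemma IsConeSymbol.exists_hasDerivAt {w : ℝ → ℝ → ℝ} (hw : IsConeSymbol w) :
    ∃ w', IsConeSymbol w' ∧ ∀ t r, HasDerivAt (w t) (w' t r) r := by
  obtain ⟨Φ, Ψ, hΦ, hΨ, hw⟩ := hw
  -- the derivative of the weight `(1 + s ^ 2)⁻¹` is `-2 tan a cos a ^ 4` with `s = tan a`
  have hq : ∀ s : ℝ, (1 + s ^ 2)⁻¹ * -(2 * sin (arctan s) * cos (arctan s)) =
      -(2 * s) / (1 + s ^ 2) ^ 2 := by
    intro s
    have h0 : 0 < √(1 + s ^ 2) := by positivity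
    have h1 : √(1 + s ^ 2) ^ 2 = 1 + s ^ 2 := sq_sqrt (by positivity)
    rw [sin_arctan, cos_arctan]
    generalize √(1 + s ^ 2) = a at h0 h1
    rw [← h1]
    field_simp
  have hd : ∀ s : ℝ, HasDerivAt (fun s => (1 + s ^ 2)⁻¹) (-(2 * s) / (1 + s ^ 2) ^ 2) s := by
    intro s
    refine ((((hasDerivAt_id' s).fun_pow 2).const_add 1).fun_inv (by positivity)).congr_deriv ?_
    simp
  have hc : ContDiff ℝ ∞ fun z : ℝ × ℝ => -(2 * sin z.1 * cos z.1) := by fun_prop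
  have hc' : ContDiff ℝ ∞ fun z : ℝ × ℝ => 2 * sin z.2 * cos z.2 := by fun_prop
  have h1 : ContDiff ℝ ∞ fun z : ℝ × ℝ => cos z.1 ^ 2 := by fun_prop
  have h2 : ContDiff ℝ ∞ fun z : ℝ × ℝ => cos z.2 ^ 2 := by fun_prop
  have hDΦ := contDiff_fderiv_apply hΦ
  have hDΨ := contDiff_fderiv_apply hΨ
  refine ⟨_, ⟨fun z => -(2 * sin z.1 * cos z.1) * Φ z + cos z.1 ^ 2 * fderiv ℝ Φ z (1, 0) -
      cos z.2 ^ 2 * fderiv ℝ Φ z (0, 1),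
    fun z => 2 * sin z.2 * cos z.2 * Ψ z + cos z.1 ^ 2 * fderiv ℝ Ψ z (1, 0) -
      cos z.2 ^ 2 * fderiv ℝ Ψ z (0, 1), ?_, ?_, fun _ _ => rfl⟩, fun t r => ?_⟩
  · exact ((hc.mul hΦ).add (h1.mul (hDΦ _))).sub (h2.mul (hDΦ _))
  · exact ((hc'.mul hΨ).add (h1.mul (hDΨ _))).sub (h2.mul (hDΨ _))
  · have hid := hasDerivAt_id' r
    have e : w t = fun r => (1 + (t + r) ^ 2)⁻¹ * Φ (arctan (t + r), arctan (t - r)) +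
      (1 + (t - r) ^ 2)⁻¹ * Ψ (arctan (t + r), arctan (t - r)) := funext (hw t)
    rw [e]
    have dA : HasDerivAt (fun r => (1 + (t + r) ^ 2)⁻¹) _ r :=
      (hd (t + r)).comp r (hid.const_add t)
    have dB : HasDerivAt (fun r => (1 + (t - r) ^ 2)⁻¹) _ r :=
      (hd (t - r)).comp r (hid.const_sub t)
    refine ((dA.fun_mul (hasDerivAt_comp_arctan hΦ t r)).fun_add
      (dB.fun_mul (hasDerivAt_comp_arctan hΨ t r))).congr_deriv ?_
    rw [← hq (t + r), ← hq (t - r)]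
    simp only [cos_sq_arctan, one_div]
    ring

lemma IsConeSymbol.exists_bound {w : ℝ → ℝ → ℝ} (hw : IsConeSymbol w) :
    ∃ C, 0 ≤ C ∧ ∀ t r, |w t r| ≤ C * shellWeight t r := by
  obtain ⟨Φ, Ψ, hΦ, hΨ, hw⟩ := hw
  set K : Set (ℝ × ℝ) := Icc (-(π / 2)) (π / 2) ×ˢ Icc (-(π / 2)) (π / 2) with hK
  have hKc : IsCompact K := isCompact_Icc.prod isCompact_Icc
  obtain ⟨A, hA⟩ := hKc.exists_bound_of_continuousOn hΦ.continuous.continuousOn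
  obtain ⟨B, hB⟩ := hKc.exists_bound_of_continuousOn hΨ.continuous.continuousOn
  have hmem : ∀ t r, (arctan (t + r), arctan (t - r)) ∈ K := fun t r =>
    ⟨⟨(neg_pi_div_two_lt_arctan _).le, (arctan_lt_pi_div_two _).le⟩,
      ⟨(neg_pi_div_two_lt_arctan _).le, (arctan_lt_pi_div_two _).le⟩⟩
  refine ⟨max A B, (norm_nonneg _).trans ((hA _ (hmem 0 0)).trans (le_max_left _ _)),
    fun t r => ?_⟩
  have h1 := (hA _ (hmem t r)).trans (le_max_left A B)
  have h2 := (hB _ (hmem t r)).trans (le_max_right A B)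
  rw [hw, shellWeight, mul_add]
  refine (abs_add_le _ _).trans ?_
  rw [abs_mul, abs_mul, abs_of_pos (by positivity : 0 < (1 + (t + r) ^ 2)⁻¹),
    abs_of_pos (by positivity : 0 < (1 + (t - r) ^ 2)⁻¹), mul_comm (max A B), mul_comm (max A B)]
  exact add_le_add (mul_le_mul_of_nonneg_left h1 (by positivity))
    (mul_le_mul_of_nonneg_left h2 (by positivity))

/-- All radial derivatives of a symbol are symbols. -/
lemma IsConeSymbol.exists_seq {w : ℝ → ℝ → ℝ} (hw : IsConeSymbol w) :
    ∃ W : ℕ → ℝ → ℝ → ℝ, W 0 = w ∧ (∀ k, IsConeSymbol (W k)) ∧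
      ∀ k t r, HasDerivAt (W k t) (W (k + 1) t r) r := by
  choose D hD hD' using fun v : {w // IsConeSymbol w} => v.2.exists_hasDerivAt
  let V : ℕ → {w // IsConeSymbol w} := fun k =>
    Nat.rec ⟨w, hw⟩ (fun _ v => ⟨D v, hD v⟩) k
  exact ⟨fun k => (V k).1, rfl, fun k => (V k).2, fun k t r => hD' (V k) t r⟩

/-- The factor `r / t` is harmless because it is bounded near the light cone and the weight decays away
from it. -/
lemma mul_shellWeight_sq_le {t : ℝ} (ht : 1 ≤ t) (r : ℝ) :
    (r / t * shellWeight t r) ^ 2 ≤ 8 * shellWeight t r := by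
  have key : ∀ s q : ℝ, |s| ≤ t + |q| → (s / t * (1 + q ^ 2)⁻¹) ^ 2 ≤ 4 * (1 + q ^ 2)⁻¹ := by
    intro s q hs
    have h0 : 0 < 1 + q ^ 2 := by positivity
    have h1 : (s / t) ^ 2 ≤ 4 * (1 + q ^ 2) := by
      have h2 : |s / t| ≤ 1 + |q| := by
        rw [abs_div, abs_of_pos (by linarith : 0 < t), div_le_iff₀ (by linarith)]
        nlinarith [abs_nonneg q]
      rw [← sq_abs]
      nlinarith [abs_nonneg q, abs_nonneg (s / t), sq_abs q, sq_nonneg (1 - |q|)]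
    rw [mul_pow]
    calc (s / t) ^ 2 * (1 + q ^ 2)⁻¹ ^ 2 ≤ 4 * (1 + q ^ 2) * (1 + q ^ 2)⁻¹ ^ 2 := by gcongr
      _ = _ := by field_simp
  have h1 := key r (t + r) (by
    have := abs_sub (t + r) t
    rw [add_sub_cancel_left, abs_of_pos (by linarith : 0 < t)] at this
    linarith)
  have h2 := key r (t - r) (by
    have := abs_sub t (t - r)
    rw [sub_sub_cancel, abs_of_pos (by linarith : 0 < t)] at this
    linarith)
  have h3 : r / t * shellWeight t r =
    r / t * (1 + (t + r) ^ 2)⁻¹ + r / t * (1 + (t - r) ^ 2)⁻¹ := by unfold shellWeight; ring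
  rw [h3]
  refine (add_sq_le).trans ?_
  unfold shellWeight
  linarith

lemma shellWeight_sq_le {t : ℝ} (r : ℝ) : shellWeight t r ^ 2 ≤ 2 * shellWeight t r := by
  have h1 : (1 + (t + r) ^ 2)⁻¹ ≤ 1 := inv_le_one_of_one_le₀ (by nlinarith [sq_nonneg (t + r)])
  have h2 : (1 + (t - r) ^ 2)⁻¹ ≤ 1 := inv_le_one_of_one_le₀ (by nlinarith [sq_nonneg (t - r)])
  have h3 := shellWeight_nonneg t r
  have h4 : shellWeight t r ≤ 2 := by unfold shellWeight; linarith
  nlinarith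

/-- Radial derivatives of `r / t` times a symbol are square integrable, uniformly in time. -/
lemma IsConeSymbol.exists_bound_sq {w v : ℝ → ℝ → ℝ} (hw : IsConeSymbol w) (hv : IsConeSymbol v)
    (c : ℝ) : ∃ C, 0 ≤ C ∧ ∀ t r : ℝ, 1 ≤ t →
      (r / t * w t r + c / t * v t r) ^ 2 ≤ C * shellWeight t r := by
  obtain ⟨A, hA0, hA⟩ := hw.exists_bound
  obtain ⟨B, hB0, hB⟩ := hv.exists_bound
  refine ⟨16 * A ^ 2 + 4 * c ^ 2 * B ^ 2, by positivity, fun t r ht => ?_⟩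
  have hκ := shellWeight_nonneg t r
  have h1 : (r / t * w t r) ^ 2 ≤ A ^ 2 * (8 * shellWeight t r) := by
    refine le_trans ?_ (mul_le_mul_of_nonneg_left (mul_shellWeight_sq_le ht r) (sq_nonneg A))
    have : w t r ^ 2 ≤ (A * shellWeight t r) ^ 2 := sq_le_sq' (abs_le.1 (hA t r)).1 (abs_le.1 (hA t r)).2
    calc (r / t * w t r) ^ 2 = (r / t) ^ 2 * w t r ^ 2 := by ring
      _ ≤ (r / t) ^ 2 * (A * shellWeight t r) ^ 2 := by gcongr
      _ = _ := by ring
  have h2 : (c / t * v t r) ^ 2 ≤ c ^ 2 * (B ^ 2 * (2 * shellWeight t r)) := by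
    have : v t r ^ 2 ≤ (B * shellWeight t r) ^ 2 := sq_le_sq' (abs_le.1 (hB t r)).1 (abs_le.1 (hB t r)).2
    have h3 : (c / t) ^ 2 ≤ c ^ 2 := by
      rw [div_pow]
      exact div_le_self (sq_nonneg c) (by nlinarith)
    calc (c / t * v t r) ^ 2 = (c / t) ^ 2 * v t r ^ 2 := by ring
      _ ≤ c ^ 2 * (B * shellWeight t r) ^ 2 := by gcongr
      _ = c ^ 2 * (B ^ 2 * shellWeight t r ^ 2) := by ring
      _ ≤ _ := by gcongr; exact shellWeight_sq_le r
  refine (add_sq_le).trans ?_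
  nlinarith

section

variable {X Y ε : ℝ} {U H : ℝ → ℝ}

/-- The explicit approximation of the radial profile, a multiple of the indicator function of the
interior of the light cone. -/
def boxProfile (H : ℝ → ℝ) (t r : ℝ) : ℝ := if |r| < t then H 0 / t else 0

lemma inv_le_shellWeight (t r : ℝ) : (1 + (t - |r|) ^ 2)⁻¹ ≤ shellWeight t r := by
  rw [← shellWeight_abs]
  unfold shellWeight
  have : 0 ≤ (1 + (t + |r|) ^ 2)⁻¹ := by positivity
  linarith

lemma inv_sq_le_shellWeight {t r : ℝ} (ht : 1 ≤ t) (hr : |r| < t) :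
    (t ^ 2)⁻¹ ≤ 5 * shellWeight t r := by
  refine le_trans ?_ (mul_le_mul_of_nonneg_left (inv_le_shellWeight t r) (by norm_num))
  rw [← div_eq_mul_inv, inv_eq_one_div, div_le_div_iff₀ (by positivity) (by positivity)]
  nlinarith [abs_nonneg r]

/-- The bound for the distance of the radial profile to its approximation that comes from
`exists_bound_sub_box`, with the weight `1 + r ^ 2`. -/
lemma sin_angle_div_sq_mul_le {t : ℝ} (ht : 1 ≤ t) (r : ℝ) :
    (1 + r ^ 2) * (sin (angle t |r|) / t) ^ 2 ≤ 4 * shellWeight t r := by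
  have ht0 : 0 < t := by linarith
  refine le_trans ?_ (mul_le_mul_of_nonneg_left (inv_le_shellWeight t r) (by norm_num))
  rw [sin_angle, div_pow, div_pow, mul_pow √_, sq_sqrt (by positivity), sq_sqrt (by positivity)]
  have h1 : 1 + r ^ 2 ≤ 1 + (t + |r|) ^ 2 := by nlinarith [abs_nonneg r, sq_abs r]
  calc (1 + r ^ 2) * ((2 * t) ^ 2 / ((1 + (t + |r|) ^ 2) * (1 + (t - |r|) ^ 2)) / t ^ 2)
      ≤ (1 + (t + |r|) ^ 2) * ((2 * t) ^ 2 / ((1 + (t + |r|) ^ 2) * (1 + (t - |r|) ^ 2)) / t ^ 2) := by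
        gcongr
    _ = _ := by
        have h2 : 0 < 1 + (t + |r|) ^ 2 := by positivity
        have h3 : 0 < 1 + (t - |r|) ^ 2 := by positivity
        field_simp
        norm_num

/-- The radial profile is close to its approximation in the square mean, even with the weight
`1 + r ^ 2`. -/
lemma exists_bound_sub_boxProfile (h : IsProfile X Y ε U H) : ∃ C, 0 ≤ C ∧ ∀ t r : ℝ, 1 ≤ t →
    (1 + r ^ 2) * (posProfile H t r - boxProfile H t r) ^ 2 ≤ C * shellWeight t r := by
  obtain ⟨C, hC0, hC⟩ := exists_bound_sub_box h
  refine ⟨C ^ 2 * 4, by positivity, fun t r ht => ?_⟩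
  have ht0 : 0 < t := by linarith
  have h1 := hC t |r| ht (abs_nonneg r)
  have h2 : posProfile H t r - boxProfile H t r =
      (H (angle t |r|) - if |r| < t then H 0 else 0) / t := by
    rw [← posProfile_abs, posProfile, boxProfile]
    split_ifs <;> ring
  have h3 : (posProfile H t r - boxProfile H t r) ^ 2 ≤ (C * sin (angle t |r|) / t) ^ 2 := by
    rw [h2, div_pow, div_pow, ← sq_abs]
    gcongr
  calc _ ≤ (1 + r ^ 2) * (C * sin (angle t |r|) / t) ^ 2 := by gcongr
    _ = C ^ 2 * ((1 + r ^ 2) * (sin (angle t |r|) / t) ^ 2) := by ring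
    _ ≤ C ^ 2 * (4 * shellWeight t r) :=
      mul_le_mul_of_nonneg_left (sin_angle_div_sq_mul_le ht r) (sq_nonneg C)
    _ = _ := by ring

lemma exists_bound_posProfile_sq (h : IsProfile X Y ε U H) : ∃ C, 0 ≤ C ∧ ∀ t r : ℝ, 1 ≤ t →
    (1 + (r / t) ^ 2) * posProfile H t r ^ 2 ≤ C * shellWeight t r := by
  obtain ⟨C, hC0, hC⟩ := exists_bound_sub_boxProfile h
  refine ⟨2 * C + 40, by positivity, fun t r ht => ?_⟩
  have ht0 : 0 < t := by linarith
  have h1 := hC t r ht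
  have h2 : (1 + (r / t) ^ 2) * boxProfile H t r ^ 2 ≤ 20 * shellWeight t r := by
    unfold boxProfile
    split_ifs with hr
    · have h3 : (r / t) ^ 2 ≤ 1 := by
        rw [div_pow, div_le_one (by positivity), ← sq_abs]
        gcongr
      rw [div_pow (H 0), h.sq_zero, div_eq_mul_inv 2]
      have := inv_sq_le_shellWeight ht hr
      have h4 : 0 ≤ (t ^ 2)⁻¹ := by positivity
      nlinarith
    · have := shellWeight_nonneg t r
      simpa
  have h3 : (r / t) ^ 2 ≤ r ^ 2 := by
    rw [div_pow]
    exact div_le_self (sq_nonneg r) (by nlinarith)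
  have h4 : posProfile H t r ^ 2 ≤ 2 * (posProfile H t r - boxProfile H t r) ^ 2 +
      2 * boxProfile H t r ^ 2 := by
    nlinarith [sq_nonneg (posProfile H t r - 2 * boxProfile H t r)]
  calc _ ≤ (1 + (r / t) ^ 2) * (2 * (posProfile H t r - boxProfile H t r) ^ 2 +
      2 * boxProfile H t r ^ 2) := by gcongr
    _ = 2 * ((1 + (r / t) ^ 2) * (posProfile H t r - boxProfile H t r) ^ 2) +
      2 * ((1 + (r / t) ^ 2) * boxProfile H t r ^ 2) := by ring
    _ ≤ 2 * ((1 + r ^ 2) * (posProfile H t r - boxProfile H t r) ^ 2) +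
      2 * (20 * shellWeight t r) := by gcongr
    _ ≤ _ := by linarith

/-- The successive radial derivatives of `H (angle t r)`. From the first derivative on they are
symbols, whereas `H (angle t r)` itself does not decay away from the light cone. -/
lemma exists_profile_seq (h : IsProfile X Y ε U H) : ∃ F : ℕ → ℝ → ℝ → ℝ,
    (∀ t r, F 0 t r = H (angle t r)) ∧
    (∀ t r, F 1 t r = deriv H (angle t r) * (-(1 + (t + r) ^ 2)⁻¹ + (1 + (t - r) ^ 2)⁻¹)) ∧
    (∀ k, IsConeSymbol (F (k + 1))) ∧ ∀ k t r, HasDerivAt (F k t) (F (k + 1) t r) r := by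
  have hH' : ContDiff ℝ ∞ (deriv H) := (contDiff_infty_iff_deriv.1 h.contDiff).2
  have hsym : IsConeSymbol fun t r =>
      deriv H (angle t r) * (-(1 + (t + r) ^ 2)⁻¹ + (1 + (t - r) ^ 2)⁻¹) := by
    refine ⟨fun z => -deriv H (π - (z.1 + z.2)), fun z => deriv H (π - (z.1 + z.2)),
      (hH'.comp (by fun_prop)).neg, hH'.comp (by fun_prop), fun t r => ?_⟩
    simp only [angle]
    ring
  obtain ⟨W, hW0, hW, hd⟩ := hsym.exists_seq
  refine ⟨fun k => Nat.casesOn k (fun t r => H (angle t r)) W, fun _ _ => rfl,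
    fun t r => congrFun (congrFun hW0 t) r, fun k => hW k, fun k t r => ?_⟩
  cases k with
  | zero =>
    refine HasDerivAt.congr_deriv (((h.contDiff.differentiable (by simp) _).hasDerivAt).comp r
      (hasDerivAt_angle_right t r)) ?_
    simp only [hW0]
  | succ k => exact hd k t r

lemma hasDerivAt_mul_seq {F : ℕ → ℝ → ℝ → ℝ} (hF : ∀ k t r, HasDerivAt (F k t) (F (k + 1) t r) r)
    (k : ℕ) (t r : ℝ) : HasDerivAt (fun r => r / t * F k t r + k / t * F (k - 1) t r)
      (r / t * F (k + 1) t r + (k + 1 : ℕ) / t * F k t r) r := by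
  have h1 := ((hasDerivAt_id' r).div_const t).fun_mul (hF k t r)
  cases k with
  | zero => simpa [add_comm] using h1
  | succ k =>
    refine (h1.fun_add ((hF k t r).const_mul ((k + 1 : ℕ) / t))).congr_deriv ?_
    push_cast
    ring

/-- All radial derivatives of `r u` of positive order are square integrable on the line, uniformly in
time. -/
lemma exists_pos_seq (h : IsProfile X Y ε U H) : ∃ G : ℕ → ℝ → ℝ → ℝ,
    (∀ t r, G 0 t r = r * posProfile H t r) ∧
    (∀ t r, G 1 t r = r / t * (deriv H (angle t r) *
      (-(1 + (t + r) ^ 2)⁻¹ + (1 + (t - r) ^ 2)⁻¹)) + H (angle t r) / t) ∧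
    (∀ k t r, HasDerivAt (G k t) (G (k + 1) t r) r) ∧
    ∀ k, ∃ C, 0 ≤ C ∧ ∀ t r : ℝ, 1 ≤ t → G (k + 1) t r ^ 2 ≤ C * shellWeight t r := by
  obtain ⟨F, hF0, hF1, hFs, hFd⟩ := exists_profile_seq h
  refine ⟨fun k t r => r / t * F k t r + k / t * F (k - 1) t r, fun t r => ?_, fun t r => ?_,
    fun k t r => hasDerivAt_mul_seq hFd k t r, fun k => ?_⟩
  · simp [hF0, posProfile]; ring
  · simp [hF0, hF1]; ring
  · cases k with
    | zero =>
      obtain ⟨A, hA0, hA⟩ := (hFs 0).exists_bound_sq (hFs 0) 0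
      obtain ⟨B, hB0, hB⟩ := exists_bound_posProfile_sq h
      refine ⟨2 * A + 2 * B, by positivity, fun t r ht => ?_⟩
      have h1 := hA t r ht
      have h2 := hB t r ht
      have h3 : posProfile H t r ^ 2 ≤ B * shellWeight t r := by
        nlinarith [sq_nonneg (r / t), sq_nonneg (posProfile H t r),
          mul_nonneg (sq_nonneg (r / t)) (sq_nonneg (posProfile H t r))]
      simp only [zero_add, zero_div, zero_mul, add_zero, Nat.cast_one, Nat.sub_self, hF0] at h1 ⊢
      have h4 : 1 / t * H (angle t r) = posProfile H t r := by rw [posProfile]; ring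
      rw [h4]
      refine (add_sq_le).trans ?_
      linarith
    | succ k => exact (hFs (k + 1)).exists_bound_sq (hFs k) _

/-- The function `r ∂ₜu` and all its radial derivatives are square integrable on the line, uniformly
in time. -/
lemma exists_vel_seq (h : IsProfile X Y ε U H) : ∃ K : ℕ → ℝ → ℝ → ℝ,
    (∀ t r, K 0 t r = r * velProfile H t r) ∧
    (∀ k t r, HasDerivAt (K k t) (K (k + 1) t r) r) ∧
    ∀ k, ∃ C, 0 ≤ C ∧ ∀ t r : ℝ, 1 ≤ t → K k t r ^ 2 ≤ C * shellWeight t r := by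
  obtain ⟨G, hG0, -, hGd, hGb⟩ := exists_pos_seq h
  have hH' : ContDiff ℝ ∞ (deriv H) := (contDiff_infty_iff_deriv.1 h.contDiff).2
  have hsym : IsConeSymbol fun t r => deriv H (angle t r) * shellWeight t r := by
    refine ⟨fun z => deriv H (π - (z.1 + z.2)), fun z => deriv H (π - (z.1 + z.2)),
      hH'.comp (by fun_prop), hH'.comp (by fun_prop), fun t r => ?_⟩
    simp only [angle, shellWeight]
    ring
  obtain ⟨W, hW0, hW, hWd⟩ := hsym.exists_seq
  have hG : ∀ k, ∃ C, 0 ≤ C ∧ ∀ t r : ℝ, 1 ≤ t → (G k t r / t) ^ 2 ≤ C * shellWeight t r := by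
    intro k
    cases k with
    | zero =>
      obtain ⟨B, hB0, hB⟩ := exists_bound_posProfile_sq h
      refine ⟨B, hB0, fun t r ht => le_trans ?_ (hB t r ht)⟩
      rw [hG0]
      have : (r * posProfile H t r / t) ^ 2 = (r / t) ^ 2 * posProfile H t r ^ 2 := by ring
      rw [this]
      gcongr
      linarith
    | succ k =>
      obtain ⟨B, hB0, hB⟩ := hGb k
      refine ⟨B, hB0, fun t r ht => le_trans ?_ (hB t r ht)⟩
      rw [div_pow]
      exact div_le_self (sq_nonneg _) (by nlinarith)
  refine ⟨fun k t r => -(G k t r / t) - (r / t * W k t r + k / t * W (k - 1) t r),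
    fun t r => ?_, fun k t r => ?_, fun k => ?_⟩
  · simp only [hG0, hW0, velProfile, posProfile, shellWeight, CharP.cast_eq_zero]
    ring
  · exact ((hGd k t r).div_const t).fun_neg.fun_sub (hasDerivAt_mul_seq hWd k t r)
  · obtain ⟨A, hA0, hA⟩ := hG k
    obtain ⟨B, hB0, hB⟩ := (hW k).exists_bound_sq (hW (k - 1)) k
    refine ⟨2 * A + 2 * B, by positivity, fun t r ht => ?_⟩
    have h1 := hA t r ht
    have h2 := hB t r ht
    nlinarith [sq_nonneg (G k t r / t - (r / t * W k t r + k / t * W (k - 1) t r))]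

/-- The majorant of `r ∂ₜu` has an integral that does not depend on `t`, see
`integral_indicator_add_shellWeight`. -/
lemma exists_bound_mul_velProfile (h : IsProfile X Y ε U H) : ∃ C, 0 ≤ C ∧ ∀ t r : ℝ, 1 ≤ t →
    |r * velProfile H t r| ≤ C * ((Ioo (-t) t).indicator (fun _ => t⁻¹) r + shellWeight t r) ∧
    |r * (r * velProfile H t r)| ≤
      C * t * ((Ioo (-t) t).indicator (fun _ => t⁻¹) r + shellWeight t r) := by
  obtain ⟨C, hC0, hC⟩ := exists_bound_velProfile h
  refine ⟨C, hC0, fun t r ht => ?_⟩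
  have ht0 : 0 < t := by linarith
  have h1 := hC t |r| ht (abs_nonneg r)
  rw [velProfile_abs] at h1
  have hr := abs_nonneg r
  have hind : (Ioo (-t) t).indicator (fun _ => t⁻¹) r = if |r| < t then t⁻¹ else 0 := by
    simp only [indicator, mem_Ioo, abs_lt]
  have hp : 0 < 1 + (t + |r|) ^ 2 := by positivity
  have hq : 0 < 1 + (t - |r|) ^ 2 := by positivity
  have hs := inv_le_shellWeight t r
  have e1 : |r| * (t / ((1 + (t + |r|) ^ 2) * (1 + (t - |r|) ^ 2))) ≤ shellWeight t r := by
    refine le_trans ?_ hs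
    rw [← mul_div_assoc, inv_eq_one_div, div_le_div_iff₀ (by positivity) hq]
    nlinarith [mul_le_mul_of_nonneg_right (show |r| * t ≤ 1 + (t + |r|) ^ 2 by nlinarith) hq.le]
  have e2 : |r| * |r| * (t / ((1 + (t + |r|) ^ 2) * (1 + (t - |r|) ^ 2))) ≤ t * shellWeight t r := by
    refine le_trans ?_ (mul_le_mul_of_nonneg_left hs ht0.le)
    rw [← mul_div_assoc, ← div_eq_mul_inv, div_le_div_iff₀ (by positivity) hq]
    nlinarith [mul_le_mul_of_nonneg_right (show |r| * |r| ≤ 1 + (t + |r|) ^ 2 by nlinarith)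
      (mul_pos ht0 hq).le]
  have e3 : |r| * (if |r| < t then (t ^ 2)⁻¹ else 0) ≤ if |r| < t then t⁻¹ else 0 := by
    split_ifs with hlt
    · rw [← div_eq_mul_inv, inv_eq_one_div, div_le_div_iff₀ (by positivity) ht0]
      nlinarith
    · simp
  have e4 : |r| * |r| * (if |r| < t then (t ^ 2)⁻¹ else 0) ≤ t * if |r| < t then t⁻¹ else 0 := by
    split_ifs with hlt
    · rw [mul_inv_cancel₀ ht0.ne', ← div_eq_mul_inv, div_le_one (by positivity)]
      nlinarith
    · simp
  rw [hind]
  constructor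
  · rw [abs_mul]
    nlinarith [mul_le_mul_of_nonneg_left h1 hr, mul_le_mul_of_nonneg_left (add_le_add e3 e1) hC0]
  · rw [abs_mul, abs_mul, ← mul_assoc]
    nlinarith [mul_le_mul_of_nonneg_left h1 (mul_nonneg hr hr),
      mul_le_mul_of_nonneg_left (add_le_add e4 e2) hC0]

/-- In a window at a fixed distance from the light cone, the first derivatives of `r u` do not
decay. -/
lemma exists_window (h : IsProfile X Y ε U H) : ∃ c η q T : ℝ, 0 < c ∧ 0 < η ∧ 1 ≤ T ∧
    ∀ t r : ℝ, T ≤ t → r ∈ Icc (t - q - η) (t - q + η) →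
      t / 2 ≤ r ∧ c ≤ t * |velProfile H t r| ∧
      c ≤ |r / t * (deriv H (angle t r) * (-(1 + (t + r) ^ 2)⁻¹ + (1 + (t - r) ^ 2)⁻¹)) +
        H (angle t r) / t| := by
  obtain ⟨θ, hθ, hne⟩ := exists_deriv_ne_zero h
  obtain ⟨A, hA0, hA⟩ := exists_bound_H h
  set d := |deriv H θ| / 2 with hd
  have hd0 : 0 < d := by have := abs_pos.2 hne; positivity
  have hcont : Continuous fun θ => |deriv H θ| := (h.contDiff.continuous_deriv (by simp)).abs
  obtain ⟨δ, hδ0, hδ⟩ := Metric.eventually_nhds_iff.1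
    (hcont.continuousAt.eventually (lt_mem_nhds (show d < |deriv H θ| by linarith)))
  -- On the line `t - r = q` the angle tends to `θ` as `t → ∞`.
  set q := tan (π / 2 - θ) with hq
  have harc : arctan q = π / 2 - θ := arctan_tan (by linarith [hθ.2]) (by linarith [hθ.1])
  obtain ⟨η', hη0', hη'⟩ := Metric.continuousAt_iff.1 (continuous_arctan.continuousAt (x := q))
    (δ / 2) (by positivity)
  set η := η' / 2 with hη
  have hη0 : 0 < η := by positivity
  have hlim : ∀ᶠ x in atTop, π / 2 - δ / 2 < arctan x :=
    (tendsto_arctan_atTop.mono_right nhdsWithin_le_nhds).eventually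
      (lt_mem_nhds (by linarith : π / 2 - δ / 2 < π / 2))
  obtain ⟨T₀, hT₀⟩ := eventually_atTop.1 hlim
  set b := (1 + (|q| + η) ^ 2)⁻¹ with hb
  have hb0 : 0 < b := by positivity
  set c := d * b / 8 with hc
  have hc0 : 0 < c := by positivity
  -- The four thresholds for `t` make `arctan (t + r)` close to `π / 2`, keep the window in `r ≥ t / 2`, and
  -- make the terms with `H / t` and with `(1 + (t + r) ^ 2)⁻¹` small.
  refine ⟨c, η, q, max (max 1 T₀) (max (2 * (|q| + η)) (max (A / c) (2 / b))), hc0, hη0,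
    (le_max_left _ _).trans (le_max_left _ _), fun t r hT hr => ?_⟩
  simp only [max_le_iff] at hT
  obtain ⟨⟨ht1, hT0⟩, hT2, hTA, hTb⟩ := hT
  have ht0 : 0 < t := by linarith
  have hqr : |t - r| ≤ |q| + η := by
    have := abs_le.1 (le_refl |q|)
    rw [abs_le]; constructor <;> linarith [hr.1, hr.2]
  have hr2 : t / 2 ≤ r := by linarith [(abs_le.1 hqr).2]
  have hmem : angle t r ∈ Icc 0 π := ⟨(angle_pos t r).le, (angle_lt_pi ht0 r).le⟩
  have hderiv : d < |deriv H (angle t r)| := by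
    refine hδ ?_
    have h1 := hT₀ (t + r) (by linarith)
    have h2 := arctan_lt_pi_div_two (t + r)
    have h3 : dist (t - r) q < η' := by
      rw [Real.dist_eq, abs_lt]; constructor <;> linarith [hr.1, hr.2]
    have h4 := hη' h3
    rw [Real.dist_eq, harc, abs_lt] at h4
    rw [Real.dist_eq, angle, abs_lt]
    constructor <;> linarith
  have hH := (hA _ hmem).1
  have hbq : b ≤ (1 + (t - r) ^ 2)⁻¹ := by
    rw [hb, ← sq_abs (t - r)]
    gcongr
  have hbp : (1 + (t + r) ^ 2)⁻¹ ≤ b / 2 := by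
    have h1 : 2 / b ≤ 1 + (t + r) ^ 2 := hTb.trans (by nlinarith)
    calc (1 + (t + r) ^ 2)⁻¹ ≤ (2 / b)⁻¹ := by gcongr
      _ = b / 2 := by rw [inv_div]
  have hp0 : 0 ≤ (1 + (t + r) ^ 2)⁻¹ := by positivity
  have hHt : |H (angle t r) / t| ≤ c := by
    rw [abs_div, abs_of_pos ht0, div_le_iff₀ ht0]
    rw [div_le_iff₀ hc0] at hTA
    linarith
  refine ⟨hr2, ?_, ?_⟩
  · have e : t * |velProfile H t r| = |H (angle t r) / t +
        deriv H (angle t r) * ((1 + (t + r) ^ 2)⁻¹ + (1 + (t - r) ^ 2)⁻¹)| := by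
      rw [velProfile, abs_div, abs_neg, abs_of_pos ht0]
      field_simp
    rw [e]
    have h1 : d * b ≤ |deriv H (angle t r) * ((1 + (t + r) ^ 2)⁻¹ + (1 + (t - r) ^ 2)⁻¹)| := by
      rw [abs_mul, abs_of_nonneg (a := (1 + (t + r) ^ 2)⁻¹ + _) (by positivity)]
      gcongr
      linarith
    have h2 := abs_sub_abs_le_abs_add (deriv H (angle t r) *
      ((1 + (t + r) ^ 2)⁻¹ + (1 + (t - r) ^ 2)⁻¹)) (H (angle t r) / t)
    rw [add_comm]
    linarith
  · have h1 : d * b / 4 ≤ |r / t * (deriv H (angle t r) *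
        (-(1 + (t + r) ^ 2)⁻¹ + (1 + (t - r) ^ 2)⁻¹))| := by
      have h3 : (1 : ℝ) / 2 ≤ r / t := by rw [div_le_div_iff₀ (by norm_num) ht0]; linarith
      have h4 : b / 2 ≤ -(1 + (t + r) ^ 2)⁻¹ + (1 + (t - r) ^ 2)⁻¹ := by linarith
      rw [abs_mul, abs_mul, abs_of_nonneg (a := r / t) (by linarith),
        abs_of_nonneg (a := -(1 + (t + r) ^ 2)⁻¹ + _) (by linarith)]
      calc d * b / 4 = 1 / 2 * (d * (b / 2)) := by ring
        _ ≤ _ := by gcongr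
    have h2 := abs_sub_abs_le_abs_add (r / t * (deriv H (angle t r) *
        (-(1 + (t + r) ^ 2)⁻¹ + (1 + (t - r) ^ 2)⁻¹))) (H (angle t r) / t)
    linarith

end

/-! ### Lebesgue norms -/

lemma eLpNorm_radial {φ : ℝ → ℝ} (hφ : Measurable φ) {p : ℝ} (hp : 0 < p) :
    eLpNorm (fun x : E3 => φ ‖x‖) (ENNReal.ofReal p) volume =
      (ENNReal.ofReal (4 * π) * ∫⁻ r in Ioi 0, ENNReal.ofReal (r ^ 2 * |φ r| ^ p)) ^ (1 / p) := by
  rw [eLpNorm_eq_lintegral_rpow_enorm_toReal (by simpa using hp) ENNReal.ofReal_ne_top,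
    ENNReal.toReal_ofReal hp.le, lintegral_fun_norm (G := fun r => ‖φ r‖ₑ ^ p) (by fun_prop)]
  congr 2
  refine setLIntegral_congr_fun measurableSet_Ioi fun r hr => ?_
  rw [ENNReal.ofReal_mul (by positivity), ← ofReal_norm, Real.norm_eq_abs,
    ENNReal.ofReal_rpow_of_nonneg (abs_nonneg _) hp.le]

/-- A criterion for the decay rate of Lebesgue norms of radial functions that are concentrated near the
light cone, with `a > 1` as the rate of concentration. -/
lemma exists_eLpNorm_radial_le {p : ℝ} (hp : 0 < p) {a : ℝ} (ha : 1 < a) (C : ℝ) : ∃ C', 0 ≤ C' ∧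
    ∀ (t : ℝ) (φ : ℝ → ℝ), 1 ≤ t → Measurable φ →
      (∀ r, 0 < r → r ^ 2 * |φ r| ^ p ≤ C * t ^ (2 - p) * (1 + (t - r) ^ 2) ^ (-a / 2)) →
      eLpNorm (fun x : E3 => φ ‖x‖) (ENNReal.ofReal p) volume ≤
        ENNReal.ofReal (C' * t ^ (2 / p - 1)) := by
  have hJ : Integrable fun q : ℝ => (1 + q ^ 2) ^ (-a / 2) := by
    have := integrable_rpow_neg_one_add_norm_sq (E := ℝ) (μ := volume) (r := a) (by simpa using ha)
    simpa using this
  set J := ∫ q : ℝ, (1 + q ^ 2) ^ (-a / 2) with hJdef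
  have hJ0 : 0 ≤ J := integral_nonneg fun q => by positivity
  refine ⟨(4 * π * (|C| * J)) ^ (1 / p), by positivity, fun t φ ht hφ hb => ?_⟩
  have ht0 : 0 < t := by linarith
  rw [eLpNorm_radial hφ hp]
  have h1 : ∫⁻ r in Ioi (0 : ℝ), ENNReal.ofReal (r ^ 2 * |φ r| ^ p) ≤
      ENNReal.ofReal (|C| * t ^ (2 - p) * J) := by
    have hJt : ∫ r : ℝ, (1 + (t - r) ^ 2) ^ (-a / 2) = J :=
      integral_sub_left_eq_self (fun q : ℝ => (1 + q ^ 2) ^ (-a / 2)) volume t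
    rw [← hJt, ← integral_const_mul, ofReal_integral_eq_lintegral_ofReal
      ((hJ.comp_sub_left t).const_mul _) (.of_forall fun r => by positivity)]
    refine le_trans ?_ (setLIntegral_le_lintegral (Ioi 0) _)
    refine setLIntegral_mono' measurableSet_Ioi fun r hr => ENNReal.ofReal_le_ofReal ?_
    refine (hb r hr).trans ?_
    gcongr
    exact le_abs_self C
  calc _ ≤ (ENNReal.ofReal (4 * π) * ENNReal.ofReal (|C| * t ^ (2 - p) * J)) ^ (1 / p) := by gcongr
    _ = _ := by
      rw [← ENNReal.ofReal_mul (by positivity), ENNReal.ofReal_rpow_of_nonneg (by positivity)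
        (by positivity)]
      congr 1
      rw [show 4 * π * (|C| * t ^ (2 - p) * J) = (4 * π * (|C| * J)) * t ^ (2 - p) by ring,
        mul_rpow (by positivity) (by positivity), ← rpow_mul ht0.le]
      congr 2
      field_simp

section

variable {X Y ε : ℝ} {U H : ℝ → ℝ}

lemma measurable_posProfile (h : IsProfile X Y ε U H) (t : ℝ) : Measurable (posProfile H t) := by
  unfold posProfile angle
  have := h.contDiff.continuous
  fun_prop

lemma measurable_velProfile (h : IsProfile X Y ε U H) (t : ℝ) : Measurable (velProfile H t) := by
  unfold velProfile angle
  have h1 : Measurable H := h.contDiff.continuous.measurable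
  have h2 : Measurable (deriv H) := (h.contDiff.continuous_deriv (by simp)).measurable
  fun_prop

lemma measurable_boxProfile (H : ℝ → ℝ) (t : ℝ) : Measurable (boxProfile H t) := by
  unfold boxProfile
  exact Measurable.ite (measurableSet_lt (by fun_prop) (by fun_prop)) (by fun_prop) (by fun_prop)

/-- The decay at distance `|t - r|` from the light cone is integrable, uniformly in time on the scale
`t ^ (2 - p)`. For `p < 2` the factor `(t + r) ^ (2 - p)` uses up a part of it, so that the rate is
`a = 2 * p - 2` instead of `p`; this exceeds `1` exactly for `p > 3 / 2`. -/
lemma exists_weight_bound {p : ℝ} (hp : 3 / 2 < p) : ∃ C a : ℝ, 1 < a ∧ ∀ t r : ℝ, 1 ≤ t → 0 < r →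
    r ^ 2 * (1 / (√(1 + (t + r) ^ 2) * √(1 + (t - r) ^ 2))) ^ p ≤
      C * t ^ (2 - p) * (1 + (t - r) ^ 2) ^ (-a / 2) := by
  have key : ∀ t r : ℝ, 1 ≤ t → 0 < r →
    r ^ 2 * (1 / (√(1 + (t + r) ^ 2) * √(1 + (t - r) ^ 2))) ^ p ≤
      (t + r) ^ (2 - p) * (1 + (t - r) ^ 2) ^ (-p / 2) := by
    intro t r ht hr
    have hq : 0 < 1 + (t - r) ^ 2 := by positivity
    have h1 : 1 / (√(1 + (t + r) ^ 2) * √(1 + (t - r) ^ 2)) ≤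
        (t + r)⁻¹ * (1 + (t - r) ^ 2) ^ (-1 / 2 : ℝ) := by
      have e : (1 + (t - r) ^ 2) ^ (-1 / 2 : ℝ) = (√(1 + (t - r) ^ 2))⁻¹ := by
        rw [sqrt_eq_rpow, ← rpow_neg hq.le]; norm_num
      rw [e, one_div, mul_inv]
      gcongr
      exact le_sqrt_of_sq_le (by linarith)
    calc r ^ 2 * (1 / (√(1 + (t + r) ^ 2) * √(1 + (t - r) ^ 2))) ^ p
        ≤ (t + r) ^ 2 * ((t + r)⁻¹ * (1 + (t - r) ^ 2) ^ (-1 / 2 : ℝ)) ^ p := by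
          gcongr
          linarith
      _ = _ := by
          rw [mul_rpow (by positivity) (by positivity), ← rpow_mul hq.le, inv_rpow (by positivity),
            ← rpow_neg (by positivity), ← mul_assoc, ← rpow_natCast, ← rpow_add (by positivity)]
          congr 2
          ring
  rcases le_or_gt 2 p with h2 | h2
  · refine ⟨1, p, by linarith, fun t r ht hr => (key t r ht hr).trans ?_⟩
    rw [one_mul]
    gcongr ?_ * _
    exact rpow_le_rpow_of_nonpos (by linarith) (by linarith) (by linarith)
  · refine ⟨3 ^ (2 - p), 2 * p - 2, by linarith, fun t r ht hr => (key t r ht hr).trans ?_⟩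
    have hq : 0 < 1 + (t - r) ^ 2 := by positivity
    have h3 : t + r ≤ 3 * t * (1 + (t - r) ^ 2) ^ (1 / 2 : ℝ) := by
      rw [← sqrt_eq_rpow]
      have h4 : |t - r| ≤ √(1 + (t - r) ^ 2) := abs_le_sqrt (by linarith)
      have h5 : 1 ≤ √(1 + (t - r) ^ 2) := one_le_sqrt.2 (by nlinarith [sq_nonneg (t - r)])
      nlinarith [neg_abs_le (t - r)]
    calc _ ≤ (3 * t * (1 + (t - r) ^ 2) ^ (1 / 2 : ℝ)) ^ (2 - p) * (1 + (t - r) ^ 2) ^ (-p / 2) := by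
          gcongr
      _ = _ := by
          rw [mul_rpow (by positivity) (by positivity), mul_rpow (by positivity) (by linarith),
            ← rpow_mul hq.le, mul_assoc, ← rpow_add hq]
          congr 2
          ring

/-- The solution differs from `H 0 / t` times the characteristic function of a ball by a function of the
size of `1 / t` on a shell of fixed width. -/
lemma exists_eLpNorm_sub_box_le (h : IsProfile X Y ε U H) {p : ℝ} (hp : 3 / 2 < p) :
    ∃ C, 0 ≤ C ∧ ∀ t : ℝ, 1 ≤ t →
      eLpNorm (fun x : E3 => posProfile H t ‖x‖ - boxProfile H t ‖x‖) (ENNReal.ofReal p) volume ≤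
        ENNReal.ofReal (C * t ^ (2 / p - 1)) := by
  obtain ⟨A, hA0, hA⟩ := exists_bound_sub_box h
  obtain ⟨B, a, ha, hB⟩ := exists_weight_bound hp
  obtain ⟨C, hC0, hC⟩ := exists_eLpNorm_radial_le (by linarith : 0 < p) ha ((2 * A) ^ p * B)
  refine ⟨C, hC0, fun t ht => hC t (fun r => posProfile H t r - boxProfile H t r) ht
    ((measurable_posProfile h t).sub (measurable_boxProfile H t)) fun r hr => ?_⟩
  have ht0 : 0 < t := by linarith
  have h1 : |posProfile H t r - boxProfile H t r| ≤
      2 * A * (1 / (√(1 + (t + r) ^ 2) * √(1 + (t - r) ^ 2))) := by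
    have h2 := hA t r ht hr.le
    have h3 : posProfile H t r - boxProfile H t r =
        (H (angle t r) - if r < t then H 0 else 0) / t := by
      rw [posProfile, boxProfile, abs_of_pos hr]
      split_ifs <;> ring
    rw [h3, abs_div, abs_of_pos ht0, div_le_iff₀ ht0]
    refine h2.trans (le_of_eq ?_)
    rw [sin_angle]
    ring
  calc r ^ 2 * |posProfile H t r - boxProfile H t r| ^ p
      ≤ r ^ 2 * (2 * A * (1 / (√(1 + (t + r) ^ 2) * √(1 + (t - r) ^ 2)))) ^ p := by gcongr
    _ = (2 * A) ^ p * (r ^ 2 * (1 / (√(1 + (t + r) ^ 2) * √(1 + (t - r) ^ 2))) ^ p) := by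
        rw [mul_rpow (by positivity) (by positivity)]; ring
    _ ≤ (2 * A) ^ p * (B * t ^ (2 - p) * (1 + (t - r) ^ 2) ^ (-a / 2)) :=
        mul_le_mul_of_nonneg_left (hB t r ht hr) (by positivity)
    _ = _ := by ring

lemma boxProfile_norm (t : ℝ) : (fun x : E3 => boxProfile H t ‖x‖) =
    (Metric.ball (0 : E3) t).indicator fun _ => H 0 / t := by
  ext x
  simp [boxProfile, indicator]

lemma eLpNorm_ball_const {p : ℝ} (hp : 0 < p) {t : ℝ} (ht : 0 < t) (c : ℝ) :
    eLpNorm ((Metric.ball (0 : E3) t).indicator fun _ => c) (ENNReal.ofReal p) volume =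
      ENNReal.ofReal (|c| * (4 * π / 3 * t ^ 3) ^ (1 / p)) := by
  rw [eLpNorm_indicator_const Metric.isOpen_ball.measurableSet
    (by simpa using hp) ENNReal.ofReal_ne_top, ENNReal.toReal_ofReal hp.le,
    EuclideanSpace.volume_ball_fin_three, ENNReal.ofReal_mul (abs_nonneg c), ← Real.norm_eq_abs,
    ofReal_norm, ← ENNReal.ofReal_rpow_of_nonneg (by positivity) (by positivity),
    ← ENNReal.ofReal_pow ht.le, ← ENNReal.ofReal_mul (by positivity)]
  congr 3
  ring

lemma abs_H_zero (h : IsProfile X Y ε U H) : |H 0| = √2 := by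
  rw [← h.sq_zero, sqrt_sq_eq_abs]

lemma boxProfile_lebesgueNorm (h : IsProfile X Y ε U H) {p : ℝ} (hp : 0 < p) {t : ℝ} (ht : 0 < t) :
    1 / (4 * π) ^ (1 / p) * lebesgueNorm p univ (fun x : E3 => boxProfile H t ‖x‖) =
      √2 / 3 ^ (1 / p) * t ^ (3 / p - 1) := by
  rw [lebesgueNorm, Measure.restrict_univ, boxProfile_norm, eLpNorm_ball_const hp ht,
    ENNReal.toReal_ofReal (by positivity), abs_div, abs_H_zero h, abs_of_pos ht,
    mul_rpow (x := 4 * π / 3) (by positivity) (by positivity),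
    div_rpow (by positivity) (by positivity), rpow_sub ht, rpow_one, ← rpow_natCast, ← rpow_mul ht.le]
  have : (4 * π) ^ (1 / p) ≠ 0 := by positivity
  have : (3 : ℝ) ^ (1 / p) ≠ 0 := by positivity
  have e : ((3 : ℕ) : ℝ) * (1 / p) = 3 / p := by push_cast; ring
  rw [e]
  field_simp

lemma abs_toReal_eLpNorm_sub_le {α E : Type*} [MeasurableSpace α] [NormedAddCommGroup E]
    {μ : Measure α} {f g : α → E} {p : ℝ≥0∞} (hp : 1 ≤ p) (hf : MemLp f p μ) (hg : MemLp g p μ) :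
    |(eLpNorm f p μ).toReal - (eLpNorm g p μ).toReal| ≤ (eLpNorm (f - g) p μ).toReal := by
  have key : ∀ f g : α → E, MemLp f p μ → MemLp g p μ →
      (eLpNorm f p μ).toReal ≤ (eLpNorm g p μ).toReal + (eLpNorm (f - g) p μ).toReal := by
    intro f g hf hg
    rw [← ENNReal.toReal_add hg.2.ne (hf.sub hg).2.ne]
    refine ENNReal.toReal_mono (ENNReal.add_ne_top.2 ⟨hg.2.ne, (hf.sub hg).2.ne⟩) ?_
    have := eLpNorm_add_le (μ := μ) hg.1 (hf.sub hg).1 hp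
    rwa [add_sub_cancel] at this
  have h1 := key f g hf hg
  have h2 := key g f hg hf
  rw [eLpNorm_sub_comm] at h2
  rw [abs_le]
  constructor <;> linarith

lemma memLp_boxProfile {p : ℝ} (hp : 0 < p) {t : ℝ} (ht : 0 < t) :
    MemLp (fun x : E3 => boxProfile H t ‖x‖) (ENNReal.ofReal p) volume := by
  refine ⟨((measurable_boxProfile H t).comp measurable_norm).aestronglyMeasurable, ?_⟩
  rw [boxProfile_norm, eLpNorm_ball_const hp ht]
  exact ENNReal.ofReal_lt_top

lemma memLp_sub_boxProfile (h : IsProfile X Y ε U H) {p : ℝ} (hp : 3 / 2 < p) {t : ℝ} (ht : 1 ≤ t) :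
    MemLp (fun x : E3 => posProfile H t ‖x‖ - boxProfile H t ‖x‖) (ENNReal.ofReal p) volume := by
  obtain ⟨C, -, hC⟩ := exists_eLpNorm_sub_box_le h hp
  exact ⟨(((measurable_posProfile h t).comp measurable_norm).sub
    ((measurable_boxProfile H t).comp measurable_norm)).aestronglyMeasurable,
    (hC t ht).trans_lt ENNReal.ofReal_lt_top⟩

lemma memLp_posProfile (h : IsProfile X Y ε U H) {p : ℝ} (hp : 3 / 2 < p) {t : ℝ} (ht : 1 ≤ t) :
    MemLp (fun x : E3 => posProfile H t ‖x‖) (ENNReal.ofReal p) volume := by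
  refine ((memLp_sub_boxProfile h hp ht).add
    (memLp_boxProfile (H := H) (by linarith : 0 < p) (by linarith : 0 < t))).ae_eq (.of_forall fun x => ?_)
  simp

lemma isBigO_lebesgueNorm_pos (h : IsProfile X Y ε U H) {p : ℝ} (hp : 3 / 2 < p) :
    (fun t : ℝ => 1 / (4 * π) ^ (1 / p) * lebesgueNorm p univ (fun x => posProfile H t ‖x‖)
      - √2 / 3 ^ (1 / p) * t ^ (3 / p - 1)) =O[atTop] (fun t : ℝ => t ^ (2 / p - 1)) := by
  obtain ⟨C, hC0, hC⟩ := exists_eLpNorm_sub_box_le h hp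
  refine IsBigO.of_bound (1 / (4 * π) ^ (1 / p) * C) ?_
  filter_upwards [eventually_ge_atTop 1] with t ht
  have ht0 : 0 < t := by linarith
  rw [← boxProfile_lebesgueNorm h (by linarith : 0 < p) ht0, ← mul_sub, norm_mul,
    Real.norm_of_nonneg (show 0 ≤ 1 / (4 * π) ^ (1 / p) by positivity),
    Real.norm_of_nonneg (show 0 ≤ t ^ (2 / p - 1) by positivity), mul_assoc]
  gcongr
  have h1 := abs_toReal_eLpNorm_sub_le (by rw [ENNReal.one_le_ofReal]; linarith)
    (memLp_posProfile h hp ht) (memLp_boxProfile (H := H) (by linarith : 0 < p) ht0)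
  rw [lebesgueNorm, lebesgueNorm, Measure.restrict_univ, Real.norm_eq_abs]
  refine h1.trans ?_
  rw [← ENNReal.toReal_ofReal (r := C * t ^ (2 / p - 1)) (by positivity)]
  exact ENNReal.toReal_mono ENNReal.ofReal_ne_top (hC t ht)

/-- The weight `(1 + (t - r) ^ 2)⁻¹` is bounded below in the shell `t - M < r < t`, which therefore falls
under the criterion `exists_eLpNorm_radial_le`. -/
lemma exists_eLpNorm_box_shell_le (h : IsProfile X Y ε U H) {p : ℝ} (hp : 0 < p) (M : ℝ) :
    ∃ C, 0 ≤ C ∧ ∀ t : ℝ, 1 ≤ t →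
      eLpNorm (fun x : E3 => boxProfile H t ‖x‖) (ENNReal.ofReal p)
        (volume.restrict {x | t - M < ‖x‖}) ≤ ENNReal.ofReal (C * t ^ (2 / p - 1)) := by
  obtain ⟨C, hC0, hC⟩ := exists_eLpNorm_radial_le hp (by norm_num : (1 : ℝ) < 2) (√2 ^ p * (1 + M ^ 2))
  refine ⟨C, hC0, fun t ht => ?_⟩
  have ht0 : 0 < t := by linarith
  have hms : MeasurableSet {x : E3 | t - M < ‖x‖} := measurableSet_lt (by fun_prop) (by fun_prop)
  rw [← eLpNorm_indicator_eq_eLpNorm_restrict hms]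
  have e : {x : E3 | t - M < ‖x‖}.indicator (fun x : E3 => boxProfile H t ‖x‖) =
      fun x : E3 => (Ioi (t - M)).indicator (boxProfile H t) ‖x‖ := by
    ext x; simp [indicator]
  rw [e]
  refine hC t _ ht ((measurable_boxProfile H t).indicator measurableSet_Ioi) fun r hr => ?_
  have hq : 0 < 1 + (t - r) ^ 2 := by positivity
  by_cases hin : t - M < r ∧ r < t
  · have e1 : |(Ioi (t - M)).indicator (boxProfile H t) r| = √2 / t := by
      rw [indicator_of_mem (mem_Ioi.2 hin.1), boxProfile, abs_of_pos hr, if_pos hin.2, abs_div, abs_H_zero h,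
        abs_of_pos ht0]
    rw [e1, div_rpow (by positivity) ht0.le]
    have h2 : (1 + M ^ 2)⁻¹ ≤ (1 + (t - r) ^ 2) ^ (-2 / 2 : ℝ) := by
      rw [show (-2 / 2 : ℝ) = -1 by norm_num, rpow_neg_one]
      gcongr
      · linarith
      · linarith [hin.1]
    calc r ^ 2 * (√2 ^ p / t ^ p) ≤ t ^ 2 * (√2 ^ p / t ^ p) := by gcongr; exact hin.2.le
      _ = √2 ^ p * (1 + M ^ 2) * t ^ (2 - p) * (1 + M ^ 2)⁻¹ := by
        rw [rpow_sub ht0]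
        have : t ^ p ≠ 0 := by positivity
        field_simp
        norm_num
      _ ≤ _ := by gcongr
  · have e1 : (Ioi (t - M)).indicator (boxProfile H t) r = 0 := by
      rw [indicator, boxProfile, abs_of_pos hr]
      split_ifs with h1 h2
      · exact absurd ⟨h1, h2⟩ hin
      · rfl
      · rfl
    rw [e1, abs_zero, zero_rpow hp.ne', mul_zero]
    positivity

lemma isBigO_lebesgueNorm_pos_shell (h : IsProfile X Y ε U H) {p : ℝ} (hp : 3 / 2 < p) (M : ℝ) :
    (fun t : ℝ => lebesgueNorm p {x : E3 | t - M < ‖x‖} (fun x => posProfile H t ‖x‖))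
      =O[atTop] (fun t : ℝ => t ^ (2 / p - 1)) := by
  obtain ⟨C, hC0, hC⟩ := exists_eLpNorm_sub_box_le h hp
  obtain ⟨D, hD0, hD⟩ := exists_eLpNorm_box_shell_le h (by linarith : 0 < p) M
  refine IsBigO.of_bound (C + D) ?_
  filter_upwards [eventually_ge_atTop 1] with t ht
  have ht0 : 0 < t := by linarith
  rw [lebesgueNorm, Real.norm_of_nonneg ENNReal.toReal_nonneg, Real.norm_of_nonneg (by positivity),
    ← ENNReal.toReal_ofReal (r := (C + D) * t ^ (2 / p - 1)) (by positivity)]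
  refine ENNReal.toReal_mono ENNReal.ofReal_ne_top ?_
  rw [add_mul, ENNReal.ofReal_add (by positivity) (by positivity)]
  have e : (fun x : E3 => posProfile H t ‖x‖) = (fun x : E3 => posProfile H t ‖x‖ - boxProfile H t ‖x‖)
      + fun x : E3 => boxProfile H t ‖x‖ := by ext x; simp
  rw [e]
  refine (eLpNorm_add_le ?_ ?_ (by rw [ENNReal.one_le_ofReal]; linarith)).trans
    (add_le_add ((eLpNorm_mono_measure _ Measure.restrict_le_self).trans (hC t ht)) (hD t ht))
  · exact (memLp_sub_boxProfile h hp ht).1.restrict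
  · exact (memLp_boxProfile (H := H) (by linarith : 0 < p) ht0).1.restrict

lemma exists_eLpNorm_vel_le (h : IsProfile X Y ε U H) {p : ℝ} (hp : 1 ≤ p) :
    ∃ C, 0 ≤ C ∧ ∀ t : ℝ, 1 ≤ t →
      eLpNorm (fun x : E3 => velProfile H t ‖x‖) (ENNReal.ofReal p) volume ≤
        ENNReal.ofReal (C * t ^ (2 / p - 1)) := by
  have hp0 : 0 < p := by linarith
  obtain ⟨A, hA0, hA⟩ := exists_bound_velProfile h
  obtain ⟨C, hC0, hC⟩ := exists_eLpNorm_radial_le hp0 (by norm_num : (1 : ℝ) < 2) 1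
  refine ⟨A * ((4 * π / 3) ^ (1 / p) + C), by positivity, fun t ht => ?_⟩
  have ht0 : 0 < t := by linarith
  set φ : ℝ → ℝ := fun r => t / ((1 + (t + r) ^ 2) * (1 + (t - r) ^ 2)) with hφdef
  have hφm : Measurable φ := by fun_prop
  have h1 : eLpNorm (fun x : E3 => φ ‖x‖) (ENNReal.ofReal p) volume ≤
      ENNReal.ofReal (C * t ^ (2 / p - 1)) := by
    refine hC t φ ht hφm fun r hr => ?_
    have hq : 1 ≤ 1 + (t - r) ^ 2 := by nlinarith [sq_nonneg (t - r)]
    rw [one_mul, show (-2 / 2 : ℝ) = -1 by norm_num]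
    have e1 : |φ r| ≤ t * ((t + r) ^ (-2 : ℝ) * (1 + (t - r) ^ 2)⁻¹) := by
      rw [abs_of_pos (by positivity), hφdef, rpow_neg (by positivity), rpow_two, ← mul_inv,
        ← div_eq_mul_inv]
      simp only
      gcongr
      linarith
    calc r ^ 2 * |φ r| ^ p ≤ (t + r) ^ 2 * (t * ((t + r) ^ (-2 : ℝ) * (1 + (t - r) ^ 2)⁻¹)) ^ p := by
          gcongr; linarith
      _ = t ^ p * (t + r) ^ (2 - 2 * p) * (1 + (t - r) ^ 2) ^ (-p) := by
          rw [mul_rpow ht0.le (by positivity), mul_rpow (by positivity) (by positivity),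
            ← rpow_mul (by positivity), inv_rpow (by positivity), ← rpow_neg (by positivity),
            show 2 - 2 * p = (2 : ℕ) + -2 * p by push_cast; ring, rpow_add (by positivity),
            rpow_natCast]
          ring
      _ ≤ t ^ p * t ^ (2 - 2 * p) * (1 + (t - r) ^ 2) ^ (-1 : ℝ) := by
          gcongr ?_ * ?_ * ?_
          · exact rpow_le_rpow_of_nonpos ht0 (by linarith) (by linarith)
          · exact rpow_le_rpow_of_exponent_le hq (by linarith)
      _ = _ := by rw [← rpow_add ht0]; congr 2; ring
  have h2 : eLpNorm ((Metric.ball (0 : E3) t).indicator fun _ => (t ^ 2)⁻¹) (ENNReal.ofReal p)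
      volume ≤ ENNReal.ofReal ((4 * π / 3) ^ (1 / p) * t ^ (2 / p - 1)) := by
    rw [eLpNorm_ball_const hp0 ht0, abs_of_pos (by positivity),
      mul_rpow (by positivity) (by positivity)]
    refine ENNReal.ofReal_le_ofReal ?_
    rw [mul_left_comm]
    gcongr
    rw [← rpow_natCast t 3, ← rpow_mul ht0.le, ← rpow_natCast, ← rpow_neg ht0.le, ← rpow_add ht0]
    refine rpow_le_rpow_of_exponent_le ht ?_
    have : 1 / p ≤ 1 := by rw [div_le_one hp0]; exact hp
    have e : 2 / p = 2 * (1 / p) := by ring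
    rw [e]
    push_cast
    linarith
  have h3 : ∀ x : E3, ‖velProfile H t ‖x‖‖ ≤
      A * ‖(Metric.ball (0 : E3) t).indicator (fun _ => (t ^ 2)⁻¹) x + φ ‖x‖‖ := by
    intro x
    rw [Real.norm_eq_abs, Real.norm_eq_abs]
    refine (hA t ‖x‖ ht (norm_nonneg x)).trans ?_
    gcongr
    refine le_trans (le_of_eq ?_) (le_abs_self _)
    simp [indicator, hφdef]
  refine (eLpNorm_le_mul_eLpNorm_of_ae_le_mul (.of_forall h3) _).trans ?_
  rw [mul_assoc, ENNReal.ofReal_mul hA0, add_mul, ENNReal.ofReal_add (by positivity) (by positivity)]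
  gcongr
  refine (eLpNorm_add_le ?_ ?_ (by rwa [ENNReal.one_le_ofReal])).trans (add_le_add h2 h1)
  · exact aestronglyMeasurable_const.indicator Metric.isOpen_ball.measurableSet
  · exact (hφm.comp measurable_norm).aestronglyMeasurable

lemma memLp_velProfile (h : IsProfile X Y ε U H) {p : ℝ} (hp : 1 ≤ p) {t : ℝ} (ht : 1 ≤ t) :
    MemLp (fun x : E3 => velProfile H t ‖x‖) (ENNReal.ofReal p) volume := by
  obtain ⟨C, -, hC⟩ := exists_eLpNorm_vel_le h hp
  exact ⟨((measurable_velProfile h t).comp measurable_norm).aestronglyMeasurable,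
    (hC t ht).trans_lt ENNReal.ofReal_lt_top⟩

/-- The lower bound comes from the window of fixed width in which the velocity has size `1 / t`. -/
lemma isTheta_lebesgueNorm_vel (h : IsProfile X Y ε U H) {p : ℝ} (hp : 1 ≤ p) :
    (fun t : ℝ => lebesgueNorm p univ (fun x => velProfile H t ‖x‖))
      =Θ[atTop] (fun t : ℝ => t ^ (-1 + 2 / p)) := by
  have hp0 : 0 < p := by linarith
  obtain ⟨C, hC0, hC⟩ := exists_eLpNorm_vel_le h hp
  simp only [lebesgueNorm, Measure.restrict_univ, neg_add_eq_sub]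
  constructor
  · refine IsBigO.of_bound C ?_
    filter_upwards [eventually_ge_atTop 1] with t ht
    have ht0 : 0 < t := by linarith
    rw [Real.norm_of_nonneg ENNReal.toReal_nonneg, Real.norm_of_nonneg (by positivity),
      ← ENNReal.toReal_ofReal (r := C * t ^ (2 / p - 1)) (by positivity)]
    exact ENNReal.toReal_mono ENNReal.ofReal_ne_top (hC t ht)
  · obtain ⟨c, η, q, T, hc, hη, hT, hw⟩ := exists_window h
    set B := (4 * π * (c ^ p / 4 * (2 * η))) ^ (1 / p) with hB
    have hB0 : 0 < B := by positivity
    refine IsBigO.of_bound B⁻¹ ?_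
    filter_upwards [eventually_ge_atTop T] with t ht
    have ht1 : 1 ≤ t := hT.trans ht
    have ht0 : 0 < t := by linarith
    rw [Real.norm_of_nonneg ENNReal.toReal_nonneg, Real.norm_of_nonneg (by positivity),
      inv_mul_eq_div, le_div_iff₀ hB0, ← ENNReal.toReal_ofReal (r := t ^ (2 / p - 1) * B) (by positivity)]
    refine ENNReal.toReal_mono ((hC t ht1).trans_lt ENNReal.ofReal_lt_top).ne ?_
    rw [eLpNorm_radial (measurable_velProfile h t) hp0]
    have hsub : Icc (t - q - η) (t - q + η) ⊆ Ioi 0 := fun r hr => by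
      have := (hw t r ht hr).1
      simp only [mem_Ioi]; linarith
    have h1 : ENNReal.ofReal (t ^ (2 - p) * (c ^ p / 4) * (2 * η)) ≤
        ∫⁻ r in Ioi 0, ENNReal.ofReal (r ^ 2 * |velProfile H t r| ^ p) := by
      calc _ = ∫⁻ r in Icc (t - q - η) (t - q + η), ENNReal.ofReal (t ^ (2 - p) * (c ^ p / 4)) := by
            rw [setLIntegral_const, Real.volume_Icc, ← ENNReal.ofReal_mul (by positivity)]
            congr 2; ring
        _ ≤ ∫⁻ r in Icc (t - q - η) (t - q + η), ENNReal.ofReal (r ^ 2 * |velProfile H t r| ^ p) := by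
            refine setLIntegral_mono' measurableSet_Icc fun r hr => ENNReal.ofReal_le_ofReal ?_
            obtain ⟨h2, h3, -⟩ := hw t r ht hr
            calc t ^ (2 - p) * (c ^ p / 4) = (t / 2) ^ 2 * (c / t) ^ p := by
                  rw [div_rpow hc.le ht0.le, rpow_sub ht0, rpow_two]
                  ring
              _ ≤ r ^ 2 * |velProfile H t r| ^ p := by
                  gcongr
                  rw [div_le_iff₀ ht0]
                  linarith
        _ ≤ _ := lintegral_mono_set hsub
    calc _ = (ENNReal.ofReal (4 * π) * ENNReal.ofReal (t ^ (2 - p) * (c ^ p / 4) * (2 * η))) ^ (1 / p) := by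
          rw [← ENNReal.ofReal_mul (by positivity), ENNReal.ofReal_rpow_of_nonneg (by positivity)
            (by positivity)]
          congr 1
          rw [show 4 * π * (t ^ (2 - p) * (c ^ p / 4) * (2 * η)) =
            t ^ (2 - p) * (4 * π * (c ^ p / 4 * (2 * η))) by ring,
            mul_rpow (by positivity) (by positivity), ← rpow_mul ht0.le]
          congr 2
          field_simp
      _ ≤ _ := by gcongr

end

/-! ### Spectral densities on the line -/

/-- The transform inherits the parity of the function, with `c = 1` or `c = -1`. -/
lemma plancherel_comp_neg {f : ℝ → ℂ} (hf : MemLp f 2 (volume : Measure ℝ)) {c : ℂ}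
    (hc : ∀ x, f (-x) = c * f x) :
    (fun η => plancherel hf (-η)) =ᵐ[volume] fun η => c * plancherel hf η := by
  have hloc : LocallyIntegrable (plancherel hf) := (Lp.memLp _).locallyIntegrable (by norm_num)
  have hmem : MemLp (fun η => plancherel hf (-η)) 2 volume :=
    (Lp.memLp (𝓕 (hf.toLp f))).comp_measurePreserving (Measure.measurePreserving_neg volume)
  refine ae_eq_of_integral_contDiff_smul_eq (hmem.locallyIntegrable (by norm_num))
    ?_ fun g hg hgs => ?_
  · exact hloc.smul c
  have hgc : HasCompactSupport fun x => (g x : ℂ) := hgs.comp_left (g := fun x : ℝ => (x : ℂ)) (by simp)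
  have hgC : ContDiff ℝ ∞ fun x => (g x : ℂ) := Complex.ofRealCLM.contDiff.comp hg
  set G : SchwartzMap ℝ ℂ := hgc.toSchwartzMap hgC with hG
  have hGx : ∀ x, G x = (g x : ℂ) := fun x => rfl
  have hg2c : HasCompactSupport fun x => (g (-x) : ℂ) :=
    hgc.comp_homeomorph (Homeomorph.neg ℝ)
  have hg2C : ContDiff ℝ ∞ fun x => (g (-x) : ℂ) := hgC.comp contDiff_neg
  set G₂ : SchwartzMap ℝ ℂ := hg2c.toSchwartzMap hg2C with hG₂
  have hG2x : ∀ x, G₂ x = (g (-x) : ℂ) := fun x => rfl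
  have hF : ∀ x, (𝓕 G₂ : SchwartzMap ℝ ℂ) x = (𝓕 G : SchwartzMap ℝ ℂ) (-x) := by
    intro x
    rw [SchwartzMap.fourier_coe, SchwartzMap.fourier_coe]
    exact fourier_comp_linearIsometry (LinearIsometryEquiv.neg ℝ) (G : ℝ → ℂ) x
  have e1 := integral_fourier_mul hf G₂
  have e2 := integral_fourier_mul hf G
  simp only [hF] at e1
  rw [← integral_neg_eq_self] at e1
  simp only [neg_neg, hc] at e1
  rw [← integral_neg_eq_self (fun x => G₂ x * plancherel hf x)] at e1
  simp only [hG2x, neg_neg] at e1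
  simp only [Complex.real_smul]
  rw [← e1]
  simp only [hGx] at e2
  calc ∫ x, (𝓕 G : SchwartzMap ℝ ℂ) x * (c * f x) = c * ∫ x, (𝓕 G : SchwartzMap ℝ ℂ) x * f x := by
        rw [← integral_const_mul]
        exact integral_congr_ae (.of_forall fun x => by ring)
    _ = _ := by
        rw [e2, ← integral_const_mul]
        exact integral_congr_ae (.of_forall fun x => by ring)

/-- The squared modulus of the Fourier transform of a real function on the line, in the
normalization without `2 π` in the exponent. -/
def spectralDensity {φ : ℝ → ℝ} (hφ : MemLp (fun r => (φ r : ℂ)) 2 (volume : Measure ℝ)) (ρ : ℝ) :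
    ℝ≥0∞ :=
  ‖plancherel hφ ((2 * π)⁻¹ * ρ)‖ₑ ^ 2

lemma measurable_spectralDensity {φ : ℝ → ℝ}
    (hφ : MemLp (fun r => (φ r : ℂ)) 2 (volume : Measure ℝ)) : Measurable (spectralDensity hφ) := by
  have := (stronglyMeasurable_plancherel hφ).measurable
  unfold spectralDensity
  fun_prop

/-- The homogeneous Sobolev norms of the radial function `F ‖x‖` as moments of the spectral density of
`r F |r|`. -/
lemma sobolevSqENorm_eq {F φ : ℝ → ℝ} (hF : Measurable F) (s : ℝ)
    (hφ : MemLp (fun r => (φ r : ℂ)) 2 (volume : Measure ℝ)) (e : ∀ r, φ r = r * F |r|) :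
    sobolevSqENorm s (fun x => F ‖x‖) = ENNReal.ofReal (16 * π ^ 3) *
      ∫⁻ ρ in Ioi 0, ENNReal.ofReal (ρ ^ (2 * s)) * spectralDensity hφ ρ := by
  have e' : (fun r => (φ r : ℂ)) = fun r : ℝ => (r : ℂ) * (F |r| : ℂ) := by
    ext r; rw [e]; push_cast; rfl
  have hg : MemLp (fun r : ℝ => (r : ℂ) * (F |r| : ℂ)) 2 (volume : Measure ℝ) := e' ▸ hφ
  rw [sobolevSqENorm_radial hF s hg]
  unfold spectralDensity
  congr! 7
  exact e'.symm

lemma two_pi_inv_ne_zero : (2 * π)⁻¹ ≠ 0 := by positivity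

lemma quasiMeasurePreserving_two_pi_inv_mul :
    Measure.QuasiMeasurePreserving (fun ρ : ℝ => (2 * π)⁻¹ * ρ) volume volume := by
  refine ⟨by fun_prop, ?_⟩
  rw [Real.map_volume_mul_left two_pi_inv_ne_zero]
  exact Measure.smul_absolutelyContinuous

lemma lintegral_comp_two_pi_inv_mul {g : ℝ → ℝ≥0∞} (hg : Measurable g) :
    ∫⁻ ρ, g ((2 * π)⁻¹ * ρ) = ENNReal.ofReal (2 * π) * ∫⁻ η, g η := by
  rw [← lintegral_map (f := g) (g := fun ρ => (2 * π)⁻¹ * ρ) hg (by fun_prop),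
    Real.map_volume_mul_left two_pi_inv_ne_zero, lintegral_smul_measure,
    inv_inv, abs_of_pos (by positivity), smul_eq_mul]

lemma lintegral_spectralDensity {φ : ℝ → ℝ}
    (hφ : MemLp (fun r => (φ r : ℂ)) 2 (volume : Measure ℝ)) :
    ∫⁻ ρ, spectralDensity hφ ρ = ENNReal.ofReal (2 * π) * ∫⁻ r, ‖(φ r : ℂ)‖ₑ ^ 2 := by
  have hm := (stronglyMeasurable_plancherel hφ).measurable
  have h1 : ∫⁻ η, ‖plancherel hφ η‖ₑ ^ 2 = ∫⁻ r, ‖(φ r : ℂ)‖ₑ ^ 2 := by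
    rw [← enorm_sq_integral_eq, ← enorm_sq_integral_eq]
    congr 1
    unfold plancherel
    rw [← Lp.enorm_def, ← ofReal_norm, Lp.norm_fourier_eq, ofReal_norm, Lp.enorm_toLp]
  rw [← h1]
  exact lintegral_comp_two_pi_inv_mul (g := fun η => ‖plancherel hφ η‖ₑ ^ 2) (by fun_prop)

/-- The Plancherel identity on the half-line, for even and for odd functions. -/
lemma two_mul_lintegral_spectralDensity {φ : ℝ → ℝ}
    (hφ : MemLp (fun r => (φ r : ℂ)) 2 (volume : Measure ℝ)) {c : ℝ} (hc : c ^ 2 = 1)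
    (hpar : ∀ r, φ (-r) = c * φ r) :
    2 * ∫⁻ ρ in Ioi 0, spectralDensity hφ ρ =
      ENNReal.ofReal (2 * π) * ∫⁻ r, ‖(φ r : ℂ)‖ₑ ^ 2 := by
  rw [← lintegral_spectralDensity hφ]
  have hae : ∀ᵐ ρ : ℝ, spectralDensity hφ (-ρ) = spectralDensity hφ ρ := by
    have h1 := plancherel_comp_neg hφ (c := c) (fun r => by simp [hpar])
    filter_upwards [quasiMeasurePreserving_two_pi_inv_mul.ae h1] with ρ hρ
    unfold spectralDensity
    rw [mul_neg, hρ, enorm_mul, mul_pow]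
    have : ‖(c : ℂ)‖ₑ ^ 2 = 1 := by
      rw [← ofReal_norm, ← ENNReal.ofReal_pow (norm_nonneg _)]
      simp [hc]
    rw [this, one_mul]
  have h2 : ∫⁻ ρ in Iic 0, spectralDensity hφ ρ = ∫⁻ ρ in Ioi 0, spectralDensity hφ ρ := by
    have h3 := (Measure.measurePreserving_neg (volume : Measure ℝ)).setLIntegral_comp_preimage
      (measurableSet_Iic (a := (0 : ℝ))) (measurable_spectralDensity hφ)
    rw [← h3]
    rw [show (Neg.neg ⁻¹' Iic 0 : Set ℝ) = Ici 0 by ext; simp, ← setLIntegral_congr Ioi_ae_eq_Ici]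
    exact setLIntegral_congr_fun_ae measurableSet_Ioi (hae.mono fun ρ h _ => h)
  have h4 := (lintegral_add_compl (μ := volume) (spectralDensity hφ)
    (measurableSet_Ioi (a := (0 : ℝ)))).symm
  rw [compl_Ioi, h2, ← two_mul] at h4
  exact h4.symm

lemma spectralDensity_deriv {φ φ' : ℝ → ℝ} (hφ : MemLp (fun r => (φ r : ℂ)) 2 (volume : Measure ℝ))
    (hφ' : MemLp (fun r => (φ' r : ℂ)) 2 (volume : Measure ℝ))
    (hd : ∀ r, HasDerivAt φ (φ' r) r) :
    ∀ᵐ ρ : ℝ, spectralDensity hφ' ρ = ENNReal.ofReal (ρ ^ 2) * spectralDensity hφ ρ := by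
  have h1 := plancherel_deriv hφ hφ' (fun r => (hd r).ofReal_comp)
  filter_upwards [quasiMeasurePreserving_two_pi_inv_mul.ae h1] with ρ hρ
  unfold spectralDensity
  rw [hρ, enorm_mul, mul_pow]
  congr 1
  rw [← ofReal_norm, ← ENNReal.ofReal_pow (norm_nonneg _)]
  congr 1
  have h2 : (π : ℂ) ≠ 0 := by exact_mod_cast pi_ne_zero
  have e : 2 * (π : ℂ) * Complex.I * (((2 * π)⁻¹ * ρ : ℝ) : ℂ) = Complex.I * ρ := by
    push_cast
    field_simp
  rw [e]
  simp

/-- Each derivative multiplies the spectral density by `ρ ^ 2`. -/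
lemma spectralDensity_iterate {G : ℕ → ℝ → ℝ} (hG : ∀ k, MemLp (fun r => (G k r : ℂ)) 2 volume)
    (hd : ∀ k r, HasDerivAt (G k) (G (k + 1) r) r) (k : ℕ) :
    ∀ᵐ ρ : ℝ, spectralDensity (hG k) ρ = ENNReal.ofReal (ρ ^ (2 * k)) * spectralDensity (hG 0) ρ := by
  induction k with
  | zero => simp
  | succ k ih =>
    filter_upwards [ih, spectralDensity_deriv (hG k) (hG (k + 1)) (hd k)] with ρ h1 h2
    rw [h2, h1, ← mul_assoc, ← ENNReal.ofReal_mul (by positivity)]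
    congr 2
    ring

lemma enorm_plancherel_le {f : ℝ → ℂ} (h1 : Integrable f) (h2 : MemLp f 2 (volume : Measure ℝ)) :
    ∀ᵐ η, ‖plancherel h2 η‖ₑ ≤ ∫⁻ x, ‖f x‖ₑ := by
  filter_upwards [plancherel_ae_eq h1 h2] with η hη
  rw [hη, Real.fourier_real_eq]
  refine (enorm_integral_le_lintegral_enorm _).trans (le_of_eq ?_)
  have h1 : ∀ z : Circle, ‖(z : ℂ)‖ₑ = 1 := fun z => by rw [← ofReal_norm, Circle.norm_coe]; simp
  simp [Circle.smul_def, enorm_mul, h1]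

/-- The transform of an odd function vanishes at the origin. -/
lemma enorm_plancherel_le_of_odd {f : ℝ → ℂ} (h1 : Integrable f) (h2 : MemLp f 2 (volume : Measure ℝ))
    (hodd : ∀ x, f (-x) = -f x) :
    ∀ᵐ η, ‖plancherel h2 η‖ₑ ≤ ENNReal.ofReal (2 * π * |η|) * ∫⁻ x : ℝ, ‖(x : ℂ) * f x‖ₑ := by
  filter_upwards [plancherel_ae_eq h1 h2] with η hη
  have h0 : ∫ x, f x = 0 := by
    have h := integral_neg_eq_self f volume
    simp only [hodd, integral_neg] at h
    exact self_eq_neg.1 h.symm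
  have hi : Integrable fun x : ℝ => Real.fourierChar (-(x * η)) • f x :=
    (Real.fourierIntegral_convergent_iff (V := ℝ) η).2 h1 |>.congr (.of_forall fun x => by
      simp [mul_comm])
  rw [hη, Real.fourier_real_eq]
  have e : ∫ x, Real.fourierChar (-(x * η)) • f x =
      ∫ x, ((Real.fourierChar (-(x * η)) : ℂ) - 1) * f x := by
    have : ∀ x : ℝ, ((Real.fourierChar (-(x * η)) : ℂ) - 1) * f x =
      Real.fourierChar (-(x * η)) • f x - f x := fun x => by rw [Circle.smul_def, smul_eq_mul]; ring
    simp only [this]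
    rw [integral_sub hi h1, h0, sub_zero]
  rw [e, ← lintegral_const_mul' _ _ ENNReal.ofReal_ne_top]
  refine (enorm_integral_le_lintegral_enorm _).trans (lintegral_mono fun x => ?_)
  rw [enorm_mul, enorm_mul, ← mul_assoc]
  gcongr
  rw [← ofReal_norm, ← ofReal_norm, ← ENNReal.ofReal_mul (by positivity)]
  refine ENNReal.ofReal_le_ofReal ?_
  rw [Real.fourierChar_apply]
  have := Real.norm_exp_I_mul_ofReal_sub_one_le (x := 2 * π * -(x * η))
  rw [mul_comm Complex.I] at this
  refine this.trans (le_of_eq ?_)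
  rw [Real.norm_eq_abs, Complex.norm_real, Real.norm_eq_abs, abs_mul, abs_mul, abs_neg, abs_mul,
    abs_of_pos pi_pos, abs_two]
  ring

/-! ### Power integrals and the constant `κ_ν` -/

lemma lintegral_rpow_Ioc {a b s : ℝ} (ha : 0 ≤ a) (hab : a ≤ b) (hs : -1 < s ∨ s ≠ -1 ∧ 0 < a) :
    ∫⁻ ρ in Ioc a b, ENNReal.ofReal (ρ ^ s) =
      ENNReal.ofReal ((b ^ (s + 1) - a ^ (s + 1)) / (s + 1)) := by
  have hmem : 0 < a → (0 : ℝ) ∉ uIcc a b := fun h h' => by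
    rw [uIcc_of_le hab] at h'; linarith [h'.1]
  have h0 : -1 < s ∨ s ≠ -1 ∧ (0 : ℝ) ∉ uIcc a b := hs.imp_right fun h => ⟨h.1, hmem h.2⟩
  have hi : IntervalIntegrable (fun ρ : ℝ => ρ ^ s) volume a b := by
    rcases hs with h | h
    · exact intervalIntegral.intervalIntegrable_rpow' h
    · exact intervalIntegral.intervalIntegrable_rpow (.inr (hmem h.2))
  rw [← integral_rpow h0, intervalIntegral.integral_of_le hab, ofReal_integral_eq_lintegral_ofReal]
  · exact (intervalIntegrable_iff_integrableOn_Ioc_of_le hab).1 hi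
  · exact (ae_restrict_mem measurableSet_Ioc).mono fun ρ hρ => rpow_nonneg (ha.trans hρ.1.le) s

lemma lintegral_inv_Ioc {a b : ℝ} (ha : 0 < a) (hab : a ≤ b) :
    ∫⁻ ρ in Ioc a b, ENNReal.ofReal ρ⁻¹ = ENNReal.ofReal (log (b / a)) := by
  have hi : IntervalIntegrable (fun ρ : ℝ => ρ⁻¹) volume a b :=
    intervalIntegrable_inv_iff.2 (.inr (by rw [uIcc_of_le hab]; exact fun h => by linarith [h.1]))
  rw [← integral_inv_of_pos ha (ha.trans_le hab), intervalIntegral.integral_of_le hab,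
    ofReal_integral_eq_lintegral_ofReal]
  · exact (intervalIntegrable_iff_integrableOn_Ioc_of_le hab).1 hi
  · exact (ae_restrict_mem measurableSet_Ioc).mono fun ρ hρ => inv_nonneg.2 (ha.trans hρ.1).le

lemma sq_sin_sub_mul_cos_le {x : ℝ} (hx : 0 ≤ x) : (sin x - x * cos x) ^ 2 ≤ 4 * x ^ 2 := by
  have h1 : |sin x - x * cos x| ≤ 2 * x := by
    have h2 : |x * cos x| ≤ x := by
      rw [abs_mul, abs_of_nonneg hx]
      exact mul_le_of_le_one_right hx (abs_cos_le_one x)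
    have h3 : |sin x| ≤ x := by simpa [abs_of_nonneg hx] using abs_sin_le_abs (x := x)
    calc _ ≤ |sin x| + |x * cos x| := abs_sub _ _
      _ ≤ 2 * x := by linarith
  rw [← sq_abs]
  calc _ ≤ (2 * x) ^ 2 := by gcongr
    _ = _ := by ring

lemma sq_sin_sub_mul_cos_le_pow {x : ℝ} (hx : 0 < x) :
    (sin x - x * cos x) ^ 2 ≤ x ^ 6 := by
  have h1 : sin x ≤ x := sin_le hx.le
  have h2 := one_sub_sq_div_two_le_cos (x := x)
  have h3 := sin_gt_sub_cube hx
  have h4 := cos_le_one x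
  have h5 : 0 < x ^ 3 := by positivity
  have h6 : |sin x - x * cos x| ≤ x ^ 3 := by
    rw [abs_le]
    constructor
    · nlinarith
    · nlinarith
  rw [← sq_abs]
  calc _ ≤ (x ^ 3) ^ 2 := by gcongr
    _ = _ := by ring

lemma kappaIntegrand_nonneg (ν : ℝ) {σ : ℝ} (hσ : 0 < σ) : 0 ≤ kappaIntegrand ν σ := by
  unfold kappaIntegrand; positivity

lemma kappaIntegrand_le_rpow (ν : ℝ) {σ : ℝ} (hσ : 0 < σ) :
    kappaIntegrand ν σ ≤ 4 * σ ^ (-2 + 2 * ν) := by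
  have e : σ ^ (-2 + 2 * ν) = σ ^ 2 * σ ^ (-4 + 2 * ν) := by
    rw [← rpow_natCast, ← rpow_add hσ]; congr 1; push_cast; ring
  rw [e, ← mul_assoc]
  exact mul_le_mul_of_nonneg_right (sq_sin_sub_mul_cos_le hσ.le) (by positivity)

lemma kappaIntegrand_le_one {ν σ : ℝ} (hν : 0 ≤ ν) (hσ : 0 < σ) (hσ1 : σ ≤ 1) :
    kappaIntegrand ν σ ≤ 1 := by
  calc _ ≤ σ ^ 6 * σ ^ (-4 + 2 * ν) :=
        mul_le_mul_of_nonneg_right (sq_sin_sub_mul_cos_le_pow hσ) (by positivity)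
    _ = σ ^ (2 + 2 * ν) := by
        rw [← rpow_natCast, ← rpow_add hσ]; congr 1; push_cast; ring
    _ ≤ 1 := rpow_le_one hσ.le hσ1 (by linarith)

lemma continuousOn_kappaIntegrand (ν : ℝ) : ContinuousOn (kappaIntegrand ν) (Ioi 0) := by
  unfold kappaIntegrand
  refine (by fun_prop : Continuous fun σ : ℝ => (sin σ - σ * cos σ) ^ 2).continuousOn.mul ?_
  exact continuousOn_id.rpow_const fun x hx => .inl (ne_of_gt hx)

lemma integrableOn_kappaIntegrand_Ioc_one {ν : ℝ} (hν : 0 ≤ ν) :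
    IntegrableOn (kappaIntegrand ν) (Ioc 0 1) := by
  refine Integrable.mono' (integrableOn_const (C := (1 : ℝ)) (by simp)) ?_ ?_
  · exact ((continuousOn_kappaIntegrand ν).mono Ioc_subset_Ioi_self).aestronglyMeasurable
      measurableSet_Ioc
  · refine (ae_restrict_mem measurableSet_Ioc).mono fun σ hσ => ?_
    rw [Real.norm_of_nonneg (kappaIntegrand_nonneg ν hσ.1)]
    exact kappaIntegrand_le_one hν hσ.1 hσ.2

lemma integrableOn_kappaIntegrand_Ioc {ν : ℝ} (hν : 0 ≤ ν) {t : ℝ} (ht : 1 ≤ t) :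
    IntegrableOn (kappaIntegrand ν) (Ioc 0 t) := by
  rw [← Ioc_union_Ioc_eq_Ioc zero_le_one ht]
  refine (integrableOn_kappaIntegrand_Ioc_one hν).union ?_
  exact (((continuousOn_kappaIntegrand ν).mono fun x hx =>
    zero_lt_one.trans_le hx.1).integrableOn_Icc).mono_set Ioc_subset_Icc_self

lemma integrableOn_kappaIntegrand_Ioi_one {ν : ℝ} (hν : ν < 1 / 2) :
    IntegrableOn (kappaIntegrand ν) (Ioi 1) := by
  refine Integrable.mono' ((integrableOn_Ioi_rpow_of_lt (a := -2 + 2 * ν) (by linarith)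
    zero_lt_one).const_mul 4) ?_ ?_
  · exact ((continuousOn_kappaIntegrand ν).mono (Ioi_subset_Ioi zero_le_one)).aestronglyMeasurable
      measurableSet_Ioi
  · refine (ae_restrict_mem measurableSet_Ioi).mono fun σ hσ => ?_
    have hσ0 : (0 : ℝ) < σ := zero_lt_one.trans hσ
    rw [Real.norm_of_nonneg (kappaIntegrand_nonneg ν hσ0)]
    exact kappaIntegrand_le_rpow ν hσ0

lemma integrableOn_kappaIntegrand {ν : ℝ} (hν : 0 ≤ ν) (hν1 : ν < 1 / 2) :
    IntegrableOn (kappaIntegrand ν) (Ioi 0) := by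
  rw [← Ioc_union_Ioi_eq_Ioi zero_le_one]
  exact (integrableOn_kappaIntegrand_Ioc_one hν).union (integrableOn_kappaIntegrand_Ioi_one hν1)

/-- The rate at which the truncated integrals converge to the integral in `κ_ν`. -/
lemma abs_integral_kappaIntegrand_sub_le {ν : ℝ} (hν : 0 ≤ ν) (hν1 : ν < 1 / 2) {t : ℝ}
    (ht : 1 ≤ t) :
    |(∫ σ in Ioc 0 t, kappaIntegrand ν σ) - ∫ σ in Ioi 0, kappaIntegrand ν σ| ≤
      4 / (1 - 2 * ν) * t ^ (2 * ν - 1) := by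
  have ht0 : 0 < t := by linarith
  have hi := integrableOn_kappaIntegrand hν hν1
  have e : ∫ σ in Ioi 0, kappaIntegrand ν σ =
      (∫ σ in Ioc 0 t, kappaIntegrand ν σ) + ∫ σ in Ioi t, kappaIntegrand ν σ := by
    rw [← Ioc_union_Ioi_eq_Ioi ht0.le]
    exact setIntegral_union (Ioc_disjoint_Ioi le_rfl) measurableSet_Ioi
      (hi.mono_set Ioc_subset_Ioi_self) (hi.mono_set (Ioi_subset_Ioi ht0.le))
  rw [e, sub_add_cancel_left, abs_neg, abs_of_nonneg (setIntegral_nonneg measurableSet_Ioi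
    fun σ hσ => kappaIntegrand_nonneg ν (ht0.trans hσ))]
  have hr : -2 + 2 * ν < -1 := by linarith
  calc _ ≤ ∫ σ in Ioi t, 4 * σ ^ (-2 + 2 * ν) :=
        setIntegral_mono_on (hi.mono_set (Ioi_subset_Ioi ht0.le))
          ((integrableOn_Ioi_rpow_of_lt hr ht0).const_mul 4) measurableSet_Ioi
          fun σ hσ => kappaIntegrand_le_rpow ν (ht0.trans hσ)
    _ = _ := by
        rw [integral_const_mul, integral_Ioi_rpow_of_lt hr ht0,
          show -2 + 2 * ν + 1 = -(1 - 2 * ν) by ring, show 2 * ν - 1 = -(1 - 2 * ν) by ring]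
        have : 1 - 2 * ν ≠ 0 := by linarith
        field_simp

lemma integral_kappaIntegrand_le {ν : ℝ} (hν : 1 / 2 < ν) {t : ℝ} (ht : 1 ≤ t) :
    ∫ σ in Ioc 0 t, kappaIntegrand ν σ ≤ 4 / (2 * ν - 1) * t ^ (2 * ν - 1) := by
  have ht0 : 0 ≤ t := by linarith
  have hr : -1 < -2 + 2 * ν := by linarith
  have hi := (intervalIntegrable_iff_integrableOn_Ioc_of_le ht0).1
    (intervalIntegral.intervalIntegrable_rpow' (a := 0) (b := t) hr)
  calc _ ≤ ∫ σ in Ioc 0 t, 4 * σ ^ (-2 + 2 * ν) :=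
        setIntegral_mono_on (integrableOn_kappaIntegrand_Ioc (by linarith) ht) (hi.const_mul 4)
          measurableSet_Ioc fun σ hσ => kappaIntegrand_le_rpow ν hσ.1
    _ = _ := by
        rw [integral_const_mul, ← intervalIntegral.integral_of_le ht0, integral_rpow (.inl hr),
          show -2 + 2 * ν + 1 = 2 * ν - 1 by ring, zero_rpow (by linarith)]
        ring

/-- The logarithm comes from the mean value `1 / 2` of `cos ^ 2`, the oscillating rest being
integrated by parts. -/
lemma exists_bound_integral_kappaIntegrand_half : ∃ C, ∀ t : ℝ, 1 ≤ t →
    |(∫ σ in Ioc 0 t, kappaIntegrand (1 / 2) σ) - log t / 2| ≤ C := by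
  -- `F` is a primitive of `f`, which agrees with `cos σ ^ 2 / σ` and with the integrand up to `O(σ⁻²)`.
  set F : ℝ → ℝ := fun σ => log σ / 2 + sin (2 * σ) / (4 * σ) with hF
  set f : ℝ → ℝ := fun σ => cos σ ^ 2 / σ - sin (2 * σ) / (4 * σ ^ 2) with hf
  have hd : ∀ σ : ℝ, 0 < σ → HasDerivAt F (f σ) σ := by
    intro σ hσ
    have h1 := (hasDerivAt_log hσ.ne').div_const 2
    have h2 := (((hasDerivAt_id' σ).const_mul 2).sin).fun_div ((hasDerivAt_id' σ).const_mul 4)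
      (by positivity)
    refine (h1.fun_add h2).congr_deriv ?_
    simp only [hf]
    rw [cos_two_mul]
    field_simp
    ring
  have hb : ∀ σ : ℝ, 1 ≤ σ → |kappaIntegrand (1 / 2) σ - f σ| ≤ 4 * σ ^ (-2 : ℝ) := by
    intro σ hσ
    have hσ0 : 0 < σ := by linarith
    have e1 : σ ^ (-4 + 2 * (1 / 2) : ℝ) = (σ ^ 3)⁻¹ := by
      rw [← rpow_natCast, ← rpow_neg hσ0.le]; congr 1; norm_num
    have e2 : σ ^ (-2 : ℝ) = (σ ^ 2)⁻¹ := by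
      rw [← rpow_natCast, ← rpow_neg hσ0.le]; congr 1
    have e : kappaIntegrand (1 / 2) σ - f σ =
        (sin σ ^ 2 / σ - sin (2 * σ) + sin (2 * σ) / 4) * (σ ^ 2)⁻¹ := by
      simp only [kappaIntegrand, hf, e1]
      rw [sin_two_mul]
      field_simp
      ring
    rw [e, e2, abs_mul, abs_of_pos (a := (σ ^ 2)⁻¹) (by positivity)]
    gcongr
    have h1 : |sin σ ^ 2 / σ| ≤ 1 := by
      rw [abs_of_nonneg (by positivity), div_le_one hσ0]
      exact (sin_sq_le_one σ).trans hσ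
    have h2 := abs_sin_le_one (2 * σ)
    rw [abs_le] at *
    constructor <;> linarith
  have hcf : ContinuousOn f (Ioi 0) := by
    intro σ hσ
    have : σ ≠ 0 := ne_of_gt hσ
    have h4 : 4 * σ ^ 2 ≠ 0 := by positivity
    exact ((by fun_prop : ContinuousAt (fun σ : ℝ => cos σ ^ 2) σ).div continuousAt_id this |>.sub
      ((by fun_prop : ContinuousAt (fun σ : ℝ => sin (2 * σ)) σ).div (by fun_prop) h4)
      ).continuousWithinAt
  have hi2 : IntegrableOn (fun σ : ℝ => 4 * σ ^ (-2 : ℝ)) (Ioi 1) :=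
    (integrableOn_Ioi_rpow_of_lt (by norm_num) zero_lt_one).const_mul 4
  refine ⟨|∫ σ in Ioc 0 1, kappaIntegrand (1 / 2) σ| + (∫ σ in Ioi (1 : ℝ), 4 * σ ^ (-2 : ℝ)) +
    1 / 2, fun t ht => ?_⟩
  have ht0 : 0 < t := by linarith
  have hk := integrableOn_kappaIntegrand_Ioc (ν := 1 / 2) (by norm_num) ht
  have hfi : IntegrableOn f (Ioc 1 t) :=
    ((hcf.mono fun x hx => zero_lt_one.trans_le hx.1).integrableOn_Icc).mono_set Ioc_subset_Icc_self
  have hk1 : IntegrableOn (kappaIntegrand (1 / 2)) (Ioc 1 t) :=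
    hk.mono_set (Ioc_subset_Ioc_left zero_le_one)
  have e1 : ∫ σ in Ioc 0 t, kappaIntegrand (1 / 2) σ =
      (∫ σ in Ioc 0 1, kappaIntegrand (1 / 2) σ) + ∫ σ in Ioc 1 t, kappaIntegrand (1 / 2) σ := by
    rw [← Ioc_union_Ioc_eq_Ioc zero_le_one ht]
    exact setIntegral_union (Ioc_disjoint_Ioc_of_le le_rfl) measurableSet_Ioc
      (hk.mono_set (Ioc_subset_Ioc_right ht)) hk1
  have e2 : ∫ σ in Ioc 1 t, f σ = F t - F 1 := by
    rw [← intervalIntegral.integral_of_le ht]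
    refine intervalIntegral.integral_eq_sub_of_hasDerivAt (fun σ hσ => hd σ ?_)
      ((intervalIntegrable_iff_integrableOn_Ioc_of_le ht).2 hfi)
    rw [uIcc_of_le ht] at hσ
    linarith [hσ.1]
  have e3 : |(∫ σ in Ioc 1 t, kappaIntegrand (1 / 2) σ) - ∫ σ in Ioc 1 t, f σ| ≤
      ∫ σ in Ioi (1 : ℝ), 4 * σ ^ (-2 : ℝ) := by
    rw [← integral_sub hk1 hfi, ← Real.norm_eq_abs]
    refine (norm_integral_le_of_norm_le (hi2.mono_set Ioc_subset_Ioi_self)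
      ((ae_restrict_mem measurableSet_Ioc).mono fun σ hσ => hb σ hσ.1.le)).trans ?_
    refine setIntegral_mono_set hi2 ?_ (Ioc_subset_Ioi_self).eventuallyLE
    exact (ae_restrict_mem measurableSet_Ioi).mono fun σ hσ => by
      have : (0 : ℝ) < σ := zero_lt_one.trans hσ
      show 0 ≤ 4 * σ ^ (-2 : ℝ)
      positivity
  have e4 : |F t - F 1 - log t / 2| ≤ 1 / 2 := by
    have h1 : |sin (2 * t) / (4 * t)| ≤ 1 / 4 := by
      rw [abs_div, abs_of_pos (a := 4 * t) (by positivity), div_le_iff₀ (by positivity)]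
      have := abs_sin_le_one (2 * t)
      linarith
    have h2 : |sin (2 * 1) / (4 * 1)| ≤ 1 / 4 := by
      rw [abs_div, abs_of_pos (a := (4 : ℝ) * 1) (by positivity), div_le_iff₀ (by positivity)]
      exact (abs_sin_le_one _).trans (by norm_num)
    simp only [hF, log_one]
    generalize sin (2 * t) / (4 * t) = a at h1
    generalize sin (2 * 1) / (4 * 1) = b at h2
    rw [abs_le] at h1 h2 ⊢
    constructor <;> linarith
  rw [e1]
  rw [e2] at e3
  have h5 := le_abs_self (∫ σ in Ioc 0 1, kappaIntegrand (1 / 2) σ)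
  have h6 := neg_abs_le (∫ σ in Ioc 0 1, kappaIntegrand (1 / 2) σ)
  rw [abs_le] at *
  constructor <;> linarith

/-! ### Low and high frequencies -/

/-- The contribution of the frequencies `0 < ρ ≤ 1` to the squared homogeneous Sobolev norm of
order `s` of a function on the line (on the positive half of the frequency axis). -/
def lowEnergy {φ : ℝ → ℝ} (hφ : MemLp (fun r => (φ r : ℂ)) 2 (volume : Measure ℝ)) (s : ℝ) :
    ℝ≥0∞ :=
  ∫⁻ ρ in Ioc 0 1, ENNReal.ofReal (ρ ^ (2 * s)) * spectralDensity hφ ρ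

/-- The contribution of the frequencies `ρ > 1`, see `lowEnergy`. -/
def highEnergy {φ : ℝ → ℝ} (hφ : MemLp (fun r => (φ r : ℂ)) 2 (volume : Measure ℝ)) (s : ℝ) :
    ℝ≥0∞ :=
  ∫⁻ ρ in Ioi 1, ENNReal.ofReal (ρ ^ (2 * s)) * spectralDensity hφ ρ

lemma lowEnergy_add_highEnergy {φ : ℝ → ℝ}
    (hφ : MemLp (fun r => (φ r : ℂ)) 2 (volume : Measure ℝ)) (s : ℝ) :
    ∫⁻ ρ in Ioi 0, ENNReal.ofReal (ρ ^ (2 * s)) * spectralDensity hφ ρ =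
      lowEnergy hφ s + highEnergy hφ s := by
  rw [← Ioc_union_Ioi_eq_Ioi zero_le_one]
  exact lintegral_union measurableSet_Ioi (Ioc_disjoint_Ioi le_rfl)

/-- At frequencies `ρ > 1` the weight `ρ ^ (2 s)` is dominated by `ρ ^ (2 k)`, which amounts to `k`
derivatives. -/
lemma highEnergy_le {G : ℕ → ℝ → ℝ} (hG : ∀ k, MemLp (fun r => (G k r : ℂ)) 2 volume)
    (hd : ∀ k r, HasDerivAt (G k) (G (k + 1) r) r) {s : ℝ} {k : ℕ} (hs : s ≤ k) :
    highEnergy (hG 0) s ≤ ENNReal.ofReal (2 * π) * ∫⁻ r, ‖(G k r : ℂ)‖ₑ ^ 2 := by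
  rw [← lintegral_spectralDensity (hG k)]
  refine le_trans ?_ (setLIntegral_le_lintegral (Ioi 1) _)
  refine lintegral_mono_ae ?_
  filter_upwards [ae_restrict_of_ae (spectralDensity_iterate hG hd k),
    ae_restrict_mem measurableSet_Ioi] with ρ h1 h2
  rw [h1]
  gcongr
  rw [← rpow_natCast]
  refine rpow_le_rpow_of_exponent_le (le_of_lt h2) ?_
  push_cast
  linarith

/-- At frequencies `ρ ≤ 1` the weight `ρ ^ (2 s)` is at most `1`. -/
lemma lowEnergy_le {φ : ℝ → ℝ} (hφ : MemLp (fun r => (φ r : ℂ)) 2 (volume : Measure ℝ)) {s : ℝ}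
    (hs : 0 ≤ s) : lowEnergy hφ s ≤ ENNReal.ofReal (2 * π) * ∫⁻ r, ‖(φ r : ℂ)‖ₑ ^ 2 := by
  rw [← lintegral_spectralDensity hφ]
  refine le_trans ?_ (setLIntegral_le_lintegral (Ioc 0 1) _)
  refine lintegral_mono_ae ((ae_restrict_mem measurableSet_Ioc).mono fun ρ hρ => ?_)
  refine mul_le_of_le_one_left zero_le (ENNReal.ofReal_le_one.2 ?_)
  exact rpow_le_one hρ.1.le hρ.2 (by linarith)

lemma lowEnergy_ne_top {φ : ℝ → ℝ} (hφ : MemLp (fun r => (φ r : ℂ)) 2 (volume : Measure ℝ)) {s : ℝ}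
    (hs : 0 ≤ s) : lowEnergy hφ s ≠ ⊤ := by
  refine ne_top_of_le_ne_top ?_ (lowEnergy_le hφ hs)
  rw [← enorm_sq_integral_eq]
  exact ENNReal.mul_ne_top ENNReal.ofReal_ne_top (ENNReal.pow_ne_top hφ.2.ne)

/-- The triangle inequality for low frequencies: the error is controlled by the distance
in `L²(ℝ)`. -/
lemma abs_sqrt_lowEnergy_sub_le {φ ψ : ℝ → ℝ}
    (hφ : MemLp (fun r => (φ r : ℂ)) 2 (volume : Measure ℝ))
    (hψ : MemLp (fun r => (ψ r : ℂ)) 2 (volume : Measure ℝ)) {s C : ℝ} (hs : 0 ≤ s) (hC : 0 ≤ C)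
    (h : ∫⁻ r, ‖((φ r - ψ r : ℝ) : ℂ)‖ₑ ^ 2 ≤ ENNReal.ofReal C) :
    |√(lowEnergy hφ s).toReal - √(lowEnergy hψ s).toReal| ≤ √(2 * π * C) := by
  set μ : Measure ℝ :=
    (volume.restrict (Ioc 0 1)).withDensity fun ρ => ENNReal.ofReal (ρ ^ (2 * s)) with hμ
  have hw : Measurable fun ρ : ℝ => ENNReal.ofReal (ρ ^ (2 * s)) := by fun_prop
  have key : ∀ g : ℝ → ℂ, Measurable g → eLpNorm g 2 μ ^ 2 =
      ∫⁻ ρ in Ioc 0 1, ENNReal.ofReal (ρ ^ (2 * s)) * ‖g ρ‖ₑ ^ 2 := by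
    intro g hg
    rw [enorm_sq_integral_eq, hμ, lintegral_withDensity_eq_lintegral_mul _ hw (by fun_prop)]
    rfl
  have hm : ∀ {φ : ℝ → ℝ} (hφ : MemLp (fun r => (φ r : ℂ)) 2 (volume : Measure ℝ)),
      Measurable fun ρ : ℝ => plancherel hφ ((2 * π)⁻¹ * ρ) := fun hφ => by
    have := (stronglyMeasurable_plancherel hφ).measurable
    fun_prop
  have hsq : ∀ {φ : ℝ → ℝ} (hφ : MemLp (fun r => (φ r : ℂ)) 2 (volume : Measure ℝ)),
      eLpNorm (fun ρ => plancherel hφ ((2 * π)⁻¹ * ρ)) 2 μ ^ 2 = lowEnergy hφ s := fun hφ =>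
    key _ (hm hφ)
  have hLp : ∀ {φ : ℝ → ℝ} (hφ : MemLp (fun r => (φ r : ℂ)) 2 (volume : Measure ℝ)),
      MemLp (fun ρ => plancherel hφ ((2 * π)⁻¹ * ρ)) 2 μ := fun hφ => by
    refine ⟨(hm hφ).aestronglyMeasurable, lt_top_iff_ne_top.2 fun ht => ?_⟩
    have := hsq hφ
    rw [ht] at this
    exact lowEnergy_ne_top hφ hs (by rw [← this]; simp)
  have hsqrt : ∀ {φ : ℝ → ℝ} (hφ : MemLp (fun r => (φ r : ℂ)) 2 (volume : Measure ℝ)),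
      √(lowEnergy hφ s).toReal = (eLpNorm (fun ρ => plancherel hφ ((2 * π)⁻¹ * ρ)) 2 μ).toReal :=
    fun hφ => by rw [← hsq hφ, ENNReal.toReal_pow, sqrt_sq ENNReal.toReal_nonneg]
  rw [hsqrt, hsqrt]
  refine (abs_toReal_eLpNorm_sub_le (by norm_num) (hLp hφ) (hLp hψ)).trans ?_
  refine Real.le_sqrt_of_sq_le ?_
  rw [← ENNReal.toReal_pow]
  refine ENNReal.toReal_le_of_le_ofReal (by positivity) ?_
  rw [key _ ((hm hφ).sub (hm hψ)), ENNReal.ofReal_mul (by positivity)]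
  have hm1 := (stronglyMeasurable_plancherel hφ).measurable
  have hm2 := (stronglyMeasurable_plancherel hψ).measurable
  calc _ ≤ ∫⁻ ρ in Ioc 0 1, ‖(plancherel hφ - plancherel hψ) ((2 * π)⁻¹ * ρ)‖ₑ ^ 2 := by
        refine lintegral_mono_ae ((ae_restrict_mem measurableSet_Ioc).mono fun ρ hρ => ?_)
        refine mul_le_of_le_one_left zero_le (ENNReal.ofReal_le_one.2 ?_)
        exact rpow_le_one hρ.1.le hρ.2 (by linarith)
    _ ≤ ∫⁻ ρ, ‖(plancherel hφ - plancherel hψ) ((2 * π)⁻¹ * ρ)‖ₑ ^ 2 :=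
        setLIntegral_le_lintegral _ _
    _ = ENNReal.ofReal (2 * π) * ∫⁻ η, ‖(plancherel hφ - plancherel hψ) η‖ₑ ^ 2 :=
        lintegral_comp_two_pi_inv_mul (g := fun η => ‖(plancherel hφ - plancherel hψ) η‖ₑ ^ 2)
          ((hm1.sub hm2).enorm.pow_const 2)
    _ ≤ _ := by
        gcongr
        rw [← enorm_sq_integral_eq, eLpNorm_plancherel_sub, enorm_sq_integral_eq]
        refine le_trans (le_of_eq ?_) h
        simp

/-- Interpolation: a spectral measure of mass bounded below, whose moments of a positive and of a
negative order are bounded, has no small moments. -/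
lemma exists_lower_bound_moment {c C : ℝ} (hc : 0 < c) (hC : 0 ≤ C) (s : ℝ) : ∃ c', 0 < c' ∧
    ∀ m : ℝ → ℝ≥0∞, Measurable m → ENNReal.ofReal c ≤ ∫⁻ ρ in Ioi 0, m ρ →
      ∫⁻ ρ in Ioi 0, ENNReal.ofReal (ρ ^ (2 : ℝ)) * m ρ ≤ ENNReal.ofReal C →
      ∫⁻ ρ in Ioi 0, ENNReal.ofReal (ρ ^ (-(1 / 2) : ℝ)) * m ρ ≤ ENNReal.ofReal C →
      ENNReal.ofReal c' ≤ ∫⁻ ρ in Ioi 0, ENNReal.ofReal (ρ ^ s) * m ρ := by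
  -- The weight `1` is split into `δ ρ ^ a + K ρ ^ s`, where the first term absorbs at most half of the mass.
  set δ := c / (2 * (C + 1)) with hδ
  have hδ0 : 0 < δ := by positivity
  have hδC : δ * C ≤ c / 2 := by
    rw [hδ, div_mul_eq_mul_div, div_le_div_iff₀ (by positivity) (by positivity)]
    nlinarith
  have main : ∀ a : ℝ, (∃ K, 0 < K ∧ ∀ ρ : ℝ, 0 < ρ → 1 ≤ δ * ρ ^ a + K * ρ ^ s) →
      ∃ c', 0 < c' ∧ ∀ m : ℝ → ℝ≥0∞, Measurable m → ENNReal.ofReal c ≤ ∫⁻ ρ in Ioi 0, m ρ →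
        ∫⁻ ρ in Ioi 0, ENNReal.ofReal (ρ ^ a) * m ρ ≤ ENNReal.ofReal C →
        ENNReal.ofReal c' ≤ ∫⁻ ρ in Ioi 0, ENNReal.ofReal (ρ ^ s) * m ρ := by
    rintro a ⟨K, hK0, hK⟩
    refine ⟨c / 2 / K, by positivity, fun m hm h1 h2 => ?_⟩
    have h3 : ∫⁻ ρ in Ioi 0, m ρ ≤
        ENNReal.ofReal δ * (∫⁻ ρ in Ioi 0, ENNReal.ofReal (ρ ^ a) * m ρ) +
          ENNReal.ofReal K * ∫⁻ ρ in Ioi 0, ENNReal.ofReal (ρ ^ s) * m ρ := by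
      rw [← lintegral_const_mul _ (by fun_prop), ← lintegral_const_mul _ (by fun_prop),
        ← lintegral_add_left (by fun_prop)]
      refine lintegral_mono_ae ((ae_restrict_mem measurableSet_Ioi).mono fun ρ hρ => ?_)
      have hρ0 : 0 < ρ := hρ
      rw [← mul_assoc, ← mul_assoc, ← add_mul, ← ENNReal.ofReal_mul hδ0.le,
        ← ENNReal.ofReal_mul hK0.le, ← ENNReal.ofReal_add (by positivity) (by positivity)]
      exact le_mul_of_one_le_left zero_le (ENNReal.one_le_ofReal.2 (hK ρ hρ0))
    have h4 : ENNReal.ofReal (c / 2) ≤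
        ENNReal.ofReal K * ∫⁻ ρ in Ioi 0, ENNReal.ofReal (ρ ^ s) * m ρ := by
      have h5 : ENNReal.ofReal c ≤ ENNReal.ofReal (c / 2) +
          ENNReal.ofReal K * ∫⁻ ρ in Ioi 0, ENNReal.ofReal (ρ ^ s) * m ρ := by
        refine h1.trans (h3.trans (add_le_add_left ?_ _))
        calc _ ≤ ENNReal.ofReal δ * ENNReal.ofReal C := by gcongr
          _ = ENNReal.ofReal (δ * C) := (ENNReal.ofReal_mul hδ0.le).symm
          _ ≤ _ := ENNReal.ofReal_le_ofReal hδC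
      rw [show c = c / 2 + c / 2 by ring, ENNReal.ofReal_add (by positivity) (by positivity)] at h5
      rw [show c / 2 + c / 2 = c by ring] at h5
      exact (ENNReal.add_le_add_iff_left ENNReal.ofReal_ne_top).1 h5
    rw [ENNReal.ofReal_div_of_pos hK0]
    exact ENNReal.div_le_of_le_mul' h4
  -- For `s ≤ 0` the term with `a = 2` takes care of the high frequencies, where `ρ ^ s` is small. For
  -- `s > 0` the term with `a = -1 / 2` takes care of the low ones.
  rcases le_or_gt s 0 with hs | hs
  · obtain ⟨c', h1, h2⟩ := main 2 ⟨(δ⁻¹ ^ (1 / 2 : ℝ)) ^ (-s), by positivity, fun ρ hρ => by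
      rcases le_or_gt (δ⁻¹ ^ (1 / 2 : ℝ)) ρ with h | h
      · have : δ⁻¹ ≤ ρ ^ (2 : ℝ) := by
          calc δ⁻¹ = (δ⁻¹ ^ (1 / 2 : ℝ)) ^ (2 : ℝ) := by
                rw [← rpow_mul (by positivity)]; norm_num
            _ ≤ _ := rpow_le_rpow (by positivity) h (by norm_num)
        have h5 : 1 ≤ δ * ρ ^ (2 : ℝ) := by
          calc 1 = δ * δ⁻¹ := (mul_inv_cancel₀ hδ0.ne').symm
            _ ≤ _ := by gcongr
        have : 0 ≤ (δ⁻¹ ^ (1 / 2 : ℝ)) ^ (-s) * ρ ^ s := by positivity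
        linarith
      · have h5 : 1 ≤ (δ⁻¹ ^ (1 / 2 : ℝ)) ^ (-s) * ρ ^ s := by
          calc 1 = ρ ^ (-s) * ρ ^ s := by rw [← rpow_add hρ]; simp
            _ ≤ _ := by gcongr; linarith
        have : 0 ≤ δ * ρ ^ (2 : ℝ) := by positivity
        linarith⟩
    exact ⟨c', h1, fun m hm a b _ => h2 m hm a b⟩
  · obtain ⟨c', h1, h2⟩ := main (-(1 / 2)) ⟨(δ ^ (2 : ℝ)) ^ (-s), by positivity, fun ρ hρ => by
      rcases le_or_gt ρ (δ ^ (2 : ℝ)) with h | h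
      · have : (δ ^ (2 : ℝ)) ^ (-(1 / 2) : ℝ) ≤ ρ ^ (-(1 / 2) : ℝ) :=
          rpow_le_rpow_of_nonpos hρ h (by norm_num)
        rw [← rpow_mul hδ0.le, show (2 * -(1 / 2) : ℝ) = -1 by norm_num, rpow_neg_one] at this
        have h5 : 1 ≤ δ * ρ ^ (-(1 / 2) : ℝ) := by
          calc 1 = δ * δ⁻¹ := (mul_inv_cancel₀ hδ0.ne').symm
            _ ≤ _ := by gcongr
        have : 0 ≤ (δ ^ (2 : ℝ)) ^ (-s) * ρ ^ s := by positivity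
        linarith
      · have h5 : 1 ≤ (δ ^ (2 : ℝ)) ^ (-s) * ρ ^ s := by
          calc 1 = (δ ^ (2 : ℝ)) ^ (-s) * (δ ^ (2 : ℝ)) ^ s := by
                rw [← rpow_add (by positivity)]; simp
            _ ≤ _ := by gcongr
        have : 0 ≤ δ * ρ ^ (-(1 / 2) : ℝ) := by positivity
        linarith⟩
    exact ⟨c', h1, fun m hm a _ b => h2 m hm a b⟩

/-! ### The spectral density of the box -/

lemma memLp_mul_boxProfile (H : ℝ → ℝ) (t : ℝ) (p : ℝ≥0∞) :
    MemLp (fun r : ℝ => ((r * boxProfile H t r : ℝ) : ℂ)) p volume := by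
  have hm := measurable_boxProfile H t
  have e : (fun r : ℝ => ((r * boxProfile H t r : ℝ) : ℂ)) =
      (Icc (-t) t).indicator fun r : ℝ => ((r * boxProfile H t r : ℝ) : ℂ) := by
    refine (indicator_eq_self.2 fun r hr => ?_).symm
    by_contra hc
    refine hr ?_
    have : ¬ |r| < t := fun h => hc ⟨by linarith [(abs_lt.1 h).1], by linarith [(abs_lt.1 h).2]⟩
    simp [boxProfile, this]
  rw [e, memLp_indicator_iff_restrict measurableSet_Icc]
  refine MemLp.of_bound (by fun_prop) |H 0| ?_
  refine .of_forall fun r => ?_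
  rw [Complex.norm_real, Real.norm_eq_abs]
  unfold boxProfile
  split_ifs with h
  · have ht : 0 < t := (abs_nonneg r).trans_lt h
    rw [abs_mul, abs_div, abs_of_pos ht, ← mul_div_assoc, div_le_iff₀ ht, mul_comm]
    gcongr
  · simp

lemma integral_mul_exp_interval {c : ℂ} (hc : c ≠ 0) (t : ℝ) :
    ∫ r in (-t)..t, (r : ℂ) * Complex.exp (c * r) =
      t / c * (Complex.exp (c * t) + Complex.exp (-(c * t))) -
        (Complex.exp (c * t) - Complex.exp (-(c * t))) / c ^ 2 := by
  have hd : ∀ r : ℝ, HasDerivAt (fun r : ℝ => ((r : ℂ) / c - 1 / c ^ 2) * Complex.exp (c * r))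
      ((r : ℂ) * Complex.exp (c * r)) r := by
    intro r
    have h1 : HasDerivAt (fun r : ℝ => (r : ℂ)) 1 r := (hasDerivAt_id' r).ofReal_comp
    refine ((h1.div_const c).sub_const (1 / c ^ 2)).fun_mul (h1.const_mul c).cexp
      |>.congr_deriv ?_
    field_simp
    ring
  rw [intervalIntegral.integral_eq_sub_of_hasDerivAt (fun r _ => hd r)
    ((by fun_prop : Continuous fun r : ℝ => (r : ℂ) * Complex.exp (c * r)).intervalIntegrable _ _)]
  push_cast
  rw [mul_neg]
  field_simp
  ring

lemma fourier_mul_boxProfile (H : ℝ → ℝ) {t : ℝ} (ht : 0 < t) {ρ : ℝ} (hρ : ρ ≠ 0) :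
    𝓕 (fun r : ℝ => ((r * boxProfile H t r : ℝ) : ℂ)) ((2 * π)⁻¹ * ρ) =
      ((-2 * H 0 * (sin (t * ρ) - t * ρ * cos (t * ρ)) / (t * ρ ^ 2) : ℝ) : ℂ) * Complex.I := by
  have hc : -(ρ : ℂ) * Complex.I ≠ 0 := by simp [hρ]
  have e : ∀ r : ℝ, Real.fourierChar (-(r * ((2 * π)⁻¹ * ρ))) • ((r * boxProfile H t r : ℝ) : ℂ) =
      (Ioo (-t) t).indicator
        (fun r : ℝ => (H 0 / t : ℂ) * ((r : ℂ) * Complex.exp (-(ρ : ℂ) * Complex.I * r))) r := by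
    intro r
    simp only [indicator, mem_Ioo, ← abs_lt, boxProfile]
    split_ifs with h
    · rw [Circle.smul_def, Real.fourierChar_apply, smul_eq_mul,
        show 2 * π * -(r * ((2 * π)⁻¹ * ρ)) = -(ρ * r) by field_simp]
      push_cast
      rw [show -((ρ : ℂ) * r) * Complex.I = -(ρ : ℂ) * Complex.I * r by ring]
      ring
    · simp
  rw [Real.fourier_real_eq]
  simp only [e]
  rw [integral_indicator measurableSet_Ioo, ← integral_Ioc_eq_integral_Ioo,
    ← intervalIntegral.integral_of_le (by linarith), intervalIntegral.integral_const_mul,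
    integral_mul_exp_interval hc]
  have e1 : -(ρ : ℂ) * Complex.I * t = -(t * ρ : ℝ) * Complex.I := by push_cast; ring
  have e2 : -(-(ρ : ℂ) * Complex.I * t) = (t * ρ : ℝ) * Complex.I := by push_cast; ring
  rw [e2, e1, Complex.exp_mul_I, Complex.exp_mul_I, Complex.cos_neg, Complex.sin_neg,
    ← Complex.ofReal_cos, ← Complex.ofReal_sin]
  have hρ' : (ρ : ℂ) ≠ 0 := by exact_mod_cast hρ
  have ht' : (t : ℂ) ≠ 0 := by exact_mod_cast ht.ne'
  have hI : Complex.I ≠ 0 := Complex.I_ne_zero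
  generalize sin (t * ρ) = S
  generalize cos (t * ρ) = D
  push_cast
  field_simp
  ring_nf
  simp only [show Complex.I ^ 3 = -Complex.I by rw [pow_succ, Complex.I_sq]; ring]
  ring

lemma spectralDensity_boxProfile {H : ℝ → ℝ} (hH : H 0 ^ 2 = 2) {t : ℝ} (ht : 0 < t) :
    ∀ᵐ ρ : ℝ, ρ ≠ 0 → spectralDensity (memLp_mul_boxProfile H t 2) ρ =
      ENNReal.ofReal (8 * (sin (t * ρ) - t * ρ * cos (t * ρ)) ^ 2 / (t ^ 2 * ρ ^ 4)) := by
  have h1 := plancherel_ae_eq (memLp_one_iff_integrable.1 (memLp_mul_boxProfile H t 1))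
    (memLp_mul_boxProfile H t 2)
  filter_upwards [quasiMeasurePreserving_two_pi_inv_mul.ae h1] with ρ h2 hρ
  unfold spectralDensity
  rw [h2, fourier_mul_boxProfile H ht hρ, ← ofReal_norm, ← ENNReal.ofReal_pow (norm_nonneg _)]
  congr 1
  rw [norm_mul, Complex.norm_I, mul_one, Complex.norm_real, Real.norm_eq_abs, sq_abs, div_pow,
    mul_pow, mul_pow, hH]
  ring

/-- The substitution `σ = t ρ` in the explicit transform of `r (H 0 / t) 1_{|r| < t}`. -/
lemma lowEnergy_boxProfile {H : ℝ → ℝ} (hH : H 0 ^ 2 = 2) {t ν : ℝ} (hν : 0 ≤ ν) (ht : 1 ≤ t) :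
    lowEnergy (memLp_mul_boxProfile H t 2) ν =
      ENNReal.ofReal (8 * t ^ (1 - 2 * ν) * ∫ σ in Ioc 0 t, kappaIntegrand ν σ) := by
  have ht0 : 0 < t := by linarith
  have hk := integrableOn_kappaIntegrand_Ioc hν ht
  have hm : Measurable fun σ => ENNReal.ofReal (kappaIntegrand ν σ) := by
    unfold kappaIntegrand; fun_prop
  have hm2 : Measurable fun ρ => ENNReal.ofReal (kappaIntegrand ν (t * ρ)) :=
    hm.comp (measurable_const_mul t)
  have e1 : lowEnergy (memLp_mul_boxProfile H t 2) ν = ∫⁻ ρ in Ioc 0 1,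
      ENNReal.ofReal (8 * t ^ (2 - 2 * ν)) * ENNReal.ofReal (kappaIntegrand ν (t * ρ)) := by
    refine lintegral_congr_ae ?_
    filter_upwards [ae_restrict_of_ae (spectralDensity_boxProfile hH ht0),
      ae_restrict_mem measurableSet_Ioc] with ρ h1 h2
    have hρ : 0 < ρ := h2.1
    rw [h1 hρ.ne', ← ENNReal.ofReal_mul (by positivity), ← ENNReal.ofReal_mul (by positivity)]
    congr 1
    unfold kappaIntegrand
    have e2 : (t * ρ) ^ (-4 + 2 * ν) = t ^ (-(2 - 2 * ν)) * ρ ^ (2 * ν) / (t ^ 2 * ρ ^ 4) := by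
      rw [mul_rpow ht0.le hρ.le, show -4 + 2 * ν = -(2 - 2 * ν) - 2 by ring, rpow_sub ht0,
        show -(2 - 2 * ν) - 2 = 2 * ν - 4 by ring, rpow_sub hρ]
      norm_cast
      field_simp
    rw [e2, rpow_neg ht0.le]
    have : t ^ (2 - 2 * ν) ≠ 0 := by positivity
    field_simp
  have e3 : ∫⁻ ρ in Ioc 0 1, ENNReal.ofReal (kappaIntegrand ν (t * ρ)) =
      ENNReal.ofReal t⁻¹ * ∫⁻ σ in Ioc 0 t, ENNReal.ofReal (kappaIntegrand ν σ) := by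
    rw [← lintegral_indicator measurableSet_Ioc, ← lintegral_indicator measurableSet_Ioc]
    have h1 := lintegral_map (μ := volume) (f := (Ioc 0 t).indicator fun σ =>
      ENNReal.ofReal (kappaIntegrand ν σ)) (g := fun ρ => t * ρ)
      (hm.indicator measurableSet_Ioc) (by fun_prop)
    rw [Real.map_volume_mul_left ht0.ne', lintegral_smul_measure,
      abs_of_pos (by positivity), smul_eq_mul] at h1
    rw [h1]
    refine lintegral_congr fun ρ => ?_
    have : t * ρ ∈ Ioc 0 t ↔ ρ ∈ Ioc (0 : ℝ) 1 := by
      simp only [mem_Ioc, mul_pos_iff_of_pos_left ht0, mul_le_iff_le_one_right ht0]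
    simp only [indicator, this]
  have hnn : 0 ≤ᵐ[volume.restrict (Ioc 0 t)] kappaIntegrand ν :=
    (ae_restrict_mem measurableSet_Ioc).mono fun σ hσ => kappaIntegrand_nonneg ν hσ.1
  rw [e1, lintegral_const_mul _ hm2, e3,
    ← ofReal_integral_eq_lintegral_ofReal hk hnn, ← ENNReal.ofReal_mul (by positivity),
    ← ENNReal.ofReal_mul (by positivity)]
  congr 1
  rw [show 2 - 2 * ν = (1 - 2 * ν) + 1 by ring, rpow_add_one ht0.ne']
  field_simp

/-! ### Sobolev energies of the solution and of its time derivative -/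

/-- The integral over all positive frequencies, which is the squared homogeneous Sobolev norm up to
the factor `16 π³`. -/
def energy {φ : ℝ → ℝ} (hφ : MemLp (fun r => (φ r : ℂ)) 2 (volume : Measure ℝ)) (s : ℝ) : ℝ≥0∞ :=
  ∫⁻ ρ in Ioi 0, ENNReal.ofReal (ρ ^ (2 * s)) * spectralDensity hφ ρ

lemma highEnergy_congr {φ ψ : ℝ → ℝ} (hφ : MemLp (fun r => (φ r : ℂ)) 2 (volume : Measure ℝ))
    (hψ : MemLp (fun r => (ψ r : ℂ)) 2 (volume : Measure ℝ)) (e : ∀ r, φ r = ψ r) (s : ℝ) :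
    highEnergy hφ s = highEnergy hψ s := by
  obtain rfl : φ = ψ := funext e
  rfl

/-- Energies of order `1` are energies of order `0` of the derivative. -/
lemma energy_one_eq {φ φ' : ℝ → ℝ} (hφ : MemLp (fun r => (φ r : ℂ)) 2 (volume : Measure ℝ))
    (hφ' : MemLp (fun r => (φ' r : ℂ)) 2 (volume : Measure ℝ))
    (hd : ∀ r, HasDerivAt φ (φ' r) r) : energy hφ 1 = energy hφ' 0 := by
  refine lintegral_congr_ae (ae_restrict_of_ae ?_)
  filter_upwards [spectralDensity_deriv hφ hφ' hd] with ρ h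
  rw [h, mul_zero, rpow_zero, ENNReal.ofReal_one, one_mul, mul_one, rpow_two]

/-- A lower bound for the energy of one order `a` implies a lower bound for every order `s`, in the
presence of upper bounds for one higher and one lower order. -/
lemma exists_lower_bound_energy {c C : ℝ} (hc : 0 < c) (hC : 0 ≤ C) (a s : ℝ) : ∃ c', 0 < c' ∧
    ∀ (φ : ℝ → ℝ) (hφ : MemLp (fun r => (φ r : ℂ)) 2 (volume : Measure ℝ)),
      ENNReal.ofReal c ≤ energy hφ a → energy hφ (a + 1) ≤ ENNReal.ofReal C →
      energy hφ (a - 1 / 4) ≤ ENNReal.ofReal C → ENNReal.ofReal c' ≤ energy hφ s := by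
  obtain ⟨c', hc', h⟩ := exists_lower_bound_moment hc hC (2 * (s - a))
  refine ⟨c', hc', fun φ hφ h1 h2 h3 => ?_⟩
  have hm := measurable_spectralDensity hφ
  have e : ∀ b : ℝ, ∫⁻ ρ in Ioi 0, ENNReal.ofReal (ρ ^ (2 * (b - a))) *
      (ENNReal.ofReal (ρ ^ (2 * a)) * spectralDensity hφ ρ) = energy hφ b := by
    intro b
    refine setLIntegral_congr_fun measurableSet_Ioi fun ρ hρ => ?_
    have hρ0 : 0 < ρ := hρ
    rw [← mul_assoc, ← ENNReal.ofReal_mul (by positivity), ← rpow_add hρ0]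
    congr 3
    ring
  rw [← e s]
  refine h _ (by fun_prop) h1 ?_ ?_
  · rw [← e (a + 1)] at h2
    convert h2 using 6
    ring
  · rw [← e (a - 1 / 4)] at h3
    convert h3 using 6
    ring

/-- A function of definite parity bounded below on an interval has positive energy. -/
lemma le_energy_zero {φ : ℝ → ℝ} (hφ : MemLp (fun r => (φ r : ℂ)) 2 (volume : Measure ℝ)) {k : ℝ}
    (hk : k ^ 2 = 1) (hpar : ∀ r, φ (-r) = k * φ r) {a η c : ℝ} (hc : 0 ≤ c)
    (h : ∀ r ∈ Icc (a - η) (a + η), c ≤ |φ r|) :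
    ENNReal.ofReal (2 * π * (c ^ 2 * (2 * η))) ≤ 2 * energy hφ 0 := by
  have e : energy hφ 0 = ∫⁻ ρ in Ioi 0, spectralDensity hφ ρ := by simp [energy]
  rw [e, two_mul_lintegral_spectralDensity hφ hk hpar, ENNReal.ofReal_mul (by positivity)]
  gcongr
  calc ENNReal.ofReal (c ^ 2 * (2 * η)) = ∫⁻ _ in Icc (a - η) (a + η), ENNReal.ofReal (c ^ 2) := by
        rw [setLIntegral_const, Real.volume_Icc, ← ENNReal.ofReal_mul (by positivity)]
        congr 1
        ring
    _ ≤ ∫⁻ r in Icc (a - η) (a + η), ‖(φ r : ℂ)‖ₑ ^ 2 := by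
        refine setLIntegral_mono' measurableSet_Icc fun r hr => ?_
        rw [← ofReal_norm, ← ENNReal.ofReal_pow (norm_nonneg _), Complex.norm_real, Real.norm_eq_abs]
        gcongr
        exact h r hr
    _ ≤ _ := setLIntegral_le_lintegral _ _

variable {X Y ε : ℝ} {U H : ℝ → ℝ}

lemma exists_bound_lintegral_sub_box (h : IsProfile X Y ε U H) : ∃ C, 0 ≤ C ∧ ∀ t : ℝ, 1 ≤ t →
    MemLp (fun r => ((r * posProfile H t r - r * boxProfile H t r : ℝ) : ℂ)) 2 volume ∧
    ∫⁻ r, ‖((r * posProfile H t r - r * boxProfile H t r : ℝ) : ℂ)‖ₑ ^ 2 ≤ ENNReal.ofReal C := by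
  obtain ⟨C, hC0, hC⟩ := exists_bound_sub_boxProfile h
  have hb : ∀ t r : ℝ, 1 ≤ t →
      (r * posProfile H t r - r * boxProfile H t r) ^ 2 ≤ C * shellWeight t r := by
    intro t r ht
    refine le_trans ?_ (hC t r ht)
    rw [← mul_sub, mul_pow]
    gcongr
    linarith
  have hm : ∀ t, Measurable fun r => r * posProfile H t r - r * boxProfile H t r := fun t => by
    have h1 := measurable_posProfile h t
    have h2 := measurable_boxProfile H t
    fun_prop
  exact ⟨C * (2 * π), by positivity, fun t ht =>
    ⟨memLp_two_of_sq_le hC0 (hm t) fun r => hb t r ht, lintegral_enorm_sq_le hC0 fun r => hb t r ht⟩⟩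

lemma memLp_mul_posProfile (h : IsProfile X Y ε U H) {t : ℝ} (ht : 1 ≤ t) :
    MemLp (fun r => ((r * posProfile H t r : ℝ) : ℂ)) 2 volume := by
  obtain ⟨C, -, hC⟩ := exists_bound_lintegral_sub_box h
  refine ((hC t ht).1.add (memLp_mul_boxProfile H t 2)).ae_eq (.of_forall fun r => ?_)
  simp

lemma memLp_mul_velProfile (h : IsProfile X Y ε U H) {t : ℝ} (ht : 1 ≤ t) :
    MemLp (fun r => ((r * velProfile H t r : ℝ) : ℂ)) 2 volume := by
  obtain ⟨K, hK0, -, hK⟩ := exists_vel_seq h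
  obtain ⟨C, hC0, hC⟩ := hK 0
  refine memLp_two_of_sq_le (t := t) hC0 ?_ fun r => ?_
  · have := measurable_velProfile h t
    fun_prop
  · rw [← hK0]; exact hC t r ht

lemma exists_highEnergy_posProfile_le (h : IsProfile X Y ε U H) (s : ℝ) : ∃ C, 0 ≤ C ∧
    ∀ t (ht : 1 ≤ t), highEnergy (memLp_mul_posProfile h ht) s ≤ ENNReal.ofReal C := by
  obtain ⟨G, hG0, -, hGd, hGb⟩ := exists_pos_seq h
  obtain ⟨k, hk⟩ := exists_nat_ge s
  obtain ⟨C, hC0, hC⟩ := hGb k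
  refine ⟨2 * π * (C * (2 * π)), by positivity, fun t ht => ?_⟩
  have hG : ∀ k, MemLp (fun r => (G k t r : ℂ)) 2 volume := by
    intro k
    cases k with
    | zero => simpa only [hG0] using memLp_mul_posProfile h ht
    | succ k =>
      obtain ⟨C, hC0, hC⟩ := hGb k
      refine memLp_two_of_sq_le hC0 ?_ fun r => hC t r ht
      exact (continuous_iff_continuousAt.2 fun r => (hGd (k + 1) t r).continuousAt).measurable
  rw [highEnergy_congr _ (hG 0) fun r => (hG0 t r).symm, ENNReal.ofReal_mul (by positivity)]
  refine (highEnergy_le hG (fun k r => hGd k t r) (k := k + 1) (by push_cast; linarith)).trans ?_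
  gcongr
  exact lintegral_enorm_sq_le hC0 fun r => hC t r ht

lemma memLp_vel_seq {K : ℕ → ℝ → ℝ → ℝ} (hKd : ∀ k t r, HasDerivAt (K k t) (K (k + 1) t r) r)
    (hKb : ∀ k, ∃ C, 0 ≤ C ∧ ∀ t r : ℝ, 1 ≤ t → K k t r ^ 2 ≤ C * shellWeight t r) {t : ℝ}
    (ht : 1 ≤ t) (k : ℕ) : MemLp (fun r => (K k t r : ℂ)) 2 volume := by
  obtain ⟨C, hC0, hC⟩ := hKb k
  refine memLp_two_of_sq_le hC0 ?_ fun r => hC t r ht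
  exact (continuous_iff_continuousAt.2 fun r => (hKd k t r).continuousAt).measurable

lemma exists_highEnergy_velProfile_le (h : IsProfile X Y ε U H) (s : ℝ) : ∃ C, 0 ≤ C ∧
    ∀ t (ht : 1 ≤ t), highEnergy (memLp_mul_velProfile h ht) s ≤ ENNReal.ofReal C := by
  obtain ⟨K, hK0, hKd, hKb⟩ := exists_vel_seq h
  obtain ⟨k, hk⟩ := exists_nat_ge s
  obtain ⟨C, hC0, hC⟩ := hKb k
  refine ⟨2 * π * (C * (2 * π)), by positivity, fun t ht => ?_⟩
  have hK := memLp_vel_seq hKd hKb ht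
  rw [highEnergy_congr _ (hK 0) fun r => (hK0 t r).symm, ENNReal.ofReal_mul (by positivity)]
  refine (highEnergy_le hK (fun k r => hKd k t r) hk).trans ?_
  gcongr
  exact lintegral_enorm_sq_le hC0 fun r => hC t r ht

/-- At low frequencies the solution is, up to a bounded error, the multiple of a characteristic
function. -/
lemma exists_lowEnergy_posProfile (h : IsProfile X Y ε U H) : ∃ c, 0 ≤ c ∧
    ∀ t (ht : 1 ≤ t) (ν : ℝ), 0 ≤ ν →
      |√(lowEnergy (memLp_mul_posProfile h ht) ν).toReal -
        √(8 * t ^ (1 - 2 * ν) * ∫ σ in Ioc 0 t, kappaIntegrand ν σ)| ≤ c := by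
  obtain ⟨C, hC0, hC⟩ := exists_bound_lintegral_sub_box h
  refine ⟨√(2 * π * C), by positivity, fun t ht ν hν => ?_⟩
  have h1 := abs_sqrt_lowEnergy_sub_le (memLp_mul_posProfile h ht) (memLp_mul_boxProfile H t 2) hν
    hC0 (hC t ht).2
  rwa [lowEnergy_boxProfile h.sq_zero hν ht, ENNReal.toReal_ofReal] at h1
  have : 0 ≤ ∫ σ in Ioc 0 t, kappaIntegrand ν σ :=
    setIntegral_nonneg measurableSet_Ioc fun σ hσ => kappaIntegrand_nonneg ν hσ.1
  have : 0 ≤ t := by linarith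
  positivity

lemma integral_indicator_add_shellWeight {t : ℝ} (ht : 0 < t) :
    Integrable (fun r => (Ioo (-t) t).indicator (fun _ => t⁻¹) r + shellWeight t r) ∧
    ∫ r, ((Ioo (-t) t).indicator (fun _ => t⁻¹) r + shellWeight t r) = 2 + 2 * π := by
  have h1 : Integrable ((Ioo (-t) t).indicator fun _ => t⁻¹) :=
    (integrable_indicator_iff measurableSet_Ioo).2 (integrableOn_const (by simp))
  refine ⟨h1.add (integrable_shellWeight t), ?_⟩
  rw [integral_add h1 (integrable_shellWeight t), integral_shellWeight,
    integral_indicator measurableSet_Ioo, setIntegral_const, Real.volume_real_Ioo_of_le (by linarith)]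
  rw [smul_eq_mul]
  field_simp
  ring

/-- The spectral density of the velocity is bounded, because `r ∂ₜ u` is bounded in `L¹`, and it
vanishes to second order at the origin on the scale `1 / t`, because `r ∂ₜ u` is odd. -/
lemma exists_spectralDensity_velProfile_le (h : IsProfile X Y ε U H) : ∃ C, 0 ≤ C ∧
    ∀ t (ht : 1 ≤ t), ∀ᵐ ρ : ℝ, 0 < ρ → spectralDensity (memLp_mul_velProfile h ht) ρ ≤
      ENNReal.ofReal (C * min 1 ((t * ρ) ^ 2)) := by
  obtain ⟨C, hC0, hC⟩ := exists_bound_mul_velProfile h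
  set D := C * (2 + 2 * π) with hD
  have hD0 : 0 ≤ D := by positivity
  refine ⟨D ^ 2, by positivity, fun t ht => ?_⟩
  have ht0 : 0 < t := by linarith
  obtain ⟨hi, hint⟩ := integral_indicator_add_shellWeight ht0
  set w : ℝ → ℝ := fun r => (Ioo (-t) t).indicator (fun _ => t⁻¹) r + shellWeight t r with hw
  have hw0 : ∀ r, 0 ≤ w r := fun r =>
    add_nonneg (indicator_nonneg (fun _ _ => by positivity) r) (shellWeight_nonneg t r)
  have hm := measurable_velProfile h t
  have key : ∀ (φ : ℝ → ℂ) (A : ℝ), 0 ≤ A → (∀ r, ‖φ r‖ ≤ A * w r) →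
      ∫⁻ r, ‖φ r‖ₑ ≤ ENNReal.ofReal (A * (2 + 2 * π)) := by
    intro φ A hA hφ
    rw [← hint, ← integral_const_mul, ofReal_integral_eq_lintegral_ofReal (hi.const_mul A)
      (.of_forall fun r => mul_nonneg hA (hw0 r))]
    refine lintegral_mono fun r => ?_
    rw [← ofReal_norm]
    exact ENNReal.ofReal_le_ofReal (hφ r)
  have hb1 : ∀ r, ‖((r * velProfile H t r : ℝ) : ℂ)‖ ≤ C * w r := fun r => by
    rw [Complex.norm_real, Real.norm_eq_abs]; exact (hC t r ht).1
  have hI : Integrable fun r : ℝ => ((r * velProfile H t r : ℝ) : ℂ) :=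
    Integrable.mono' (hi.const_mul C) (by fun_prop) (.of_forall hb1)
  have h1 := enorm_plancherel_le hI (memLp_mul_velProfile h ht)
  have h2 := enorm_plancherel_le_of_odd hI (memLp_mul_velProfile h ht) fun r => by
    rw [← velProfile_abs, abs_neg, velProfile_abs]; push_cast; ring
  filter_upwards [quasiMeasurePreserving_two_pi_inv_mul.ae h1,
    quasiMeasurePreserving_two_pi_inv_mul.ae h2] with ρ h3 h4 hρ
  unfold spectralDensity
  rcases le_total 1 ((t * ρ) ^ 2) with hmin | hmin
  · rw [min_eq_left hmin, mul_one, ENNReal.ofReal_pow hD0]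
    gcongr
    exact h3.trans (key _ C hC0 hb1)
  · rw [min_eq_right hmin, ← mul_pow, ENNReal.ofReal_pow (by positivity)]
    gcongr
    refine h4.trans ?_
    have hb2 : ∀ r : ℝ, ‖(r : ℂ) * ((r * velProfile H t r : ℝ) : ℂ)‖ ≤ C * t * w r := fun r => by
      rw [← Complex.ofReal_mul, Complex.norm_real, Real.norm_eq_abs]; exact (hC t r ht).2
    calc _ ≤ ENNReal.ofReal (2 * π * |(2 * π)⁻¹ * ρ|) *
          ENNReal.ofReal (C * t * (2 + 2 * π)) := by
          gcongr
          exact key _ (C * t) (by positivity) hb2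
      _ = _ := by
          rw [← ENNReal.ofReal_mul (by positivity), abs_of_pos (by positivity)]
          congr 1
          rw [hD]
          field_simp

/-- The low-frequency energy of a density `min 1 ((t ρ) ^ 2)`, split at `ρ = 1 / t`. -/
lemma lintegral_rpow_mul_min_le {ν t : ℝ} (hν : 0 ≤ ν) (ht : 1 ≤ t) :
    ∫⁻ ρ in Ioc 0 1, ENNReal.ofReal (ρ ^ (2 * (ν - 1)) * min 1 ((t * ρ) ^ 2)) ≤
      ENNReal.ofReal (t ^ (1 - 2 * ν)) +
        ∫⁻ ρ in Ioc t⁻¹ 1, ENNReal.ofReal (ρ ^ (2 * (ν - 1))) := by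
  have ht0 : 0 < t := by linarith
  rw [← Ioc_union_Ioc_eq_Ioc (inv_nonneg.2 ht0.le) (inv_le_one_of_one_le₀ ht)]
  refine (lintegral_union_le _ _ _).trans (add_le_add ?_ ?_)
  · calc _ ≤ ∫⁻ ρ in Ioc 0 t⁻¹, ENNReal.ofReal (t ^ 2) * ENNReal.ofReal (ρ ^ (2 * ν)) := by
          refine setLIntegral_mono' measurableSet_Ioc fun ρ hρ => ?_
          have hρ0 : 0 < ρ := hρ.1
          rw [← ENNReal.ofReal_mul (by positivity)]
          refine ENNReal.ofReal_le_ofReal ?_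
          calc _ ≤ ρ ^ (2 * (ν - 1)) * (t * ρ) ^ 2 := by gcongr; exact min_le_right _ _
            _ = _ := by
                rw [show 2 * ν = 2 * (ν - 1) + (2 : ℕ) by push_cast; ring, rpow_add_natCast hρ0.ne']
                ring
      _ = ENNReal.ofReal (t ^ (1 - 2 * ν) / (2 * ν + 1)) := by
          rw [lintegral_const_mul _ (by fun_prop), lintegral_rpow_Ioc le_rfl (by positivity)
            (.inl (by linarith)), ← ENNReal.ofReal_mul (by positivity),
            zero_rpow (by linarith), sub_zero, inv_rpow ht0.le, ← rpow_neg ht0.le, ← mul_div_assoc,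
            ← rpow_natCast, ← rpow_add ht0]
          congr 3
          push_cast
          ring
      _ ≤ _ := by
          refine ENNReal.ofReal_le_ofReal (div_le_self (by positivity) (by linarith))
  · refine setLIntegral_mono' measurableSet_Ioc fun ρ hρ => ENNReal.ofReal_le_ofReal ?_
    have hρ0 : 0 < ρ := (inv_pos.2 ht0).trans hρ.1
    exact mul_le_of_le_one_right (by positivity) (min_le_left _ _)

/-! ### Asymptotics of the Sobolev norms -/

variable {X Y ε : ℝ} {U H : ℝ → ℝ}

lemma sobolevSqENorm_posProfile (h : IsProfile X Y ε U H) {t : ℝ} (ht : 1 ≤ t) (s : ℝ) :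
    sobolevSqENorm s (fun x => posProfile H t ‖x‖) =
      ENNReal.ofReal (16 * π ^ 3) * energy (memLp_mul_posProfile h ht) s :=
  sobolevSqENorm_eq (measurable_posProfile h t) s _ fun r => by rw [posProfile_abs]

lemma sobolevSqENorm_velProfile (h : IsProfile X Y ε U H) {t : ℝ} (ht : 1 ≤ t) (s : ℝ) :
    sobolevSqENorm s (fun x => velProfile H t ‖x‖) =
      ENNReal.ofReal (16 * π ^ 3) * energy (memLp_mul_velProfile h ht) s :=
  sobolevSqENorm_eq (measurable_velProfile h t) s _ fun r => by rw [velProfile_abs]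

/-- `16 π³` times this quantity is the leading part of `‖u(t)‖²` in the homogeneous Sobolev space of
order `ν`: the low-frequency energy of the multiple of a characteristic function that approximates
the solution. -/
def boxEnergy (ν t : ℝ) : ℝ := 8 * t ^ (1 - 2 * ν) * ∫ σ in Ioc 0 t, kappaIntegrand ν σ

lemma boxEnergy_nonneg (ν : ℝ) {t : ℝ} (ht : 0 ≤ t) : 0 ≤ boxEnergy ν t := by
  have : 0 ≤ ∫ σ in Ioc 0 t, kappaIntegrand ν σ :=
    setIntegral_nonneg measurableSet_Ioc fun σ hσ => kappaIntegrand_nonneg ν hσ.1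
  unfold boxEnergy
  positivity

/-- The triangle inequality for square roots of low-frequency energies, squared: the error is of the
order of the square root of the leading part. -/
lemma exists_bound_sobolevSq_posProfile (h : IsProfile X Y ε U H) {ν : ℝ} (hν : 0 ≤ ν) :
    ∃ C, 0 ≤ C ∧ ∀ t : ℝ, 1 ≤ t → sobolevSqENorm ν (fun x => posProfile H t ‖x‖) < ⊤ ∧
      |sobolevSq ν (fun x => posProfile H t ‖x‖) - 16 * π ^ 3 * boxEnergy ν t| ≤
        C * (1 + √(boxEnergy ν t)) := by
  obtain ⟨c, hc0, hc⟩ := exists_lowEnergy_posProfile h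
  obtain ⟨D, hD0, hD⟩ := exists_highEnergy_posProfile_le h ν
  refine ⟨16 * π ^ 3 * (c ^ 2 + 2 * c + D), by positivity, fun t ht => ?_⟩
  have ht0 : 0 ≤ t := by linarith
  have hlow := lowEnergy_ne_top (memLp_mul_posProfile h ht) hν
  have hhigh := ((hD t ht).trans_lt ENNReal.ofReal_lt_top).ne
  have e := sobolevSqENorm_posProfile h ht ν
  rw [energy, lowEnergy_add_highEnergy] at e
  refine ⟨e ▸ ENNReal.mul_lt_top ENNReal.ofReal_lt_top
    (ENNReal.add_lt_top.2 ⟨hlow.lt_top, hhigh.lt_top⟩), ?_⟩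
  have h1 := hc t ht ν hν
  have h2 := ENNReal.toReal_le_of_le_ofReal hD0 (hD t ht)
  have h3 : 0 ≤ (highEnergy (memLp_mul_posProfile h ht) ν).toReal := ENNReal.toReal_nonneg
  have h4 := boxEnergy_nonneg ν ht0
  have h5 : 0 ≤ (lowEnergy (memLp_mul_posProfile h ht) ν).toReal := ENNReal.toReal_nonneg
  rw [sobolevSq, e, ENNReal.toReal_mul, ENNReal.toReal_ofReal (by positivity),
    ENNReal.toReal_add hlow hhigh]
  change |√_ - √(boxEnergy ν t)| ≤ c at h1
  generalize (highEnergy (memLp_mul_posProfile h ht) ν).toReal = a at h2 h3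
  generalize (lowEnergy (memLp_mul_posProfile h ht) ν).toReal = b at h1 h5
  generalize boxEnergy ν t = B at h1 h4
  have h6 : |b - B| ≤ c * (c + 2 * √B) := by
    have e1 : b - B = (√b - √B) * (√b + √B) := by
      nlinarith [sq_sqrt h4, sq_sqrt h5]
    rw [e1, abs_mul, abs_of_nonneg (a := √b + √B) (by positivity)]
    have := (abs_le.1 h1).2
    exact mul_le_mul h1 (by linarith) (by positivity) hc0
  have h7 := sqrt_nonneg B
  have h8 : |b - B + a| ≤ (c ^ 2 + 2 * c + D) * (1 + √B) := by
    calc _ ≤ |b - B| + |a| := abs_add_le _ _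
      _ ≤ c * (c + 2 * √B) + D := by rw [abs_of_nonneg h3]; linarith
      _ ≤ _ := by nlinarith [mul_nonneg hc0 hc0, mul_nonneg (mul_nonneg hc0 hc0) h7, mul_nonneg hD0 h7]
  have e2 : 16 * π ^ 3 * (b + a) - 16 * π ^ 3 * B = 16 * π ^ 3 * (b - B + a) := by ring
  rw [e2, abs_mul, abs_of_pos (a := 16 * π ^ 3) (by positivity)]
  calc _ ≤ 16 * π ^ 3 * ((c ^ 2 + 2 * c + D) * (1 + √B)) := by gcongr
    _ = _ := by ring

lemma isBigO_sobolevSq_posProfile (h : IsProfile X Y ε U H) {ν : ℝ} (hν : 0 ≤ ν)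
    (hν1 : ν < 1 / 2) :
    (fun t : ℝ => sobolevSq ν (fun x => posProfile H t ‖x‖) - kappa ν * t ^ (1 - 2 * ν))
      =O[atTop] (fun t : ℝ => t ^ (1 / 2 - ν)) := by
  obtain ⟨C, hC0, hC⟩ := exists_bound_sobolevSq_posProfile h hν
  set I := ∫ σ in Ioi (0 : ℝ), kappaIntegrand ν σ with hI
  have hI0 : 0 ≤ I := setIntegral_nonneg measurableSet_Ioi fun σ hσ => kappaIntegrand_nonneg ν hσ
  refine IsBigO.of_bound (C * (1 + √(8 * I)) + 128 * π ^ 3 * (4 / (1 - 2 * ν))) ?_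
  filter_upwards [eventually_ge_atTop 1] with t ht
  have ht0 : 0 < t := by linarith
  have h1 := (hC t ht).2
  have h2 := abs_integral_kappaIntegrand_sub_le hν hν1 ht
  have h3 : ∫ σ in Ioc 0 t, kappaIntegrand ν σ ≤ I :=
    setIntegral_mono_set (integrableOn_kappaIntegrand hν hν1)
      ((ae_restrict_mem measurableSet_Ioi).mono fun σ hσ => kappaIntegrand_nonneg ν hσ)
      Ioc_subset_Ioi_self.eventuallyLE
  have h4 : √(boxEnergy ν t) ≤ √(8 * I) * t ^ (1 / 2 - ν) := by
    rw [sqrt_le_left (by positivity), mul_pow, sq_sqrt (by positivity), ← rpow_natCast,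
      ← rpow_mul ht0.le, show (1 / 2 - ν) * (2 : ℕ) = 1 - 2 * ν by push_cast; ring, boxEnergy]
    have : 0 ≤ t ^ (1 - 2 * ν) := by positivity
    nlinarith
  have h5 : 1 ≤ t ^ (1 / 2 - ν) := one_le_rpow ht (by linarith)
  have h6 : |16 * π ^ 3 * boxEnergy ν t - kappa ν * t ^ (1 - 2 * ν)| ≤
      128 * π ^ 3 * (4 / (1 - 2 * ν)) := by
    have e : 16 * π ^ 3 * boxEnergy ν t - kappa ν * t ^ (1 - 2 * ν) =
        128 * π ^ 3 * (t ^ (1 - 2 * ν) * ((∫ σ in Ioc 0 t, kappaIntegrand ν σ) - I)) := by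
      rw [boxEnergy, kappa]; ring
    rw [e, abs_mul (128 * π ^ 3), abs_of_pos (a := 128 * π ^ 3) (by positivity), abs_mul,
      abs_of_pos (a := t ^ (1 - 2 * ν)) (by positivity)]
    have e2 : t ^ (1 - 2 * ν) * t ^ (2 * ν - 1) = 1 := by
      rw [← rpow_add ht0]; simp
    refine mul_le_mul_of_nonneg_left ?_ (by positivity)
    calc _ ≤ t ^ (1 - 2 * ν) * (4 / (1 - 2 * ν) * t ^ (2 * ν - 1)) := by gcongr
      _ = _ := by rw [mul_left_comm, e2, mul_one]
  rw [Real.norm_eq_abs, Real.norm_of_nonneg (show 0 ≤ t ^ (1 / 2 - ν) by positivity)]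
  have h7 : 0 ≤ 128 * π ^ 3 * (4 / (1 - 2 * ν)) := (abs_nonneg _).trans h6
  calc _ ≤ C * (1 + √(boxEnergy ν t)) + 128 * π ^ 3 * (4 / (1 - 2 * ν)) := by
        refine (abs_sub_le _ (16 * π ^ 3 * boxEnergy ν t) _).trans (add_le_add h1 h6)
    _ ≤ C * (t ^ (1 / 2 - ν) + √(8 * I) * t ^ (1 / 2 - ν)) +
        128 * π ^ 3 * (4 / (1 - 2 * ν)) * t ^ (1 / 2 - ν) := by
        refine add_le_add ?_ (le_mul_of_one_le_right h7 h5)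
        gcongr
    _ = _ := by ring

lemma isBigO_sobolevSq_posProfile_half (h : IsProfile X Y ε U H) :
    (fun t : ℝ => sobolevSq (1 / 2) (fun x => posProfile H t ‖x‖) - 64 * π ^ 3 * log t)
      =O[atTop] (fun t : ℝ => √(log t)) := by
  obtain ⟨C, hC0, hC⟩ := exists_bound_sobolevSq_posProfile h (ν := 1 / 2) (by norm_num)
  obtain ⟨D, hD⟩ := exists_bound_integral_kappaIntegrand_half
  have hD0 : 0 ≤ D := (abs_nonneg _).trans (hD 1 le_rfl)
  refine IsBigO.of_bound (C * (1 + √(8 * D + 4)) + 128 * π ^ 3 * D) ?_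
  -- For `t ≥ e` bounded errors are absorbed by `√(log t)`.
  filter_upwards [eventually_ge_atTop (exp 1)] with t ht
  have ht1 : 1 ≤ t := (one_le_exp zero_le_one).trans ht
  have ht0 : 0 < t := by linarith
  have hlog : 1 ≤ log t := by rw [le_log_iff_exp_le ht0]; exact ht
  have h1 := (hC t ht1).2
  have h2 := hD t ht1
  have e : boxEnergy (1 / 2) t = 8 * ∫ σ in Ioc 0 t, kappaIntegrand (1 / 2) σ := by
    rw [boxEnergy, show (1 - 2 * (1 / 2) : ℝ) = 0 by norm_num, rpow_zero, mul_one]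
  have h4 : √(boxEnergy (1 / 2) t) ≤ √(8 * D + 4) * √(log t) := by
    rw [← sqrt_mul (by positivity), e]
    refine sqrt_le_sqrt ?_
    have := (abs_le.1 h2).2
    nlinarith
  have h5 : 1 ≤ √(log t) := one_le_sqrt.2 hlog
  have h6 : |16 * π ^ 3 * boxEnergy (1 / 2) t - 64 * π ^ 3 * log t| ≤ 128 * π ^ 3 * D := by
    have e : 16 * π ^ 3 * boxEnergy (1 / 2) t - 64 * π ^ 3 * log t =
        128 * π ^ 3 * ((∫ σ in Ioc 0 t, kappaIntegrand (1 / 2) σ) - log t / 2) := by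
      rw [e]; ring
    rw [e, abs_mul, abs_of_pos (a := 128 * π ^ 3) (by positivity)]
    gcongr
  rw [Real.norm_eq_abs, Real.norm_of_nonneg (sqrt_nonneg _)]
  calc _ ≤ C * (1 + √(boxEnergy (1 / 2) t)) + 128 * π ^ 3 * D := by
        refine (abs_sub_le _ (16 * π ^ 3 * boxEnergy (1 / 2) t) _).trans (add_le_add h1 h6)
    _ ≤ C * (√(log t) + √(8 * D + 4) * √(log t)) + 128 * π ^ 3 * D * √(log t) := by
        refine add_le_add ?_ (le_mul_of_one_le_right (by positivity) h5)
        gcongr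
    _ = _ := by ring

/-- For `ν > 1 / 2` the growth of the integral of `kappaIntegrand` cancels the factor `t ^ (1 - 2 ν)`. -/
lemma exists_sobolevSqENorm_posProfile_le (h : IsProfile X Y ε U H) {ν : ℝ} (hν : 1 / 2 < ν) :
    ∃ C, 0 ≤ C ∧ ∀ t : ℝ, 1 ≤ t →
      sobolevSqENorm ν (fun x => posProfile H t ‖x‖) ≤ ENNReal.ofReal C := by
  obtain ⟨C, hC0, hC⟩ := exists_bound_sobolevSq_posProfile h (ν := ν) (by linarith)
  have hν0 : 0 < 2 * ν - 1 := by linarith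
  set B := 8 * (4 / (2 * ν - 1)) with hB
  refine ⟨16 * π ^ 3 * B + C * (1 + √B), by positivity, fun t ht => ?_⟩
  have ht0 : 0 < t := by linarith
  obtain ⟨h1, h2⟩ := hC t ht
  have h3 : boxEnergy ν t ≤ B := by
    have e2 : t ^ (1 - 2 * ν) * t ^ (2 * ν - 1) = 1 := by
      rw [← rpow_add ht0]; simp
    calc boxEnergy ν t ≤ 8 * t ^ (1 - 2 * ν) * (4 / (2 * ν - 1) * t ^ (2 * ν - 1)) := by
          unfold boxEnergy
          exact mul_le_mul_of_nonneg_left (integral_kappaIntegrand_le hν ht) (by positivity)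
      _ = 8 * (4 / (2 * ν - 1)) * (t ^ (1 - 2 * ν) * t ^ (2 * ν - 1)) := by ring
      _ = B := by rw [e2, mul_one]
  rw [← ENNReal.ofReal_toReal h1.ne]
  refine ENNReal.ofReal_le_ofReal ?_
  have h4 := (abs_le.1 h2).2
  calc _ ≤ 16 * π ^ 3 * boxEnergy ν t + C * (1 + √(boxEnergy ν t)) := by
        rw [sobolevSq] at h4; linarith
    _ ≤ _ := by gcongr

/-- The remaining integral is elementary; its growth depends on the sign of `ν - 1 / 2`. -/
lemma exists_sobolevSqENorm_velProfile_le (h : IsProfile X Y ε U H) {ν : ℝ} (hν : 0 ≤ ν) :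
    ∃ C, 0 ≤ C ∧ ∀ t : ℝ, 1 ≤ t → sobolevSqENorm (ν - 1) (fun x => velProfile H t ‖x‖) ≤
      ENNReal.ofReal C * (ENNReal.ofReal (1 + t ^ (1 - 2 * ν)) +
        ∫⁻ ρ in Ioc t⁻¹ 1, ENNReal.ofReal (ρ ^ (2 * (ν - 1)))) := by
  obtain ⟨C, hC0, hC⟩ := exists_spectralDensity_velProfile_le h
  obtain ⟨D, hD0, hD⟩ := exists_highEnergy_velProfile_le h (ν - 1)
  refine ⟨16 * π ^ 3 * (C + D), by positivity, fun t ht => ?_⟩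
  have ht0 : 0 < t := by linarith
  rw [sobolevSqENorm_velProfile h ht, energy, lowEnergy_add_highEnergy,
    ENNReal.ofReal_mul (p := 16 * π ^ 3) (by positivity), mul_assoc]
  gcongr
  set L := ∫⁻ ρ in Ioc t⁻¹ 1, ENNReal.ofReal (ρ ^ (2 * (ν - 1))) with hL
  have h1 : lowEnergy (memLp_mul_velProfile h ht) (ν - 1) ≤
      ENNReal.ofReal C * (ENNReal.ofReal (t ^ (1 - 2 * ν)) + L) := by
    refine le_trans ?_ (mul_le_mul_right (lintegral_rpow_mul_min_le hν ht) _)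
    rw [← lintegral_const_mul _ (by fun_prop)]
    refine lintegral_mono_ae ?_
    filter_upwards [ae_restrict_of_ae (hC t ht), ae_restrict_mem measurableSet_Ioc] with ρ h1 h2
    have hρ : 0 < ρ := h2.1
    calc _ ≤ ENNReal.ofReal (ρ ^ (2 * (ν - 1))) * ENNReal.ofReal (C * min 1 ((t * ρ) ^ 2)) := by
          gcongr; exact h1 hρ
      _ = _ := by
          rw [← ENNReal.ofReal_mul (by positivity), ← ENNReal.ofReal_mul (by positivity)]
          congr 1
          ring
  have h3 : ENNReal.ofReal D ≤ ENNReal.ofReal D * (ENNReal.ofReal (1 + t ^ (1 - 2 * ν)) + L) := by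
    refine le_mul_of_one_le_right zero_le (le_add_right (ENNReal.one_le_ofReal.2 ?_))
    have : 0 ≤ t ^ (1 - 2 * ν) := by positivity
    linarith
  rw [ENNReal.ofReal_add hC0 hD0, add_mul]
  refine add_le_add (h1.trans ?_) ((hD t ht).trans h3)
  gcongr
  linarith

lemma exists_sobolevSqENorm_velProfile_le_of_lt (h : IsProfile X Y ε U H) {ν : ℝ} (hν : 0 ≤ ν)
    (hν1 : ν < 1 / 2) : ∃ C, 0 ≤ C ∧ ∀ t : ℝ, 1 ≤ t →
      sobolevSqENorm (ν - 1) (fun x => velProfile H t ‖x‖) ≤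
        ENNReal.ofReal (C * t ^ (1 - 2 * ν)) := by
  obtain ⟨C, hC0, hC⟩ := exists_sobolevSqENorm_velProfile_le h hν
  have hν2 : 0 < 1 - 2 * ν := by linarith
  refine ⟨C * (2 + 1 / (1 - 2 * ν)), by positivity, fun t ht => (hC t ht).trans ?_⟩
  have ht0 : 0 < t := by linarith
  rw [lintegral_rpow_Ioc (inv_nonneg.2 ht0.le) (inv_le_one_of_one_le₀ ht)
    (.inr ⟨by linarith, inv_pos.2 ht0⟩), mul_assoc, ENNReal.ofReal_mul hC0]
  gcongr
  have e : ((1 : ℝ) ^ (2 * (ν - 1) + 1) - t⁻¹ ^ (2 * (ν - 1) + 1)) / (2 * (ν - 1) + 1) =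
      (t ^ (1 - 2 * ν) - 1) / (1 - 2 * ν) := by
    rw [one_rpow, inv_rpow ht0.le, ← rpow_neg ht0.le, show -(2 * (ν - 1) + 1) = 1 - 2 * ν by ring,
      show 2 * (ν - 1) + 1 = -(1 - 2 * ν) by ring, div_neg, ← neg_div, neg_sub]
  have h1 : 1 ≤ t ^ (1 - 2 * ν) := one_le_rpow ht hν2.le
  rw [e, ← ENNReal.ofReal_add (by positivity) (div_nonneg (by linarith) hν2.le)]
  refine ENNReal.ofReal_le_ofReal ?_
  have : (t ^ (1 - 2 * ν) - 1) / (1 - 2 * ν) ≤ 1 / (1 - 2 * ν) * t ^ (1 - 2 * ν) := by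
    rw [div_mul_eq_mul_div, one_mul]
    gcongr
    linarith
  linarith

lemma exists_sobolevSqENorm_velProfile_half_le (h : IsProfile X Y ε U H) :
    ∃ C, 0 ≤ C ∧ ∀ t : ℝ, 1 ≤ t → sobolevSqENorm (-1 / 2) (fun x => velProfile H t ‖x‖) ≤
        ENNReal.ofReal (C * (2 + log t)) := by
  obtain ⟨C, hC0, hC⟩ := exists_sobolevSqENorm_velProfile_le h (ν := 1 / 2) (by norm_num)
  refine ⟨C, hC0, fun t ht => ?_⟩
  have ht0 : 0 < t := by linarith
  have h1 := hC t ht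
  rw [show (1 / 2 - 1 : ℝ) = -1 / 2 by norm_num, show (1 - 2 * (1 / 2) : ℝ) = 0 by norm_num,
    rpow_zero, show (2 * (-1 / 2) : ℝ) = -1 by norm_num] at h1
  simp only [rpow_neg_one] at h1
  rw [lintegral_inv_Ioc (inv_pos.2 ht0) (inv_le_one_of_one_le₀ ht), one_div, inv_inv,
    ← ENNReal.ofReal_add (by norm_num) (log_nonneg ht), ← ENNReal.ofReal_mul hC0] at h1
  convert h1 using 3
  norm_num

lemma exists_sobolevSqENorm_velProfile_le_of_gt (h : IsProfile X Y ε U H) {ν : ℝ}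
    (hν : 1 / 2 < ν) : ∃ C, 0 ≤ C ∧ ∀ t : ℝ, 1 ≤ t →
      sobolevSqENorm (ν - 1) (fun x => velProfile H t ‖x‖) ≤ ENNReal.ofReal C := by
  obtain ⟨C, hC0, hC⟩ := exists_sobolevSqENorm_velProfile_le h (ν := ν) (by linarith)
  have hν2 : 0 < 2 * ν - 1 := by linarith
  refine ⟨C * (2 + 1 / (2 * ν - 1)), by positivity, fun t ht => (hC t ht).trans ?_⟩
  have ht0 : 0 < t := by linarith
  rw [lintegral_rpow_Ioc (inv_nonneg.2 ht0.le) (inv_le_one_of_one_le₀ ht)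
    (.inl (by linarith)), ENNReal.ofReal_mul hC0]
  gcongr
  have h1 : t ^ (1 - 2 * ν) ≤ 1 := rpow_le_one_of_one_le_of_nonpos ht (by linarith)
  rw [ENNReal.ofReal_add (p := 2) (by norm_num) (by positivity)]
  refine add_le_add (ENNReal.ofReal_le_ofReal (by linarith)) (ENNReal.ofReal_le_ofReal ?_)
  rw [one_rpow, show 2 * (ν - 1) + 1 = 2 * ν - 1 by ring]
  gcongr
  have : 0 ≤ t⁻¹ ^ (2 * ν - 1) := by positivity
  linarith

variable {X Y ε : ℝ} {U H : ℝ → ℝ}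

/-! ### Lower bounds and supercritical norms -/

lemma le_ofReal_of_mul_le {b C : ℝ} {E : ℝ≥0∞}
    (h : ENNReal.ofReal (16 * π ^ 3) * E ≤ ENNReal.ofReal C) (hb : C ≤ b) :
    E ≤ ENNReal.ofReal b := by
  have h1 : (1 : ℝ≥0∞) ≤ ENNReal.ofReal (16 * π ^ 3) := by
    refine ENNReal.one_le_ofReal.2 ?_
    have : 1 ≤ π ^ 3 := one_le_pow₀ (by linarith [pi_gt_three])
    linarith
  exact (le_mul_of_one_le_left zero_le h1).trans (h.trans (ENNReal.ofReal_le_ofReal hb))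

/-- The supercritical norms do not tend to zero: near the light cone the radial derivative of `r u`
stays bounded below. -/
lemma exists_le_sobolevSqENorm_posProfile (h : IsProfile X Y ε U H) (ν : ℝ) :
    ∃ c T, 0 < c ∧ 1 ≤ T ∧ ∀ t : ℝ, T ≤ t →
      ENNReal.ofReal c ≤ sobolevSqENorm ν (fun x => posProfile H t ‖x‖) := by
  obtain ⟨G, hG0, hG1, hGd, hGb⟩ := exists_pos_seq h
  obtain ⟨d, η, q, T, hd, hη, hT, hw⟩ := exists_window h
  obtain ⟨A, hA0, hA⟩ := exists_sobolevSqENorm_posProfile_le h (ν := 2) (by norm_num)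
  obtain ⟨B, hB0, hB⟩ := exists_sobolevSqENorm_posProfile_le h (ν := 3 / 4) (by norm_num)
  obtain ⟨C₁, hC₁, hC⟩ := hGb 0
  -- Interpolation between the orders `2 = 1 + 1` and `3 / 4 = 1 - 1 / 4` around the energy of order `1`,
  -- which is the square integral of `∂ᵣ(r u)`.
  obtain ⟨c, hc, hlow⟩ := exists_lower_bound_energy (c := 2 * π * (d ^ 2 * (2 * η)) / 2) (C := A + B)
    (by positivity) (by positivity) 1 ν
  refine ⟨16 * π ^ 3 * c, T, by positivity, hT, fun t ht => ?_⟩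
  have ht1 : 1 ≤ t := hT.trans ht
  have hA' := hA t ht1
  have hB' := hB t ht1
  rw [sobolevSqENorm_posProfile h ht1] at hA' hB' ⊢
  rw [ENNReal.ofReal_mul (by positivity)]
  gcongr
  refine hlow _ _ ?_ ?_ ?_
  · have hφ' : MemLp (fun r => (G 1 t r : ℂ)) 2 volume :=
      memLp_two_of_sq_le hC₁ (continuous_iff_continuousAt.2 fun r =>
        (hGd 1 t r).continuousAt).measurable fun r => hC t r ht1
    rw [energy_one_eq _ hφ' fun r => by
      have := hGd 0 t r
      rwa [show G 0 t = fun r => r * posProfile H t r from funext (hG0 t)] at this]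
    have h1 := le_energy_zero hφ' (k := 1) (by norm_num) (fun r => by
      rw [hG1, hG1, angle_neg]; ring_nf) (a := t - q) hd.le fun r hr => by
        rw [hG1]; exact (hw t r ht hr).2.2
    rw [ENNReal.ofReal_div_of_pos two_pos, ENNReal.ofReal_ofNat]
    exact ENNReal.div_le_of_le_mul' h1
  · exact le_ofReal_of_mul_le (C := A) (by convert hA' using 3; norm_num) (by linarith)
  · exact le_ofReal_of_mul_le (C := B) (by convert hB' using 3; norm_num) (by linarith)

/-- As in `exists_le_sobolevSqENorm_posProfile`, from the energy of order `0` of `r ∂ₜu`, between the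
orders `1` and `-1 / 4`. -/
lemma exists_le_sobolevSqENorm_velProfile (h : IsProfile X Y ε U H) (s : ℝ) :
    ∃ c T, 0 < c ∧ 1 ≤ T ∧ ∀ t : ℝ, T ≤ t →
      ENNReal.ofReal c ≤ sobolevSqENorm s (fun x => velProfile H t ‖x‖) := by
  obtain ⟨d, η, q, T, hd, hη, hT, hw⟩ := exists_window h
  obtain ⟨A, hA0, hA⟩ := exists_sobolevSqENorm_velProfile_le_of_gt h (ν := 2) (by norm_num)
  obtain ⟨B, hB0, hB⟩ := exists_sobolevSqENorm_velProfile_le_of_gt h (ν := 3 / 4) (by norm_num)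
  obtain ⟨c, hc, hlow⟩ := exists_lower_bound_energy
    (c := 2 * π * ((d / 2) ^ 2 * (2 * η)) / 2) (C := A + B)
    (by positivity) (by positivity) 0 s
  refine ⟨16 * π ^ 3 * c, T, by positivity, hT, fun t ht => ?_⟩
  have ht1 : 1 ≤ t := hT.trans ht
  have ht0 : 0 < t := by linarith
  have hA' := hA t ht1
  have hB' := hB t ht1
  rw [sobolevSqENorm_velProfile h ht1] at hA' hB' ⊢
  rw [ENNReal.ofReal_mul (by positivity)]
  gcongr
  refine hlow _ _ ?_ ?_ ?_
  · have h1 := le_energy_zero (memLp_mul_velProfile h ht1) (k := -1) (by norm_num) (fun r => by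
      rw [← velProfile_abs, abs_neg, velProfile_abs]; ring) (a := t - q) (c := d / 2)
      (by positivity) fun r hr => by
        obtain ⟨h1, h2, -⟩ := hw t r ht hr
        rw [abs_mul, abs_of_pos (by linarith)]
        have := abs_nonneg (velProfile H t r)
        nlinarith
    rw [ENNReal.ofReal_div_of_pos two_pos, ENNReal.ofReal_ofNat]
    exact ENNReal.div_le_of_le_mul' h1
  · exact le_ofReal_of_mul_le (C := A) (by convert hA' using 3; norm_num) (by linarith)
  · exact le_ofReal_of_mul_le (C := B) (by convert hB' using 3; norm_num) (by linarith)

lemma isTheta_one_of_bounds {f : ℝ → ℝ≥0∞} {c C T : ℝ} (hc : 0 < c) (hC : 0 ≤ C)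
    (h1 : ∀ t, T ≤ t → ENNReal.ofReal c ≤ f t) (h2 : ∀ t, 1 ≤ t → f t ≤ ENNReal.ofReal C) :
    (fun t => (f t).toReal) =Θ[atTop] fun _ : ℝ => (1 : ℝ) := by
  constructor
  · refine IsBigO.of_bound C ?_
    filter_upwards [eventually_ge_atTop 1] with t ht
    rw [Real.norm_of_nonneg ENNReal.toReal_nonneg, norm_one, mul_one]
    exact ENNReal.toReal_le_of_le_ofReal hC (h2 t ht)
  · refine IsBigO.of_bound c⁻¹ ?_
    filter_upwards [eventually_ge_atTop 1, eventually_ge_atTop T] with t ht ht'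
    rw [Real.norm_of_nonneg ENNReal.toReal_nonneg, norm_one, inv_mul_eq_div, one_le_div hc]
    exact (ENNReal.ofReal_le_iff_le_toReal ((h2 t ht).trans_lt ENNReal.ofReal_lt_top).ne).1
      (h1 t ht')

lemma isTheta_sobolevSq_posProfile (h : IsProfile X Y ε U H) {ν : ℝ} (hν : 1 / 2 < ν) :
    (fun t : ℝ => sobolevSq ν (fun x => posProfile H t ‖x‖)) =Θ[atTop] fun _ : ℝ => (1 : ℝ) := by
  obtain ⟨C, hC, h2⟩ := exists_sobolevSqENorm_posProfile_le h hν
  obtain ⟨c, T, hc, -, h1⟩ := exists_le_sobolevSqENorm_posProfile h ν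
  exact isTheta_one_of_bounds hc hC h1 h2

lemma isTheta_sobolevSq_velProfile (h : IsProfile X Y ε U H) {ν : ℝ} (hν : 1 / 2 < ν) :
    (fun t : ℝ => sobolevSq (ν - 1) (fun x => velProfile H t ‖x‖)) =Θ[atTop]
      fun _ : ℝ => (1 : ℝ) := by
  obtain ⟨C, hC, h2⟩ := exists_sobolevSqENorm_velProfile_le_of_gt h hν
  obtain ⟨c, T, hc, -, h1⟩ := exists_le_sobolevSqENorm_velProfile h (ν - 1)
  exact isTheta_one_of_bounds hc hC h1 h2

lemma isBigO_sobolevSq_velProfile (h : IsProfile X Y ε U H) {ν : ℝ} (hν : 0 ≤ ν)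
    (hν1 : ν < 1 / 2) : (fun t : ℝ => sobolevSq (ν - 1) (fun x => velProfile H t ‖x‖))
      =O[atTop] fun t : ℝ => t ^ (1 - 2 * ν) := by
  obtain ⟨C, hC0, hC⟩ := exists_sobolevSqENorm_velProfile_le_of_lt h hν hν1
  refine IsBigO.of_bound C ?_
  filter_upwards [eventually_ge_atTop 1] with t ht
  have ht0 : 0 < t := by linarith
  rw [sobolevSq, Real.norm_of_nonneg ENNReal.toReal_nonneg,
    Real.norm_of_nonneg (show 0 ≤ t ^ (1 - 2 * ν) by positivity)]
  exact ENNReal.toReal_le_of_le_ofReal (by positivity) (hC t ht)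

lemma isBigO_sobolevSq_velProfile_half (h : IsProfile X Y ε U H) :
    (fun t : ℝ => sobolevSq (-1 / 2) (fun x => velProfile H t ‖x‖)) =O[atTop] log := by
  obtain ⟨C, hC0, hC⟩ := exists_sobolevSqENorm_velProfile_half_le h
  refine IsBigO.of_bound (C * 3) ?_
  filter_upwards [eventually_ge_atTop (exp 1)] with t ht
  have ht1 : 1 ≤ t := (one_le_exp zero_le_one).trans ht
  have hlog : 1 ≤ log t := by rw [le_log_iff_exp_le (by linarith)]; exact ht
  rw [sobolevSq, Real.norm_of_nonneg ENNReal.toReal_nonneg, Real.norm_of_nonneg (by linarith)]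
  refine (ENNReal.toReal_le_of_le_ofReal (by positivity) (hC t ht1)).trans ?_
  rw [mul_assoc]
  gcongr
  linarith

lemma sobolevSqENorm_velProfile_lt_top (h : IsProfile X Y ε U H) {ν : ℝ} (hν : 0 ≤ ν) {t : ℝ}
    (ht : 1 ≤ t) : sobolevSqENorm (ν - 1) (fun x => velProfile H t ‖x‖) < ⊤ := by
  rcases lt_trichotomy ν (1 / 2) with h1 | rfl | h1
  · obtain ⟨C, -, hC⟩ := exists_sobolevSqENorm_velProfile_le_of_lt h hν h1
    exact (hC t ht).trans_lt ENNReal.ofReal_lt_top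
  · obtain ⟨C, -, hC⟩ := exists_sobolevSqENorm_velProfile_half_le h
    rw [show (1 / 2 - 1 : ℝ) = -1 / 2 by norm_num]
    exact (hC t ht).trans_lt ENNReal.ofReal_lt_top
  · obtain ⟨C, -, hC⟩ := exists_sobolevSqENorm_velProfile_le_of_gt h h1
    exact (hC t ht).trans_lt ENNReal.ofReal_lt_top

/-- By uniqueness every solution with the given data is, for positive times, the radial function
given by the profile. -/
lemma IsGlobalSolution.eq_profile (h : IsProfile X Y ε U H) {u : ℝ → E3 → ℝ}
    (hu : IsGlobalSolution X Y u) {t : ℝ} (ht : 0 < t) :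
    u t = (fun x => posProfile H t ‖x‖) ∧ dt u t = fun x => velProfile H t ‖x‖ := by
  have hv := isGlobalSolution_penrose h
  refine ⟨funext fun x => (hu.eq hv ht.le x).trans (penrose_eq_posProfile h ht x),
    funext fun x => ?_⟩
  rw [← dt_penrose h ht x]
  refine Filter.EventuallyEq.deriv_eq ?_
  filter_upwards [lt_mem_nhds ht] with τ hτ
  exact hu.eq hv hτ.le x

end CubicWave

end

theorem theorem1p4 (X Y : ℝ) (hXY : Y = beta X ∨ Y = -beta (-X)) :
    (∃ u : ℝ → E3 → ℝ, IsGlobalSolution X Y u) ∧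
    ∀ u : ℝ → E3 → ℝ, IsGlobalSolution X Y u →
      -- Lebesgue norms of the solution
      (∀ p : ℝ, 3 / 2 < p →
        (∀ᶠ t in atTop, MemLp (u t) (ENNReal.ofReal p) volume) ∧
        (fun t : ℝ => 1 / (4 * π) ^ (1 / p) * lebesgueNorm p univ (u t)
            - √2 / 3 ^ (1 / p) * t ^ (3 / p - 1)) =O[atTop] (fun t : ℝ => t ^ (2 / p - 1)) ∧
        ∀ M : ℝ, 0 < M →
          (fun t : ℝ => lebesgueNorm p {x : E3 | t - M < ‖x‖} (u t))
            =O[atTop] (fun t : ℝ => t ^ (2 / p - 1))) ∧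
      -- Lebesgue norms of the time derivative
      (∀ p : ℝ, 1 ≤ p →
        (∀ᶠ t in atTop, MemLp (dt u t) (ENNReal.ofReal p) volume) ∧
        (fun t : ℝ => lebesgueNorm p univ (dt u t)) =Θ[atTop] (fun t : ℝ => t ^ (-1 + 2 / p))) ∧
      -- all the homogeneous Sobolev norms below are finite
      (∀ ν : ℝ, 0 ≤ ν → ∀ᶠ t in atTop,
        sobolevSqENorm ν (u t) < ⊤ ∧ sobolevSqENorm (ν - 1) (dt u t) < ⊤) ∧
      -- subcritical Sobolev norms
      (∀ ν : ℝ, 0 ≤ ν → ν < 1 / 2 →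
        IntegrableOn (kappaIntegrand ν) (Ioi 0) ∧
        (fun t : ℝ => sobolevSq ν (u t) - kappa ν * t ^ (1 - 2 * ν))
          =O[atTop] (fun t : ℝ => t ^ (1 / 2 - ν)) ∧
        (fun t : ℝ => sobolevSq (ν - 1) (dt u t)) =O[atTop] (fun t : ℝ => t ^ (1 - 2 * ν))) ∧
      -- critical Sobolev norms
      ((fun t : ℝ => sobolevSq (1 / 2) (u t) - 64 * π ^ 3 * Real.log t)
          =O[atTop] (fun t : ℝ => √(Real.log t)) ∧
        (fun t : ℝ => sobolevSq (-1 / 2) (dt u t)) =O[atTop] (fun t : ℝ => Real.log t)) ∧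
      -- supercritical Sobolev norms
      (∀ ν : ℝ, 1 / 2 < ν →
        (fun t : ℝ => sobolevSq ν (u t)) =Θ[atTop] (fun _ : ℝ => (1 : ℝ)) ∧
        (fun t : ℝ => sobolevSq (ν - 1) (dt u t)) =Θ[atTop] (fun _ : ℝ => (1 : ℝ))) := by
  obtain ⟨ε, U, H, h⟩ := exists_isProfile hXY
  refine ⟨⟨_, isGlobalSolution_penrose h⟩, fun u hu => ?_⟩
  have ev : ∀ᶠ t : ℝ in atTop, 1 ≤ t := eventually_ge_atTop 1
  have hpos : ∀ᶠ t in atTop, u t = fun x => posProfile H t ‖x‖ := by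
    filter_upwards [ev] with t ht
    exact (hu.eq_profile h (by linarith)).1
  have hvel : ∀ᶠ t in atTop, dt u t = fun x => velProfile H t ‖x‖ := by
    filter_upwards [ev] with t ht
    exact (hu.eq_profile h (by linarith)).2
  have cp : ∀ F : ℝ → (E3 → ℝ) → ℝ,
      (fun t => F t fun x => posProfile H t ‖x‖) =ᶠ[atTop] fun t => F t (u t) := fun F => by
    filter_upwards [hpos] with t ht
    rw [ht]
  have cv : ∀ F : ℝ → (E3 → ℝ) → ℝ,
      (fun t => F t fun x => velProfile H t ‖x‖) =ᶠ[atTop] fun t => F t (dt u t) := fun F => by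
    filter_upwards [hvel] with t ht
    rw [ht]
  refine ⟨fun p hp => ⟨?_, ?_, fun M _ => ?_⟩, fun p hp => ⟨?_, ?_⟩, fun ν hν => ?_,
    fun ν hν hν1 => ⟨integrableOn_kappaIntegrand hν hν1, ?_, ?_⟩, ⟨?_, ?_⟩, fun ν hν => ⟨?_, ?_⟩⟩
  · filter_upwards [hpos, ev] with t h1 ht
    exact h1 ▸ memLp_posProfile h hp ht
  · exact (isBigO_lebesgueNorm_pos h hp).congr' (cp fun t f =>
      1 / (4 * π) ^ (1 / p) * lebesgueNorm p univ f - √2 / 3 ^ (1 / p) * t ^ (3 / p - 1)) .rfl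
  · exact (isBigO_lebesgueNorm_pos_shell h hp M).congr' (cp fun t f =>
      lebesgueNorm p {x : E3 | t - M < ‖x‖} f) .rfl
  · filter_upwards [hvel, ev] with t h1 ht
    exact h1 ▸ memLp_velProfile h hp ht
  · exact (cv fun t f => lebesgueNorm p univ f).symm.trans_isTheta (isTheta_lebesgueNorm_vel h hp)
  · obtain ⟨C, -, hC⟩ := exists_bound_sobolevSq_posProfile h hν
    filter_upwards [hpos, hvel, ev] with t h1 h2 ht
    rw [h1, h2]
    exact ⟨(hC t ht).1, sobolevSqENorm_velProfile_lt_top h hν ht⟩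
  · exact (isBigO_sobolevSq_posProfile h hν hν1).congr' (cp fun t f =>
      sobolevSq ν f - kappa ν * t ^ (1 - 2 * ν)) .rfl
  · exact (isBigO_sobolevSq_velProfile h hν hν1).congr' (cv fun t f => sobolevSq (ν - 1) f) .rfl
  · exact (isBigO_sobolevSq_posProfile_half h).congr' (cp fun t f =>
      sobolevSq (1 / 2) f - 64 * π ^ 3 * Real.log t) .rfl
  · exact (isBigO_sobolevSq_velProfile_half h).congr' (cv fun t f => sobolevSq (-1 / 2) f) .rfl
  · exact (cp fun t f => sobolevSq ν f).symm.trans_isTheta (isTheta_sobolevSq_posProfile h hν)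
  · exact (cv fun t f => sobolevSq (ν - 1) f).symm.trans_isTheta
      (isTheta_sobolevSq_velProfile h hν)
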